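/- Let $X$ be a complex manifold of dimension $n$ (Hausdorff, second countable), let $E\to X_\zeta\times X_z$ be a holomorphic vector bundle of rank $n$, and let $\eta$ be a holomorphic section of $E$ that defines the diagonal $\Delta=\{(\zeta,z):\zeta=z\}$: $\eta$ is non-zero outside $\Delta$ and vanishes to the first order on $\Delta$ (the differentials of its components in a local frame are linearly independent at the points of $\Delta$). Let $h$ be a Hermitian metric on $E$, $D$ its Chern connection and $\Theta$ its Chern curvature. Work in the algebra of sections of $\Lambda[T^*(X\times X)\oplus E\oplus E^*]$. For a local holomorphic frame $e_1,\dots,e_n$ of $E$ with dual frame $e_i^*$, write $\eta=\sum_j\eta_je_j$, let $\theta$ be the connection matrix, and put $D\eta=\sum_i\big(d\eta_i+\sum_j\theta_{ij}\eta_j\big)\wedge e_i$ and $\tilde\Theta=\sum_{i,j}\Theta_{ij}\wedge e_i\wedge e_j^*$. Let $\delta_\eta$ be contraction with $\eta$ (the antiderivation that is evaluation at $\eta$ on $E^*$ and zero on $T^*$ and $E$), let $\bar\partial$ act coefficientwise in holomorphic frames, and set $\nabla=\delta_\eta-\bar\partial$. Write $a_n=a^n/n!$. The fibre integral $\int_E$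 is the linear map with $\int_E f\wedge e_1\wedge e_1^*\wedge\dots\wedge e_n\wedge e_n^*=f$ for differential forms $f$, and it is zero on terms that are not of full degree in $E$ and $E^*$. Outside $\Delta$ let $\sigma$ be the section of $E^*$ with $\delta_\eta\sigma=1$ of minimal pointwise norm, and put $$u=\frac{\sigma}{\nabla\sigma}=\sum_{k\ge0}\sigma\wedge(\bar\partial\sigma)^k .$$ A weight is a smooth section $g$ of $\bigoplus_k\Lambda^kE^*\wedge\Lambda^kT^*_{0,1}(X\times X)$ with $\nabla g=0$ whose component $g_{0,0}$ of degree $0$ satisfies $g_{0,0}(z,z)=1$ for all $z\in X$. For a weight $g$ put $$K=\int_E u\wedge g\wedge\Big(\frac{D\eta}{2\pi i}+\frac{i\tilde\Theta}{2\pi}\Big)_n,\qquad P=\int_E g\wedge\Big(\frac{D\eta}{2\pi i}+\frac{i\tilde\Theta}{2\pi}\Big)_n .$$ Then, for every weight $g$ and in particular for $g=1$, $K$ is locally integrable on $X\times X$, $P$ is smooth, and $$\bar\partial K=[\Delta]-P$$ in the sense of currents on $X\times X$, where $[\Delta]$ is the current of integration over $\Delta$: for every smooth compactly supported form $\varphi$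 on $X\times X$, $\int K\wedge\bar\partial\varphi=\int_\Delta\varphi-\int P\wedge\varphi$. If $g=1$, then $P=\det\big(\tfrac{i\Theta}{2\pi}\big)=c_n(E)$, the top Chern form of $(E,h)$. Consequently the (weighted) Koppelman formula $$\phi(z)=\int_\zeta K\wedge\bar\partial\phi+\bar\partial_z\int_\zeta K\wedge\phi+\int_\zeta P\wedge\phi$$ holds in the sense of currents on $X_z$ for every smooth compactly supported form $\phi(\zeta)$ of degree $r$ on $X$; that is, for every smooth compactly supported form $\psi(z)$ on $X$, $$\int_X\phi\wedge\psi=\int_{X\times X}K\wedge\bar\partial\phi(\zeta)\wedge\psi(z)+(-1)^r\int_{X\times X}K\wedge\phi(\zeta)\wedge\bar\partial\psi(z)+\int_{X\times X}P\wedge\phi(\zeta)\wedge\psi(z).$$ -/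

import Mathlib

open Bundle Module MeasureTheory
open scoped Manifold ContDiff Topology ComplexConjugate

noncomputable section

namespace Koppelman

/-! ## Linear algebra of complex-valued forms -/

/-- Standard linear complex coordinates on a model space; only used for `Fin n → ℂ` and products. -/
class ComplexCoords (V : Type*) [NormedAddCommGroup V] [NormedSpace ℂ V] where
  /-- the complex dimension -/
  dim : ℕ
  /-- the standard basis -/
  basis : Basis (Fin dim) ℂ V

instance instComplexCoordsPi (n : ℕ) : ComplexCoords (Fin n → ℂ) where
  dim := n
  basis := Pi.basisFun ℂ (Fin n)

instance instComplexCoordsProd (V W : Type*) [NormedAddCommGroup V] [NormedSpace ℂ V]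
    [NormedAddCommGroup W] [NormedSpace ℂ W] [ComplexCoords V] [ComplexCoords W] :
    ComplexCoords (V × W) where
  dim := ComplexCoords.dim V + ComplexCoords.dim W
  basis := ((ComplexCoords.basis (V := V)).prod (ComplexCoords.basis (V := W))).reindex
    finSumFinEquiv

/-- The exterior algebra of a finite-dimensional space is finite-dimensional. -/
instance instFiniteExteriorAlgebra (W : Type*) [AddCommGroup W] [Module ℂ W] [Module.Finite ℂ W] :
    Module.Finite ℂ (ExteriorAlgebra ℂ W) :=
  Module.Finite.of_basis (finBasis ℂ W).ExteriorAlgebra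

section Flat

variable {V : Type*} [NormedAddCommGroup V] [NormedSpace ℂ V]

/-- Pull-back of (complex-valued, real-linear) covectors along a real-linear map. -/
def precomp {V V' : Type*} [AddCommGroup V] [Module ℝ V] [AddCommGroup V'] [Module ℝ V']
    (L : V' →ₗ[ℝ] V) : (V →ₗ[ℝ] ℂ) →ₗ[ℂ] (V' →ₗ[ℝ] ℂ) where
  toFun ℓ := ℓ ∘ₗ L
  map_add' _ _ := rfl
  map_smul' _ _ := rfl

/-- Multiplication by `i` as a real-linear map. -/
def mulI : V →ₗ[ℝ] V := (LinearMap.lsmul ℂ V Complex.I).restrictScalars ℝ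

/-- The `(1,0)`-part of a covector. -/
def part10 (ℓ : V →ₗ[ℝ] ℂ) : V →ₗ[ℝ] ℂ :=
  (1 / 2 : ℂ) • (ℓ - Complex.I • (ℓ ∘ₗ mulI))

/-- The covectors of type `(0,1)`, i.e. the conjugate-linear ones. -/
def covec01 (V : Type*) [NormedAddCommGroup V] [NormedSpace ℂ V] : Submodule ℂ (V →ₗ[ℝ] ℂ) where
  carrier := {ℓ | ∀ v, ℓ (Complex.I • v) = -Complex.I * ℓ v}
  add_mem' {a b} ha hb v := by
    have h1 := ha v
    have h2 := hb v
    simp only [LinearMap.add_apply, h1, h2]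
    ring
  zero_mem' v := by simp
  smul_mem' c a ha v := by
    have h1 := ha v
    simp only [LinearMap.smul_apply, h1, smul_eq_mul]
    ring

variable [ComplexCoords V]

/-- The covector `dz_j`. -/
def dz (j : Fin (ComplexCoords.dim V)) : V →ₗ[ℝ] ℂ :=
  ((ComplexCoords.basis (V := V)).coord j).restrictScalars ℝ

/-- The covector `d\bar z_j`. -/
def dzbar (j : Fin (ComplexCoords.dim V)) : V →ₗ[ℝ] ℂ :=
  Complex.conjAe.toLinearMap ∘ₗ dz j

/-- Directional derivative of a map into a finite-dimensional complex vector space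
(which need not carry a norm), taken componentwise. -/
def dirDeriv {A : Type*} [AddCommGroup A] [Module ℂ A] [Module.Finite ℂ A]
    (f : V → A) (x v : V) : A :=
  ∑ i, (fderiv ℝ (fun y => (finBasis ℂ A).repr (f y) i) x v) • finBasis ℂ A i

/-- `∂f/∂z_j`. -/
def dirDz {A : Type*} [AddCommGroup A] [Module ℂ A] [Module.Finite ℂ A]
    (f : V → A) (x : V) (j : Fin (ComplexCoords.dim V)) : A :=
  (1 / 2 : ℂ) • (dirDeriv f x (ComplexCoords.basis j)
    - Complex.I • dirDeriv f x (Complex.I • ComplexCoords.basis j))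

/-- `∂f/∂\bar z_j`. -/
def dirDzbar {A : Type*} [AddCommGroup A] [Module ℂ A] [Module.Finite ℂ A]
    (f : V → A) (x : V) (j : Fin (ComplexCoords.dim V)) : A :=
  (1 / 2 : ℂ) • (dirDeriv f x (ComplexCoords.basis j)
    + Complex.I • dirDeriv f x (Complex.I • ComplexCoords.basis j))

/-- `∂̄ f = ∑ d\bar z_j ∧ ∂f/∂\bar z_j` for a map `f` into an algebra `A` that contains
the covectors through `c`. -/
def dbarFlat {A : Type*} [Ring A] [Algebra ℂ A] [Module.Finite ℂ A]
    (c : (V →ₗ[ℝ] ℂ) →ₗ[ℂ] A) (f : V → A) (x : V) : A :=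
  ∑ j, c (dzbar j) * dirDzbar f x j

/-- `d f = ∑ dz_j ∧ ∂f/∂z_j + ∑ d\bar z_j ∧ ∂f/∂\bar z_j`. -/
def dFlat {A : Type*} [Ring A] [Algebra ℂ A] [Module.Finite ℂ A]
    (c : (V →ₗ[ℝ] ℂ) →ₗ[ℂ] A) (f : V → A) (x : V) : A :=
  (∑ j, c (dz j) * dirDz f x j) + dbarFlat c f x

/-- The positively oriented real basis `b₁, i b₁, b₂, i b₂, …`. -/
def realFrame (k : Fin (ComplexCoords.dim V * 2)) : V :=
  let p := finProdFinEquiv.symm k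
  if p.2 = 0 then ComplexCoords.basis p.1 else Complex.I • ComplexCoords.basis p.1

/-- The coefficient of `dx₁ ∧ dy₁ ∧ dx₂ ∧ dy₂ ∧ …` in an element of the exterior algebra. -/
def topCoeff : ExteriorAlgebra ℂ (V →ₗ[ℝ] ℂ) →ₗ[ℂ] ℂ :=
  ExteriorAlgebra.liftAlternating
    (Pi.single (ComplexCoords.dim V * 2)
      ((Matrix.detRowAlternating (R := ℂ) (n := Fin (ComplexCoords.dim V * 2))).compLinearMap
        (LinearMap.pi fun k => (LinearMap.applyₗ' ℂ (realFrame k : V)))))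

end Flat

/-! ## Differential forms on a complex manifold -/

section Forms

variable {V : Type*} [NormedAddCommGroup V] [NormedSpace ℂ V]
  {H : Type*} [TopologicalSpace H] (I : ModelWithCorners ℂ V H)
  {M : Type*} [TopologicalSpace M] [ChartedSpace H M]

/-- A complex-valued differential form (of possibly mixed degree) on `M`. As with Mathlib's tangent
spaces, the cotangent space at `p` is written in the preferred chart at `p`. -/
abbrev Form (V M : Type*) [NormedAddCommGroup V] [NormedSpace ℂ V] : Type _ :=
  M → ExteriorAlgebra ℂ (V →ₗ[ℝ] ℂ)

/-- The derivative at `x` of the change of coordinates from the chart at `c` to the chart at `p`. -/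
def transition (c p : M) (x : V) : V →ₗ[ℝ] V :=
  ((fderiv ℂ (fun y => extChartAt I p ((extChartAt I c).symm y)) x : V →L[ℂ] V) :
    V →ₗ[ℂ] V).restrictScalars ℝ

/-- The expression of a form in the chart at `c`. -/
def localForm (α : Form V M) (c : M) (x : V) : ExteriorAlgebra ℂ (V →ₗ[ℝ] ℂ) :=
  let p := (extChartAt I c).symm x
  ExteriorAlgebra.map (precomp (transition I c p x)) (α p)

/-- Smooth forms: all coefficients in all charts are smooth in the real sense. -/
def SmoothForm (α : Form V M) : Prop :=
  ∀ (c : M) (ℓ : Dual ℂ (ExteriorAlgebra ℂ (V →ₗ[ℝ] ℂ))),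
    ContDiffOn ℝ ∞ (fun x => ℓ (localForm I α c x)) (extChartAt I c).target

/-- Smooth compactly supported forms. -/
def TestForm (α : Form V M) : Prop :=
  SmoothForm I α ∧ HasCompactSupport α

/-- Forms that are homogeneous of degree `r`. -/
def HasDegree (r : ℕ) (α : Form V M) : Prop :=
  ∀ p, α p ∈ ⋀[ℂ]^r (V →ₗ[ℝ] ℂ)

/-- Forms with locally integrable coefficients. -/
def LocIntForm [MeasureSpace V] (α : Form V M) : Prop :=
  ∀ (c : M) (ℓ : Dual ℂ (ExteriorAlgebra ℂ (V →ₗ[ℝ] ℂ))),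
    LocallyIntegrableOn (fun x => ℓ (localForm I α c x)) (extChartAt I c).target volume

/-- The operator `∂̄` on forms. -/
def dbarForm [FiniteDimensional ℂ V] [ComplexCoords V] (α : Form V M) : Form V M := fun p =>
  dbarFlat (ExteriorAlgebra.ι ℂ) (localForm I α p) (extChartAt I p p)

/-- Pull-back of forms. -/
def pullback {V' : Type*} [NormedAddCommGroup V'] [NormedSpace ℂ V']
    {H' : Type*} [TopologicalSpace H'] (I' : ModelWithCorners ℂ V' H')
    {M' : Type*} [TopologicalSpace M'] [ChartedSpace H' M']
    (f : M' → M) (α : Form V M) : Form V' M' := fun p =>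
  let D : V' →L[ℂ] V := mfderiv I' I f p
  ExteriorAlgebra.map (precomp ((D : V' →ₗ[ℂ] V).restrictScalars ℝ)) (α (f p))

/-- Existence of a partition of unity subordinate to the preferred charts. -/
theorem exists_chartPartition [FiniteDimensional ℂ V] [T2Space M] [SecondCountableTopology M] :
    ∃ ρ : PartitionOfUnity M M Set.univ, ρ.IsSubordinate fun c => (extChartAt I c).source := by
  have : LocallyCompactSpace M := Manifold.locallyCompact_of_finiteDimensional I
  exact PartitionOfUnity.exists_isSubordinate isClosed_univ _
    (fun c => isOpen_extChartAt_source c)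
    fun p _ => Set.mem_iUnion.2 ⟨p, mem_extChartAt_source p⟩

/-- A partition of unity subordinate to the preferred charts. -/
def chartPartition [FiniteDimensional ℂ V] [T2Space M] [SecondCountableTopology M] :
    PartitionOfUnity M M Set.univ :=
  (exists_chartPartition (M := M) I).choose

/-- The integral over `M` (with its complex orientation) of the top degree part of a compactly
supported form. -/
def integralForm [FiniteDimensional ℂ V] [ComplexCoords V] [MeasureSpace V]
    [T2Space M] [SecondCountableTopology M] (α : Form V M) : ℂ :=
  ∑ᶠ c : M, ∫ x in (extChartAt I c).target,
    (chartPartition I c ((extChartAt I c).symm x) : ℂ) * topCoeff (localForm I α c x)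

/-- The functional on test forms given by a locally integrable form: `φ ↦ ∫ α ∧ φ`. -/
def formCurrent [FiniteDimensional ℂ V] [ComplexCoords V] [MeasureSpace V]
    [T2Space M] [SecondCountableTopology M] (α φ : Form V M) : ℂ :=
  integralForm I fun p => α p * φ p

/-- The operator `∂̄` on currents `T` of degree `k`: `⟨∂̄T, φ⟩ = (-1)^(k+1) ⟨T, ∂̄φ⟩`. -/
def dbarCurrent [FiniteDimensional ℂ V] [ComplexCoords V] (k : ℕ) (T : Form V M → ℂ)
    (φ : Form V M) : ℂ :=
  (-1) ^ (k + 1) * T (dbarForm I φ)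

/-- The current of integration over the diagonal of `M × M`. -/
def diagonalCurrent [FiniteDimensional ℂ V] [ComplexCoords V] [MeasureSpace V]
    [T2Space M] [SecondCountableTopology M] (φ : Form (V × V) (M × M)) : ℂ :=
  integralForm I (pullback (I.prod I) I (fun x : M => (x, x)) φ)

end Forms

/-! ## Hermitian holomorphic vector bundles of rank `n` and the algebra `G_E` -/

section Bundles

variable {n : ℕ} {V : Type*} [NormedAddCommGroup V] [NormedSpace ℂ V]
  {H : Type*} [TopologicalSpace H] (I : ModelWithCorners ℂ V H)
  {M : Type*} [TopologicalSpace M] [ChartedSpace H M]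
  {E : M → Type*} [TopologicalSpace (TotalSpace (Fin n → ℂ) E)]
  [∀ p, AddCommGroup (E p)] [∀ p, Module ℂ (E p)] [∀ p, TopologicalSpace (E p)]
  [FiberBundle (Fin n → ℂ) E] [VectorBundle ℂ (Fin n → ℂ) E]

/-- The identification of the fibre over `p` with `ℂⁿ` in the preferred trivialization at `c`. -/
def coordAt (n : ℕ) (E : M → Type*) [TopologicalSpace (TotalSpace (Fin n → ℂ) E)]
    [∀ p, AddCommGroup (E p)] [∀ p, Module ℂ (E p)] [∀ p, TopologicalSpace (E p)]
    [FiberBundle (Fin n → ℂ) E] [VectorBundle ℂ (Fin n → ℂ) E] (c p : M) :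
    E p →ₗ[ℂ] (Fin n → ℂ) :=
  (trivializationAt (Fin n → ℂ) E c).linearMapAt ℂ p

/-- The inverse of `coordAt`. -/
def symmAt (n : ℕ) (E : M → Type*) [TopologicalSpace (TotalSpace (Fin n → ℂ) E)]
    [∀ p, AddCommGroup (E p)] [∀ p, Module ℂ (E p)] [∀ p, TopologicalSpace (E p)]
    [FiberBundle (Fin n → ℂ) E] [VectorBundle ℂ (Fin n → ℂ) E] (c p : M) :
    (Fin n → ℂ) →ₗ[ℂ] E p :=
  (trivializationAt (Fin n → ℂ) E c).symmₗ ℂ p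

/-- The local frame `e₁, …, eₙ` of `E` given by the preferred trivialization at `c`. -/
def frame (n : ℕ) (E : M → Type*) [TopologicalSpace (TotalSpace (Fin n → ℂ) E)]
    [∀ p, AddCommGroup (E p)] [∀ p, Module ℂ (E p)] [∀ p, TopologicalSpace (E p)]
    [FiberBundle (Fin n → ℂ) E] [VectorBundle ℂ (Fin n → ℂ) E] (c : M) (i : Fin n) (p : M) : E p :=
  symmAt n E c p (Pi.single i 1)

/-- The dual local frame `e₁*, …, eₙ*` of `E*`. -/
def dualFrame (n : ℕ) (E : M → Type*) [TopologicalSpace (TotalSpace (Fin n → ℂ) E)]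
    [∀ p, AddCommGroup (E p)] [∀ p, Module ℂ (E p)] [∀ p, TopologicalSpace (E p)]
    [FiberBundle (Fin n → ℂ) E] [VectorBundle ℂ (Fin n → ℂ) E] (c : M) (i : Fin n) (p : M) :
    Dual ℂ (E p) :=
  LinearMap.proj i ∘ₗ coordAt n E c p

/-- The image, in coordinates, of the open set on which both the preferred chart and the preferred
trivialization at `c` are defined. -/
def localDomain (n : ℕ) (E : M → Type*) [TopologicalSpace (TotalSpace (Fin n → ℂ) E)]
    [∀ p, AddCommGroup (E p)] [∀ p, Module ℂ (E p)] [∀ p, TopologicalSpace (E p)]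
    [FiberBundle (Fin n → ℂ) E] [VectorBundle ℂ (Fin n → ℂ) E] (c : M) : Set V :=
  (extChartAt I c).target ∩
    (extChartAt I c).symm ⁻¹' (trivializationAt (Fin n → ℂ) E c).baseSet

/-- The fibre `Λ[T* ⊕ E ⊕ E*]` of `G_E`, where `T` is the (complexified real) tangent space, of
dimension given by `V`, and `Ep` is the fibre of `E`. -/
abbrev GFib (V Ep : Type*) [NormedAddCommGroup V] [NormedSpace ℂ V] [AddCommGroup Ep]
    [Module ℂ Ep] : Type _ :=
  ExteriorAlgebra ℂ ((V →ₗ[ℝ] ℂ) × Ep × Dual ℂ Ep)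

section Fibre

variable {Ep : Type*} [AddCommGroup Ep] [Module ℂ Ep]

/-- Covectors as elements of `G_E`. -/
def inT : (V →ₗ[ℝ] ℂ) →ₗ[ℂ] GFib V Ep :=
  ExteriorAlgebra.ι ℂ ∘ₗ LinearMap.inl ℂ _ _

/-- Elements of `E` as elements of `G_E`. -/
def inE : Ep →ₗ[ℂ] GFib V Ep :=
  ExteriorAlgebra.ι ℂ ∘ₗ LinearMap.inr ℂ _ _ ∘ₗ LinearMap.inl ℂ _ _

/-- Elements of `E*` as elements of `G_E`. -/
def inEDual : Dual ℂ Ep →ₗ[ℂ] GFib V Ep :=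
  ExteriorAlgebra.ι ℂ ∘ₗ LinearMap.inr ℂ _ _ ∘ₗ LinearMap.inr ℂ _ _

/-- Differential forms as elements of `G_E`. -/
def inForm : ExteriorAlgebra ℂ (V →ₗ[ℝ] ℂ) →ₐ[ℂ] GFib V Ep :=
  ExteriorAlgebra.map (LinearMap.inl ℂ _ _)

/-- The contraction `δ_v` with an element `v` of `E`: the antiderivation of `G_E` that is
evaluation at `v` on `E*` and zero on `T*` and on `E`. -/
def delta (v : Ep) : GFib V Ep →ₗ[ℂ] GFib V Ep :=
  CliffordAlgebra.contractLeft (Dual.eval ℂ Ep v ∘ₗ LinearMap.snd ℂ _ _ ∘ₗ LinearMap.snd ℂ _ _)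

/-- The fibre of `⨁ Λᵏ E* ∧ Λᵏ⁺ᵐ T*_{0,1}`, whose smooth sections form `𝓛ᵐ`. -/
def lFib (V Ep : Type*) [NormedAddCommGroup V] [NormedSpace ℂ V] [AddCommGroup Ep]
    [Module ℂ Ep] (m : ℤ) : Submodule ℂ (GFib V Ep) :=
  ⨆ (k : ℕ) (l : ℕ) (_ : (l : ℤ) = k + m),
    LinearMap.range (inEDual : Dual ℂ Ep →ₗ[ℂ] GFib V Ep) ^ k *
      (covec01 V).map (inT : (V →ₗ[ℝ] ℂ) →ₗ[ℂ] GFib V Ep) ^ l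

end Fibre

variable (n) in
/-- The expression of a section of `G_E` in the preferred chart and trivialization at `c`. -/
def localSec (ξ : ∀ p, GFib V (E p)) (c : M) (x : V) : GFib V (Fin n → ℂ) :=
  let p := (extChartAt I c).symm x
  ExteriorAlgebra.map ((precomp (transition I c p x)).prodMap
    ((coordAt n E c p).prodMap (symmAt n E c p).dualMap)) (ξ p)

variable (n) in
/-- Smooth sections of `G_E`. -/
def SmoothSec (ξ : ∀ p, GFib V (E p)) : Prop :=
  ∀ (c : M) (ℓ : Dual ℂ (GFib V (Fin n → ℂ))),
    ContDiffOn ℝ ∞ (fun x => ℓ (localSec n I ξ c x)) (localDomain I n E c)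

variable [FiniteDimensional ℂ V] [ComplexCoords V]

variable (n) in
/-- The operator `∂̄` on sections of `G_E`, computed in a holomorphic frame. -/
def dbarSec (ξ : ∀ p, GFib V (E p)) (p : M) : GFib V (E p) :=
  ExteriorAlgebra.map (LinearMap.id.prodMap
      ((symmAt n E p p).prodMap (coordAt n E p p).dualMap))
    (dbarFlat inT (localSec n I ξ p) (extChartAt I p p))

variable (n) in
/-- The operator `∇_η = δ_η - ∂̄`. -/
def nabla (η : ∀ p, E p) (ξ : ∀ p, GFib V (E p)) (p : M) : GFib V (E p) :=
  delta (η p) (ξ p) - dbarSec n I ξ p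

/-- A smooth Hermitian metric on `E`, conjugate-linear in the first argument. -/
structure HermitianMetric (n : ℕ) (E : M → Type*) [TopologicalSpace (TotalSpace (Fin n → ℂ) E)]
    [∀ p, AddCommGroup (E p)] [∀ p, Module ℂ (E p)] [∀ p, TopologicalSpace (E p)]
    [FiberBundle (Fin n → ℂ) E] [VectorBundle ℂ (Fin n → ℂ) E] where
  /-- the sesquilinear form on each fibre -/
  inner : ∀ p, E p →ₗ⋆[ℂ] E p →ₗ[ℂ] ℂ
  symm : ∀ p (v w : E p), conj (inner p v w) = inner p w v
  pos : ∀ p (v : E p), v ≠ 0 → 0 < (inner p v v).re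
  smooth : ∀ (c : M) (i j : Fin n),
    ContDiffOn ℝ ∞ (fun x : V =>
      inner ((extChartAt I c).symm x) (frame n E c i ((extChartAt I c).symm x))
        (frame n E c j ((extChartAt I c).symm x))) (localDomain I n E c)

variable {I}

/-- The norm on the fibres of `E`. -/
def HermitianMetric.norm (h : HermitianMetric I n E) {p : M} (v : E p) : ℝ :=
  Real.sqrt (h.inner p v v).re

/-- The dual norm on the fibres of `E*`. -/
def HermitianMetric.dualNorm (h : HermitianMetric I n E) {p : M} (τ : Dual ℂ (E p)) : ℝ :=
  sSup {r | ∃ v : E p, h.norm v ≤ 1 ∧ r = ‖τ v‖}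

/-- Outside the zero set of `η`, the section `σ` of `E*` is the solution of `δ_η σ = 1` of minimal
pointwise norm. -/
def IsMinimalSolution (h : HermitianMetric I n E) (η : ∀ p, E p) (σ : ∀ p, Dual ℂ (E p)) : Prop :=
  ∀ p, η p ≠ 0 → σ p (η p) = 1 ∧
    ∀ τ : Dual ℂ (E p), τ (η p) = 1 → h.dualNorm (σ p) ≤ h.dualNorm τ

/-- The Gram matrix `(h(e_k, e_j))` of the local frame at `c`. -/
def gram (h : HermitianMetric I n E) (c : M) (x : V) : Matrix (Fin n) (Fin n) ℂ :=
  Matrix.of fun k j => h.inner ((extChartAt I c).symm x)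
    (frame n E c k ((extChartAt I c).symm x)) (frame n E c j ((extChartAt I c).symm x))

/-- The matrix `θ = G⁻¹ ∂G` of the Chern connection in the (holomorphic) local frame at `c`,
with `D e_j = ∑ θ_ij ⊗ e_i`. -/
def connMat (h : HermitianMetric I n E) (c : M) (x : V) (i j : Fin n) : V →ₗ[ℝ] ℂ :=
  ∑ k, ((gram h c x)⁻¹ i k) • part10 (fderiv ℝ (fun y => gram h c y k j) x : V →ₗ[ℝ] ℂ)

/-- The curvature matrix `Θ = dθ + θ ∧ θ` in the local frame at `c`. -/
def curvMat (h : HermitianMetric I n E) (c : M) (x : V) (i j : Fin n) :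
    ExteriorAlgebra ℂ (V →ₗ[ℝ] ℂ) :=
  dFlat (ExteriorAlgebra.ι ℂ) (fun y => ExteriorAlgebra.ι ℂ (connMat h c y i j)) x
    + ∑ k, ExteriorAlgebra.ι ℂ (connMat h c x i k) * ExteriorAlgebra.ι ℂ (connMat h c x k j)

/-- `Dη`, the covariant derivative of `η` as a section of `G_E`. -/
def covDeriv (h : HermitianMetric I n E) (η : ∀ p, E p) (p : M) : GFib V (E p) :=
  let x := extChartAt I p p
  ∑ i, inT ((fderiv ℝ (fun y => coordAt n E p ((extChartAt I p).symm y)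
          (η ((extChartAt I p).symm y)) i) x : V →ₗ[ℝ] ℂ)
        + ∑ j, (coordAt n E p p (η p) j) • connMat h p x i j)
      * inE (frame n E p i p)

/-- `Θ̃`, the Chern curvature as a section of `G_E`. -/
def curvTilde (h : HermitianMetric I n E) (p : M) : GFib V (E p) :=
  ∑ i, ∑ j, inForm (curvMat h p (extChartAt I p p) i j)
    * inE (frame n E p i p) * inEDual (dualFrame n E p j p)

/-- `Dη/2πi + iΘ̃/2π`. -/
def superCurv (h : HermitianMetric I n E) (η : ∀ p, E p) (p : M) : GFib V (E p) :=
  (1 / (2 * Real.pi * Complex.I) : ℂ) • covDeriv h η p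
    + (Complex.I / (2 * Real.pi) : ℂ) • curvTilde h p

/-- `a_k = a^k / k!`. -/
def divPow {A : Type*} [Ring A] [Algebra ℂ A] (a : A) (k : ℕ) : A :=
  ((k.factorial : ℂ)⁻¹) • a ^ k

variable (n) in
/-- The fibre integral `∫_E`, i.e. `f ∧ e₁ ∧ e₁* ∧ ⋯ ∧ eₙ ∧ eₙ* ↦ f` for forms `f`, and zero on
elements whose degree in `E` or in `E*` is less than `n`. It is built from the contractions that are
dual to `e_j` and `e_j*`. -/
def berezin (p : M) : GFib V (E p) →ₗ[ℂ] ExteriorAlgebra ℂ (V →ₗ[ℝ] ℂ) :=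
  (ExteriorAlgebra.map (LinearMap.fst ℂ (V →ₗ[ℝ] ℂ) (E p × Dual ℂ (E p)))).toLinearMap ∘ₗ
    (List.ofFn fun j : Fin n =>
      (CliffordAlgebra.contractLeft (Dual.eval ℂ (E p) (frame n E p j p) ∘ₗ
          LinearMap.snd ℂ _ _ ∘ₗ LinearMap.snd ℂ _ _) ∘ₗ
        CliffordAlgebra.contractLeft (dualFrame n E p j p ∘ₗ
          LinearMap.fst ℂ _ _ ∘ₗ LinearMap.snd ℂ _ _) :
        Module.End ℂ (GFib V (E p)))).prod

variable (n) in
/-- `u = σ/∇σ = ∑ σ ∧ (∂̄σ)^k`; the terms with `k ≥ n` vanish. -/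
def uSec (I : ModelWithCorners ℂ V H) (σ : ∀ p, Dual ℂ (E p)) (p : M) : GFib V (E p) :=
  ∑ k ∈ Finset.range n, inEDual (σ p) * dbarSec n I (fun q => inEDual (σ q)) p ^ k

/-- `K = ∫_E u ∧ g ∧ (Dη/2πi + iΘ̃/2π)_n`. -/
def kernelK (h : HermitianMetric I n E) (η : ∀ p, E p) (σ : ∀ p, Dual ℂ (E p))
    (g : ∀ p, GFib V (E p)) : Form V M := fun p =>
  berezin n p (uSec n I σ p * g p * divPow (superCurv h η p) n)

/-- `P = ∫_E g ∧ (Dη/2πi + iΘ̃/2π)_n`. -/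
def kernelP (h : HermitianMetric I n E) (η : ∀ p, E p) (g : ∀ p, GFib V (E p)) : Form V M := fun p =>
  berezin n p (g p * divPow (superCurv h η p) n)

/-- The top Chern form `c_n(E) = det(iΘ/2π)`. -/
def topChernForm (h : HermitianMetric I n E) : Form V M := fun p =>
  ∑ s : Equiv.Perm (Fin n), ((Equiv.Perm.sign s : ℤ) : ℂ) •
    (List.ofFn fun i : Fin n =>
      (Complex.I / (2 * Real.pi) : ℂ) • curvMat h p (extChartAt I p p) i (s i)).prod

end Bundles

/-! ## The diagonal -/

section Diagonal

variable {n : ℕ} {X : Type*} [TopologicalSpace X] [ChartedSpace (Fin n → ℂ) X]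

/-- The model with corners of `X × X`. -/
abbrev modelXX (n : ℕ) : ModelWithCorners ℂ ((Fin n → ℂ) × (Fin n → ℂ))
    (ModelProd (Fin n → ℂ) (Fin n → ℂ)) :=
  𝓘(ℂ, Fin n → ℂ).prod 𝓘(ℂ, Fin n → ℂ)

variable {E : X × X → Type*} [TopologicalSpace (TotalSpace (Fin n → ℂ) E)]
  [∀ p, AddCommGroup (E p)] [∀ p, Module ℂ (E p)] [∀ p, TopologicalSpace (E p)]
  [FiberBundle (Fin n → ℂ) E] [VectorBundle ℂ (Fin n → ℂ) E]

variable (n) in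
/-- `η` vanishes exactly on the diagonal, and to first order there: the differentials of its
components in a local frame are linearly independent on the diagonal. -/
def DefinesDiagonal (η : ∀ p, E p) : Prop :=
  (∀ p, η p = 0 ↔ p.1 = p.2) ∧
    ∀ x : X, Function.Surjective
      (mfderiv (modelXX n) 𝓘(ℂ, Fin n → ℂ) (fun q => coordAt n E (x, x) q (η q)) (x, x))

variable (n) in
/-- Weights: smooth sections `g` of `𝓛⁰` with `∇g = 0` and `g_{0,0} = 1` on the diagonal. -/
def IsWeight (η : ∀ p, E p) (g : ∀ p, GFib ((Fin n → ℂ) × (Fin n → ℂ)) (E p)) : Prop :=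
  SmoothSec n (modelXX n) g ∧
    (∀ p, g p ∈ lFib ((Fin n → ℂ) × (Fin n → ℂ)) (E p) 0) ∧
    (∀ p, nabla n (modelXX n) η g p = 0) ∧
    ∀ z : X, ExteriorAlgebra.algebraMapInv (g (z, z)) = 1

variable [T2Space X] [SecondCountableTopology X]

/-- The equation `∂̄K = [Δ] - P` of currents on `X × X`, for a kernel `K` of degree `2n - 1`. -/
def SolvesDiagonalEquation (K P : Form ((Fin n → ℂ) × (Fin n → ℂ)) (X × X)) : Prop :=
  LocIntForm (modelXX n) K ∧ SmoothForm (modelXX n) P ∧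
    ∀ φ, TestForm (modelXX n) φ →
      dbarCurrent (modelXX n) (2 * n - 1) (formCurrent (modelXX n) K) φ
        = diagonalCurrent 𝓘(ℂ, Fin n → ℂ) φ - formCurrent (modelXX n) P φ

/-- The Koppelman formula
`φ(z) = ∫_ζ K ∧ ∂̄φ + ∂̄_z ∫_ζ K ∧ φ + ∫_ζ P ∧ φ`
in the sense of currents, for compactly supported `φ` of degree `r`, tested against `ψ(z)`. -/
def KoppelmanFormula (K P : Form ((Fin n → ℂ) × (Fin n → ℂ)) (X × X)) : Prop :=
  ∀ (r : ℕ) (φ ψ : Form (Fin n → ℂ) X), TestForm 𝓘(ℂ, Fin n → ℂ) φ → HasDegree r φ →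
    TestForm 𝓘(ℂ, Fin n → ℂ) ψ →
    let atζ := pullback 𝓘(ℂ, Fin n → ℂ) (modelXX n) (Prod.fst : X × X → X)
    let atz := pullback 𝓘(ℂ, Fin n → ℂ) (modelXX n) (Prod.snd : X × X → X)
    integralForm 𝓘(ℂ, Fin n → ℂ) (fun x => φ x * ψ x) =
      integralForm (modelXX n) (fun p => K p * atζ (dbarForm 𝓘(ℂ, Fin n → ℂ) φ) p * atz ψ p)
      + (-1) ^ r *
        integralForm (modelXX n) (fun p => K p * atζ φ p * atz (dbarForm 𝓘(ℂ, Fin n → ℂ) ψ) p)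
      + integralForm (modelXX n) (fun p => P p * atζ φ p * atz ψ p)

end Diagonal

end Koppelman

end

/-!
The proof regularises the kernel and lets the parameter tend to zero. Let `s = h(η, ·)` be the
section of `E*` that corresponds to `η` under the metric, so that `δ_η s = |η|²` and
`∇s = |η|² - ∂̄s`. The minimal solution is `σ = s / |η|²` (`minimalSolution_eq`), and since
`s ∧ s = 0`, the section `u = σ / ∇σ` is equal to `s / ∇s`. For `ε > 0` the even element `ε + ∇s` is
invertible everywhere, the section `u_ε = s (ε + ∇s)⁻¹` is smooth, and from `∇² s = 0` one gets
`∇u_ε = 1 - ε (ε + ∇s)⁻¹` (`nablaFlat_secS_mul_resolvent`).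

*The equation for `ε > 0`.* The super-curvature `A = Dη/2πi + iΘ̃/2π` is `∇`-closed: `∂̄Dη = Θη`
cancels against `δ_η Θ̃`, and `∂̄Θ̃ = 0` (`nablaFlat_superFlat`). The weight is `∇`-closed as well, and
the fibre integral annihilates contractions (`berezinOf_delta`) and hence turns `∇` into `-∂̄`. So
`K_ε = ∫_E u_ε ∧ g ∧ A_n` satisfies `∂̄K_ε = R_ε - P` with `R_ε = ∫_E ε (ε + ∇s)⁻¹ ∧ g ∧ A_n`
(`dbarFlat_kerReg`), and Stokes' theorem gives the weak form of this equation
(`integral_kerReg_dbarFlat`).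

*The limit of the kernels.* Near the diagonal `|η|` is comparable with `|ζ - z|`
(`exists_norm_bounds`), so the term `s ∧ (∂̄s)ᵏ / (|η|² + ε)ᵏ⁺¹` of `u_ε` is bounded by
`|ζ - z|⁻²ᵏ⁻¹` with `k < n`. This is integrable uniformly in `ε`, so `K` is locally integrable and
`K_ε → K` weakly (`DiagonalModel.tendsto_kerReg`).

*The residue.* The terms `ε (∂̄s)ᵏ / (|η|² + ε)ᵏ⁺¹` of `R_ε` with `k < n` tend to zero by the same
estimates. In the term with `k = n` put `ε = t²` and substitute `ζ = z + t w`
(`tendsto_integral_residue_leading`): it tends to the integral over the diagonal of the form at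
`(z, z)`, times `∫ (Q_z(w) + 1)⁻ⁿ⁻¹ dw`, where `Q_z` is the Hessian form of `|η|²` in the normal
directions. As `(∂̄s)ⁿ` contains all of `E*`, on the diagonal only `g_{0,0} = 1` and the part
`(Dη/2πi)ⁿ / n!` of `A_n` contribute (`topCoeff_residue`), and the determinants that occur cancel
against those of the Gaussian type integral, so that the limit is `[Δ]` with the factor one
(`DiagonalModel.residue_mass`).

*From charts to the manifold.* The operators and the kernels do not depend on coordinates and
holomorphic frames (`dbarFlat_map`, `map_superFlat`, `berezinOf_congr`), so the equation can be
checked on test forms with small support: near the diagonal by the above, and outside of it by Stokes'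
theorem with `ε = 0`, where the residue vanishes (`formCurrent_dbarForm`).

For `g = 1`, the part of `A_n` that contains all of `E` and `E*` is `(iΘ̃/2π)ⁿ / n!`, whose fibre
integral is the determinant (`kernelP_one`). The Koppelman formula is the current equation tested on
the forms `φ(ζ) ∧ ψ(z)` (`koppelmanFormula_of_current_equation`).
-/

noncomputable section

set_option linter.unusedSectionVars false

open ExteriorAlgebra (ι map map_apply_ι)
open Koppelman.ComplexCoords (dim basis)

namespace Koppelman

/-! ### Calculus of maps into finite-dimensional complex vector spaces -/

section Calculus

variable {V : Type*} [NormedAddCommGroup V] [NormedSpace ℂ V]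
  {V' : Type*} [NormedAddCommGroup V'] [NormedSpace ℂ V']
  {A : Type*} [AddCommGroup A] [Module ℂ A] [Module.Finite ℂ A]
  {B : Type*} [AddCommGroup B] [Module ℂ B] [Module.Finite ℂ B]
  {C : Type*} [AddCommGroup C] [Module ℂ C] [Module.Finite ℂ C]

/-- Real smoothness at a point of a map into a finite-dimensional complex vector space, which need
not carry a norm: all linear functionals of it are smooth. -/
def SmoothAt (f : V → A) (x : V) : Prop :=
  ∀ ℓ : Dual ℂ A, ContDiffAt ℝ ∞ (fun y => ℓ (f y)) x

theorem SmoothAt.of_basis {ι : Type*} [Fintype ι] (b : Basis ι ℂ A) {f : V → A} {x : V}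
    (h : ∀ i, ContDiffAt ℝ ∞ (fun y => b.repr (f y) i) x) : SmoothAt f x := by
  intro ℓ
  have : (fun y => ℓ (f y)) = fun y => ∑ i, b.repr (f y) i * ℓ (b i) := by
    funext y
    conv_lhs => rw [← b.sum_repr (f y)]
    simp only [map_sum, map_smul, smul_eq_mul]
  rw [this]
  exact ContDiffAt.sum fun i _ => (h i).mul contDiffAt_const

theorem SmoothAt.repr {ι : Type*} [Fintype ι] (b : Basis ι ℂ A) {f : V → A} {x : V}
    (h : SmoothAt f x) (i : ι) : ContDiffAt ℝ ∞ (fun y => b.repr (f y) i) x :=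
  h (b.coord i)

theorem smoothAt_const (a : A) (x : V) : SmoothAt (fun _ => a) x := fun _ => contDiffAt_const

theorem SmoothAt.congr {f g : V → A} {x : V} (h : SmoothAt f x) (hfg : g =ᶠ[𝓝 x] f) :
    SmoothAt g x := fun ℓ =>
  (h ℓ).congr_of_eventuallyEq (hfg.mono fun y hy => by simp only [hy])

theorem SmoothAt.add {f g : V → A} {x : V} (hf : SmoothAt f x) (hg : SmoothAt g x) :
    SmoothAt (fun y => f y + g y) x := fun ℓ => by
  simpa only [map_add] using (hf ℓ).add (hg ℓ)

theorem SmoothAt.sub {f g : V → A} {x : V} (hf : SmoothAt f x) (hg : SmoothAt g x) :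
    SmoothAt (fun y => f y - g y) x := fun ℓ => by
  simpa only [map_sub] using (hf ℓ).sub (hg ℓ)

theorem SmoothAt.sum {ι : Type*} {s : Finset ι} {f : ι → V → A} {x : V}
    (h : ∀ i ∈ s, SmoothAt (f i) x) : SmoothAt (fun y => ∑ i ∈ s, f i y) x := fun ℓ => by
  simpa only [map_sum] using ContDiffAt.sum fun i hi => h i hi ℓ

theorem SmoothAt.linear (L : A →ₗ[ℂ] B) {f : V → A} {x : V} (hf : SmoothAt f x) :
    SmoothAt (fun y => L (f y)) x := fun ℓ => hf (ℓ ∘ₗ L)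

theorem SmoothAt.const_smul (c : ℂ) {f : V → A} {x : V} (hf : SmoothAt f x) :
    SmoothAt (fun y => c • f y) x := hf.linear (c • LinearMap.id)

theorem SmoothAt.bilinear (L : A →ₗ[ℂ] B →ₗ[ℂ] C) {f : V → A} {g : V → B} {x : V}
    (hf : SmoothAt f x) (hg : SmoothAt g x) : SmoothAt (fun y => L (f y) (g y)) x := fun ℓ => by
  have : (fun y => ℓ (L (f y) (g y))) = fun y =>
      ∑ i, (finBasis ℂ A).repr (f y) i * ℓ (L (finBasis ℂ A i) (g y)) := by
    funext y
    conv_lhs => rw [← (finBasis ℂ A).sum_repr (f y)]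
    simp only [map_sum, map_smul, smul_eq_mul, LinearMap.sum_apply, LinearMap.smul_apply]
  rw [this]
  exact ContDiffAt.sum fun i _ => (hf.repr _ i).mul (hg (ℓ ∘ₗ L (finBasis ℂ A i)))

theorem smoothAt_complex_iff {f : V → ℂ} {x : V} : SmoothAt f x ↔ ContDiffAt ℝ ∞ f x := by
  refine ⟨fun h => h LinearMap.id, fun h ℓ => ?_⟩
  have : (fun y => ℓ (f y)) = fun y => f y * ℓ 1 := by
    funext y
    rw [← smul_eq_mul, ← map_smul, smul_eq_mul, mul_one]
  rw [this]
  exact h.mul contDiffAt_const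

theorem SmoothAt.smul {φ : V → ℂ} {f : V → A} {x : V} (hφ : ContDiffAt ℝ ∞ φ x)
    (hf : SmoothAt f x) : SmoothAt (fun y => φ y • f y) x :=
  SmoothAt.bilinear (LinearMap.lsmul ℂ A) (smoothAt_complex_iff.2 hφ) hf

theorem SmoothAt.mul {R : Type*} [Ring R] [Algebra ℂ R] [Module.Finite ℂ R] {f g : V → R} {x : V}
    (hf : SmoothAt f x) (hg : SmoothAt g x) : SmoothAt (fun y => f y * g y) x :=
  SmoothAt.bilinear (LinearMap.mul ℂ R) hf hg

theorem SmoothAt.pow {R : Type*} [Ring R] [Algebra ℂ R] [Module.Finite ℂ R] {f : V → R} {x : V}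
    (hf : SmoothAt f x) (k : ℕ) : SmoothAt (fun y => f y ^ k) x := by
  induction k with
  | zero => simpa using smoothAt_const 1 x
  | succ k ih => simpa only [pow_succ] using ih.mul hf

theorem SmoothAt.differentiableAt {f : V → A} {x : V} (hf : SmoothAt f x) (ℓ : Dual ℂ A) :
    DifferentiableAt ℝ (fun y => ℓ (f y)) x := (hf ℓ).differentiableAt (by simp)

theorem ext_dual {a b : A} (h : ∀ ℓ : Dual ℂ A, ℓ a = ℓ b) : a = b := by
  rw [← sub_eq_zero]
  exact (forall_dual_apply_eq_zero_iff ℂ _).1 fun ℓ => by rw [map_sub, h, sub_self]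

theorem repr_dirDeriv (f : V → A) (x v : V) (i) :
    (finBasis ℂ A).repr (dirDeriv f x v) i
      = fderiv ℝ (fun y => (finBasis ℂ A).repr (f y) i) x v := by
  simp [dirDeriv, Finsupp.single_apply]

theorem dual_dirDeriv {f : V → A} {x : V} (hf : SmoothAt f x) (v : V) (ℓ : Dual ℂ A) :
    ℓ (dirDeriv f x v) = fderiv ℝ (fun y => ℓ (f y)) x v := by
  have : (fun y => ℓ (f y)) = fun y =>
      ∑ i, (finBasis ℂ A).repr (f y) i * ℓ (finBasis ℂ A i) := by
    funext y
    conv_lhs => rw [← (finBasis ℂ A).sum_repr (f y)]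
    simp only [map_sum, map_smul, smul_eq_mul]
  have hd : ∀ i, DifferentiableAt ℝ (fun y => (finBasis ℂ A).repr (f y) i) x := fun i =>
    hf.differentiableAt ((finBasis ℂ A).coord i)
  rw [this, fderiv_fun_sum fun i _ => (hd i).mul_const _]
  simp only [dirDeriv, map_sum, map_smul, smul_eq_mul, _root_.sum_apply]
  refine Finset.sum_congr rfl fun i _ => ?_
  rw [fderiv_mul_const (hd i)]
  simp [mul_comm]

theorem dirDeriv_complex {f : V → ℂ} {x : V} (hf : ContDiffAt ℝ ∞ f x) (v : V) :
    dirDeriv f x v = fderiv ℝ f x v :=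
  dual_dirDeriv (smoothAt_complex_iff.2 hf) v LinearMap.id

theorem dirDeriv_congr {f g : V → A} {x : V} (h : f =ᶠ[𝓝 x] g) (v : V) :
    dirDeriv f x v = dirDeriv g x v := by
  unfold dirDeriv
  refine Finset.sum_congr rfl fun i _ => ?_
  have : (fun y => (finBasis ℂ A).repr (f y) i) =ᶠ[𝓝 x] fun y => (finBasis ℂ A).repr (g y) i :=
    h.mono fun y hy => by simp only [hy]
  rw [this.fderiv_eq]

theorem dirDeriv_linear (L : A →ₗ[ℂ] B) {f : V → A} {x : V} (hf : SmoothAt f x) (v : V) :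
    dirDeriv (fun y => L (f y)) x v = L (dirDeriv f x v) := ext_dual fun ℓ => by
  rw [dual_dirDeriv (hf.linear L)]
  exact (dual_dirDeriv hf v (ℓ ∘ₗ L)).symm

theorem dirDeriv_add {f g : V → A} {x : V} (hf : SmoothAt f x) (hg : SmoothAt g x) (v : V) :
    dirDeriv (fun y => f y + g y) x v = dirDeriv f x v + dirDeriv g x v := ext_dual fun ℓ => by
  rw [map_add, dual_dirDeriv (hf.add hg), dual_dirDeriv hf, dual_dirDeriv hg]
  simp only [map_add]
  rw [fderiv_fun_add (hf.differentiableAt ℓ) (hg.differentiableAt ℓ)]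
  rfl

theorem dirDeriv_const (a : A) (x v : V) : dirDeriv (fun _ => a) x v = 0 := ext_dual fun ℓ => by
  rw [dual_dirDeriv (smoothAt_const a x)]
  simp

theorem dirDeriv_sum {ι : Type*} {s : Finset ι} {f : ι → V → A} {x : V}
    (h : ∀ i ∈ s, SmoothAt (f i) x) (v : V) :
    dirDeriv (fun y => ∑ i ∈ s, f i y) x v = ∑ i ∈ s, dirDeriv (f i) x v :=
  ext_dual fun ℓ => by
    rw [map_sum, dual_dirDeriv (SmoothAt.sum h)]
    simp only [map_sum]
    rw [fderiv_fun_sum fun i hi => (h i hi).differentiableAt ℓ, _root_.sum_apply]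
    exact Finset.sum_congr rfl fun i hi => (dual_dirDeriv (h i hi) v ℓ).symm

theorem dirDeriv_smul_const {φ : V → ℂ} {x : V} (hφ : ContDiffAt ℝ ∞ φ x) (a : A) (v : V) :
    dirDeriv (fun y => φ y • a) x v = (fderiv ℝ φ x v) • a := by
  rw [← dirDeriv_complex hφ]
  exact dirDeriv_linear (LinearMap.toSpanSingleton ℂ A a) (smoothAt_complex_iff.2 hφ) v

theorem sum_repr_smul (f : V → A) :
    f = fun y => ∑ i, (finBasis ℂ A).repr (f y) i • finBasis ℂ A i := by
  funext y
  exact ((finBasis ℂ A).sum_repr (f y)).symm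

theorem dirDeriv_bilinear (L : A →ₗ[ℂ] B →ₗ[ℂ] C) {f : V → A} {g : V → B} {x : V}
    (hf : SmoothAt f x) (hg : SmoothAt g x) (v : V) :
    dirDeriv (fun y => L (f y) (g y)) x v
      = L (dirDeriv f x v) (g x) + L (f x) (dirDeriv g x v) := ext_dual fun ℓ => by
  have h1 : (fun y => ℓ (L (f y) (g y))) = fun y =>
      ∑ i, (finBasis ℂ A).repr (f y) i * ℓ (L (finBasis ℂ A i) (g y)) := by
    funext y
    conv_lhs => rw [← (finBasis ℂ A).sum_repr (f y)]
    simp only [map_sum, map_smul, smul_eq_mul, LinearMap.sum_apply, LinearMap.smul_apply]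
  have hd : ∀ i, DifferentiableAt ℝ (fun y => (finBasis ℂ A).repr (f y) i) x := fun i =>
    hf.differentiableAt ((finBasis ℂ A).coord i)
  have hd2 : ∀ i, DifferentiableAt ℝ (fun y => ℓ (L (finBasis ℂ A i) (g y))) x := fun i =>
    hg.differentiableAt (ℓ ∘ₗ L (finBasis ℂ A i))
  rw [dual_dirDeriv (hf.bilinear L hg), h1, fderiv_fun_sum fun i _ => (hd i).fun_mul (hd2 i)]
  have h2 : ∀ b : B, ℓ (L (f x) b)
      = ∑ i, (finBasis ℂ A).repr (f x) i * ℓ (L (finBasis ℂ A i) b) := by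
    intro b
    conv_lhs => rw [← (finBasis ℂ A).sum_repr (f x)]
    simp only [map_sum, map_smul, smul_eq_mul, LinearMap.sum_apply, LinearMap.smul_apply]
  have h3 : dirDeriv f x v = ∑ i, (fderiv ℝ (fun y => (finBasis ℂ A).repr (f y) i) x v) •
    finBasis ℂ A i := rfl
  rw [map_add, h2, h3]
  simp only [_root_.sum_apply, map_sum, LinearMap.sum_apply, map_smul,
    LinearMap.smul_apply, smul_eq_mul]
  rw [← Finset.sum_add_distrib]
  refine Finset.sum_congr rfl fun i _ => ?_
  rw [fderiv_fun_mul (hd i) (hd2 i)]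
  have := dual_dirDeriv hg v (ℓ ∘ₗ L (finBasis ℂ A i))
  simp only [LinearMap.comp_apply] at this
  rw [this]
  simp only [_root_.add_apply, _root_.smul_apply, smul_eq_mul]
  ring

theorem SmoothAt.dirDeriv {f : V → A} {x : V} (hf : SmoothAt f x) (v : V) :
    SmoothAt (fun y => dirDeriv f y v) x := by
  refine SmoothAt.of_basis (finBasis ℂ A) fun i => ?_
  simp only [repr_dirDeriv]
  exact ((hf.repr _ i).fderiv_right (m := ∞) (by simp)).clm_apply contDiffAt_const

theorem dirDeriv_comm {f : V → A} {x : V} (hf : SmoothAt f x) (v w : V) :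
    dirDeriv (fun y => dirDeriv f y v) x w = dirDeriv (fun y => dirDeriv f y w) x v := by
  apply (finBasis ℂ A).repr.injective
  ext i
  simp only [repr_dirDeriv]
  have h2 : ContDiffAt ℝ ∞ (fun y => (finBasis ℂ A).repr (f y) i) x := hf.repr _ i
  have hsym := (h2.isSymmSndFDerivAt (by simp; norm_cast)).eq v w
  have hd : DifferentiableAt ℝ (fderiv ℝ (fun y => (finBasis ℂ A).repr (f y) i)) x :=
    (h2.fderiv_right (m := 1) (by norm_cast)).differentiableAt (by simp)
  rw [fderiv_clm_apply hd (differentiableAt_const _),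
    fderiv_clm_apply hd (differentiableAt_const _)]
  simpa using hsym.symm

end Calculus

/-! ### The operators `∂` and `∂̄` in coordinates -/

section Wirtinger

variable {V : Type*} [NormedAddCommGroup V] [NormedSpace ℂ V] [ComplexCoords V]
  {A : Type*} [AddCommGroup A] [Module ℂ A] [Module.Finite ℂ A]
  {B : Type*} [AddCommGroup B] [Module ℂ B] [Module.Finite ℂ B]
  {C : Type*} [AddCommGroup C] [Module ℂ C] [Module.Finite ℂ C]
  {R : Type*} [Ring R] [Algebra ℂ R] [Module.Finite ℂ R]

/-- The derivative `(∂/∂x_j + e i ∂/∂y_j) / 2`; it is `∂/∂\bar z_j` for `e = 1` and `∂/∂z_j` for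
`e = -1`. -/
def dirE (e : ℂ) (f : V → A) (x : V) (j : Fin (dim V)) : A :=
  (1 / 2 : ℂ) • (dirDeriv f x (basis j)
    + (e * Complex.I) • dirDeriv f x (Complex.I • basis j))

/-- The operator `f ↦ ∑ ν_j ∧ (∂/∂x_j + e i ∂/∂y_j) f / 2`, a common form of `∂` and `∂̄`. -/
def wirt (e : ℂ) (ν : Fin (dim V) → V →ₗ[ℝ] ℂ) (c : (V →ₗ[ℝ] ℂ) →ₗ[ℂ] R)
    (f : V → R) (x : V) : R :=
  ∑ j, c (ν j) * dirE e f x j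

/-- The operator `∂` in coordinates. -/
def delFlat (c : (V →ₗ[ℝ] ℂ) →ₗ[ℂ] R) (f : V → R) (x : V) : R := wirt (-1) dz c f x

theorem dbarFlat_eq_wirt (c : (V →ₗ[ℝ] ℂ) →ₗ[ℂ] R) (f : V → R) :
    dbarFlat c f = wirt 1 dzbar c f := by
  funext x
  simp [dbarFlat, wirt, dirE, dirDzbar]

theorem dFlat_eq (c : (V →ₗ[ℝ] ℂ) →ₗ[ℂ] R) (f : V → R) (x : V) :
    dFlat c f x = delFlat c f x + dbarFlat c f x := by
  simp [dFlat, delFlat, wirt, dirE, dirDz, sub_eq_add_neg]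

variable {e : ℂ} {ν : Fin (dim V) → V →ₗ[ℝ] ℂ} {c : (V →ₗ[ℝ] ℂ) →ₗ[ℂ] R}

theorem dirE_linear (L : A →ₗ[ℂ] B) {f : V → A} {x : V} (hf : SmoothAt f x) (j) :
    dirE e (fun y => L (f y)) x j = L (dirE e f x j) := by
  simp only [dirE, dirDeriv_linear L hf, map_smul, map_add]

theorem dirE_add {f g : V → A} {x : V} (hf : SmoothAt f x) (hg : SmoothAt g x) (j) :
    dirE e (fun y => f y + g y) x j = dirE e f x j + dirE e g x j := by
  simp only [dirE, dirDeriv_add hf hg]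
  module

theorem dirE_sum {ι : Type*} {s : Finset ι} {f : ι → V → A} {x : V}
    (h : ∀ i ∈ s, SmoothAt (f i) x) (j) :
    dirE e (fun y => ∑ i ∈ s, f i y) x j = ∑ i ∈ s, dirE e (f i) x j := by
  simp only [dirE, dirDeriv_sum h, Finset.smul_sum, ← Finset.sum_add_distrib]

theorem dirE_bilinear (L : A →ₗ[ℂ] B →ₗ[ℂ] C) {f : V → A} {g : V → B} {x : V}
    (hf : SmoothAt f x) (hg : SmoothAt g x) (j) :
    dirE e (fun y => L (f y) (g y)) x j = L (dirE e f x j) (g x) + L (f x) (dirE e g x j) := by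
  simp only [dirE, dirDeriv_bilinear L hf hg, map_smul, map_add, LinearMap.smul_apply,
    LinearMap.add_apply]
  module

theorem dirE_congr {f g : V → A} {x : V} (h : f =ᶠ[𝓝 x] g) (j) : dirE e f x j = dirE e g x j := by
  simp only [dirE, dirDeriv_congr h]

theorem SmoothAt.dirE {f : V → A} {x : V} (hf : SmoothAt f x) (j) :
    SmoothAt (fun y => dirE e f y j) x :=
  ((hf.dirDeriv _).add ((hf.dirDeriv _).const_smul _)).const_smul _

theorem dirE_comm {f : V → A} {x : V} (hf : SmoothAt f x) (j k) :
    dirE e (fun y => dirE e f y j) x k = dirE e (fun y => dirE e f y k) x j := by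
  have key : ∀ j v, dirDeriv (fun y => dirE e f y j) x v = (1 / 2 : ℂ) •
      (dirDeriv (fun y => dirDeriv f y (basis j)) x v + (e * Complex.I) •
        dirDeriv (fun y => dirDeriv f y (Complex.I • basis j)) x v) := by
    intro j v
    have h1 := dirDeriv_linear ((1 / 2 : ℂ) • LinearMap.id)
      ((hf.dirDeriv (basis j)).add
        ((hf.dirDeriv (Complex.I • basis j)).const_smul (e * Complex.I))) v
    have h2 := dirDeriv_linear ((e * Complex.I) • LinearMap.id)
      (hf.dirDeriv (Complex.I • basis j)) v
    simp only [LinearMap.smul_apply, LinearMap.id_apply] at h1 h2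
    unfold Koppelman.dirE
    rw [h1, dirDeriv_add (hf.dirDeriv _) ((hf.dirDeriv _).const_smul _), h2]
  simp only [dirE, key, show ∀ j, (fun y => (1 / 2 : ℂ) • (dirDeriv f y (basis j)
    + (e * Complex.I) • dirDeriv f y (Complex.I • basis j))) =
      fun y => Koppelman.dirE e f y j from fun _ => rfl]
  rw [dirDeriv_comm hf (basis k) (basis j),
    dirDeriv_comm hf (Complex.I • basis k) (basis j),
    dirDeriv_comm hf (basis k) (Complex.I • basis j),
    dirDeriv_comm hf (Complex.I • basis k) (Complex.I • basis j)]
  module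

theorem SmoothAt.wirt {f : V → R} {x : V} (hf : SmoothAt f x) : SmoothAt (wirt e ν c f) x :=
  SmoothAt.sum fun j _ => (smoothAt_const _ x).mul (hf.dirE j)

theorem SmoothAt.dbarFlat {f : V → R} {x : V} (hf : SmoothAt f x) :
    SmoothAt (dbarFlat c f) x := by
  rw [dbarFlat_eq_wirt]
  exact hf.wirt

theorem wirt_add {f g : V → R} {x : V} (hf : SmoothAt f x) (hg : SmoothAt g x) :
    wirt e ν c (fun y => f y + g y) x = wirt e ν c f x + wirt e ν c g x := by
  simp only [wirt, dirE_add hf hg, mul_add, Finset.sum_add_distrib]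

theorem wirt_sum {ι : Type*} {s : Finset ι} {f : ι → V → R} {x : V}
    (h : ∀ i ∈ s, SmoothAt (f i) x) :
    wirt e ν c (fun y => ∑ i ∈ s, f i y) x = ∑ i ∈ s, wirt e ν c (f i) x := by
  simp only [wirt, dirE_sum h, Finset.mul_sum]
  exact Finset.sum_comm

theorem wirt_congr {f g : V → R} {x : V} (h : f =ᶠ[𝓝 x] g) : wirt e ν c f x = wirt e ν c g x := by
  simp only [wirt, dirE_congr h]

theorem wirt_const_smul (a : ℂ) {f : V → R} {x : V} (hf : SmoothAt f x) :
    wirt e ν c (fun y => a • f y) x = a • wirt e ν c f x := by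
  simp only [wirt, Finset.smul_sum]
  refine Finset.sum_congr rfl fun j _ => ?_
  have := dirE_linear (e := e) (a • LinearMap.id) hf j
  simp only [LinearMap.smul_apply, LinearMap.id_apply] at this
  rw [this, mul_smul_comm]

theorem wirt_const (a : R) (x : V) : wirt e ν c (fun _ => a) x = 0 := by
  simp [wirt, dirE, dirDeriv_const]

/-- The graded Leibniz rule. -/
theorem wirt_mul (inv : R →ₗ[ℂ] R) (hc : ∀ ℓ a, c ℓ * a = inv a * c ℓ) {f g : V → R} {x : V}
    (hf : SmoothAt f x) (hg : SmoothAt g x) :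
    wirt e ν c (fun y => f y * g y) x = wirt e ν c f x * g x + inv (f x) * wirt e ν c g x := by
  simp only [wirt, Finset.sum_mul, Finset.mul_sum, ← Finset.sum_add_distrib]
  refine Finset.sum_congr rfl fun j _ => ?_
  have := dirE_bilinear (e := e) (LinearMap.mul ℂ R) hf hg j
  simp only [LinearMap.mul_apply'] at this
  rw [this, mul_add, ← mul_assoc, ← mul_assoc, hc _ (f x), mul_assoc (inv (f x))]

/-- Both `∂` and `∂̄` square to zero, since second derivatives are symmetric. -/
theorem wirt_wirt (hc : ∀ ℓ m, c ℓ * c m = -(c m * c ℓ)) {f : V → R} {x : V} (hf : SmoothAt f x) :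
    wirt e ν c (wirt e ν c f) x = 0 := by
  have h1 : wirt e ν c (wirt e ν c f) x
      = ∑ k, ∑ j, c (ν k) * (c (ν j) * dirE e (fun y => dirE e f y j) x k) := by
    unfold wirt
    refine Finset.sum_congr rfl fun k _ => ?_
    rw [dirE_sum fun j _ => (smoothAt_const _ x).mul (hf.dirE j), Finset.mul_sum]
    refine Finset.sum_congr rfl fun j _ => ?_
    congr 1
    exact dirE_linear (LinearMap.mulLeft ℂ (c (ν j))) (hf.dirE j) k
  have h2 : wirt e ν c (wirt e ν c f) x = - wirt e ν c (wirt e ν c f) x := by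
    conv_lhs => rw [h1, Finset.sum_comm]
    rw [h1, ← Finset.sum_neg_distrib]
    refine Finset.sum_congr rfl fun j _ => ?_
    rw [← Finset.sum_neg_distrib]
    refine Finset.sum_congr rfl fun k _ => ?_
    rw [← mul_assoc, hc, neg_mul, mul_assoc, dirE_comm hf]
  have h3 : (2 : ℂ) • wirt e ν c (wirt e ν c f) x = 0 := by
    rw [two_smul]
    nth_rewrite 2 [h2]
    exact add_neg_cancel _
  exact (smul_eq_zero.1 h3).resolve_left two_ne_zero

theorem wirt_linear {S : Type*} [Ring S] [Algebra ℂ S] [Module.Finite ℂ S] (F : R →ₗ[ℂ] S)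
    (c' : (V →ₗ[ℝ] ℂ) →ₗ[ℂ] S) (hF : ∀ ℓ a, F (c ℓ * a) = c' ℓ * F a) {f : V → R} {x : V}
    (hf : SmoothAt f x) : wirt e ν c' (fun y => F (f y)) x = F (wirt e ν c f x) := by
  simp only [wirt, map_sum, hF, dirE_linear F hf]

/-- The `(0,1)`-part of a covector. -/
def part01 (ℓ : V →ₗ[ℝ] ℂ) : V →ₗ[ℝ] ℂ :=
  (1 / 2 : ℂ) • (ℓ + Complex.I • (ℓ ∘ₗ mulI))

theorem part01_apply (ℓ : V →ₗ[ℝ] ℂ) (v : V) :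
    part01 ℓ v = (1 / 2 : ℂ) * (ℓ v + Complex.I * ℓ (Complex.I • v)) := rfl

theorem part10_apply (ℓ : V →ₗ[ℝ] ℂ) (v : V) :
    part10 ℓ v = (1 / 2 : ℂ) * (ℓ v - Complex.I * ℓ (Complex.I • v)) := rfl

theorem part10_add_part01 (ℓ : V →ₗ[ℝ] ℂ) : part10 ℓ + part01 ℓ = ℓ := by
  ext v
  rw [LinearMap.add_apply, part01_apply, part10_apply]
  ring

theorem real_smul_decomp (ℓ : V →ₗ[ℝ] ℂ) (z : ℂ) (v : V) :
    ℓ (z • v) = z.re * ℓ v + z.im * ℓ (Complex.I • v) := by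
  have : z • v = z.re • v + z.im • (Complex.I • v) := by
    rw [← Complex.coe_smul z.re v, ← Complex.coe_smul z.im (Complex.I • v), smul_smul, ← add_smul,
      Complex.re_add_im]
  rw [this, map_add, map_smul, map_smul, Complex.real_smul, Complex.real_smul]

theorem part01_smul (ℓ : V →ₗ[ℝ] ℂ) (z : ℂ) (v : V) :
    part01 ℓ (z • v) = conj z * part01 ℓ v := by
  rw [real_smul_decomp, part01_apply, part01_apply, smul_smul, Complex.I_mul_I, neg_one_smul,
    map_neg]
  have hz : conj z = z.re - z.im * Complex.I := by
    apply Complex.ext <;> simp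
  rw [hz]
  linear_combination ((1 / 2 : ℂ) * (z.im) * ℓ (Complex.I • v)) * Complex.I_sq

theorem part10_smul (ℓ : V →ₗ[ℝ] ℂ) (z : ℂ) (v : V) :
    part10 ℓ (z • v) = z * part10 ℓ v := by
  rw [real_smul_decomp, part10_apply, part10_apply, smul_smul, Complex.I_mul_I, neg_one_smul,
    map_neg]
  have hz : z = z.re + z.im * Complex.I := (Complex.re_add_im z).symm
  have : z * (1 / 2 * (ℓ v - Complex.I * ℓ (Complex.I • v))) = (z.re + z.im * Complex.I)
    * (1 / 2 * (ℓ v - Complex.I * ℓ (Complex.I • v))) := by rw [← hz]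
  rw [this]
  linear_combination ((1 / 2 : ℂ) * (z.im) * ℓ (Complex.I • v)) * Complex.I_sq

theorem part01_eq_self {ℓ : V →ₗ[ℝ] ℂ} (h : ∀ v, ℓ (Complex.I • v) = -Complex.I * ℓ v) :
    part01 ℓ = ℓ := by
  ext v
  rw [part01_apply, h]
  linear_combination (-(1 / 2 : ℂ) * ℓ v) * Complex.I_sq

theorem part01_eq_zero {ℓ : V →ₗ[ℝ] ℂ} (h : ∀ v, ℓ (Complex.I • v) = Complex.I * ℓ v) :
    part01 ℓ = 0 := by
  ext v
  rw [part01_apply, h, LinearMap.zero_apply]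
  linear_combination ((1 / 2 : ℂ) * ℓ v) * Complex.I_sq

theorem dz_apply (j) (v : V) : dz j v = basis.repr v j := rfl

theorem dzbar_apply (j) (v : V) : dzbar j v = conj (basis.repr v j) := rfl

theorem sum_part01 (ℓ : V →ₗ[ℝ] ℂ) :
    ∑ j, part01 ℓ (basis j) • dzbar j = part01 ℓ := by
  ext v
  conv_rhs => rw [← basis.sum_repr v, map_sum]
  simp only [LinearMap.sum_apply, LinearMap.smul_apply, part01_smul, dzbar_apply, smul_eq_mul,
    mul_comm]

theorem sum_part10 (ℓ : V →ₗ[ℝ] ℂ) :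
    ∑ j, part10 ℓ (basis j) • dz j = part10 ℓ := by
  ext v
  conv_rhs => rw [← basis.sum_repr v, map_sum]
  simp only [LinearMap.sum_apply, LinearMap.smul_apply, part10_smul, dz_apply, smul_eq_mul,
    mul_comm]

theorem dbarFlat_smul_const {φ : V → ℂ} {x : V} (hφ : ContDiffAt ℝ ∞ φ x) (a : R) :
    dbarFlat c (fun y => φ y • a) x = c (part01 (fderiv ℝ φ x : V →ₗ[ℝ] ℂ)) * a := by
  rw [← sum_part01, map_sum, Finset.sum_mul]
  refine Finset.sum_congr rfl fun j _ => ?_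
  rw [dirDzbar, dirDeriv_smul_const hφ, dirDeriv_smul_const hφ, LinearMap.map_smul c, part01_apply,
    smul_smul, ← add_smul, smul_smul, mul_smul_comm, smul_mul_assoc]
  rfl

theorem delFlat_smul_const {φ : V → ℂ} {x : V} (hφ : ContDiffAt ℝ ∞ φ x) (a : R) :
    delFlat c (fun y => φ y • a) x = c (part10 (fderiv ℝ φ x : V →ₗ[ℝ] ℂ)) * a := by
  rw [← sum_part10, map_sum, Finset.sum_mul]
  change ∑ j, c (dz j) * dirE (-1) (fun y => φ y • a) x j = _
  refine Finset.sum_congr rfl fun j _ => ?_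
  rw [dirE, dirDeriv_smul_const hφ, dirDeriv_smul_const hφ, LinearMap.map_smul c, part10_apply,
    smul_smul, ← add_smul, smul_smul, mul_smul_comm, smul_mul_assoc, neg_one_mul, neg_mul,
    ← sub_eq_add_neg]
  rfl

theorem dbarFlat_eq_sum_repr {f : V → R} {x : V} (hf : SmoothAt f x) :
    dbarFlat c f x = ∑ i, c (part01 (fderiv ℝ (fun y => (finBasis ℂ R).repr (f y) i) x :
      V →ₗ[ℝ] ℂ)) * finBasis ℂ R i := by
  have h1 : dbarFlat c f x = dbarFlat c
      (fun y => ∑ i, (finBasis ℂ R).repr (f y) i • finBasis ℂ R i) x :=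
    congrArg (fun g => dbarFlat c g x) (sum_repr_smul f)
  rw [h1, dbarFlat_eq_wirt, wirt_sum fun i _ => SmoothAt.smul (hf.repr _ i) (smoothAt_const _ x)]
  exact Finset.sum_congr rfl fun i _ => by
    rw [← dbarFlat_smul_const (hf.repr _ i), dbarFlat_eq_wirt]

theorem sum_symm_mul_eq_zero {m : ℕ} (S : Fin m → Fin m → ℂ) (hS : ∀ j k, S j k = S k j)
    (a : Fin m → R) (ha : ∀ j k, a j * a k = -(a k * a j)) :
    ∑ j, ∑ k, S j k • (a j * a k) = 0 := by
  have h2 : ∑ j, ∑ k, S j k • (a j * a k) = - ∑ j, ∑ k, S j k • (a j * a k) := by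
    conv_lhs => rw [Finset.sum_comm]
    rw [← Finset.sum_neg_distrib]
    refine Finset.sum_congr rfl fun j _ => ?_
    rw [← Finset.sum_neg_distrib]
    refine Finset.sum_congr rfl fun k _ => ?_
    rw [ha, hS, smul_neg]
  have h3 : (2 : ℂ) • ∑ j, ∑ k, S j k • (a j * a k) = 0 := by
    rw [two_smul]
    nth_rewrite 2 [h2]
    exact add_neg_cancel _
  exact (smul_eq_zero.1 h3).resolve_left two_ne_zero

end Wirtinger

/-! ### The exterior algebra: parity and contractions -/

section Exterior

variable {W : Type*} [AddCommGroup W] [Module ℂ W] {W' : Type*} [AddCommGroup W'] [Module ℂ W']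

/-- The grading involution of the exterior algebra. -/
abbrev invol : ExteriorAlgebra ℂ W →ₐ[ℂ] ExteriorAlgebra ℂ W := CliffordAlgebra.involute

/-- Contraction with a linear functional. -/
abbrev contr (d : Dual ℂ W) : ExteriorAlgebra ℂ W →ₗ[ℂ] ExteriorAlgebra ℂ W :=
  CliffordAlgebra.contractLeft d

theorem invol_ι (w : W) : invol (ι ℂ w) = -ι ℂ w :=
  CliffordAlgebra.involute_ι w

theorem invol_invol (a : ExteriorAlgebra ℂ W) : invol (invol a) = a :=
  CliffordAlgebra.involute_involute a

theorem ι_mul_eq_invol_mul (w : W) (a : ExteriorAlgebra ℂ W) :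
    ι ℂ w * a = invol a * ι ℂ w := by
  induction a using ExteriorAlgebra.induction with
  | algebraMap r => rw [AlgHom.commutes]; exact (Algebra.commutes r _).symm
  | ι v =>
    rw [invol_ι, neg_mul]
    exact eq_neg_of_add_eq_zero_left (ExteriorAlgebra.ι_add_mul_swap w v)
  | mul a b ha hb => rw [← mul_assoc, ha, mul_assoc, hb, map_mul, mul_assoc]
  | add a b ha hb => rw [mul_add, ha, hb, map_add, add_mul]

theorem ι_anticomm (v w : W) : ι ℂ v * ι ℂ w
    = -(ι ℂ w * ι ℂ v) :=
  eq_neg_of_add_eq_zero_left (ExteriorAlgebra.ι_add_mul_swap v w)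

theorem contr_ι_mul (d : Dual ℂ W) (w : W) (b : ExteriorAlgebra ℂ W) :
    contr d (ι ℂ w * b) = d w • b - ι ℂ w * contr d b :=
  CliffordAlgebra.contractLeft_ι_mul d w b

theorem contr_ι (d : Dual ℂ W) (w : W) :
    contr d (ι ℂ w) = algebraMap ℂ _ (d w) :=
  CliffordAlgebra.contractLeft_ι _ d w

theorem contr_mul (d : Dual ℂ W) (a b : ExteriorAlgebra ℂ W) :
    contr d (a * b) = contr d a * b + invol a * contr d b := by
  induction a using ExteriorAlgebra.induction generalizing b with
  | algebraMap r =>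
    rw [AlgHom.commutes]
    change CliffordAlgebra.contractLeft d _ = CliffordAlgebra.contractLeft d _ * b + _
    rw [CliffordAlgebra.contractLeft_algebraMap, zero_mul, zero_add]
    exact CliffordAlgebra.contractLeft_algebraMap_mul d r b
  | ι v =>
    rw [contr_ι_mul, contr_ι, invol_ι, neg_mul, ← sub_eq_add_neg, Algebra.smul_def]
  | mul a c ha hc =>
    rw [mul_assoc, ha, hc, ha, map_mul]
    noncomm_ring
  | add a c ha hc =>
    rw [add_mul, map_add, ha, hc, map_add, map_add]
    noncomm_ring

theorem contr_one (d : Dual ℂ W) : contr d (1 : ExteriorAlgebra ℂ W) = 0 :=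
  CliffordAlgebra.contractLeft_one _ d

theorem contr_contr (d : Dual ℂ W) (a : ExteriorAlgebra ℂ W) : contr d (contr d a) = 0 :=
  CliffordAlgebra.contractLeft_contractLeft d a

theorem contr_comm (d d' : Dual ℂ W) (a : ExteriorAlgebra ℂ W) :
    contr d (contr d' a) = -contr d' (contr d a) :=
  CliffordAlgebra.contractLeft_comm d d' a

theorem invol_contr (d : Dual ℂ W) (a : ExteriorAlgebra ℂ W) :
    invol (contr d a) = -contr d (invol a) := by
  induction a using ExteriorAlgebra.induction with
  | algebraMap r =>
    have h : contr d (algebraMap ℂ (ExteriorAlgebra ℂ W) r) = 0 :=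
      CliffordAlgebra.contractLeft_algebraMap _ d r
    rw [AlgHom.commutes, h, map_zero, neg_zero]
  | ι v => rw [invol_ι, map_neg, neg_neg, contr_ι, AlgHom.commutes]
  | mul a b ha hb =>
    rw [contr_mul, map_add, map_mul, map_mul, map_mul, ha, hb, contr_mul]
    noncomm_ring
  | add a b ha hb => rw [map_add, map_add, ha, hb, map_add, map_add, neg_add]

theorem invol_map (f : W →ₗ[ℂ] W') (a : ExteriorAlgebra ℂ W) :
    invol (map f a) = map f (invol a) := by
  induction a using ExteriorAlgebra.induction with
  | algebraMap r => simp only [AlgHom.commutes]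
  | ι v => rw [map_apply_ι, invol_ι, invol_ι, map_neg, map_apply_ι]
  | mul a b ha hb => simp only [map_mul, ha, hb]
  | add a b ha hb => simp only [map_add, ha, hb]

theorem contr_map (f : W →ₗ[ℂ] W') (d : Dual ℂ W') (a : ExteriorAlgebra ℂ W) :
    contr d (map f a) = map f (contr (d ∘ₗ f) a) := by
  induction a using ExteriorAlgebra.induction with
  | algebraMap r =>
    have h : ∀ (d : Dual ℂ W), contr d (algebraMap ℂ (ExteriorAlgebra ℂ W) r) = 0 :=
      fun d => CliffordAlgebra.contractLeft_algebraMap _ d r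
    have h' : contr d (algebraMap ℂ (ExteriorAlgebra ℂ W') r) = 0 :=
      CliffordAlgebra.contractLeft_algebraMap _ d r
    rw [AlgHom.commutes, h, h', map_zero]
  | ι v => rw [map_apply_ι, contr_ι, contr_ι, AlgHom.commutes]; rfl
  | mul a b ha hb =>
    rw [map_mul, contr_mul, ha, hb, contr_mul, map_add, map_mul, map_mul, invol_map]
  | add a b ha hb => simp only [map_add, ha, hb]

/-- Even elements of the exterior algebra are central. -/
theorem commute_of_even {a : ExteriorAlgebra ℂ W} (ha : invol a = a) (b : ExteriorAlgebra ℂ W) :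
    Commute a b := by
  induction b using ExteriorAlgebra.induction with
  | algebraMap r => exact (Algebra.commutes r a).symm
  | ι v => exact (by rw [ι_mul_eq_invol_mul, ha] : _ = _).symm
  | mul b c hb hc => exact hb.mul_right hc
  | add b c hb hc => exact hb.add_right hc

theorem invol_ι_mul_ι (v w : W) : invol (ι ℂ v * ι ℂ w)
    = ι ℂ v * ι ℂ w := by
  rw [map_mul, invol_ι, invol_ι, neg_mul_neg]

theorem ι_mul_ι_mul_self (v w : W) : ι ℂ v * ι ℂ w *
    (ι ℂ v * ι ℂ w) = 0 := by
  rw [← mul_assoc, mul_assoc (ι ℂ v), ι_anticomm w v, mul_neg, ← mul_assoc,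
    ExteriorAlgebra.ι_sq_zero]
  simp

theorem invol_ιMulti {m : ℕ} (v : Fin m → W) :
    invol (ExteriorAlgebra.ιMulti ℂ m v) = (-1 : ℂ) ^ m • ExteriorAlgebra.ιMulti ℂ m v := by
  induction m with
  | zero => simp
  | succ m ih =>
    rw [ExteriorAlgebra.ιMulti_succ_apply, map_mul, ih, invol_ι, mul_smul_comm, pow_succ]
    simp

theorem prod_ι_mul_ι {m : ℕ} : ∃ ε : ℂ, ∀ a u : Fin m → W,
    (List.ofFn fun i => ι ℂ (a i) * ι ℂ (u i)).prod
      = ε • (ExteriorAlgebra.ιMulti ℂ m a * ExteriorAlgebra.ιMulti ℂ m u) := by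
  induction m with
  | zero => exact ⟨1, fun a u => by simp⟩
  | succ m ih =>
    obtain ⟨ε, hε⟩ := ih
    refine ⟨(-1) ^ m * ε, fun a u => ?_⟩
    rw [List.ofFn_succ, List.prod_cons, hε, ExteriorAlgebra.ιMulti_succ_apply,
      ExteriorAlgebra.ιMulti_succ_apply, mul_smul_comm]
    have h := ι_mul_eq_invol_mul (u 0) (ExteriorAlgebra.ιMulti ℂ m (fun i => a i.succ))
    rw [invol_ιMulti] at h
    have h2 : ι ℂ (a 0) * ι ℂ (u 0) *
        (ExteriorAlgebra.ιMulti ℂ m (fun i => a i.succ) *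
          ExteriorAlgebra.ιMulti ℂ m (fun i => u i.succ)) = ι ℂ (a 0) *
        (ι ℂ (u 0) * ExteriorAlgebra.ιMulti ℂ m (fun i => a i.succ)) *
          ExteriorAlgebra.ιMulti ℂ m (fun i => u i.succ) := by noncomm_ring
    rw [h2, h]
    simp only [smul_mul_assoc, mul_smul_comm, smul_smul, mul_assoc, mul_comm]
    rfl

end Exterior

/-! ### Products of commuting elements -/

section Products

variable {R : Type*} [Ring R] [Algebra ℂ R]

theorem add_pow_of_sq_zero {a y : R} (h : Commute a y) (ha : a * a = 0) (m : ℕ) :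
    (a + y) ^ (m + 1) = y ^ (m + 1) + ((m : ℂ) + 1) • (a * y ^ m) := by
  induction m with
  | zero => simp [add_comm]
  | succ m ih =>
    have e1 : a * y ^ (m + 1) = y ^ (m + 1) * a := (h.pow_right _).eq
    have e2 : a * y ^ m * a = 0 := by
      rw [(h.pow_right m).eq, mul_assoc, ha, mul_zero]
    rw [pow_succ, ih, add_mul, mul_add, mul_add, ← e1, smul_mul_assoc, smul_mul_assoc, e2,
      mul_assoc, ← pow_succ, ← pow_succ]
    push_cast
    module

/-- For commuting elements with square zero, the `n`-th power of the sum of `n` of them is `n!`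
times their product, and the next power vanishes. -/
theorem sum_pow_of_sq_zero {n : ℕ} (X : Fin n → R) (hc : ∀ i j, Commute (X i) (X j))
    (h0 : ∀ i, X i * X i = 0) :
    (∑ i, X i) ^ n = (n.factorial : ℂ) • (List.ofFn X).prod ∧ (∑ i, X i) ^ (n + 1) = 0 := by
  induction n with
  | zero => simp
  | succ n ih =>
    obtain ⟨h1, h2⟩ := ih (fun i => X i.succ) (fun i j => hc _ _) (fun i => h0 _)
    have hcomm : Commute (X 0) (∑ i : Fin n, X i.succ) := Commute.sum_right _ _ _ fun i _ => hc _ _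
    rw [Fin.sum_univ_succ]
    constructor
    · rw [add_pow_of_sq_zero hcomm (h0 0), h2, h1, zero_add, List.ofFn_succ, List.prod_cons,
        mul_smul_comm, smul_smul, Nat.factorial_succ]
      push_cast
      rfl
    · rw [add_pow_of_sq_zero hcomm (h0 0), h2, pow_succ, h2]
      simp

theorem prod_ofFn_mul {n : ℕ} (X Y : Fin n → R) (hc : ∀ i j, Commute (X i) (Y j)) :
    (List.ofFn fun i => X i * Y i).prod = (List.ofFn X).prod * (List.ofFn Y).prod := by
  induction n with
  | zero => simp
  | succ n ih =>
    simp only [List.ofFn_succ, List.prod_cons]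
    rw [ih _ _ fun i j => hc _ _]
    have : Commute (Y 0) (List.ofFn fun i : Fin n => X i.succ).prod :=
      Commute.list_prod_right _ _ fun x hx => by
        obtain ⟨i, rfl⟩ := List.mem_ofFn.1 hx
        exact (hc _ _).symm
    rw [mul_assoc, ← mul_assoc (Y 0), this.eq]
    noncomm_ring

theorem prod_ofFn_smul {n : ℕ} (a : Fin n → ℂ) (X : Fin n → R) :
    (List.ofFn fun i => a i • X i).prod = (∏ i, a i) • (List.ofFn X).prod := by
  induction n with
  | zero => simp
  | succ n ih =>
    simp only [List.ofFn_succ, List.prod_cons, ih, Fin.prod_univ_succ, smul_mul_smul_comm]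

theorem prod_ofFn_mul_eq_zero {n : ℕ} (X : Fin n → R) {D : R} (hD : ∀ i, Commute (X i) D) {j}
    (hj : X j * D = 0) : (List.ofFn X).prod * D = 0 := by
  induction n with
  | zero => exact j.elim0
  | succ n ih =>
    rw [List.ofFn_succ, List.prod_cons]
    have hcomm : Commute (List.ofFn fun i : Fin n => X i.succ).prod D :=
      Commute.list_prod_left _ _ fun x hx => by
        obtain ⟨i, rfl⟩ := List.mem_ofFn.1 hx
        exact hD _
    refine Fin.cases (fun h => ?_) (fun i h => ?_) j hj
    · rw [mul_assoc, hcomm.eq, ← mul_assoc, h, zero_mul]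
    · rw [mul_assoc, ih _ (fun i => hD _) h, mul_zero]

theorem map_prod_ofFn {S : Type*} [Ring S] [Algebra ℂ S] (f : R →ₐ[ℂ] S) {n : ℕ} (X : Fin n → R) :
    f (List.ofFn X).prod = (List.ofFn fun i => f (X i)).prod := by
  rw [map_list_prod, List.map_ofFn]
  rfl

end Products

/-! ### The fibre integral -/

section Berezin

variable {n : ℕ} {V : Type*} [NormedAddCommGroup V] [NormedSpace ℂ V]
  {V' : Type*} [NormedAddCommGroup V'] [NormedSpace ℂ V']
  {Ep : Type*} [AddCommGroup Ep] [Module ℂ Ep] {Fp : Type*} [AddCommGroup Fp] [Module ℂ Fp]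

/-- The contraction of `G_E` with an element of `E*`, acting on the factor `E`. -/
def contrE (τ : Dual ℂ Ep) : GFib V Ep →ₗ[ℂ] GFib V Ep :=
  contr (τ ∘ₗ LinearMap.fst ℂ _ _ ∘ₗ LinearMap.snd ℂ _ _)

/-- The fibre integral with respect to a pair of frames of `E` and `E*`. -/
def berezinOf (b : Fin n → Ep) (b' : Fin n → Dual ℂ Ep) :
    GFib V Ep →ₗ[ℂ] ExteriorAlgebra ℂ (V →ₗ[ℝ] ℂ) :=
  (map (LinearMap.fst ℂ (V →ₗ[ℝ] ℂ) (Ep × Dual ℂ Ep))).toLinearMap ∘ₗ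
    (List.ofFn fun j : Fin n => (delta (b j) ∘ₗ contrE (b' j) : Module.End ℂ (GFib V Ep))).prod

/-- Frames of `E` and `E*` that are dual to each other. -/
structure IsDualPair (b : Fin n → Ep) (b' : Fin n → Dual ℂ Ep) : Prop where
  pairing : ∀ i j, b' i (b j) = if i = j then 1 else 0
  expand : ∀ v, ∑ j, b' j v • b j = v

theorem IsDualPair.expand_dual {b : Fin n → Ep} {b' : Fin n → Dual ℂ Ep} (h : IsDualPair b b')
    (τ : Dual ℂ Ep) : ∑ j, τ (b j) • b' j = τ := by
  ext v
  conv_rhs => rw [← h.expand v, map_sum]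
  simp [mul_comm]

theorem delta_add (v w : Ep) : (delta (v + w) : GFib V Ep →ₗ[ℂ] _) = delta v + delta w := by
  simp [delta, LinearMap.add_comp]

theorem delta_smul (a : ℂ) (v : Ep) : (delta (a • v) : GFib V Ep →ₗ[ℂ] _) = a • delta v := by
  simp [delta, LinearMap.smul_comp]

/-- `delta` as a linear map in the contracted vector. -/
def deltaL : Ep →ₗ[ℂ] GFib V Ep →ₗ[ℂ] GFib V Ep where
  toFun := delta
  map_add' := delta_add
  map_smul' := delta_smul

/-- `contrE` as a linear map in the contracted functional. -/
def contrEL : Dual ℂ Ep →ₗ[ℂ] GFib V Ep →ₗ[ℂ] GFib V Ep where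
  toFun := contrE
  map_add' v w := by simp [contrE, contr, LinearMap.add_comp]
  map_smul' a v := by simp [contrE, contr, LinearMap.smul_comp]

theorem delta_delta (v w : Ep) (x : GFib V Ep) : delta v (delta w x) = -delta w (delta v x) :=
  contr_comm _ _ _

theorem delta_self (v : Ep) (x : GFib V Ep) : delta v (delta v x) = 0 := contr_contr _ _

theorem contrE_contrE (v w : Dual ℂ Ep) (x : GFib V Ep) :
    contrE v (contrE w x) = -contrE w (contrE v x) := contr_comm _ _ _

theorem delta_contrE (v : Ep) (w : Dual ℂ Ep) (x : GFib V Ep) :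
    delta v (contrE w x) = -contrE w (delta v x) := contr_comm _ _ _

theorem delta_mul (v : Ep) (x y : GFib V Ep) :
    delta v (x * y) = delta v x * y + invol x * delta v y := contr_mul _ _ _

theorem contrE_mul (v : Dual ℂ Ep) (x y : GFib V Ep) :
    contrE v (x * y) = contrE v x * y + invol x * contrE v y := contr_mul _ _ _

theorem delta_inT (v : Ep) (ℓ : V →ₗ[ℝ] ℂ) : delta v (inT ℓ : GFib V Ep) = 0 := by
  change contr _ (ι ℂ _) = _
  rw [contr_ι]
  simp

theorem delta_inE (v w : Ep) : delta v (inE w : GFib V Ep) = 0 := by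
  change contr _ (ι ℂ _) = _
  rw [contr_ι]
  simp

theorem delta_inEDual (v : Ep) (τ : Dual ℂ Ep) :
    delta v (inEDual τ : GFib V Ep) = algebraMap ℂ _ (τ v) := by
  change contr _ (ι ℂ _) = _
  rw [contr_ι]
  simp

theorem contrE_inE (v : Ep) (τ : Dual ℂ Ep) :
    contrE τ (inE v : GFib V Ep) = algebraMap ℂ _ (τ v) := by
  change contr _ (ι ℂ _) = _
  rw [contr_ι]
  simp

theorem contrE_inEDual (τ τ' : Dual ℂ Ep) : contrE τ (inEDual τ' : GFib V Ep) = 0 := by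
  change contr _ (ι ℂ _) = _
  rw [contr_ι]
  simp

theorem delta_inForm (v : Ep) (α : ExteriorAlgebra ℂ (V →ₗ[ℝ] ℂ)) :
    delta v (inForm α : GFib V Ep) = 0 := by
  change contr _ (map _ _) = _
  rw [contr_map]
  have : (Dual.eval ℂ Ep v ∘ₗ LinearMap.snd ℂ Ep (Dual ℂ Ep) ∘ₗ
    LinearMap.snd ℂ (V →ₗ[ℝ] ℂ) (Ep × Dual ℂ Ep)) ∘ₗ LinearMap.inl ℂ _ _ = 0 := by ext; simp
  rw [this]
  simp [contr]

theorem contrE_inForm (τ : Dual ℂ Ep) (α : ExteriorAlgebra ℂ (V →ₗ[ℝ] ℂ)) :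
    contrE τ (inForm α : GFib V Ep) = 0 := by
  change contr _ (map _ _) = _
  rw [contr_map]
  have : (τ ∘ₗ LinearMap.fst ℂ Ep (Dual ℂ Ep) ∘ₗ
    LinearMap.snd ℂ (V →ₗ[ℝ] ℂ) (Ep × Dual ℂ Ep)) ∘ₗ LinearMap.inl ℂ _ _ = 0 := by ext; simp
  rw [this]
  simp [contr]

theorem invol_inT (ℓ : V →ₗ[ℝ] ℂ) : invol (inT ℓ : GFib V Ep) = -inT ℓ := invol_ι _

theorem invol_inE (v : Ep) : invol (inE v : GFib V Ep) = -inE v := invol_ι _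

theorem invol_inEDual (τ : Dual ℂ Ep) : invol (inEDual τ : GFib V Ep) = -inEDual τ := invol_ι _

theorem invol_inForm (α : ExteriorAlgebra ℂ (V →ₗ[ℝ] ℂ)) :
    invol (inForm α : GFib V Ep) = inForm (invol α) := invol_map _ _

theorem inForm_ι (ℓ : V →ₗ[ℝ] ℂ) :
    (inForm (ι ℂ ℓ) : GFib V Ep) = inT ℓ := map_apply_ι _ _

theorem map_fst_inForm (α : ExteriorAlgebra ℂ (V →ₗ[ℝ] ℂ)) :
    map (LinearMap.fst ℂ (V →ₗ[ℝ] ℂ) (Ep × Dual ℂ Ep)) (inForm α) = α := by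
  change (map _).comp (map _) α = α
  rw [ExteriorAlgebra.map_comp_map, LinearMap.fst_comp_inl, ExteriorAlgebra.map_id]
  rfl

/-- The factors of the fibre integral commute with each other. -/
theorem berezin_factor_commute (b b₁ : Ep) (b' b₁' : Dual ℂ Ep) :
    Commute (delta b ∘ₗ contrE b' : Module.End ℂ (GFib V Ep)) (delta b₁ ∘ₗ contrE b₁') := by
  refine LinearMap.ext fun x => ?_
  simp only [Module.End.mul_apply, LinearMap.comp_apply]
  rw [← neg_eq_iff_eq_neg.2 (delta_contrE b₁ b' (contrE b₁' x)), contrE_contrE b' b₁']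
  simp only [map_neg, neg_neg]
  rw [delta_delta b b₁, delta_contrE b b₁']
  simp only [map_neg, neg_neg]

theorem berezin_factor_sq (b : Ep) (b' : Dual ℂ Ep) :
    (delta b ∘ₗ contrE b' : Module.End ℂ (GFib V Ep)) * (delta b ∘ₗ contrE b') = 0 := by
  refine LinearMap.ext fun x => ?_
  simp only [Module.End.mul_apply, LinearMap.comp_apply, LinearMap.zero_apply]
  rw [← neg_eq_iff_eq_neg.2 (delta_contrE b b' (contrE b' x)), map_neg, delta_self, neg_zero]

/-- The fibre integral does not depend on the choice of dual frames: it is the `n`-th divided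
power of `∑ δ_{b_j} ∘ δ_{b_j'}`, which is the canonical element of `E ⊗ E*`. -/
theorem berezinOf_congr {b c : Fin n → Ep} {b' c' : Fin n → Dual ℂ Ep} (hb : IsDualPair b b')
    (hc : IsDualPair c c') : (berezinOf b b' : GFib V Ep →ₗ[ℂ] _) = berezinOf c c' := by
  have key : ∀ (b : Fin n → Ep) (b' : Fin n → Dual ℂ Ep),
      (List.ofFn fun j : Fin n => (delta (b j) ∘ₗ contrE (b' j) : Module.End ℂ (GFib V Ep))).prod
        = ((n.factorial : ℂ)⁻¹) • (∑ j, (delta (b j) ∘ₗ contrE (b' j) :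
            Module.End ℂ (GFib V Ep))) ^ n := by
    intro b b'
    rw [(sum_pow_of_sq_zero (fun j => (delta (b j) ∘ₗ contrE (b' j) : Module.End ℂ (GFib V Ep)))
      (fun i j => berezin_factor_commute _ _ _ _) fun i => berezin_factor_sq _ _).1, smul_smul,
      inv_mul_cancel₀ (by exact_mod_cast n.factorial_ne_zero), one_smul]
  have hsum : (∑ j, (delta (b j) ∘ₗ contrE (b' j) : Module.End ℂ (GFib V Ep)))
      = ∑ j, (delta (c j) ∘ₗ contrE (c' j) : Module.End ℂ (GFib V Ep)) := by
    have h1 : ∀ j, (delta (c j) ∘ₗ contrE (c' j) : Module.End ℂ (GFib V Ep))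
        = ∑ i, b' i (c j) • (delta (b i) ∘ₗ contrE (c' j)) := by
      intro j
      refine LinearMap.ext fun x => ?_
      have := congrArg (fun v => (deltaL v : GFib V Ep →ₗ[ℂ] _) (contrE (c' j) x))
        (hb.expand (c j))
      simp only [map_sum, map_smul, LinearMap.sum_apply, LinearMap.smul_apply] at this ⊢
      exact this.symm
    have h2 : ∀ i, (delta (b i) ∘ₗ contrE (b' i) : Module.End ℂ (GFib V Ep))
        = ∑ j, b' i (c j) • (delta (b i) ∘ₗ contrE (c' j)) := by
      intro i
      refine LinearMap.ext fun x => ?_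
      have := congrArg (fun v => delta (b i) ((contrEL v : GFib V Ep →ₗ[ℂ] _) x))
        (hc.expand_dual (b' i))
      simp only [map_sum, map_smul, LinearMap.sum_apply, LinearMap.smul_apply] at this ⊢
      exact this.symm
    simp only [h1, h2]
    exact Finset.sum_comm
  unfold berezinOf
  rw [key, key, hsum]

theorem list_prod_apply_induction {M : Type*} [AddCommGroup M] [Module ℂ M] {n : ℕ}
    (Y : Fin n → Module.End ℂ M) (T : M → M) (hT : ∀ i x, Y i (T x) = T (Y i x)) (x : M) :
    (List.ofFn Y).prod (T x) = T ((List.ofFn Y).prod x) := by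
  induction n with
  | zero => simp
  | succ n ih =>
    rw [List.ofFn_succ, List.prod_cons, Module.End.mul_apply, Module.End.mul_apply,
      ih _ fun i x => hT _ x, hT]

theorem berezinOf_inForm_mul (b : Fin n → Ep) (b' : Fin n → Dual ℂ Ep)
    (α : ExteriorAlgebra ℂ (V →ₗ[ℝ] ℂ)) (x : GFib V Ep) :
    berezinOf b b' (inForm α * x) = α * berezinOf b b' x := by
  unfold berezinOf
  rw [LinearMap.comp_apply, LinearMap.comp_apply,
    list_prod_apply_induction _ (fun x => inForm α * x)]
  · simp only [AlgHom.toLinearMap_apply, map_mul, map_fst_inForm]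
  · intro i x
    simp only [LinearMap.comp_apply, contrE_mul, contrE_inForm, delta_mul, zero_mul, zero_add]
    rw [invol_invol, invol_inForm, delta_inForm, zero_mul, zero_add]

theorem invol_berezinOf (b : Fin n → Ep) (b' : Fin n → Dual ℂ Ep) (x : GFib V Ep) :
    invol (berezinOf b b' x) = berezinOf b b' (invol x) := by
  unfold berezinOf
  rw [LinearMap.comp_apply, LinearMap.comp_apply,
    list_prod_apply_induction _ (fun x : GFib V Ep => invol x)]
  · exact invol_map _ _
  · intro i x
    simp only [LinearMap.comp_apply, contrE, delta]
    change _ = invol (contr _ (contr _ x))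
    rw [invol_contr, invol_contr, map_neg, neg_neg]

theorem berezinOf_delta {b : Fin n → Ep} {b' : Fin n → Dual ℂ Ep} (hb : IsDualPair b b') (v : Ep)
    (x : GFib V Ep) : berezinOf b b' (delta v x) = 0 := by
  have h1 : ∀ j, (List.ofFn fun j : Fin n =>
      (delta (b j) ∘ₗ contrE (b' j) : Module.End ℂ (GFib V Ep))).prod * delta (b j) = 0 := by
    intro j
    refine prod_ofFn_mul_eq_zero _ (fun i => LinearMap.ext fun y => ?_) (j := j)
      (LinearMap.ext fun y => ?_)
    · simp only [Module.End.mul_apply, LinearMap.comp_apply]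
      rw [← neg_eq_iff_eq_neg.2 (delta_contrE (b j) (b' i) y), map_neg, delta_delta, neg_neg]
    · simp only [Module.End.mul_apply, LinearMap.comp_apply, LinearMap.zero_apply]
      rw [← neg_eq_iff_eq_neg.2 (delta_contrE (b j) (b' j) y), map_neg, delta_self, neg_zero]
  have h2 := congrArg (fun v => (deltaL v : GFib V Ep →ₗ[ℂ] _) x) (hb.expand v)
  simp only [map_sum, map_smul, LinearMap.sum_apply, LinearMap.smul_apply] at h2
  change berezinOf b b' (deltaL v x) = 0
  rw [← h2, map_sum]
  refine Finset.sum_eq_zero fun j _ => ?_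
  rw [map_smul]
  have h3 := LinearMap.congr_fun (h1 j) x
  rw [Module.End.mul_apply, LinearMap.zero_apply] at h3
  change _ • (map _) ((List.ofFn fun j : Fin n =>
      (delta (b j) ∘ₗ contrE (b' j) : Module.End ℂ (GFib V Ep))).prod (delta (b j) x)) = 0
  rw [h3, map_zero, smul_zero]

/-- The normalization of the fibre integral. -/
theorem berezinOf_prod {b : Fin n → Ep} {b' : Fin n → Dual ℂ Ep}
    (hb : ∀ i j, b' i (b j) = if i = j then 1 else 0) :
    berezinOf b b' (List.ofFn fun j => (inE (b j) * inEDual (b' j) : GFib V Ep)).prod = 1 := by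
  suffices h : (List.ofFn fun j : Fin n =>
      (delta (b j) ∘ₗ contrE (b' j) : Module.End ℂ (GFib V Ep))).prod
        (List.ofFn fun j => (inE (b j) * inEDual (b' j) : GFib V Ep)).prod = 1 by
    rw [berezinOf, LinearMap.comp_apply, h, AlgHom.toLinearMap_apply, map_one]
  induction n with
  | zero => simp
  | succ n ih =>
    rw [List.ofFn_succ, List.prod_cons, Module.End.mul_apply, List.ofFn_succ, List.prod_cons,
      list_prod_apply_induction _ (fun x => inE (b 0) * inEDual (b' 0) * x),
      ih (b := fun i => b i.succ) (b' := fun i => b' i.succ) fun i j => by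
        rw [hb]; simp [Fin.succ_inj]]
    · rw [mul_one, LinearMap.comp_apply, contrE_mul, contrE_inE, contrE_inEDual, mul_zero, add_zero,
        hb, if_pos rfl, map_one, one_mul, delta_inEDual, hb, if_pos rfl, map_one]
    · intro i x
      have e1 : b' i.succ (b 0) = 0 := by rw [hb, if_neg (Fin.succ_ne_zero i)]
      have e2 : b' 0 (b i.succ) = 0 := by rw [hb, if_neg (Fin.succ_ne_zero i).symm]
      simp only [LinearMap.comp_apply, contrE_mul, contrE_inE, contrE_inEDual, e1, map_zero,
        zero_mul, mul_zero, zero_add, delta_mul, delta_inE, delta_inEDual, e2, map_mul, invol_inE,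
        invol_inEDual, neg_mul_neg, add_zero]

/-- Scaling of the factor `E*` by `t` scales the fibre integral by `t ^ n`. -/
theorem berezinOf_map_smul (b : Fin n → Ep) (b' : Fin n → Dual ℂ Ep) (t : ℂ) (x : GFib V Ep) :
    berezinOf b b' (map (LinearMap.id.prodMap
      (LinearMap.id.prodMap (t • LinearMap.id))) x) = t ^ n • berezinOf b b' x := by
  have key : ∀ {n : ℕ} (b : Fin n → Ep) (b' : Fin n → Dual ℂ Ep) (x : GFib V Ep),
      (List.ofFn fun j : Fin n => (delta (b j) ∘ₗ contrE (b' j) :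
        Module.End ℂ (GFib V Ep))).prod (map (LinearMap.id.prodMap
      (LinearMap.id.prodMap (t • LinearMap.id))) x) = t ^ n • (map
        (LinearMap.id.prodMap (LinearMap.id.prodMap (t • LinearMap.id)))
          ((List.ofFn fun j : Fin n => (delta (b j) ∘ₗ contrE (b' j) :
        Module.End ℂ (GFib V Ep))).prod x)) := by
    intro n
    induction n with
    | zero => simp
    | succ n ih =>
      intro b b' x
      simp only [List.ofFn_succ, List.prod_cons, Module.End.mul_apply]
      rw [ih (fun i => b i.succ) (fun i => b' i.succ), map_smul, LinearMap.comp_apply,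
        LinearMap.comp_apply]
      have h1 : ∀ y : GFib V Ep, contrE (b' 0) (map (LinearMap.id.prodMap
          (LinearMap.id.prodMap (t • LinearMap.id))) y) = map (LinearMap.id.prodMap
          (LinearMap.id.prodMap (t • LinearMap.id))) (contrE (b' 0) y) := fun y => contr_map _ _ y
      have h2 : ∀ y : GFib V Ep, delta (b 0) (map (LinearMap.id.prodMap
          (LinearMap.id.prodMap (t • LinearMap.id))) y) = t • map
          (LinearMap.id.prodMap (LinearMap.id.prodMap (t • LinearMap.id))) (delta (b 0) y) := by
        intro y
        refine (contr_map _ _ y).trans ?_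
        rw [← map_smul]
        congr 1
        have : (Dual.eval ℂ Ep (b 0) ∘ₗ LinearMap.snd ℂ Ep (Dual ℂ Ep) ∘ₗ
          LinearMap.snd ℂ (V →ₗ[ℝ] ℂ) (Ep × Dual ℂ Ep)) ∘ₗ
          (LinearMap.id.prodMap (LinearMap.id.prodMap (t • LinearMap.id))) =
          t • (Dual.eval ℂ Ep (b 0) ∘ₗ LinearMap.snd ℂ Ep (Dual ℂ Ep) ∘ₗ
          LinearMap.snd ℂ (V →ₗ[ℝ] ℂ) (Ep × Dual ℂ Ep)) := by
            ext <;> simp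
        rw [this]
        simp [contr, delta]
      rw [h1, h2, smul_smul, pow_succ]
  unfold berezinOf
  rw [LinearMap.comp_apply, LinearMap.comp_apply, key, map_smul, AlgHom.toLinearMap_apply,
    AlgHom.toLinearMap_apply]
  congr 1
  generalize (List.ofFn fun j : Fin n => (delta (b j) ∘ₗ contrE (b' j) :
        Module.End ℂ (GFib V Ep))).prod x = y
  change (map _).comp (map _) y = _
  rw [ExteriorAlgebra.map_comp_map]
  rfl

/-- Naturality of the fibre integral. -/
theorem berezinOf_map (L : (V →ₗ[ℝ] ℂ) →ₗ[ℂ] (V' →ₗ[ℝ] ℂ)) (f : Ep →ₗ[ℂ] Fp) (g : Fp →ₗ[ℂ] Ep)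
    (b : Fin n → Fp) (b' : Fin n → Dual ℂ Fp) (x : GFib V Ep) :
    berezinOf b b' (map (L.prodMap (f.prodMap g.dualMap)) x)
      = map L (berezinOf (fun i => g (b i)) (fun i => b' i ∘ₗ f) x) := by
  have key : ∀ {n : ℕ} (b : Fin n → Fp) (b' : Fin n → Dual ℂ Fp) (x : GFib V Ep),
      (List.ofFn fun j : Fin n => (delta (b j) ∘ₗ contrE (b' j) :
        Module.End ℂ (GFib V' Fp))).prod (map (L.prodMap (f.prodMap g.dualMap)) x)
      = map (L.prodMap (f.prodMap g.dualMap)) ((List.ofFn fun j : Fin n =>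
        (delta (g (b j)) ∘ₗ contrE (b' j ∘ₗ f) : Module.End ℂ (GFib V Ep))).prod x) := by
    intro n
    induction n with
    | zero => simp
    | succ n ih =>
      intro b b' x
      simp only [List.ofFn_succ, List.prod_cons, Module.End.mul_apply]
      rw [ih (fun i => b i.succ) (fun i => b' i.succ), LinearMap.comp_apply, LinearMap.comp_apply]
      refine (congrArg _ (contr_map _ _ _)).trans ?_
      exact contr_map _ _ _
  unfold berezinOf
  rw [LinearMap.comp_apply, LinearMap.comp_apply, key, AlgHom.toLinearMap_apply,
    AlgHom.toLinearMap_apply]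
  generalize (List.ofFn fun j : Fin n => (delta (g (b j)) ∘ₗ contrE (b' j ∘ₗ f) :
        Module.End ℂ (GFib V Ep))).prod x = y
  change (map _).comp (map _) y =
    (map _).comp (map _) y
  rw [ExteriorAlgebra.map_comp_map, ExteriorAlgebra.map_comp_map]
  rfl

end Berezin

/-! ### The top Chern form -/

section Chern

variable {n : ℕ} {V : Type*} [NormedAddCommGroup V] [NormedSpace ℂ V]
  {Ep : Type*} [AddCommGroup Ep] [Module ℂ Ep]

/-- Factors with fewer than `n` elements of `E*` do not contribute to the fibre integral. -/
theorem berezinOf_pow_mul_pow (b : Fin n → Ep) (b' : Fin n → Dual ℂ Ep) {x y : GFib V Ep}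
    (hx : map (LinearMap.id.prodMap
      (LinearMap.id.prodMap ((2 : ℂ) • LinearMap.id))) x = x)
    (hy : map (LinearMap.id.prodMap
      (LinearMap.id.prodMap ((2 : ℂ) • LinearMap.id))) y = (2 : ℂ) • y) {m : ℕ} (hm : m < n)
    (k : ℕ) : berezinOf b b' (x ^ k * y ^ m) = 0 := by
  have h := berezinOf_map_smul b b' 2 (x ^ k * y ^ m)
  rw [map_mul, map_pow, map_pow, hx, hy, smul_pow, mul_smul_comm, map_smul, ← sub_eq_zero,
    ← sub_smul] at h
  refine (smul_eq_zero.1 h).resolve_left ?_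
  intro h2
  rw [sub_eq_zero] at h2
  have h3 : (2 : ℕ) ^ m = 2 ^ n := by exact_mod_cast h2
  exact hm.ne (Nat.pow_right_injective le_rfl h3)

theorem map_scale_inT (t : ℂ) (ℓ : V →ₗ[ℝ] ℂ) : map (LinearMap.id.prodMap
    (LinearMap.id.prodMap (t • LinearMap.id))) (inT ℓ : GFib V Ep) = inT ℓ := by
  refine (map_apply_ι _ _).trans ?_
  simp [inT]

theorem map_scale_inE (t : ℂ) (v : Ep) : map (LinearMap.id.prodMap
    (LinearMap.id.prodMap (t • LinearMap.id))) (inE v : GFib V Ep) = inE v := by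
  refine (map_apply_ι _ _).trans ?_
  simp [inE]

theorem map_scale_inEDual (t : ℂ) (τ : Dual ℂ Ep) : map (LinearMap.id.prodMap
    (LinearMap.id.prodMap (t • LinearMap.id))) (inEDual τ : GFib V Ep)
      = t • (inEDual τ : GFib V Ep) := by
  refine (map_apply_ι _ _).trans ?_
  change _ = t • ι ℂ _
  rw [← LinearMap.map_smul (ι ℂ)]
  simp

theorem map_scale_inForm (t : ℂ) (α : ExteriorAlgebra ℂ (V →ₗ[ℝ] ℂ)) :
    map (LinearMap.id.prodMap
      (LinearMap.id.prodMap (t • LinearMap.id))) (inForm α : GFib V Ep) = inForm α := by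
  change (map _).comp (map _) α = _
  rw [ExteriorAlgebra.map_comp_map]
  unfold inForm
  congr 2
  ext <;> simp

/-- The fibre integral of a product of `e_i ∧ e_{r i}*`: the sign of `r` if it is a permutation,
zero otherwise. -/
theorem berezinOf_inForm_mul_prod {b : Fin n → Ep} {b' : Fin n → Dual ℂ Ep}
    (hb : ∀ i j, b' i (b j) = if i = j then 1 else 0) (α : ExteriorAlgebra ℂ (V →ₗ[ℝ] ℂ))
    (r : Fin n → Fin n) :
    (∀ s : Equiv.Perm (Fin n), r = s → berezinOf b b' (inForm α *
      (List.ofFn fun i => (inE (b i) * inEDual (b' (r i)) : GFib V Ep)).prod)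
        = ((Equiv.Perm.sign s : ℤ) : ℂ) • α) ∧
    (¬ Function.Injective r → berezinOf b b' (inForm α *
      (List.ofFn fun i => (inE (b i) * inEDual (b' (r i)) : GFib V Ep)).prod) = 0) := by
  obtain ⟨ε, hε⟩ := prod_ι_mul_ι (W := (V →ₗ[ℝ] ℂ) × Ep × Dual ℂ Ep) (m := n)
  have h1 : ∀ r : Fin n → Fin n,
      (List.ofFn fun i => (inE (b i) * inEDual (b' (r i)) : GFib V Ep)).prod
      = ε • (ExteriorAlgebra.ιMulti ℂ n (fun i => ((0, b i, 0) : (V →ₗ[ℝ] ℂ) × Ep × Dual ℂ Ep)) *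
        ExteriorAlgebra.ιMulti ℂ n
          ((fun i => ((0, 0, b' i) : (V →ₗ[ℝ] ℂ) × Ep × Dual ℂ Ep)) ∘ r)) := fun r => hε _ _
  constructor
  · rintro s rfl
    have h2 := h1 id
    have h3 := berezinOf_prod (V := V) hb
    rw [h1, AlternatingMap.map_perm, berezinOf_inForm_mul]
    have h4 : berezinOf b b' (ε • (ExteriorAlgebra.ιMulti ℂ n
        (fun i => ((0, b i, 0) : (V →ₗ[ℝ] ℂ) × Ep × Dual ℂ Ep)) *
        Equiv.Perm.sign s • ExteriorAlgebra.ιMulti ℂ n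
          (fun i => ((0, 0, b' i) : (V →ₗ[ℝ] ℂ) × Ep × Dual ℂ Ep))))
        = ((Equiv.Perm.sign s : ℤ) : ℂ) • (1 : ExteriorAlgebra ℂ (V →ₗ[ℝ] ℂ)) := by
      rw [← h3, ← LinearMap.map_smul (berezinOf b b')]
      congr 1
      refine Eq.trans ?_ (congrArg (fun z => ((Equiv.Perm.sign s : ℤ) : ℂ) • z) h2).symm
      simp only [Function.comp_id]
      rcases Int.units_eq_one_or (Equiv.Perm.sign s) with h | h <;> simp [h]
    rw [h4, mul_smul_comm, mul_one]
  · intro hr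
    rw [h1, AlternatingMap.map_eq_zero_of_not_injective _ _
      (fun h => hr h.of_comp), mul_zero, smul_zero, mul_zero, map_zero]

/-- The fibre integral of the divided power of `Dη + Θ̃` is the determinant of `Θ`. -/
theorem berezinOf_divPow {b : Fin n → Ep} {b' : Fin n → Dual ℂ Ep}
    (hb : ∀ i j, b' i (b j) = if i = j then 1 else 0) (a : Fin n → V →ₗ[ℝ] ℂ)
    (Θ : Fin n → Fin n → ExteriorAlgebra ℂ (V →ₗ[ℝ] ℂ)) (hΘ : ∀ i j, invol (Θ i j) = Θ i j) :
    berezinOf b b' (divPow ((∑ i, inT (a i) * inE (b i)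
      + ∑ i, ∑ j, inForm (Θ i j) * inE (b i) * inEDual (b' j) : GFib V Ep)) n)
      = ∑ s : Equiv.Perm (Fin n), ((Equiv.Perm.sign s : ℤ) : ℂ) •
          (List.ofFn fun i : Fin n => Θ i (s i)).prod := by
  set x : GFib V Ep := ∑ i, inT (a i) * inE (b i) with hxdef
  set Y : Fin n → GFib V Ep := fun i => ∑ j, inForm (Θ i j) * inE (b i) * inEDual (b' j) with hY
  have hYeven : ∀ i, invol (Y i) = Y i := by
    intro i
    simp only [hY, map_sum, map_mul, invol_inForm, hΘ, invol_inE, invol_inEDual, mul_neg, neg_mul,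
      neg_neg]
  have hcomm : ∀ i z, Commute (Y i) z := fun i z => commute_of_even (hYeven i) z
  have hsq : ∀ i, Y i * Y i = 0 := by
    intro i
    have : Y i = inE (b i) * ∑ j, inForm (Θ i j) * inEDual (b' j) := by
      simp only [hY, Finset.mul_sum]
      refine Finset.sum_congr rfl fun j _ => ?_
      have : Commute (inForm (Θ i j) : GFib V Ep) (inE (b i)) :=
        commute_of_even (by rw [invol_inForm, hΘ]) _
      rw [this.eq, mul_assoc]
    conv_lhs => rw [(hcomm i (Y i)).eq]
    nth_rewrite 2 [this]
    rw [← mul_assoc, (hcomm i _).eq, this, ← mul_assoc]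
    have h0 : (inE (b i) : GFib V Ep) * inE (b i) = 0 := ExteriorAlgebra.ι_sq_zero _
    rw [h0, zero_mul, zero_mul]
  have hscx : map (LinearMap.id.prodMap
      (LinearMap.id.prodMap ((2 : ℂ) • LinearMap.id))) x = x := by
    simp only [hxdef, map_sum, map_mul, map_scale_inT, map_scale_inE]
  have hscy : map (LinearMap.id.prodMap
      (LinearMap.id.prodMap ((2 : ℂ) • LinearMap.id))) (∑ i, Y i) = (2 : ℂ) • ∑ i, Y i := by
    simp only [hY, map_sum, map_mul, map_scale_inForm, map_scale_inE, map_scale_inEDual,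
      Finset.smul_sum, mul_smul_comm]
  have hxy : Commute x (∑ i, Y i) := (Commute.sum_left _ _ _ fun i _ => hcomm i x).symm
  have h1 : berezinOf b b' ((x + ∑ i, Y i) ^ n) = berezinOf b b' ((∑ i, Y i) ^ n) := by
    rw [hxy.add_pow, map_sum, Finset.sum_range_succ', Finset.sum_eq_zero, zero_add]
    · simp
    · intro k hk
      rw [(Nat.cast_commute _ _).symm.eq, ← nsmul_eq_mul, map_nsmul,
        berezinOf_pow_mul_pow b b' hscx hscy (by have := Finset.mem_range.1 hk; omega), smul_zero]
  have hfac : (n.factorial : ℂ) ≠ 0 := by exact_mod_cast n.factorial_ne_zero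
  rw [divPow, map_smul, h1, (sum_pow_of_sq_zero Y (fun i j => hcomm i _) hsq).1, map_smul,
    smul_smul, inv_mul_cancel₀ hfac, one_smul]
  have h2 : (List.ofFn Y).prod = ∑ r : Fin n → Fin n,
      (List.ofFn fun i => inForm (Θ i (r i)) * inE (b i) * inEDual (b' (r i))).prod := by
    have := (MultilinearMap.mkPiAlgebraFin ℂ n (GFib V Ep)).map_sum
      (fun i j => inForm (Θ i j) * inE (b i) * inEDual (b' j))
    simpa only [MultilinearMap.mkPiAlgebraFin_apply] using this
  have h3 : ∀ r : Fin n → Fin n,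
      (List.ofFn fun i => (inForm (Θ i (r i)) * inE (b i) * inEDual (b' (r i)) : GFib V Ep)).prod
        = inForm (List.ofFn fun i => Θ i (r i)).prod *
          (List.ofFn fun i => (inE (b i) * inEDual (b' (r i)) : GFib V Ep)).prod := by
    intro r
    simp only [mul_assoc]
    rw [prod_ofFn_mul (fun i => (inForm (Θ i (r i)) : GFib V Ep)), map_prod_ofFn]
    exact fun i j => commute_of_even (by rw [invol_inForm, hΘ]) _
  rw [h2, map_sum]
  simp only [h3]
  rw [← Finset.sum_subset (Finset.subset_univ
    (Finset.univ.image fun s : Equiv.Perm (Fin n) => (s : Fin n → Fin n)))]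
  · rw [Finset.sum_image fun s _ t _ h => Equiv.coe_fn_injective h]
    exact Finset.sum_congr rfl fun s _ => (berezinOf_inForm_mul_prod hb _ _).1 s rfl
  · intro r _ hr
    refine (berezinOf_inForm_mul_prod hb _ _).2 fun hinj => hr ?_
    rw [Finset.mem_image]
    exact ⟨Equiv.ofBijective r (Finite.injective_iff_bijective.1 hinj), Finset.mem_univ _, rfl⟩

end Chern

/-! ### Naturality of `∂̄` under holomorphic maps -/

section Naturality

variable {V : Type*} [NormedAddCommGroup V] [NormedSpace ℂ V] [FiniteDimensional ℂ V]
  [ComplexCoords V]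
  {V' : Type*} [NormedAddCommGroup V'] [NormedSpace ℂ V'] [FiniteDimensional ℂ V']
  [ComplexCoords V']
  {R : Type*} [Ring R] [Algebra ℂ R] [Module.Finite ℂ R]

/-- A complex-linear map between model spaces, as a real-linear map. -/
abbrev reL (D : V' →L[ℂ] V) : V' →ₗ[ℝ] V := (D : V' →ₗ[ℂ] V).restrictScalars ℝ

theorem smoothAt_realLinear {N : Type*} [NormedAddCommGroup N] [NormedSpace ℝ N]
    [FiniteDimensional ℝ N] {A : Type*} [AddCommGroup A] [Module ℂ A] [Module.Finite ℂ A]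
    (Φ : N →ₗ[ℝ] A) {T : V → N} {x : V} (hT : ContDiffAt ℝ ∞ T x) :
    SmoothAt (fun y => Φ (T y)) x := fun ℓ =>
  ((LinearMap.toContinuousLinearMap ((ℓ.restrictScalars ℝ) ∘ₗ Φ)).contDiff.contDiffAt).comp x hT

theorem dirDeriv_realLinear {N : Type*} [NormedAddCommGroup N] [NormedSpace ℝ N]
    [FiniteDimensional ℝ N] {A : Type*} [AddCommGroup A] [Module ℂ A] [Module.Finite ℂ A]
    (Φ : N →ₗ[ℝ] A) {T : V → N} {x : V} (hT : ContDiffAt ℝ ∞ T x) (v : V) :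
    dirDeriv (fun y => Φ (T y)) x v = Φ (fderiv ℝ T x v) := ext_dual fun ℓ => by
  rw [dual_dirDeriv (smoothAt_realLinear Φ hT)]
  have := ((LinearMap.toContinuousLinearMap ((ℓ.restrictScalars ℝ) ∘ₗ Φ)).hasFDerivAt.comp x
    (hT.differentiableAt (by simp)).hasFDerivAt).fderiv
  exact congrArg (fun D => D v) this

theorem fderiv_fderiv_restrictScalars {τ : V' → V} {x : V'} (hτ : ContDiffAt ℂ ω τ x) (v : V') :
    fderiv ℝ (fderiv ℂ τ) x v = fderiv ℂ (fderiv ℂ τ) x v := by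
  have : DifferentiableAt ℂ (fderiv ℂ τ) x :=
    (hτ.fderiv_right (m := 1) le_top).differentiableAt (by simp)
  rw [this.fderiv_restrictScalars ℝ]
  rfl

theorem contDiffAt_real_fderiv {τ : V' → V} {x : V'} (hτ : ContDiffAt ℂ ω τ x) :
    ContDiffAt ℝ ∞ (fderiv ℂ τ) x :=
  ((hτ.fderiv_right (m := ω) le_top).restrict_scalars ℝ).of_le le_top

/-- The covector `ℓ ∘ D` as a function of `D`. -/
def precompL (ℓ : V →ₗ[ℝ] ℂ) : (V' →L[ℂ] V) →ₗ[ℝ] (V' →ₗ[ℝ] ℂ) where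
  toFun D := precomp (reL D) ℓ
  map_add' D D' := by ext v; simp [precomp]
  map_smul' r D := by ext v; simp [precomp]

/-- The pull-back of a constant covector under a holomorphic map is `∂̄`-closed. -/
theorem dbarFlat_precomp_fderiv (c : (V' →ₗ[ℝ] ℂ) →ₗ[ℂ] R)
    (hc : ∀ ℓ m, c ℓ * c m = -(c m * c ℓ)) {τ : V' → V} {x : V'} (hτ : ContDiffAt ℂ ω τ x)
    (ℓ : V →ₗ[ℝ] ℂ) : dbarFlat c (fun y => c (precomp (reL (fderiv ℂ τ y)) ℓ)) x = 0 := by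
  set S := fderiv ℂ (fderiv ℂ τ) x with hS
  have hsm : SmoothAt (fun y => precompL ℓ (fderiv ℂ τ y)) x :=
    smoothAt_realLinear (precompL ℓ) (contDiffAt_real_fderiv hτ)
  have h1 : ∀ v, dirDeriv (fun y => c (precomp (reL (fderiv ℂ τ y)) ℓ)) x v
      = c (precomp (reL (S v)) ℓ) := by
    intro v
    have e1 := dirDeriv_linear c hsm v
    rw [dirDeriv_realLinear (precompL ℓ) (contDiffAt_real_fderiv hτ),
      fderiv_fderiv_restrictScalars hτ] at e1
    exact e1
  have h2 : ∀ j, dirDzbar (fun y => c (precomp (reL (fderiv ℂ τ y)) ℓ)) x j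
      = ∑ k, part01 ℓ (S (basis j) (basis k)) • c (dzbar k) := by
    intro j
    rw [dirDzbar, h1, h1]
    have : (1 / 2 : ℂ) • (precomp (reL (S (basis j))) ℓ + Complex.I •
        precomp (reL (S (Complex.I • basis j))) ℓ)
        = precomp (reL (S (basis j))) (part01 ℓ) := by
      ext v
      rw [map_smul]
      rfl
    rw [← map_smul, ← map_add, ← map_smul, this]
    have h3 := sum_part01 (precomp (reL (S (basis j))) (part01 ℓ))
    have h4 : part01 (precomp (reL (S (basis j))) (part01 ℓ))
        = precomp (reL (S (basis j))) (part01 ℓ) := by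
      refine part01_eq_self fun v => ?_
      change part01 ℓ (S (basis j) (Complex.I • v)) = _
      rw [map_smul, part01_smul, Complex.conj_I]
      rfl
    rw [h4] at h3
    conv_lhs => rw [← h3, map_sum]
    simp only [LinearMap.map_smul c]
    rfl
  unfold dbarFlat
  simp only [h2, Finset.mul_sum, mul_smul_comm]
  refine sum_symm_mul_eq_zero _ (fun j k => ?_) _ fun j k => hc _ _
  rw [(hτ.isSymmSndFDerivAt (by simp)).eq]

variable {W : Type*} [AddCommGroup W] [Module ℂ W] [Module.Finite ℂ W]
  {W' : Type*} [AddCommGroup W'] [Module ℂ W'] [Module.Finite ℂ W']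

theorem smoothAt_map {N : V' → W →ₗ[ℂ] W'} {x : V'} (hN : ∀ w, SmoothAt (fun y => N y w) x)
    (a : ExteriorAlgebra ℂ W) : SmoothAt (fun y => map (N y) a) x := by
  induction a using ExteriorAlgebra.induction with
  | algebraMap r => simpa only [AlgHom.commutes] using smoothAt_const _ x
  | ι w => simpa only [map_apply_ι] using (hN w).linear (ι ℂ)
  | mul a b ha hb => simpa only [map_mul] using ha.mul hb
  | add a b ha hb => simpa only [map_add] using ha.add hb

theorem dbarFlat_mul {c : (V →ₗ[ℝ] ℂ) →ₗ[ℂ] W} {f g : V → ExteriorAlgebra ℂ W} {x : V}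
    (hf : SmoothAt f x) (hg : SmoothAt g x) :
    dbarFlat (ι ℂ ∘ₗ c) (fun y => f y * g y) x
      = dbarFlat (ι ℂ ∘ₗ c) f x * g x
        + invol (f x) * dbarFlat (ι ℂ ∘ₗ c) g x := by
  simp only [dbarFlat_eq_wirt]
  exact wirt_mul (R := ExteriorAlgebra ℂ W) invol.toLinearMap (fun ℓ a => ι_mul_eq_invol_mul _ _)
    hf hg

theorem dbarFlat_map_const {c : (V' →ₗ[ℝ] ℂ) →ₗ[ℂ] W'} {N : V' → W →ₗ[ℂ] W'} {x : V'}
    (hN : ∀ w, SmoothAt (fun y => N y w) x)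
    (hcl : ∀ w, dbarFlat (ι ℂ ∘ₗ c) (fun y => ι ℂ (N y w)) x = 0)
    (a : ExteriorAlgebra ℂ W) :
    dbarFlat (ι ℂ ∘ₗ c) (fun y => map (N y) a) x = 0 := by
  induction a using ExteriorAlgebra.induction with
  | algebraMap r =>
    simp only [AlgHom.commutes, dbarFlat_eq_wirt]
    exact wirt_const _ _
  | ι w => simpa only [map_apply_ι] using hcl w
  | mul a b ha hb =>
    simp only [map_mul]
    rw [dbarFlat_mul (smoothAt_map hN a) (smoothAt_map hN b), ha, hb, zero_mul, mul_zero, add_zero]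
  | add a b ha hb =>
    simp only [map_add, dbarFlat_eq_wirt] at *
    rw [wirt_add (smoothAt_map hN a) (smoothAt_map hN b), ha, hb, add_zero]

theorem part01_comp_reL (ℓ : V →ₗ[ℝ] ℂ) (D : V' →L[ℂ] V) :
    part01 (precomp (reL D) ℓ) = precomp (reL D) (part01 ℓ) := by
  ext v
  rw [part01_apply]
  change _ = part01 ℓ (D v)
  rw [part01_apply, ← map_smul]
  rfl

theorem part10_comp_reL (ℓ : V →ₗ[ℝ] ℂ) (D : V' →L[ℂ] V) :
    part10 (precomp (reL D) ℓ) = precomp (reL D) (part10 ℓ) := by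
  ext v
  rw [part10_apply]
  change _ = part10 ℓ (D v)
  rw [part10_apply, ← map_smul]
  rfl

theorem fderiv_comp_holomorphic {φ : V → ℂ} {τ : V' → V} {x : V'} (hτ : ContDiffAt ℂ ω τ x)
    (hφ : DifferentiableAt ℝ φ (τ x)) :
    (fderiv ℝ (fun y => φ (τ y)) x : V' →ₗ[ℝ] ℂ)
      = precomp (reL (fderiv ℂ τ x)) (fderiv ℝ φ (τ x) : V →ₗ[ℝ] ℂ) := by
  have hd : DifferentiableAt ℂ τ x := hτ.differentiableAt (by simp)
  have h1 := (hφ.hasFDerivAt.comp x (hd.hasFDerivAt.restrictScalars ℝ)).fderiv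
  change ((fderiv ℝ (φ ∘ τ) x : V' →L[ℝ] ℂ) : V' →ₗ[ℝ] ℂ) = _
  rw [h1]
  rfl

theorem SmoothAt.map_comp {N : V' → W →ₗ[ℂ] W'} {τ : V' → V} {x : V'}
    (hτ : ContDiffAt ℝ ∞ τ x) (hN : ∀ w, SmoothAt (fun y => N y w) x)
    {F : V → ExteriorAlgebra ℂ W} (hF : SmoothAt F (τ x)) :
    SmoothAt (fun y => map (N y) (F (τ y))) x := by
  have : (fun y => map (N y) (F (τ y))) = fun y => ∑ i,
      (finBasis ℂ (ExteriorAlgebra ℂ W)).repr (F (τ y)) i •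
        map (N y) (finBasis ℂ (ExteriorAlgebra ℂ W) i) := by
    funext y
    conv_lhs => rw [← (finBasis ℂ (ExteriorAlgebra ℂ W)).sum_repr (F (τ y)), map_sum]
    simp only [map_smul]
  rw [this]
  exact SmoothAt.sum fun i _ => SmoothAt.smul ((hF.repr _ i).comp x hτ) (smoothAt_map hN _)

/-- `∂̄` commutes with pull-back under a holomorphic map `τ`, twisted by maps `N` that restrict to
the pull-back on covectors and are `∂̄`-closed on constants. -/
theorem dbarFlat_map {c : (V →ₗ[ℝ] ℂ) →ₗ[ℂ] W} {c' : (V' →ₗ[ℝ] ℂ) →ₗ[ℂ] W'}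
    {N : V' → W →ₗ[ℂ] W'} {τ : V' → V} {x : V'} (hτ : ContDiffAt ℂ ω τ x)
    (hN : ∀ w, SmoothAt (fun y => N y w) x)
    (hNc : ∀ ℓ, N x (c ℓ) = c' (precomp (reL (fderiv ℂ τ x)) ℓ))
    (hcl : ∀ w, dbarFlat (ι ℂ ∘ₗ c') (fun y => ι ℂ (N y w)) x = 0)
    {F : V → ExteriorAlgebra ℂ W} (hF : SmoothAt F (τ x)) :
    dbarFlat (ι ℂ ∘ₗ c') (fun y => map (N y) (F (τ y))) x
      = map (N x) (dbarFlat (ι ℂ ∘ₗ c) F (τ x)) := by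
  have hτr : ContDiffAt ℝ ∞ τ x := (hτ.restrict_scalars ℝ).of_le le_top
  set B := finBasis ℂ (ExteriorAlgebra ℂ W) with hB
  have h0 : (fun y => map (N y) (F (τ y))) = fun y => ∑ i,
      (B.repr (F (τ y)) i • (1 : ExteriorAlgebra ℂ W')) * map (N y) (B i) := by
    funext y
    conv_lhs => rw [← B.sum_repr (F (τ y)), map_sum]
    simp only [map_smul, smul_mul_assoc, one_mul]
  have hsm : ∀ i, ContDiffAt ℝ ∞ (fun y => B.repr (F (τ y)) i) x := fun i =>
    (hF.repr B i).comp x hτr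
  have hsm1 : ∀ i, SmoothAt (fun y => B.repr (F (τ y)) i • (1 : ExteriorAlgebra ℂ W')) x :=
    fun i => SmoothAt.smul (hsm i) (smoothAt_const _ x)
  rw [h0, dbarFlat_eq_wirt, wirt_sum fun i _ => (hsm1 i).mul (smoothAt_map hN _),
    dbarFlat_eq_sum_repr hF, map_sum]
  refine Finset.sum_congr rfl fun i _ => ?_
  rw [← dbarFlat_eq_wirt, dbarFlat_mul (hsm1 i) (smoothAt_map hN _), dbarFlat_map_const hN hcl,
    mul_zero, add_zero,
    dbarFlat_smul_const (hsm i), mul_one, map_mul, fderiv_comp_holomorphic hτ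
      ((hF.repr B i).differentiableAt (by simp)), part01_comp_reL]
  congr 1
  rw [LinearMap.comp_apply, LinearMap.comp_apply, map_apply_ι, hNc]

end Naturality

/-! ### Forms in charts -/

section FormCharts

variable {V : Type*} [NormedAddCommGroup V] [NormedSpace ℂ V]
  {H : Type*} [TopologicalSpace H] {I : ModelWithCorners ℂ V H}
  {M : Type*} [TopologicalSpace M] [ChartedSpace H M]
  {V' : Type*} [NormedAddCommGroup V'] [NormedSpace ℂ V']
  {H' : Type*} [TopologicalSpace H'] {I' : ModelWithCorners ℂ V' H'}
  {M' : Type*} [TopologicalSpace M'] [ChartedSpace H' M']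
  {V'' : Type*} [NormedAddCommGroup V''] [NormedSpace ℂ V'']
  {H'' : Type*} [TopologicalSpace H''] {I'' : ModelWithCorners ℂ V'' H''}
  {M'' : Type*} [TopologicalSpace M''] [ChartedSpace H'' M'']

/-- The expression of a map in the charts at `c` and `c'`. -/
def locRep {V : Type*} [NormedAddCommGroup V] [NormedSpace ℂ V]
    {V' : Type*} [NormedAddCommGroup V'] [NormedSpace ℂ V']
    {H : Type*} [TopologicalSpace H] {M : Type*} [TopologicalSpace M] [ChartedSpace H M]
    {H' : Type*} [TopologicalSpace H'] {M' : Type*} [TopologicalSpace M'] [ChartedSpace H' M']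
    (I' : ModelWithCorners ℂ V' H') (I : ModelWithCorners ℂ V H)
    (f : M' → M) (c : M') (c' : M) (y : V') : V :=
  extChartAt I c' (f ((extChartAt I' c).symm y))

theorem transition_eq (c p : M) (x : V) :
    transition I c p x = reL (fderiv ℂ (locRep I I id c p) x) := rfl

theorem symm_locRep {f : M' → M} {c : M'} {c' : M} {y : V'}
    (h : f ((extChartAt I' c).symm y) ∈ (extChartAt I c').source) :
    (extChartAt I c').symm (locRep I' I f c c' y) = f ((extChartAt I' c).symm y) :=
  (extChartAt I c').left_inv h

theorem locRep_mem_target {f : M' → M} {c : M'} {c' : M} {y : V'}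
    (h : f ((extChartAt I' c).symm y) ∈ (extChartAt I c').source) :
    locRep I' I f c c' y ∈ (extChartAt I c').target :=
  (extChartAt I c').map_source h

theorem continuousAt_symm_chart [I.Boundaryless] {c : M} {x : V}
    (hx : x ∈ (extChartAt I c).target) : ContinuousAt (extChartAt I c).symm x :=
  (continuousOn_extChartAt_symm c).continuousAt ((isOpen_extChartAt_target c).mem_nhds hx)

theorem eventually_mem_source [I'.Boundaryless] {f : M' → M} (hf : Continuous f) {c : M'} {x : V'}
    (hx : x ∈ (extChartAt I' c).target) {s : Set M} (hs : IsOpen s)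
    (h : f ((extChartAt I' c).symm x) ∈ s) : ∀ᶠ y in 𝓝 x, y ∈ (extChartAt I' c).target ∧
      f ((extChartAt I' c).symm y) ∈ s :=
  Filter.inter_mem ((isOpen_extChartAt_target c).mem_nhds hx)
    ((hf.continuousAt.comp (continuousAt_symm_chart hx)).preimage_mem_nhds (hs.mem_nhds h))

/-- The derivative of a map between manifolds at `p`, as a map of the model spaces. -/
def tangentRep {V : Type*} [NormedAddCommGroup V] [NormedSpace ℂ V]
    {V' : Type*} [NormedAddCommGroup V'] [NormedSpace ℂ V']
    {H : Type*} [TopologicalSpace H] {M : Type*} [TopologicalSpace M] [ChartedSpace H M]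
    {H' : Type*} [TopologicalSpace H'] {M' : Type*} [TopologicalSpace M'] [ChartedSpace H' M']
    (I' : ModelWithCorners ℂ V' H') (I : ModelWithCorners ℂ V H)
    (f : M' → M) (p : M') : V' →L[ℂ] V :=
  mfderiv I' I f p

variable [I.Boundaryless] [I'.Boundaryless] [I''.Boundaryless]
  [IsManifold I ω M] [IsManifold I' ω M'] [IsManifold I'' ω M'']

theorem contDiffAt_locRep {f : M' → M} (hf : ContMDiff I' I ω f) {c : M'} {c' : M} {x : V'}
    (hx : x ∈ (extChartAt I' c).target)
    (h : f ((extChartAt I' c).symm x) ∈ (extChartAt I c').source) :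
    ContDiffAt ℂ ω (locRep I' I f c c') x := by
  rw [← contMDiffAt_iff_contDiffAt]
  have h1 : ContMDiffAt 𝓘(ℂ, V') I' ω (extChartAt I' c).symm x :=
    (contMDiffOn_extChartAt_symm c).contMDiffAt ((isOpen_extChartAt_target c).mem_nhds hx)
  have h2 : ContMDiffAt I 𝓘(ℂ, V) ω (extChartAt I c') (f ((extChartAt I' c).symm x)) :=
    contMDiffAt_extChartAt' (by rwa [extChartAt_source] at h)
  exact h2.comp x (hf.contMDiffAt.comp x h1)

/-- The chain rule for expressions in charts. -/
theorem fderiv_locRep_comp {f : M' → M} (hf : ContMDiff I' I ω f) {g : M → M''}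
    (hg : ContMDiff I I'' ω g) {c : M'} {c' : M} {c'' : M''} {x : V'}
    (hx : x ∈ (extChartAt I' c).target)
    (h : f ((extChartAt I' c).symm x) ∈ (extChartAt I c').source)
    (h' : g (f ((extChartAt I' c).symm x)) ∈ (extChartAt I'' c'').source) :
    fderiv ℂ (locRep I' I'' (g ∘ f) c c'') x
      = (fderiv ℂ (locRep I I'' g c' c'') (locRep I' I f c c' x)).comp
          (fderiv ℂ (locRep I' I f c c') x) := by
  have e : locRep I' I'' (g ∘ f) c c'' =ᶠ[𝓝 x] locRep I I'' g c' c'' ∘ locRep I' I f c c' := by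
    filter_upwards [eventually_mem_source hf.continuous hx (isOpen_extChartAt_source c') h]
      with y hy
    simp only [Function.comp_apply]
    change _ = extChartAt I'' c'' (g ((extChartAt I c').symm (locRep I' I f c c' y)))
    rw [symm_locRep hy.2]
    rfl
  rw [e.fderiv_eq]
  refine fderiv_comp x ?_ ((contDiffAt_locRep hf hx h).differentiableAt (by simp))
  refine (contDiffAt_locRep hg (locRep_mem_target h) ?_).differentiableAt (by simp)
  rwa [symm_locRep h]

theorem mfderiv_eq_fderiv_locRep {f : M' → M} (hf : ContMDiff I' I ω f) (p : M') :
    tangentRep I' I f p = fderiv ℂ (locRep I' I f p (f p)) (extChartAt I' p p) := by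
  rw [tangentRep, (hf.mdifferentiableAt (by simp)).mfderiv, I'.range_eq_univ, fderivWithin_univ]
  rfl

theorem map_precomp_comp (L : V' →ₗ[ℝ] V) (L' : V'' →ₗ[ℝ] V')
    (a : ExteriorAlgebra ℂ (V →ₗ[ℝ] ℂ)) :
    map (precomp L') (map (precomp L) a)
      = map (precomp (L ∘ₗ L')) a := by
  change (map _).comp (map _) a = _
  rw [ExteriorAlgebra.map_comp_map]
  rfl

/-- Pull-back of forms, expressed in charts. -/
theorem localForm_pullback {f : M' → M} (hf : ContMDiff I' I ω f) (α : Form V M) {c : M'} {c' : M}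
    {x : V'} (hx : x ∈ (extChartAt I' c).target)
    (h : f ((extChartAt I' c).symm x) ∈ (extChartAt I c').source) :
    localForm I' (pullback I I' f α) c x
      = map (precomp (reL (fderiv ℂ (locRep I' I f c c') x)))
          (localForm I α c' (locRep I' I f c c' x)) := by
  set p := (extChartAt I' c).symm x with hp
  have hpx : locRep I' I' id c p x = extChartAt I' p p := rfl
  have h1 := fderiv_locRep_comp contMDiff_id hf hx (c' := p) (c'' := f p)
    (mem_extChartAt_source (I := I') p) (mem_extChartAt_source (I := I) (f p))
  have h2 := fderiv_locRep_comp hf contMDiff_id hx h (c'' := f p)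
    (mem_extChartAt_source (I := I) (f p))
  have h3 : (tangentRep I' I f p).comp (fderiv ℂ (locRep I' I' id c p) x)
      = (fderiv ℂ (locRep I I id c' (f p)) (locRep I' I f c c' x)).comp
          (fderiv ℂ (locRep I' I f c c') x) := by
    rw [← h2, mfderiv_eq_fderiv_locRep hf p]
    exact h1.symm
  have e1 : localForm I' (pullback I I' f α) c x = map
      (precomp (reL ((tangentRep I' I f p).comp
        (fderiv ℂ (locRep I' I' id c p) x)))) (α (f p)) := map_precomp_comp _ _ _
  have e2 : localForm I α c' (locRep I' I f c c' x) = map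
      (precomp (reL (fderiv ℂ (locRep I I id c' (f p)) (locRep I' I f c c' x)))) (α (f p)) := by
    change map (precomp (transition I c' _ _)) (α _) = _
    rw [symm_locRep h]
    rfl
  rw [e1, e2, map_precomp_comp, h3]
  rfl

theorem pullback_id (α : Form V M) : pullback I I id α = α := by
  funext p
  have e : tangentRep I I id p = ContinuousLinearMap.id ℂ V := mfderiv_id
  change map (precomp (reL (tangentRep I I id p))) (α p) = α p
  rw [e]
  change map LinearMap.id (α p) = α p
  rw [ExteriorAlgebra.map_id]
  rfl

theorem localForm_change (α : Form V M) {c c' : M} {x : V} (hx : x ∈ (extChartAt I c).target)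
    (h : (extChartAt I c).symm x ∈ (extChartAt I c').source) :
    localForm I α c x
      = map (precomp (reL (fderiv ℂ (locRep I I id c c') x)))
          (localForm I α c' (locRep I I id c c' x)) := by
  conv_lhs => rw [← pullback_id (I := I) α]
  exact localForm_pullback contMDiff_id α hx h

variable [FiniteDimensional ℂ V] [FiniteDimensional ℂ V'] [ComplexCoords V] [ComplexCoords V']

theorem smoothAt_localForm_pullback {f : M' → M} (hf : ContMDiff I' I ω f) {α : Form V M} {c : M'}
    {c' : M} {x : V'} (hx : x ∈ (extChartAt I' c).target)
    (h : f ((extChartAt I' c).symm x) ∈ (extChartAt I c').source)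
    (hα : SmoothAt (localForm I α c') (locRep I' I f c c' x)) :
    SmoothAt (localForm I' (pullback I I' f α) c) x := by
  have hτ := contDiffAt_locRep hf hx h
  have h1 : SmoothAt (fun y => map
      (precomp (reL (fderiv ℂ (locRep I' I f c c') y)))
        (localForm I α c' (locRep I' I f c c' y))) x :=
    SmoothAt.map_comp ((hτ.restrict_scalars ℝ).of_le le_top)
      (fun w => smoothAt_realLinear (precompL w) (contDiffAt_real_fderiv hτ)) hα
  refine h1.congr ?_
  filter_upwards [eventually_mem_source hf.continuous hx (isOpen_extChartAt_source c') h] with y hy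
  exact localForm_pullback hf α hy.1 hy.2

theorem smoothAt_localForm_change {α : Form V M} {c c' : M} {x : V}
    (hx : x ∈ (extChartAt I c).target)
    (h : (extChartAt I c).symm x ∈ (extChartAt I c').source)
    (hα : SmoothAt (localForm I α c') (locRep I I id c c' x)) :
    SmoothAt (localForm I α c) x := by
  have := smoothAt_localForm_pullback contMDiff_id hx h hα
  rwa [pullback_id] at this

theorem smoothForm_iff {α : Form V M} : SmoothForm I α ↔
    ∀ c, ∀ x ∈ (extChartAt I c).target, SmoothAt (localForm I α c) x := by
  constructor
  · intro h c x hx ℓ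
    exact (h c ℓ).contDiffAt ((isOpen_extChartAt_target c).mem_nhds hx)
  · intro h c ℓ x hx
    exact (h c x hx ℓ).contDiffWithinAt

theorem smoothForm_of_forall {α : Form V M}
    (h : ∀ p, ∃ c, p ∈ (extChartAt I c).source ∧ SmoothAt (localForm I α c) (extChartAt I c p)) :
    SmoothForm I α := by
  rw [smoothForm_iff]
  intro c x hx
  obtain ⟨c', hc', hs⟩ := h ((extChartAt I c).symm x)
  exact smoothAt_localForm_change hx hc' hs

/-- `∂̄` of a pull-back, expressed in charts. -/
theorem dbarFlat_localForm_pullback {f : M' → M} (hf : ContMDiff I' I ω f) {α : Form V M} {c : M'}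
    {c' : M} {x : V'} (hx : x ∈ (extChartAt I' c).target)
    (h : f ((extChartAt I' c).symm x) ∈ (extChartAt I c').source)
    (hα : SmoothAt (localForm I α c') (locRep I' I f c c' x)) :
    dbarFlat (ι ℂ) (localForm I' (pullback I I' f α) c) x
      = map (precomp (reL (fderiv ℂ (locRep I' I f c c') x)))
          (dbarFlat (ι ℂ) (localForm I α c') (locRep I' I f c c' x)) := by
  have hτ := contDiffAt_locRep hf hx h
  have hs : ∀ w : V →ₗ[ℝ] ℂ,
      SmoothAt (fun y => precomp (reL (fderiv ℂ (locRep I' I f c c') y)) w) x :=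
    fun w => smoothAt_realLinear (precompL w) (contDiffAt_real_fderiv hτ)
  have hz : ∀ w : V →ₗ[ℝ] ℂ, dbarFlat ((ι ℂ) ∘ₗ LinearMap.id)
      (fun y => ι ℂ (precomp (reL (fderiv ℂ (locRep I' I f c c') y)) w)) x = 0 :=
    fun w => dbarFlat_precomp_fderiv (ι ℂ ∘ₗ LinearMap.id)
      (fun ℓ m => ι_anticomm _ _) hτ w
  have h1 := dbarFlat_map (c := LinearMap.id) (c' := LinearMap.id)
    (N := fun y => precomp (reL (fderiv ℂ (locRep I' I f c c') y))) hτ hs (fun ℓ => rfl) hz hα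
  rw [LinearMap.comp_id] at h1
  refine Eq.trans ?_ h1
  rw [dbarFlat_eq_wirt, dbarFlat_eq_wirt]
  apply wirt_congr
  filter_upwards [eventually_mem_source hf.continuous hx (isOpen_extChartAt_source c') h] with y hy
  exact localForm_pullback hf α hy.1 hy.2

/-- `∂̄` of forms can be computed in any chart. -/
theorem localForm_dbarForm {α : Form V M} {c : M} {x : V} (hx : x ∈ (extChartAt I c).target)
    (hα : SmoothAt (localForm I α c) x) :
    localForm I (dbarForm I α) c x = dbarFlat (ι ℂ) (localForm I α c) x := by
  set p := (extChartAt I c).symm x with hp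
  have hpc : p ∈ (extChartAt I c).source := (extChartAt I c).map_target hx
  have hpp : (extChartAt I p).symm (extChartAt I p p) = p := extChartAt_to_inv p
  have hloc : locRep I I id p c (extChartAt I p p) = x := by
    unfold locRep
    rw [hpp, id_eq, hp, (extChartAt I c).right_inv hx]
  have hsm : SmoothAt (localForm I α p) (extChartAt I p p) :=
    smoothAt_localForm_change (mem_extChartAt_target p) (by rwa [hpp]) (by rwa [hloc])
  have h1 := dbarFlat_localForm_pullback contMDiff_id hx (c' := p)
    (mem_extChartAt_source (I := I) p) hsm
  rw [pullback_id] at h1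
  exact h1.symm

theorem dbarForm_pullback {f : M' → M} (hf : ContMDiff I' I ω f) {α : Form V M}
    (hα : SmoothForm I α) :
    dbarForm I' (pullback I I' f α) = pullback I I' f (dbarForm I α) := by
  funext p
  have hpp : (extChartAt I' p).symm (extChartAt I' p p) = p := extChartAt_to_inv p
  have hloc : locRep I' I f p (f p) (extChartAt I' p p) = extChartAt I (f p) (f p) := by
    unfold locRep
    rw [hpp]
  have h1 := dbarFlat_localForm_pullback hf (c := p) (c' := f p) (mem_extChartAt_target p)
    (by rw [hpp]; exact mem_extChartAt_source (I := I) (f p))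
    (by rw [hloc]; exact smoothForm_iff.1 hα (f p) _ (mem_extChartAt_target _))
  rw [hloc, ← mfderiv_eq_fderiv_locRep hf] at h1
  exact h1

end FormCharts

/-! ### Sections of `G_E` in local frames -/

section SectionCharts

variable {n : ℕ} {V : Type*} [NormedAddCommGroup V] [NormedSpace ℂ V]
  {H : Type*} [TopologicalSpace H] {I : ModelWithCorners ℂ V H}
  {M : Type*} [TopologicalSpace M] [ChartedSpace H M]
  {E : M → Type*} [TopologicalSpace (TotalSpace (Fin n → ℂ) E)]
  [∀ p, AddCommGroup (E p)] [∀ p, Module ℂ (E p)] [∀ p, TopologicalSpace (E p)]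
  [FiberBundle (Fin n → ℂ) E] [VectorBundle ℂ (Fin n → ℂ) E]

theorem symmAt_coordAt {c q : M} (h : q ∈ (trivializationAt (Fin n → ℂ) E c).baseSet) (v : E q) :
    symmAt n E c q (coordAt n E c q v) = v :=
  (trivializationAt (Fin n → ℂ) E c).symmₗ_linearMapAt h v

theorem coordAt_symmAt {c q : M} (h : q ∈ (trivializationAt (Fin n → ℂ) E c).baseSet)
    (v : Fin n → ℂ) : coordAt n E c q (symmAt n E c q v) = v :=
  (trivializationAt (Fin n → ℂ) E c).linearMapAt_symmₗ h v

theorem isDualPair_frame {c q : M} (h : q ∈ (trivializationAt (Fin n → ℂ) E c).baseSet) :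
    IsDualPair (fun j => frame n E c j q) (fun j => dualFrame n E c j q) where
  pairing i j := by
    change (coordAt n E c q (symmAt n E c q (Pi.single j 1))) i = _
    rw [coordAt_symmAt h, Pi.single_apply]
  expand v := by
    have : ∑ j, coordAt n E c q v j • symmAt n E c q (Pi.single j 1) = v := by
      rw [← symmAt_coordAt h v]
      conv_rhs => rw [← Finset.univ_sum_single (coordAt n E c q v), map_sum]
      refine Finset.sum_congr rfl fun j _ => ?_
      rw [symmAt_coordAt h, ← map_smul]
      congr 1
      rw [← Pi.single_smul', smul_eq_mul, mul_one]
    exact this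

/-- The change of frame from the trivialization at `c'` to the one at `c`, over the chart at `c`. -/
def frameChange (n : ℕ) (I : ModelWithCorners ℂ V H) (E : M → Type*)
    [TopologicalSpace (TotalSpace (Fin n → ℂ) E)]
    [∀ p, AddCommGroup (E p)] [∀ p, Module ℂ (E p)] [∀ p, TopologicalSpace (E p)]
    [FiberBundle (Fin n → ℂ) E] [VectorBundle ℂ (Fin n → ℂ) E] (a b c : M) (y : V) :
    (Fin n → ℂ) →L[ℂ] (Fin n → ℂ) :=
  ((trivializationAt (Fin n → ℂ) E a).coordChangeL ℂ (trivializationAt (Fin n → ℂ) E b)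
    ((extChartAt I c).symm y) : (Fin n → ℂ) →L[ℂ] (Fin n → ℂ))

theorem frameChange_apply {a b c : M} {y : V}
    (ha : (extChartAt I c).symm y ∈ (trivializationAt (Fin n → ℂ) E a).baseSet)
    (hb : (extChartAt I c).symm y ∈ (trivializationAt (Fin n → ℂ) E b).baseSet)
    (v : Fin n → ℂ) : frameChange n I E a b c y v
      = coordAt n E b ((extChartAt I c).symm y) (symmAt n E a ((extChartAt I c).symm y) v) := by
  unfold frameChange coordAt symmAt
  rw [ContinuousLinearEquiv.coe_coe, Trivialization.coordChangeL_apply _ _ ⟨ha, hb⟩,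
    Trivialization.coe_linearMapAt_of_mem _ hb, Trivialization.symmₗ_apply _ ha]

theorem localDomain_open [I.Boundaryless] (c : M) : IsOpen (localDomain I n E c) :=
  (continuousOn_extChartAt_symm c).isOpen_inter_preimage (isOpen_extChartAt_target c)
    (trivializationAt (Fin n → ℂ) E c).open_baseSet

theorem mem_localDomain (p : M) : extChartAt I p p ∈ localDomain I n E p :=
  ⟨mem_extChartAt_target p, by
    rw [Set.mem_preimage, extChartAt_to_inv]
    exact FiberBundle.mem_baseSet_trivializationAt' p⟩

variable (n E) in
/-- The linear map that expresses the fibre of `T* ⊕ E ⊕ E*` over the point with coordinate `y` in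
the chart and frame at `c`, in terms of the chart and frame at `c'`. -/
def secChange (I : ModelWithCorners ℂ V H) (c c' : M) (y : V) :
    ((V →ₗ[ℝ] ℂ) × (Fin n → ℂ) × Dual ℂ (Fin n → ℂ)) →ₗ[ℂ]
      ((V →ₗ[ℝ] ℂ) × (Fin n → ℂ) × Dual ℂ (Fin n → ℂ)) :=
  (precomp (reL (fderiv ℂ (locRep I I id c c') y))).prodMap
    ((frameChange n I E c' c c y : (Fin n → ℂ) →ₗ[ℂ] (Fin n → ℂ)).prodMap
      (frameChange n I E c c' c y : (Fin n → ℂ) →ₗ[ℂ] (Fin n → ℂ)).dualMap)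

variable [I.Boundaryless] [IsManifold I ω M]

theorem localSec_change (ξ : ∀ p, GFib V (E p)) {c c' : M} {x : V} (hx : x ∈ localDomain I n E c)
    (h : (extChartAt I c).symm x ∈ (extChartAt I c').source)
    (h' : (extChartAt I c).symm x ∈ (trivializationAt (Fin n → ℂ) E c').baseSet) :
    localSec n I ξ c x
      = map (secChange n E I c c' x)
          (localSec n I ξ c' (locRep I I id c c' x)) := by
  set p := (extChartAt I c).symm x with hp
  have e2 : localSec n I ξ c' (locRep I I id c c' x) = map
      ((precomp (transition I c' p (locRep I I id c c' x))).prodMap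
        ((coordAt n E c' p).prodMap (symmAt n E c' p).dualMap)) (ξ p) := by
    have hq : (extChartAt I c').symm (locRep I I id c c' x) = p := symm_locRep (f := id) h
    unfold localSec
    simp only
    rw [hq]
  have h1 := fderiv_locRep_comp contMDiff_id contMDiff_id hx.1 h (c'' := p)
    (mem_extChartAt_source (I := I) p)
  rw [e2]
  change _ = (map _).comp (map _) (ξ p)
  rw [ExteriorAlgebra.map_comp_map]
  change map ((precomp (transition I c p x)).prodMap
        ((coordAt n E c p).prodMap (symmAt n E c p).dualMap)) (ξ p) = _
  congr 2
  refine LinearMap.ext fun w => ?_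
  obtain ⟨ℓ, v, τ⟩ := w
  refine Prod.ext ?_ (Prod.ext ?_ ?_)
  · change precomp (transition I c p x) ℓ = precomp (reL _) (precomp (transition I c' p _) ℓ)
    rw [transition_eq, transition_eq]
    have : reL (fderiv ℂ (locRep I I id c p) x) =
        reL (fderiv ℂ (locRep I I id c' p) (locRep I I id c c' x)) ∘ₗ
          reL (fderiv ℂ (locRep I I id c c') x) :=
      congrArg (fun D : V →L[ℂ] V => reL D) h1
    rw [this]
    rfl
  · change coordAt n E c p v = frameChange n I E c' c c x (coordAt n E c' p v)
    rw [frameChange_apply h' hx.2, ← hp, symmAt_coordAt h']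
  · change τ ∘ₗ symmAt n E c p = (τ ∘ₗ symmAt n E c' p) ∘ₗ
      (frameChange n I E c c' c x : (Fin n → ℂ) →ₗ[ℂ] (Fin n → ℂ))
    refine LinearMap.ext fun w => ?_
    change τ (symmAt n E c p w) = τ (symmAt n E c' p (frameChange n I E c c' c x w))
    rw [frameChange_apply hx.2 h', ← hp, symmAt_coordAt h']

theorem eventually_mem_domains {c c' : M} {x : V} (hx : x ∈ localDomain I n E c)
    (h : (extChartAt I c).symm x ∈ (extChartAt I c').source)
    (h' : (extChartAt I c).symm x ∈ (trivializationAt (Fin n → ℂ) E c').baseSet) :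
    ∀ᶠ y in 𝓝 x, y ∈ localDomain I n E c ∧ (extChartAt I c).symm y ∈ (extChartAt I c').source ∧
      (extChartAt I c).symm y ∈ (trivializationAt (Fin n → ℂ) E c').baseSet := by
  filter_upwards [(localDomain_open c).mem_nhds hx,
    (continuousAt_symm_chart hx.1).preimage_mem_nhds ((isOpen_extChartAt_source c').mem_nhds h),
    (continuousAt_symm_chart hx.1).preimage_mem_nhds
      ((trivializationAt (Fin n → ℂ) E c').open_baseSet.mem_nhds h')] with y h1 h2 h3
  exact ⟨h1, h2, h3⟩

variable [ContMDiffVectorBundle ω (Fin n → ℂ) E I]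

theorem contDiffAt_frameChange {a b c : M} {x : V} (hx : x ∈ (extChartAt I c).target)
    (ha : (extChartAt I c).symm x ∈ (trivializationAt (Fin n → ℂ) E a).baseSet)
    (hb : (extChartAt I c).symm x ∈ (trivializationAt (Fin n → ℂ) E b).baseSet) :
    ContDiffAt ℂ ω (frameChange n I E a b c) x := by
  rw [← contMDiffAt_iff_contDiffAt]
  have h1 : ContMDiffAt 𝓘(ℂ, V) I ω (extChartAt I c).symm x :=
    (contMDiffOn_extChartAt_symm c).contMDiffAt ((isOpen_extChartAt_target c).mem_nhds hx)
  exact (contMDiffAt_coordChangeL (n := ω) (IB := I) (e := trivializationAt (Fin n → ℂ) E a)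
    (e' := trivializationAt (Fin n → ℂ) E b) ha hb).comp x h1

variable [FiniteDimensional ℂ V] [ComplexCoords V]

theorem smoothAt_secChange {c c' : M} {x : V} (hx : x ∈ localDomain I n E c)
    (h : (extChartAt I c).symm x ∈ (extChartAt I c').source)
    (h' : (extChartAt I c).symm x ∈ (trivializationAt (Fin n → ℂ) E c').baseSet)
    (w : (V →ₗ[ℝ] ℂ) × (Fin n → ℂ) × Dual ℂ (Fin n → ℂ)) :
    SmoothAt (fun y => secChange n E I c c' y w) x := by
  obtain ⟨ℓ, v, τ⟩ := w
  have hτ := contDiffAt_locRep (contMDiff_id (I := I) (n := ω)) hx.1 h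
  have h1 : SmoothAt (fun y => LinearMap.inl ℂ (V →ₗ[ℝ] ℂ) ((Fin n → ℂ) × Dual ℂ (Fin n → ℂ))
      (precompL ℓ (fderiv ℂ (locRep I I id c c') y))) x :=
    (smoothAt_realLinear (precompL ℓ) (contDiffAt_real_fderiv hτ)).linear _
  have hB : ∀ {a b : M}, (extChartAt I c).symm x ∈ (trivializationAt (Fin n → ℂ) E a).baseSet →
      (extChartAt I c).symm x ∈ (trivializationAt (Fin n → ℂ) E b).baseSet →
      ContDiffAt ℝ ∞ (frameChange n I E a b c) x := fun ha hb =>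
    ((contDiffAt_frameChange hx.1 ha hb).restrict_scalars ℝ).of_le le_top
  have h2 := smoothAt_realLinear (((LinearMap.inr ℂ (V →ₗ[ℝ] ℂ) _ ∘ₗ
    LinearMap.inl ℂ (Fin n → ℂ) (Dual ℂ (Fin n → ℂ))).restrictScalars ℝ) ∘ₗ
      ((ContinuousLinearMap.apply ℂ (Fin n → ℂ) v : _ →ₗ[ℂ] _).restrictScalars ℝ)) (hB h' hx.2)
  let Φ : ((Fin n → ℂ) →L[ℂ] (Fin n → ℂ)) →ₗ[ℂ] Dual ℂ (Fin n → ℂ) :=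
    { toFun := fun D => τ ∘ₗ (D : (Fin n → ℂ) →ₗ[ℂ] (Fin n → ℂ))
      map_add' := fun D D' => by ext; simp
      map_smul' := fun r D => by ext; simp }
  have h3 := smoothAt_realLinear (((LinearMap.inr ℂ (V →ₗ[ℝ] ℂ) _ ∘ₗ
    LinearMap.inr ℂ (Fin n → ℂ) (Dual ℂ (Fin n → ℂ)) ∘ₗ Φ).restrictScalars ℝ)) (hB hx.2 h')
  refine ((h1.add h2).add h3).congr (Filter.Eventually.of_forall fun y => ?_)
  refine Prod.ext ?_ (Prod.ext ?_ ?_)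
  · change _ = _ + 0 + 0
    rw [add_zero, add_zero]
    rfl
  · change _ = 0 + _ + 0
    rw [add_zero, zero_add]
    rfl
  · change _ = 0 + 0 + _
    rw [add_zero, zero_add]
    rfl

theorem smoothAt_localSec_change {ξ : ∀ p, GFib V (E p)} {c c' : M} {x : V}
    (hx : x ∈ localDomain I n E c)
    (h : (extChartAt I c).symm x ∈ (extChartAt I c').source)
    (h' : (extChartAt I c).symm x ∈ (trivializationAt (Fin n → ℂ) E c').baseSet)
    (hξ : SmoothAt (localSec n I ξ c') (locRep I I id c c' x)) :
    SmoothAt (localSec n I ξ c) x := by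
  have hτ := contDiffAt_locRep (contMDiff_id (I := I) (n := ω)) hx.1 h
  refine (SmoothAt.map_comp ((hτ.restrict_scalars ℝ).of_le le_top)
    (smoothAt_secChange hx h h') hξ).congr ?_
  filter_upwards [eventually_mem_domains hx h h'] with y hy
  exact localSec_change ξ hy.1 hy.2.1 hy.2.2

theorem dbarFlat_holomorphic {R : Type*} [Ring R] [Algebra ℂ R] [Module.Finite ℂ R]
    {N : Type*} [NormedAddCommGroup N] [NormedSpace ℂ N] [FiniteDimensional ℂ N]
    (c : (V →ₗ[ℝ] ℂ) →ₗ[ℂ] R) (Φ : N →ₗ[ℂ] R) {T : V → N} {x : V} (hT : ContDiffAt ℂ ω T x) :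
    dbarFlat c (fun y => Φ (T y)) x = 0 := by
  refine Finset.sum_eq_zero fun j _ => ?_
  have hr : ContDiffAt ℝ ∞ T x := (hT.restrict_scalars ℝ).of_le le_top
  have hd : DifferentiableAt ℂ T x := hT.differentiableAt (by simp)
  have h1 : ∀ v, dirDeriv (fun y => Φ (T y)) x v = Φ (fderiv ℂ T x v) := by
    intro v
    have := dirDeriv_realLinear (Φ.restrictScalars ℝ) hr v
    rw [hd.fderiv_restrictScalars ℝ] at this
    exact this
  rw [dirDzbar, h1, h1, map_smul, map_smul, smul_smul, Complex.I_mul_I, neg_one_smul,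
    add_neg_cancel, smul_zero, mul_zero]

theorem dbarFlat_secChange {c c' : M} {x : V}
    (hx : x ∈ localDomain I n E c)
    (h : (extChartAt I c).symm x ∈ (extChartAt I c').source)
    (h' : (extChartAt I c).symm x ∈ (trivializationAt (Fin n → ℂ) E c').baseSet)
    (w : (V →ₗ[ℝ] ℂ) × (Fin n → ℂ) × Dual ℂ (Fin n → ℂ)) :
    dbarFlat (ι ℂ ∘ₗ LinearMap.inl ℂ (V →ₗ[ℝ] ℂ)
      ((Fin n → ℂ) × Dual ℂ (Fin n → ℂ)))
      (fun y => ι ℂ (secChange n E I c c' y w)) x = 0 := by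
  have hτ := contDiffAt_locRep (contMDiff_id (I := I) (n := ω)) hx.1 h
  obtain ⟨ℓ, v, τ⟩ := w
  have s1 : SmoothAt (fun y => ι ℂ (secChange n E I c c' y (ℓ, 0, 0))) x :=
    (smoothAt_secChange hx h h' _).linear _
  have s2 : SmoothAt (fun y => ι ℂ (secChange n E I c c' y (0, v, 0))) x :=
    (smoothAt_secChange hx h h' _).linear _
  have s3 : SmoothAt (fun y => ι ℂ (secChange n E I c c' y (0, 0, τ))) x :=
    (smoothAt_secChange hx h h' _).linear _
  have e : (fun y => ι ℂ (secChange n E I c c' y (ℓ, v, τ))) = fun y =>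
      ι ℂ (secChange n E I c c' y (ℓ, 0, 0)) +
      ι ℂ (secChange n E I c c' y (0, v, 0)) +
      ι ℂ (secChange n E I c c' y (0, 0, τ)) := by
    funext y
    rw [← map_add, ← map_add, ← map_add, ← map_add]
    simp
  have d1 := dbarFlat_precomp_fderiv (ι ℂ ∘ₗ
    LinearMap.inl ℂ (V →ₗ[ℝ] ℂ) ((Fin n → ℂ) × Dual ℂ (Fin n → ℂ)))
    (fun ℓ m => ι_anticomm _ _) hτ ℓ
  have d2 := dbarFlat_holomorphic (ι ℂ ∘ₗ
    LinearMap.inl ℂ (V →ₗ[ℝ] ℂ) ((Fin n → ℂ) × Dual ℂ (Fin n → ℂ)))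
    ((ι ℂ ∘ₗ LinearMap.inr ℂ (V →ₗ[ℝ] ℂ) _ ∘ₗ
      LinearMap.inl ℂ (Fin n → ℂ) (Dual ℂ (Fin n → ℂ))) ∘ₗ
      (ContinuousLinearMap.apply ℂ (Fin n → ℂ) v : _ →ₗ[ℂ] _))
    (contDiffAt_frameChange hx.1 h' hx.2)
  let Φ : ((Fin n → ℂ) →L[ℂ] (Fin n → ℂ)) →ₗ[ℂ] Dual ℂ (Fin n → ℂ) :=
    { toFun := fun D => τ ∘ₗ (D : (Fin n → ℂ) →ₗ[ℂ] (Fin n → ℂ))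
      map_add' := fun D D' => by ext; simp
      map_smul' := fun r D => by ext; simp }
  have d3 := dbarFlat_holomorphic (ι ℂ ∘ₗ
    LinearMap.inl ℂ (V →ₗ[ℝ] ℂ) ((Fin n → ℂ) × Dual ℂ (Fin n → ℂ)))
    ((ι ℂ ∘ₗ LinearMap.inr ℂ (V →ₗ[ℝ] ℂ) _ ∘ₗ
      LinearMap.inr ℂ (Fin n → ℂ) (Dual ℂ (Fin n → ℂ))) ∘ₗ Φ)
    (contDiffAt_frameChange hx.1 hx.2 h')
  have z1 : (fun y => ι ℂ (secChange n E I c c' y (ℓ, 0, 0))) = fun y =>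
      (ι ℂ ∘ₗ LinearMap.inl ℂ (V →ₗ[ℝ] ℂ)
        ((Fin n → ℂ) × Dual ℂ (Fin n → ℂ)))
          (precomp (reL (fderiv ℂ (locRep I I id c c') y)) ℓ) := by
    funext y
    change ι ℂ _ = ι ℂ _
    congr 1
    exact Prod.ext rfl (Prod.ext (map_zero _) (map_zero _))
  have z2 : (fun y => ι ℂ (secChange n E I c c' y (0, v, 0))) = fun y =>
      ((ι ℂ ∘ₗ LinearMap.inr ℂ (V →ₗ[ℝ] ℂ) _ ∘ₗ
      LinearMap.inl ℂ (Fin n → ℂ) (Dual ℂ (Fin n → ℂ))) ∘ₗ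
      (ContinuousLinearMap.apply ℂ (Fin n → ℂ) v : _ →ₗ[ℂ] _)) (frameChange n I E c' c c y) := by
    funext y
    change ι ℂ _ = ι ℂ _
    congr 1
  have z3 : (fun y => ι ℂ (secChange n E I c c' y (0, 0, τ))) = fun y =>
      ((ι ℂ ∘ₗ LinearMap.inr ℂ (V →ₗ[ℝ] ℂ) _ ∘ₗ
      LinearMap.inr ℂ (Fin n → ℂ) (Dual ℂ (Fin n → ℂ))) ∘ₗ Φ) (frameChange n I E c c' c y) := by
    funext y
    change ι ℂ _ = ι ℂ _
    congr 1
    exact Prod.ext rfl (Prod.ext (map_zero (frameChange n I E c' c c y)) rfl)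
  rw [dbarFlat_eq_wirt] at d1 d2 d3
  rw [e, dbarFlat_eq_wirt, wirt_add (s1.add s2) s3, wirt_add s1 s2,
    z1, z2, z3, d1, d2, d3, add_zero, add_zero]

theorem dbarFlat_localSec_change {ξ : ∀ p, GFib V (E p)} {c c' : M} {x : V}
    (hx : x ∈ localDomain I n E c)
    (h : (extChartAt I c).symm x ∈ (extChartAt I c').source)
    (h' : (extChartAt I c).symm x ∈ (trivializationAt (Fin n → ℂ) E c').baseSet)
    (hξ : SmoothAt (localSec n I ξ c') (locRep I I id c c' x)) :
    dbarFlat inT (localSec n I ξ c) x = map (secChange n E I c c' x)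
      (dbarFlat inT (localSec n I ξ c') (locRep I I id c c' x)) := by
  have hτ := contDiffAt_locRep (contMDiff_id (I := I) (n := ω)) hx.1 h
  have hz : ∀ w, dbarFlat (ι ℂ ∘ₗ LinearMap.inl ℂ (V →ₗ[ℝ] ℂ)
      ((Fin n → ℂ) × Dual ℂ (Fin n → ℂ)))
      (fun y => ι ℂ (secChange n E I c c' y w)) x = 0 :=
    dbarFlat_secChange hx h h'
  have h1 := dbarFlat_map (c := LinearMap.inl ℂ (V →ₗ[ℝ] ℂ) ((Fin n → ℂ) × Dual ℂ (Fin n → ℂ)))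
    (c' := LinearMap.inl ℂ (V →ₗ[ℝ] ℂ) ((Fin n → ℂ) × Dual ℂ (Fin n → ℂ)))
    (N := fun y => secChange n E I c c' y) hτ (smoothAt_secChange hx h h')
    (fun ℓ => Prod.ext rfl (Prod.ext (map_zero _) (map_zero _))) hz hξ
  refine Eq.trans ?_ h1
  change dbarFlat inT _ x = dbarFlat inT _ x
  rw [dbarFlat_eq_wirt, dbarFlat_eq_wirt]
  apply wirt_congr
  filter_upwards [eventually_mem_domains hx h h'] with y hy
  exact localSec_change ξ hy.1 hy.2.1 hy.2.2

/-- `∂̄` of sections of `G_E` can be computed in any chart and holomorphic frame. -/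
theorem localSec_dbarSec {ξ : ∀ p, GFib V (E p)} {c : M} {x : V}
    (hx : x ∈ localDomain I n E c) (hξ : SmoothAt (localSec n I ξ c) x) :
    localSec n I (dbarSec n I ξ) c x = dbarFlat inT (localSec n I ξ c) x := by
  set p := (extChartAt I c).symm x with hp
  have hpc : p ∈ (extChartAt I c).source := (extChartAt I c).map_target hx.1
  have hpp : (extChartAt I p).symm (extChartAt I p p) = p := extChartAt_to_inv p
  have hpb : p ∈ (trivializationAt (Fin n → ℂ) E p).baseSet :=
    FiberBundle.mem_baseSet_trivializationAt' p
  have hloc : locRep I I id p c (extChartAt I p p) = x := by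
    unfold locRep
    rw [hpp, id_eq, hp, (extChartAt I c).right_inv hx.1]
  have hsm : SmoothAt (localSec n I ξ p) (extChartAt I p p) :=
    smoothAt_localSec_change (mem_localDomain p) (by rwa [hpp]) (by rw [hpp]; exact hx.2)
      (by rwa [hloc])
  rw [dbarFlat_localSec_change hx (c' := p) (mem_extChartAt_source (I := I) p) hpb hsm]
  change (map _).comp (map _) _ = _
  rw [ExteriorAlgebra.map_comp_map]
  change map _ (dbarFlat inT (localSec n I ξ p) (extChartAt I p p)) =
    map _ (dbarFlat inT (localSec n I ξ p) (extChartAt I p p))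
  congr 2
  refine LinearMap.ext fun w => ?_
  obtain ⟨ℓ, v, τ⟩ := w
  refine Prod.ext rfl (Prod.ext ?_ ?_)
  · exact (frameChange_apply hpb hx.2 v).symm
  · change (τ ∘ₗ coordAt n E p p) ∘ₗ symmAt n E c p = τ ∘ₗ
      (frameChange n I E c p c x : (Fin n → ℂ) →ₗ[ℂ] (Fin n → ℂ))
    refine LinearMap.ext fun w => ?_
    exact congrArg τ (frameChange_apply hx.2 hpb w).symm

theorem localSec_delta (η : ∀ p, E p) (ξ : ∀ p, GFib V (E p)) {c : M} {x : V}
    (hx : x ∈ localDomain I n E c) :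
    localSec n I (fun p => delta (η p) (ξ p)) c x
      = delta (coordAt n E c ((extChartAt I c).symm x) (η ((extChartAt I c).symm x)))
          (localSec n I ξ c x) := by
  refine Eq.symm ((contr_map _ _ _).trans ?_)
  refine congrArg (fun d => map _ (contr d (ξ ((extChartAt I c).symm x)))) ?_
  refine LinearMap.ext fun w => ?_
  exact congrArg w.2.2 (symmAt_coordAt hx.2 _)

theorem localForm_berezin (ξ : ∀ p, GFib V (E p)) {c : M} {x : V}
    (hx : x ∈ localDomain I n E c) :
    localForm I (fun p => berezin n p (ξ p)) c x
      = berezinOf (fun j => Pi.single j 1) (fun j => LinearMap.proj j) (localSec n I ξ c x) := by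
  set p := (extChartAt I c).symm x with hp
  have h1 := berezinOf_map (precomp (transition I c p x)) (coordAt n E c p) (symmAt n E c p)
    (fun j => Pi.single j 1) (fun j => LinearMap.proj j) (ξ p)
  refine Eq.trans ?_ h1.symm
  change map (precomp (transition I c p x)) (berezinOf _ _ (ξ p)) = _
  rw [berezinOf_congr (isDualPair_frame (E := E) (c := p) (q := p)
    (FiberBundle.mem_baseSet_trivializationAt' p)) (isDualPair_frame (E := E) (c := c) hx.2)]
  rfl

end SectionCharts

/-! ### The Chern connection in coordinates -/

section Del

variable {V : Type*} [NormedAddCommGroup V] [NormedSpace ℂ V] [ComplexCoords V]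

/-- The `(1,0)`-part of the differential of a function. -/
def delF (φ : V → ℂ) (x : V) : V →ₗ[ℝ] ℂ := part10 (fderiv ℝ φ x : V →ₗ[ℝ] ℂ)

/-- The `(0,1)`-part of the differential of a function. -/
def dbarF (φ : V → ℂ) (x : V) : V →ₗ[ℝ] ℂ := part01 (fderiv ℝ φ x : V →ₗ[ℝ] ℂ)

theorem delF_apply (φ : V → ℂ) (x v : V) : delF φ x v
    = (1 / 2 : ℂ) * (fderiv ℝ φ x v - Complex.I * fderiv ℝ φ x (Complex.I • v)) := rfl

theorem delF_add_dbarF (φ : V → ℂ) (x : V) :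
    delF φ x + dbarF φ x = (fderiv ℝ φ x : V →ₗ[ℝ] ℂ) := part10_add_part01 _

theorem delF_congr {φ ψ : V → ℂ} {x : V} (h : φ =ᶠ[𝓝 x] ψ) : delF φ x = delF ψ x := by
  rw [delF, delF, h.fderiv_eq]

theorem delF_sum {ι : Type*} {s : Finset ι} {φ : ι → V → ℂ} {x : V}
    (h : ∀ i ∈ s, DifferentiableAt ℝ (φ i) x) :
    delF (fun y => ∑ i ∈ s, φ i y) x = ∑ i ∈ s, delF (φ i) x := by
  refine LinearMap.ext fun v => ?_
  rw [LinearMap.sum_apply]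
  simp only [delF_apply]
  rw [fderiv_fun_sum h, sum_apply, sum_apply,
    Finset.mul_sum, ← Finset.sum_sub_distrib, Finset.mul_sum]

theorem delF_mul {φ ψ : V → ℂ} {x : V} (hφ : DifferentiableAt ℝ φ x)
    (hψ : DifferentiableAt ℝ ψ x) :
    delF (fun y => φ y * ψ y) x = φ x • delF ψ x + ψ x • delF φ x := by
  refine LinearMap.ext fun v => ?_
  simp only [LinearMap.add_apply, LinearMap.smul_apply, delF_apply]
  rw [fderiv_fun_mul hφ hψ]
  simp only [add_apply, smul_apply, smul_eq_mul]
  ring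

theorem dbarF_apply (φ : V → ℂ) (x v : V) : dbarF φ x v
    = (1 / 2 : ℂ) * (fderiv ℝ φ x v + Complex.I * fderiv ℝ φ x (Complex.I • v)) := rfl

theorem dbarF_mul {φ ψ : V → ℂ} {x : V} (hφ : DifferentiableAt ℝ φ x)
    (hψ : DifferentiableAt ℝ ψ x) :
    dbarF (fun y => φ y * ψ y) x = φ x • dbarF ψ x + ψ x • dbarF φ x := by
  refine LinearMap.ext fun v => ?_
  simp only [LinearMap.add_apply, LinearMap.smul_apply, dbarF_apply]
  rw [fderiv_fun_mul hφ hψ]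
  simp only [add_apply, smul_apply, smul_eq_mul]
  ring

theorem dbarF_sum {ι : Type*} {s : Finset ι} {φ : ι → V → ℂ} {x : V}
    (h : ∀ i ∈ s, DifferentiableAt ℝ (φ i) x) :
    dbarF (fun y => ∑ i ∈ s, φ i y) x = ∑ i ∈ s, dbarF (φ i) x := by
  refine LinearMap.ext fun v => ?_
  rw [LinearMap.sum_apply]
  simp only [dbarF_apply]
  rw [fderiv_fun_sum h, sum_apply, sum_apply,
    Finset.mul_sum, ← Finset.sum_add_distrib, Finset.mul_sum]

theorem delF_const (a : ℂ) (x : V) : delF (fun _ : V => a) x = 0 := by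
  refine LinearMap.ext fun v => ?_
  rw [delF_apply]
  simp

theorem dbarF_eq_zero {φ : V → ℂ} {x : V} (h : DifferentiableAt ℂ φ x) : dbarF φ x = 0 := by
  refine part01_eq_zero fun v => ?_
  rw [h.fderiv_restrictScalars ℝ]
  change fderiv ℂ φ x (Complex.I • v) = Complex.I * fderiv ℂ φ x v
  rw [map_smul, smul_eq_mul]

theorem delF_conj_eq_zero {φ : V → ℂ} {x : V} (h : DifferentiableAt ℂ φ x) :
    delF (fun y => conj (φ y)) x = 0 := by
  have h1 : ∀ v, fderiv ℝ (fun y => conj (φ y)) x v = conj (fderiv ℂ φ x v) := by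
    intro v
    have h2 : HasFDerivAt (fun y => conj (φ y))
        ((Complex.conjCLE : ℂ →L[ℝ] ℂ).comp ((fderiv ℂ φ x).restrictScalars ℝ)) x :=
      (Complex.conjCLE : ℂ →L[ℝ] ℂ).hasFDerivAt.comp x (h.hasFDerivAt.restrictScalars ℝ)
    rw [h2.fderiv]
    rfl
  refine LinearMap.ext fun v => ?_
  rw [delF_apply, h1, h1, map_smul, smul_eq_mul, map_mul, Complex.conj_I, LinearMap.zero_apply]
  linear_combination ((1 / 2 : ℂ) * conj (fderiv ℂ φ x v)) * (Complex.I_mul_I)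

end Del

section Flat

variable {n : ℕ} {V : Type*} [NormedAddCommGroup V] [NormedSpace ℂ V]

theorem contDiffAt_det {m : ℕ} {G : V → Matrix (Fin m) (Fin m) ℂ} {x : V}
    (h : ∀ i j, ContDiffAt ℝ ∞ (fun y => G y i j) x) : ContDiffAt ℝ ∞ (fun y => (G y).det) x := by
  simp only [Matrix.det_apply]
  refine ContDiffAt.sum fun s _ => ?_
  refine ContDiffAt.const_smul _ ?_
  exact contDiffAt_prod fun i _ => h _ _

theorem contDiffAt_inv {G : V → Matrix (Fin n) (Fin n) ℂ} {x : V}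
    (h : ∀ i j, ContDiffAt ℝ ∞ (fun y => G y i j) x) (hd : IsUnit (G x).det) (i j : Fin n) :
    ContDiffAt ℝ ∞ (fun y => (G y)⁻¹ i j) x := by
  simp only [Matrix.inv_def, Matrix.smul_apply, Ring.inverse_eq_inv', smul_eq_mul,
    Matrix.adjugate_apply]
  refine ((contDiffAt_det h).inv hd.ne_zero).mul (contDiffAt_det fun k l => ?_)
  by_cases hk : k = j
  · subst hk
    simpa using contDiffAt_const
  · simpa [Matrix.updateRow_ne hk] using h k l

variable [FiniteDimensional ℂ V] [ComplexCoords V]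

theorem smoothAt_delF {φ : V → ℂ} {x : V} (h : ContDiffAt ℝ ∞ φ x) : SmoothAt (delF φ) x := by
  let Φ : (V →L[ℝ] ℂ) →ₗ[ℝ] (V →ₗ[ℝ] ℂ) :=
    { toFun := fun D => part10 (D : V →ₗ[ℝ] ℂ)
      map_add' := fun a b => LinearMap.ext fun v => by
        simp only [LinearMap.add_apply, part10_apply, ContinuousLinearMap.coe_coe,
          add_apply]
        ring
      map_smul' := fun r a => LinearMap.ext fun v => by
        simp only [LinearMap.smul_apply, part10_apply, ContinuousLinearMap.coe_coe,
          smul_apply, RingHom.id_apply, Complex.real_smul]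
        ring }
  have : FiniteDimensional ℝ V := FiniteDimensional.complexToReal V
  exact smoothAt_realLinear Φ (h.fderiv_right (by simp))

theorem delFlat_delF {φ : V → ℂ} {x : V} (h : ∀ᶠ y in 𝓝 x, ContDiffAt ℝ ∞ φ y) :
    delFlat (ι ℂ) (fun y => ι ℂ (delF φ y)) x = 0 := by
  have h1 : SmoothAt (fun y => φ y • (1 : ExteriorAlgebra ℂ (V →ₗ[ℝ] ℂ))) x :=
    SmoothAt.smul h.self_of_nhds (smoothAt_const _ _)
  have h2 := wirt_wirt (e := -1) (ν := dz) (c := ι ℂ)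
    (fun ℓ m => ι_anticomm ℓ m) h1
  rw [← h2]
  refine wirt_congr ?_
  filter_upwards [h] with y hy
  have := delFlat_smul_const (c := ι ℂ) hy (1 : ExteriorAlgebra ℂ (V →ₗ[ℝ] ℂ))
  rw [mul_one] at this
  exact this.symm

/-- The matrix `G⁻¹ ∂G`. -/
def connFlat (G : V → Matrix (Fin n) (Fin n) ℂ) (x : V) (i j : Fin n) : V →ₗ[ℝ] ℂ :=
  ∑ k, ((G x)⁻¹ i k) • delF (fun y => G y k j) x

/-- The curvature matrix `dθ + θ ∧ θ` of `θ = G⁻¹ ∂G`. -/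
def curvFlat (G : V → Matrix (Fin n) (Fin n) ℂ) (x : V) (i j : Fin n) :
    ExteriorAlgebra ℂ (V →ₗ[ℝ] ℂ) :=
  dFlat (ι ℂ) (fun y => ι ℂ (connFlat G y i j)) x
    + ∑ k, ι ℂ (connFlat G x i k) * ι ℂ (connFlat G x k j)

/-- The components of the covariant derivative `dF + θF`. -/
def covFlat (G : V → Matrix (Fin n) (Fin n) ℂ) (F : V → Fin n → ℂ) (x : V) (i : Fin n) :
    V →ₗ[ℝ] ℂ :=
  (fderiv ℝ (fun y => F y i) x : V →ₗ[ℝ] ℂ) + ∑ j, F x j • connFlat G x i j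

/-- The Gram matrix `G` is smooth and invertible at `x`. -/
def GoodAt (G : V → Matrix (Fin n) (Fin n) ℂ) (x : V) : Prop :=
  (∀ i j, ContDiffAt ℝ ∞ (fun y => G y i j) x) ∧ IsUnit (G x).det

theorem GoodAt.smoothAt_connFlat {G : V → Matrix (Fin n) (Fin n) ℂ} {x : V} (h : GoodAt G x)
    (i j : Fin n) : SmoothAt (fun y => connFlat G y i j) x :=
  SmoothAt.sum fun _ _ => SmoothAt.smul (contDiffAt_inv h.1 h.2 _ _) (smoothAt_delF (h.1 _ _))

theorem GoodAt.inv_mul {G : V → Matrix (Fin n) (Fin n) ℂ} {x : V} (h : GoodAt G x)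
    (i j : Fin n) : ∑ k, (G x)⁻¹ i k * G x k j = if i = j then 1 else 0 := by
  have := congrFun (congrFun (Matrix.nonsing_inv_mul (G x) h.2) i) j
  rw [Matrix.mul_apply, Matrix.one_apply] at this
  exact this

theorem GoodAt.mul_inv {G : V → Matrix (Fin n) (Fin n) ℂ} {x : V} (h : GoodAt G x)
    (i j : Fin n) : ∑ k, G x i k * (G x)⁻¹ k j = if i = j then 1 else 0 := by
  have := congrFun (congrFun (Matrix.mul_nonsing_inv (G x) h.2) i) j
  rw [Matrix.mul_apply, Matrix.one_apply] at this
  exact this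

/-- For holomorphic `F` the covariant derivative is `G⁻¹ ∂(GF)`. -/
theorem covFlat_eq {G : V → Matrix (Fin n) (Fin n) ℂ} {F : V → Fin n → ℂ} {x : V}
    (hG : GoodAt G x) (hF : DifferentiableAt ℂ F x) (i : Fin n) :
    covFlat G F x i = ∑ k, (G x)⁻¹ i k • delF (fun y => ∑ j, G y k j * F y j) x := by
  have hFi : ∀ j, DifferentiableAt ℂ (fun y => F y j) x := differentiableAt_pi.1 hF
  have hFr : ∀ j, DifferentiableAt ℝ (fun y => F y j) x := fun j => (hFi j).restrictScalars ℝ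
  have hGr : ∀ k j, DifferentiableAt ℝ (fun y => G y k j) x := fun k j =>
    (hG.1 k j).differentiableAt (by simp)
  have h1 : ∀ k, delF (fun y => ∑ j, G y k j * F y j) x
      = ∑ j, (G x k j • delF (fun y => F y j) x + F x j • delF (fun y => G y k j) x) := fun k => by
    rw [delF_sum fun j _ => (hGr k j).fun_mul (hFr j)]
    exact Finset.sum_congr rfl fun j _ => delF_mul (hGr k j) (hFr j)
  have h2 : (fderiv ℝ (fun y => F y i) x : V →ₗ[ℝ] ℂ) = delF (fun y => F y i) x := by
    rw [← delF_add_dbarF, dbarF_eq_zero (hFi i), add_zero]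
  simp only [h1, covFlat, h2, Finset.smul_sum, smul_add, Finset.sum_add_distrib, smul_smul,
    connFlat]
  congr 1
  · rw [Finset.sum_comm]
    simp only [← Finset.sum_smul, hG.inv_mul, ite_smul, one_smul, zero_smul, Finset.sum_ite_eq,
      Finset.mem_univ, if_true]
  · rw [Finset.sum_comm]
    refine Finset.sum_congr rfl fun k _ => Finset.sum_congr rfl fun j _ => ?_
    rw [mul_comm]

/-- `∂(G⁻¹) = -θ G⁻¹`. -/
theorem delF_inv {G : V → Matrix (Fin n) (Fin n) ℂ} {x : V} (hG : ∀ᶠ y in 𝓝 x, GoodAt G y)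
    (i k : Fin n) :
    delF (fun y => (G y)⁻¹ i k) x = -∑ l, (G x)⁻¹ l k • connFlat G x i l := by
  have hx := hG.self_of_nhds
  have hGr : ∀ k j, DifferentiableAt ℝ (fun y => G y k j) x := fun k j =>
    (hx.1 k j).differentiableAt (by simp)
  have hGi : ∀ k j, DifferentiableAt ℝ (fun y => (G y)⁻¹ k j) x := fun k j =>
    (contDiffAt_inv hx.1 hx.2 k j).differentiableAt (by simp)
  have h1 : ∀ j, ∑ m, G x m j • delF (fun y => (G y)⁻¹ i m) x = - connFlat G x i j := by
    intro j
    have h2 : delF (fun y => ∑ m, (G y)⁻¹ i m * G y m j) x = 0 := by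
      rw [← delF_const (V := V) (if i = j then 1 else 0) x]
      refine delF_congr ?_
      filter_upwards [hG] with y hy using hy.inv_mul i j
    rw [delF_sum fun m _ => (hGi i m).fun_mul (hGr m j)] at h2
    simp only [delF_mul (hGi _ _) (hGr _ _), Finset.sum_add_distrib] at h2
    rw [connFlat, eq_neg_iff_add_eq_zero, add_comm]
    exact h2
  have h3 : delF (fun y => (G y)⁻¹ i k) x
      = ∑ l, (G x)⁻¹ l k • ∑ m, G x m l • delF (fun y => (G y)⁻¹ i m) x := by
    simp only [Finset.smul_sum, smul_smul]
    rw [Finset.sum_comm]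
    simp only [← Finset.sum_smul, mul_comm ((G x)⁻¹ _ _), hx.mul_inv, ite_smul, one_smul,
      zero_smul, Finset.sum_ite_eq', Finset.mem_univ, if_true]
  rw [h3]
  simp only [h1, smul_neg, Finset.sum_neg_distrib]

theorem wirt_smul {R : Type*} [Ring R] [Algebra ℂ R] [Module.Finite ℂ R] {e : ℂ}
    {ν : Fin (dim V) → V →ₗ[ℝ] ℂ} {c : (V →ₗ[ℝ] ℂ) →ₗ[ℂ] R} {φ : V → ℂ} {f : V → R}
    {x : V} (hφ : ContDiffAt ℝ ∞ φ x) (hf : SmoothAt f x) :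
    wirt e ν c (fun y => φ y • f y) x
      = wirt e ν c (fun y => φ y • (1 : R)) x * f x + φ x • wirt e ν c f x := by
  have h : ∀ j, dirE e (fun y => φ y • f y) x j
      = dirE e (fun y => φ y • (1 : R)) x j * f x + φ x • dirE e f x j := by
    intro j
    have h1 := dirE_bilinear (e := e) (LinearMap.mul ℂ R)
      (SmoothAt.smul hφ (smoothAt_const (1 : R) x)) hf j
    simp only [LinearMap.mul_apply_apply, smul_mul_assoc, one_mul] at h1
    exact h1
  simp only [wirt, h, mul_add, Finset.sum_add_distrib, Finset.sum_mul, mul_assoc, Finset.smul_sum,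
    mul_smul_comm]

theorem dbarFlat_smul {R : Type*} [Ring R] [Algebra ℂ R] [Module.Finite ℂ R]
    {c : (V →ₗ[ℝ] ℂ) →ₗ[ℂ] R} {φ : V → ℂ} {f : V → R}
    {x : V} (hφ : ContDiffAt ℝ ∞ φ x) (hf : SmoothAt f x) :
    dbarFlat c (fun y => φ y • f y) x = c (dbarF φ x) * f x + φ x • dbarFlat c f x := by
  have h := dbarFlat_smul_const (c := c) hφ (1 : R)
  rw [mul_one, dbarFlat_eq_wirt] at h
  rw [dbarFlat_eq_wirt, dbarFlat_eq_wirt, wirt_smul hφ hf, h]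
  rfl

theorem delFlat_smul {R : Type*} [Ring R] [Algebra ℂ R] [Module.Finite ℂ R]
    {c : (V →ₗ[ℝ] ℂ) →ₗ[ℂ] R} {φ : V → ℂ} {f : V → R}
    {x : V} (hφ : ContDiffAt ℝ ∞ φ x) (hf : SmoothAt f x) :
    delFlat c (fun y => φ y • f y) x = c (delF φ x) * f x + φ x • delFlat c f x := by
  have h := delFlat_smul_const (c := c) hφ (1 : R)
  rw [mul_one] at h
  exact (wirt_smul hφ hf).trans (by rw [← delFlat, h]; rfl)

/-- The `(2,0)`-part of the Chern curvature vanishes: `Θ = ∂̄θ`. -/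
theorem curvFlat_eq {G : V → Matrix (Fin n) (Fin n) ℂ} {x : V} (hG : ∀ᶠ y in 𝓝 x, GoodAt G y)
    (i j : Fin n) : curvFlat G x i j
      = dbarFlat (ι ℂ) (fun y => ι ℂ (connFlat G y i j)) x := by
  have hx := hG.self_of_nhds
  have h1 : delFlat (ι ℂ) (fun y => ι ℂ (connFlat G y i j)) x
      = ∑ k, ι ℂ (delF (fun y => (G y)⁻¹ i k) x) *
          ι ℂ (delF (fun y => G y k j) x) := by
    have e : (fun y => ι ℂ (connFlat G y i j)) = fun y =>
        ∑ k, (G y)⁻¹ i k • ι ℂ (delF (fun z => G z k j) y) := by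
      funext y
      simp only [connFlat, map_sum, map_smul]
    have hs : ∀ k, SmoothAt (fun y => ι ℂ (delF (fun z => G z k j) y)) x :=
      fun k => (smoothAt_delF (hx.1 k j)).linear _
    rw [e]
    refine (wirt_sum fun k _ => SmoothAt.smul (contDiffAt_inv hx.1 hx.2 i k) (hs k)).trans ?_
    refine Finset.sum_congr rfl fun k _ => ?_
    refine (delFlat_smul (contDiffAt_inv hx.1 hx.2 i k) (hs k)).trans ?_
    rw [delFlat_delF (hG.mono fun y hy => hy.1 k j), smul_zero, add_zero]
  rw [curvFlat, dFlat_eq, h1]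
  simp only [delF_inv hG, map_neg, map_sum, map_smul, neg_mul, Finset.sum_mul,
    Finset.sum_neg_distrib]
  rw [Finset.sum_comm]
  have h2 : ∀ l, ∑ k, (G x)⁻¹ l k • ι ℂ (connFlat G x i l)
      * ι ℂ (delF (fun y => G y k j) x)
      = ι ℂ (connFlat G x i l) * ι ℂ (connFlat G x l j) := by
    intro l
    conv_rhs => rw [connFlat.eq_1 G x l j]
    simp only [map_sum, map_smul, Finset.mul_sum, mul_smul_comm, smul_mul_assoc]
  simp only [h2]
  abel

theorem dbarFlat_ι_fderiv {F : V → Fin n → ℂ} {x : V} (hF : ContDiffAt ℂ ω F x) (i : Fin n) :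
    SmoothAt (fun y => ι ℂ (fderiv ℝ (fun z => F z i) y : V →ₗ[ℝ] ℂ)) x ∧
    dbarFlat (ι ℂ)
      (fun y => ι ℂ (fderiv ℝ (fun z => F z i) y : V →ₗ[ℝ] ℂ)) x = 0 := by
  have e : ∀ᶠ y in 𝓝 x, ι ℂ (fderiv ℝ (fun z => F z i) y : V →ₗ[ℝ] ℂ)
      = ι ℂ (precomp (reL (fderiv ℂ F y))
          ((LinearMap.proj i : (Fin n → ℂ) →ₗ[ℂ] ℂ).restrictScalars ℝ)) := by
    filter_upwards [hF.eventually (by simp)] with y hy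
    have hd : DifferentiableAt ℂ F y := hy.differentiableAt (by simp)
    have h1 : HasFDerivAt (fun z => F z i)
        ((ContinuousLinearMap.proj (R := ℂ) (φ := fun _ : Fin n => ℂ) i).comp (fderiv ℂ F y)) y :=
      (ContinuousLinearMap.proj (R := ℂ) (φ := fun _ : Fin n => ℂ) i).hasFDerivAt.comp y
        hd.hasFDerivAt
    rw [(h1.restrictScalars ℝ).fderiv]
    rfl
  constructor
  · have hs : SmoothAt (fun y => precomp (reL (fderiv ℂ F y))
        ((LinearMap.proj i : (Fin n → ℂ) →ₗ[ℂ] ℂ).restrictScalars ℝ)) x :=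
      smoothAt_realLinear (precompL _) (contDiffAt_real_fderiv hF)
    exact (hs.linear (ι ℂ)).congr e
  · rw [dbarFlat_eq_wirt, wirt_congr e, ← dbarFlat_eq_wirt]
    exact dbarFlat_precomp_fderiv _ (fun ℓ m => ι_anticomm _ _) hF _

theorem smoothAt_covFlat {G : V → Matrix (Fin n) (Fin n) ℂ} {F : V → Fin n → ℂ} {x : V}
    (hG : GoodAt G x) (hF : ContDiffAt ℂ ω F x) (i : Fin n) :
    SmoothAt (fun y => covFlat G F y i) x := by
  have hFr : ∀ j, ContDiffAt ℝ ∞ (fun y => F y j) x := fun j =>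
    (((contDiffAt_pi.1 hF) j).restrict_scalars ℝ).of_le le_top
  have : FiniteDimensional ℝ V := FiniteDimensional.complexToReal V
  let Φ : (V →L[ℝ] ℂ) →ₗ[ℝ] (V →ₗ[ℝ] ℂ) :=
    { toFun := fun D => (D : V →ₗ[ℝ] ℂ)
      map_add' := fun a b => rfl
      map_smul' := fun r a => rfl }
  have h1 : SmoothAt (fun y => (fderiv ℝ (fun z => F z i) y : V →ₗ[ℝ] ℂ)) x :=
    smoothAt_realLinear Φ ((hFr i).fderiv_right (by simp))
  exact h1.add (SmoothAt.sum fun j _ => SmoothAt.smul (hFr j) (hG.smoothAt_connFlat i j))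

/-- `∂̄(DF) = ΘF` for holomorphic `F`. -/
theorem dbarFlat_covFlat {G : V → Matrix (Fin n) (Fin n) ℂ} {F : V → Fin n → ℂ} {x : V}
    (hG : ∀ᶠ y in 𝓝 x, GoodAt G y) (hF : ContDiffAt ℂ ω F x) (i : Fin n) :
    dbarFlat (ι ℂ) (fun y => ι ℂ (covFlat G F y i)) x
      = ∑ j, F x j • curvFlat G x i j := by
  have hx := hG.self_of_nhds
  have hFi := contDiffAt_pi.1 hF
  have hFr : ∀ j, ContDiffAt ℝ ∞ (fun y => F y j) x := fun j =>
    ((hFi j).restrict_scalars ℝ).of_le le_top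
  have e : (fun y => ι ℂ (covFlat G F y i)) = fun y =>
      ι ℂ (fderiv ℝ (fun z => F z i) y : V →ₗ[ℝ] ℂ)
        + ∑ j, F y j • ι ℂ (connFlat G y i j) := by
    funext y
    simp only [covFlat, map_add, map_sum, map_smul]
  have hs : ∀ j, SmoothAt (fun y => ι ℂ (connFlat G y i j)) x := fun j =>
    (hx.smoothAt_connFlat i j).linear _
  obtain ⟨h1, h2⟩ := dbarFlat_ι_fderiv hF i
  rw [e, dbarFlat_eq_wirt, wirt_add h1 (SmoothAt.sum fun j _ => SmoothAt.smul (hFr j) (hs j)),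
    wirt_sum fun j _ => SmoothAt.smul (hFr j) (hs j), ← dbarFlat_eq_wirt, h2, zero_add]
  refine Finset.sum_congr rfl fun j _ => ?_
  rw [← dbarFlat_eq_wirt, dbarFlat_smul (hFr j) (hs j),
    dbarF_eq_zero ((hFi j).differentiableAt (by simp)), map_zero, zero_mul, zero_add,
    curvFlat_eq hG]

/-- The covariant derivative is independent of the coordinates and the holomorphic frame. -/
theorem covFlat_change {G G' : V → Matrix (Fin n) (Fin n) ℂ} {F F' : V → Fin n → ℂ}
    {B : V → Matrix (Fin n) (Fin n) ℂ} {τ : V → V} {x : V} (hτ : ContDiffAt ℂ ω τ x)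
    (hB : ∀ i j, DifferentiableAt ℂ (fun y => B y i j) x) (hBd : IsUnit (B x).det)
    (hG : GoodAt G x) (hG' : GoodAt G' (τ x)) (hF : DifferentiableAt ℂ F x)
    (hF' : DifferentiableAt ℂ F' (τ x))
    (hGG : ∀ᶠ y in 𝓝 x, G y = (B y).conjTranspose * G' (τ y) * B y)
    (hFF : ∀ᶠ y in 𝓝 x, F' (τ y) = (B y).mulVec (F y)) (i : Fin n) :
    precomp (reL (fderiv ℂ τ x)) (covFlat G' F' (τ x) i) = ∑ k, B x i k • covFlat G F x k := by
  have hFi' : ∀ j, DifferentiableAt ℝ (fun y => F' y j) (τ x) := fun j =>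
    ((differentiableAt_pi.1 hF') j).restrictScalars ℝ
  have hGr' : ∀ k j, DifferentiableAt ℝ (fun y => G' y k j) (τ x) := fun k j =>
    (hG'.1 k j).differentiableAt (by simp)
  have hτr : DifferentiableAt ℝ τ x := (hτ.differentiableAt (by simp)).restrictScalars ℝ
  set t : Fin n → V → ℂ := fun k y => ∑ j, G' y k j * F' y j with ht
  have htd : ∀ k, DifferentiableAt ℝ (t k) (τ x) := fun k =>
    DifferentiableAt.fun_sum fun j _ => (hGr' k j).fun_mul (hFi' j)
  have hs : ∀ l, delF (fun y => ∑ j, G y l j * F y j) x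
      = ∑ k, conj (B x k l) • delF (fun y => t k (τ y)) x := by
    intro l
    have e : (fun y => ∑ j, G y l j * F y j) =ᶠ[𝓝 x] fun y => ∑ k, conj (B y k l) * t k (τ y) := by
      filter_upwards [hGG, hFF] with y h1 h2
      have : (G y).mulVec (F y) = (B y).conjTranspose.mulVec ((G' (τ y)).mulVec (F' (τ y))) := by
        rw [h1, h2, Matrix.mulVec_mulVec, Matrix.mulVec_mulVec, Matrix.mul_assoc]
      exact congrFun this l
    have hc : ∀ k, DifferentiableAt ℝ (fun y => conj (B y k l)) x := fun k =>
      (Complex.conjCLE : ℂ →L[ℝ] ℂ).differentiableAt.comp x ((hB k l).restrictScalars ℝ)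
    have hd : ∀ k, DifferentiableAt ℝ (fun y => t k (τ y)) x := fun k => (htd k).comp x hτr
    rw [delF_congr e, delF_sum fun k _ => (hc k).fun_mul (hd k)]
    refine Finset.sum_congr rfl fun k _ => ?_
    rw [delF_mul (hc k) (hd k), delF_conj_eq_zero (hB k l), smul_zero, add_zero]
  have hpull : ∀ k, delF (fun y => t k (τ y)) x = precomp (reL (fderiv ℂ τ x)) (delF (t k) (τ x)) :=
    fun k => by rw [delF, fderiv_comp_holomorphic hτ (htd k), part10_comp_reL]; rfl
  have hmat : B x * (G x)⁻¹ * (B x).conjTranspose = (G' (τ x))⁻¹ := by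
    have hBh : IsUnit (B x).conjTranspose.det := by
      rw [Matrix.det_conjTranspose]; exact hBd.star
    rw [hGG.self_of_nhds, Matrix.mul_inv_rev, Matrix.mul_inv_rev, ← Matrix.mul_assoc,
      Matrix.mul_nonsing_inv _ hBd, Matrix.one_mul, Matrix.mul_assoc,
      Matrix.nonsing_inv_mul _ hBh, Matrix.mul_one]
  rw [covFlat_eq hG' hF', map_sum]
  simp only [map_smul]
  simp only [covFlat_eq hG hF, hs, Finset.smul_sum, smul_smul]
  have : ∀ m, (G' (τ x))⁻¹ i m = ∑ k, ∑ l, B x i k * ((G x)⁻¹ k l * conj (B x m l)) := by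
    intro m
    rw [← hmat, Matrix.mul_assoc, Matrix.mul_apply]
    simp only [Matrix.mul_apply, Matrix.conjTranspose_apply, Finset.mul_sum]
    rfl
  simp only [this, Finset.sum_smul, hpull]
  rw [Finset.sum_comm]
  refine Finset.sum_congr rfl fun k _ => ?_
  rw [Finset.sum_comm]

/-- The curvature matrix transforms by conjugation under a holomorphic change of frame. -/
theorem curvFlat_change {G G' : V → Matrix (Fin n) (Fin n) ℂ}
    {B B' : V → Matrix (Fin n) (Fin n) ℂ} {τ : V → V} {x : V} (hτ : ContDiffAt ℂ ω τ x)
    (hB : ∀ i j, ContDiffAt ℂ ω (fun y => B y i j) x)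
    (hB' : ∀ i j, ContDiffAt ℂ ω (fun y => B' y i j) x)
    (hBB : ∀ᶠ y in 𝓝 x, B y * B' y = 1)
    (hG : ∀ᶠ y in 𝓝 x, GoodAt G y) (hG' : ∀ᶠ y in 𝓝 (τ x), GoodAt G' y)
    (hGG : ∀ᶠ y in 𝓝 x, G y = (B y).conjTranspose * G' (τ y) * B y) (i j : Fin n) :
    map (precomp (reL (fderiv ℂ τ x))) (curvFlat G' (τ x) i j)
      = ∑ k, ∑ l, (B x i k * B' x l j) • curvFlat G x k l := by
  have hτr : ContDiffAt ℝ ∞ τ x := (hτ.restrict_scalars ℝ).of_le le_top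
  set F : V → Fin n → ℂ := fun y l => B' y l j with hFdef
  set F' : V → Fin n → ℂ := fun _ => Pi.single j 1 with hFdef'
  have hF : ContDiffAt ℂ ω F x := contDiffAt_pi.2 fun l => hB' l j
  have hF' : ∀ z, ContDiffAt ℂ ω F' z := fun z => contDiffAt_const
  have hcurv : curvFlat G' (τ x) i j
      = dbarFlat (ι ℂ) (fun y => ι ℂ (covFlat G' F' y i)) (τ x) := by
    rw [dbarFlat_covFlat hG' (hF' _)]
    simp [hFdef', Pi.single_apply]
  have hcov := smoothAt_covFlat hG'.self_of_nhds (hF' (τ x)) i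
  have hz : ∀ w : V →ₗ[ℝ] ℂ, dbarFlat ((ι ℂ) ∘ₗ LinearMap.id)
      (fun y => ι ℂ (precomp (reL (fderiv ℂ τ y)) w)) x = 0 :=
    fun w => dbarFlat_precomp_fderiv (ι ℂ ∘ₗ LinearMap.id)
      (fun ℓ m => ι_anticomm _ _) hτ w
  have h1 := dbarFlat_map (c := LinearMap.id) (c' := LinearMap.id)
    (N := fun y => precomp (reL (fderiv ℂ τ y))) hτ
    (fun w => smoothAt_realLinear (precompL w) (contDiffAt_real_fderiv hτ)) (fun ℓ => rfl) hz
    (hcov.linear (ι ℂ))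
  rw [LinearMap.comp_id] at h1
  rw [hcurv, ← h1]
  have e : ∀ᶠ y in 𝓝 x, map (precomp (reL (fderiv ℂ τ y)))
      (ι ℂ (covFlat G' F' (τ y) i))
      = ∑ k, B y i k • ι ℂ (covFlat G F y k) := by
    have hBe : ∀ᶠ y in 𝓝 x, ∀ i j, ContDiffAt ℂ ω (fun y => B y i j) y :=
      Filter.eventually_all.2 fun i => Filter.eventually_all.2 fun j =>
        (hB i j).eventually (by simp)
    filter_upwards [hτ.eventually (by simp), hBe, hBB.eventually_nhds, hG,
      hτ.continuousAt.eventually hG', hF.eventually (by simp), hGG.eventually_nhds]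
      with y y1 y2 y3 y4 y5 y6 y7
    have hd : IsUnit (B y).det := by
      have := congrArg Matrix.det y3.self_of_nhds
      rw [Matrix.det_mul, Matrix.det_one] at this
      exact IsUnit.of_mul_eq_one _ this
    rw [map_apply_ι, covFlat_change y1
      (fun i j => (y2 i j).differentiableAt (by simp)) hd y4 y5
      (y6.differentiableAt (by simp)) ((hF' _).differentiableAt (by simp)) y7 ?_ i]
    · simp only [map_sum, map_smul]
    · filter_upwards [y3] with z hz
      funext m
      have := congrFun (congrFun hz m) j
      rw [Matrix.mul_apply, Matrix.one_apply] at this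
      change (Pi.single j (1 : ℂ) : Fin n → ℂ) m = _
      rw [Pi.single_apply, ← this]
      rfl
  have hBr : ∀ k, ContDiffAt ℝ ∞ (fun y => B y i k) x := fun k =>
    ((hB i k).restrict_scalars ℝ).of_le le_top
  have hs : ∀ k, SmoothAt (fun y => ι ℂ (covFlat G F y k)) x := fun k =>
    (smoothAt_covFlat hG.self_of_nhds hF k).linear _
  rw [dbarFlat_eq_wirt, wirt_congr e, wirt_sum fun k _ => SmoothAt.smul (hBr k) (hs k)]
  refine Finset.sum_congr rfl fun k _ => ?_
  rw [← dbarFlat_eq_wirt, dbarFlat_smul (hBr k) (hs k),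
    dbarF_eq_zero ((hB i k).differentiableAt (by simp)), map_zero, zero_mul, zero_add,
    dbarFlat_covFlat hG hF, Finset.smul_sum]
  simp only [smul_smul, hFdef]

end Flat

/-! ### The super-curvature in local frames -/

section SuperFlat

variable {n : ℕ} {V : Type*} [NormedAddCommGroup V] [NormedSpace ℂ V] [FiniteDimensional ℂ V]
  [ComplexCoords V]

/-- The expression of `DF` in a frame. -/
def covD (G : V → Matrix (Fin n) (Fin n) ℂ) (F : V → Fin n → ℂ) (x : V) : GFib V (Fin n → ℂ) :=
  ∑ i, inT (covFlat G F x i) * inE (Pi.single i 1)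

/-- The expression of `Θ̃` in a frame. -/
def curvD (G : V → Matrix (Fin n) (Fin n) ℂ) (x : V) : GFib V (Fin n → ℂ) :=
  ∑ i, ∑ j, inForm (curvFlat G x i j) * inE (Pi.single i 1) * inEDual (LinearMap.proj j)

/-- The expression of `Dη/2πi + iΘ̃/2π` in a frame. -/
def superFlat (G : V → Matrix (Fin n) (Fin n) ℂ) (F : V → Fin n → ℂ) (x : V) :
    GFib V (Fin n → ℂ) :=
  (1 / (2 * Real.pi * Complex.I) : ℂ) • covD G F x
    + (Complex.I / (2 * Real.pi) : ℂ) • curvD G x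

variable {Ep Fp : Type*} [AddCommGroup Ep] [Module ℂ Ep] [AddCommGroup Fp] [Module ℂ Fp]

theorem map_inT {L : (V →ₗ[ℝ] ℂ) →ₗ[ℂ] (V →ₗ[ℝ] ℂ)} {f : Ep →ₗ[ℂ] Fp}
    {g : Dual ℂ Ep →ₗ[ℂ] Dual ℂ Fp}
    (ℓ : V →ₗ[ℝ] ℂ) :
    map (L.prodMap (f.prodMap g)) (inT ℓ : GFib V Ep) = inT (L ℓ) := by
  refine (map_apply_ι _ _).trans ?_
  exact congrArg _ (Prod.ext rfl (Prod.ext (map_zero f) (map_zero g)))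

theorem map_inE {L : (V →ₗ[ℝ] ℂ) →ₗ[ℂ] (V →ₗ[ℝ] ℂ)} {f : Ep →ₗ[ℂ] Fp}
    {g : Dual ℂ Ep →ₗ[ℂ] Dual ℂ Fp}
    (v : Ep) :
    map (L.prodMap (f.prodMap g)) (inE v : GFib V Ep) = inE (f v) := by
  refine (map_apply_ι _ _).trans ?_
  exact congrArg _ (Prod.ext (map_zero L) (Prod.ext rfl (map_zero g)))

theorem map_inEDual {L : (V →ₗ[ℝ] ℂ) →ₗ[ℂ] (V →ₗ[ℝ] ℂ)} {f : Ep →ₗ[ℂ] Fp}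
    {g : Dual ℂ Ep →ₗ[ℂ] Dual ℂ Fp}
    (τ : Dual ℂ Ep) :
    map (L.prodMap (f.prodMap g)) (inEDual τ : GFib V Ep) = inEDual (g τ) := by
  refine (map_apply_ι _ _).trans ?_
  exact congrArg _ (Prod.ext (map_zero L) (Prod.ext (map_zero f) rfl))

theorem map_inForm {L : (V →ₗ[ℝ] ℂ) →ₗ[ℂ] (V →ₗ[ℝ] ℂ)} {f : Ep →ₗ[ℂ] Fp}
    {g : Dual ℂ Ep →ₗ[ℂ] Dual ℂ Fp}
    (α : ExteriorAlgebra ℂ (V →ₗ[ℝ] ℂ)) :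
    map (L.prodMap (f.prodMap g)) (inForm α : GFib V Ep)
      = inForm (map L α) := by
  change ((map _).comp (map _)) α =
    ((map _).comp (map _)) α
  rw [ExteriorAlgebra.map_comp_map, ExteriorAlgebra.map_comp_map]
  congr 2
  refine LinearMap.ext fun ℓ => ?_
  exact Prod.ext rfl (Prod.ext (map_zero f) (map_zero g))

/-- The super-curvature is independent of coordinates and frames. -/
theorem map_superFlat {G G' : V → Matrix (Fin n) (Fin n) ℂ} {F F' : V → Fin n → ℂ} {x x' : V}
    {L : (V →ₗ[ℝ] ℂ) →ₗ[ℂ] (V →ₗ[ℝ] ℂ)} {b b' : (Fin n → ℂ) →ₗ[ℂ] (Fin n → ℂ)}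
    (hb : ∀ v, b' (b v) = v)
    (hcov : ∀ i, L (covFlat G' F' x' i) = ∑ k, b (Pi.single k 1) i • covFlat G F x k)
    (hcurv : ∀ i j, map L (curvFlat G' x' i j)
      = ∑ k, ∑ l, (b (Pi.single k 1) i * b' (Pi.single j 1) l) • curvFlat G x k l) :
    map (L.prodMap (b'.prodMap b.dualMap)) (superFlat G' F' x')
      = superFlat G F x := by
  have hsum : ∀ v : Fin n → ℂ, ∑ i, v i • (Pi.single i 1 : Fin n → ℂ) = v := fun v => by
    conv_rhs => rw [← Finset.univ_sum_single v]
    exact Finset.sum_congr rfl fun i _ => by rw [← Pi.single_smul', smul_eq_mul, mul_one]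
  have he : ∀ k, ∑ i, b (Pi.single k 1) i • (inE (b' (Pi.single i 1)) : GFib V (Fin n → ℂ))
      = inE (Pi.single k 1) := fun k => by
    simp only [← map_smul, ← map_sum, hsum, hb]
  have hε : ∀ l, ∑ j, b' (Pi.single j 1) l • (inEDual (b.dualMap (LinearMap.proj j)) :
      GFib V (Fin n → ℂ)) = inEDual (LinearMap.proj l) := fun l => by
    simp only [← map_smul, ← map_sum]
    congr 1
    refine LinearMap.ext fun v => ?_
    have h1 : (b.dualMap (∑ j, b' (Pi.single j 1) l • (LinearMap.proj j : (Fin n → ℂ) →ₗ[ℂ] ℂ))) v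
        = (b' (∑ j, (b v) j • (Pi.single j 1 : Fin n → ℂ))) l := by
      rw [LinearMap.dualMap_apply, LinearMap.sum_apply, map_sum, Finset.sum_apply]
      refine Finset.sum_congr rfl fun j _ => ?_
      rw [map_smul, LinearMap.smul_apply, Pi.smul_apply, smul_eq_mul, smul_eq_mul, mul_comm]
      rfl
    rw [h1, hsum, hb]
    rfl
  rw [superFlat, superFlat, map_add, map_smul, map_smul]
  congr 2
  · simp only [covD, map_sum, map_mul, map_inT, map_inE, hcov, map_smul, Finset.sum_mul,
      smul_mul_assoc]
    rw [Finset.sum_comm]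
    refine Finset.sum_congr rfl fun k _ => ?_
    rw [← he k, Finset.mul_sum]
    exact Finset.sum_congr rfl fun i _ => (mul_smul_comm _ _ _).symm
  · simp only [curvD, map_sum, map_mul, map_inForm, map_inE, map_inEDual, hcurv, map_smul]
    have h2 : ∀ k l, (inForm (curvFlat G x k l) * inE (Pi.single k 1) *
        inEDual (LinearMap.proj l) : GFib V (Fin n → ℂ)) = ∑ i, ∑ j,
          (b (Pi.single k 1) i * b' (Pi.single j 1) l) • (inForm (curvFlat G x k l) *
            inE (b' (Pi.single i 1)) * inEDual (b.dualMap (LinearMap.proj j))) := by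
      intro k l
      rw [← he k, ← hε l]
      simp only [Finset.mul_sum, Finset.sum_mul, mul_smul_comm, smul_mul_assoc, Finset.smul_sum,
        smul_smul]
      rw [Finset.sum_comm]
      refine Finset.sum_congr rfl fun i _ => Finset.sum_congr rfl fun j _ => ?_
      rw [mul_comm]
    simp only [h2, Finset.sum_mul, smul_mul_assoc]
    simp only [← Finset.sum_product']
    refine Finset.sum_bij' (fun a _ => (a.2.2.1, a.2.2.2, a.1, a.2.1))
      (fun a _ => (a.2.2.1, a.2.2.2, a.1, a.2.1)) ?_ ?_ ?_ ?_ ?_ <;> simp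

end SuperFlat

section SuperCharts

variable {n : ℕ} {V : Type*} [NormedAddCommGroup V] [NormedSpace ℂ V]
  {H : Type*} [TopologicalSpace H] {I : ModelWithCorners ℂ V H}
  {M : Type*} [TopologicalSpace M] [ChartedSpace H M]
  {E : M → Type*} [TopologicalSpace (TotalSpace (Fin n → ℂ) E)]
  [∀ p, AddCommGroup (E p)] [∀ p, Module ℂ (E p)] [∀ p, TopologicalSpace (E p)]
  [FiberBundle (Fin n → ℂ) E] [VectorBundle ℂ (Fin n → ℂ) E]

/-- The components of a section of `E` in the chart and frame at `c`. -/
def secRep (I : ModelWithCorners ℂ V H) (η : ∀ p, E p) (c : M) (y : V) : Fin n → ℂ :=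
  coordAt n E c ((extChartAt I c).symm y) (η ((extChartAt I c).symm y))

theorem secRep_eq_zero_iff {η : ∀ p, E p} {c : M} {x : V} (hx : x ∈ localDomain I n E c) :
    (secRep I η c x : Fin n → ℂ) = 0 ↔ η ((extChartAt I c).symm x) = 0 := by
  constructor
  · intro h
    rw [← symmAt_coordAt hx.2 (η _)]
    exact (congrArg _ h).trans (map_zero _)
  · intro h
    rw [secRep, h, map_zero]

theorem gram_isHermitian (h : HermitianMetric I n E) (c : M) (x : V) :
    (gram h c x).IsHermitian := by
  ext i j
  exact h.symm _ _ _

theorem sum_smul_frame (c q : M) (v : Fin n → ℂ) :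
    symmAt n E c q v = ∑ j, v j • frame n E c j q := by
  conv_lhs => rw [← Finset.univ_sum_single v, map_sum]
  refine Finset.sum_congr rfl fun j _ => ?_
  rw [frame, ← map_smul, ← Pi.single_smul', smul_eq_mul, mul_one]

theorem inner_symmAt (h : HermitianMetric I n E) (c : M) (x : V) (v w : Fin n → ℂ) :
    h.inner ((extChartAt I c).symm x) (symmAt n E c _ v) (symmAt n E c _ w)
      = ∑ k, ∑ j, conj (v k) * gram h c x k j * w j := by
  rw [sum_smul_frame, sum_smul_frame]
  simp only [map_sum, LinearMap.sum_apply, LinearMap.map_smulₛₗ,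
    LinearMap.smul_apply, smul_eq_mul, Finset.mul_sum, RingHom.id_apply]
  rw [Finset.sum_comm]
  refine Finset.sum_congr rfl fun k _ => Finset.sum_congr rfl fun j _ => ?_
  rw [gram, Matrix.of_apply]
  ring

open scoped ComplexOrder in
theorem gram_posDef (h : HermitianMetric I n E) {c : M} {x : V} (hx : x ∈ localDomain I n E c) :
    (gram h c x).PosDef := by
  refine Matrix.PosDef.of_dotProduct_mulVec_pos (gram_isHermitian h c x) fun v hv => ?_
  set p := (extChartAt I c).symm x with hp
  set w : E p := symmAt n E c p v with hw
  have hw0 : w ≠ 0 := fun h0 => hv (by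
    rw [← coordAt_symmAt hx.2 v]
    exact (congrArg _ h0).trans (map_zero _))
  have h1 : dotProduct (star v) ((gram h c x).mulVec v) = h.inner p w w := by
    rw [hw, inner_symmAt]
    simp only [dotProduct, Matrix.mulVec, Finset.mul_sum, mul_assoc]
    rfl
  have him : (h.inner p w w).im = 0 := Complex.conj_eq_iff_im.1 (h.symm p w w)
  rw [h1, Complex.lt_def]
  exact ⟨h.pos p w hw0, him.symm⟩

variable [I.Boundaryless] [IsManifold I ω M] [ContMDiffVectorBundle ω (Fin n → ℂ) E I]

open scoped ComplexOrder in
theorem gram_goodAt (h : HermitianMetric I n E) {c : M} {x : V} (hx : x ∈ localDomain I n E c) :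
    GoodAt (gram h c) x :=
  ⟨fun i j => (h.smooth c i j).contDiffAt ((localDomain_open c).mem_nhds hx),
    (gram_posDef h hx).det_pos.ne'.isUnit⟩

theorem gram_goodAt_eventually (h : HermitianMetric I n E) {c : M} {x : V}
    (hx : x ∈ localDomain I n E c) : ∀ᶠ y in 𝓝 x, GoodAt (gram h c) y := by
  filter_upwards [(localDomain_open c).mem_nhds hx] with y hy using gram_goodAt h hy

theorem contDiffAt_secRep {η : ∀ p, E p} (hη : ContMDiff I (I.prod 𝓘(ℂ, Fin n → ℂ)) ω
      (fun p => TotalSpace.mk' (Fin n → ℂ) p (η p))) {c : M} {x : V}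
    (hx : x ∈ localDomain I n E c) : ContDiffAt ℂ ω (secRep (n := n) I η c) x := by
  rw [← contMDiffAt_iff_contDiffAt]
  have h1 : ContMDiffAt 𝓘(ℂ, V) I ω (extChartAt I c).symm x :=
    (contMDiffOn_extChartAt_symm c).contMDiffAt ((isOpen_extChartAt_target c).mem_nhds hx.1)
  have h2 := ((trivializationAt (Fin n → ℂ) E c).contMDiffAt_section_iff (IB := I) (n := ω)
    hx.2).1 hη.contMDiffAt
  refine (h2.comp x h1).congr_of_eventuallyEq ?_
  filter_upwards [(localDomain_open c).mem_nhds hx] with y hy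
  rw [secRep, coordAt, Trivialization.coe_linearMapAt_of_mem _ hy.2]
  rfl

theorem secRep_change (η : ∀ p, E p) {c c' : M} {x : V} (hx : x ∈ localDomain I n E c)
    (h : (extChartAt I c).symm x ∈ (extChartAt I c').source)
    (h' : (extChartAt I c).symm x ∈ (trivializationAt (Fin n → ℂ) E c').baseSet) :
    secRep I η c' (locRep I I id c c' x) = frameChange n I E c c' c x (secRep I η c x) := by
  have hq : (extChartAt I c').symm (locRep I I id c c' x) = (extChartAt I c).symm x :=
    symm_locRep (f := id) h
  rw [secRep, hq, secRep, frameChange_apply hx.2 h', symmAt_coordAt hx.2]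

/-- The matrix of a change of frame. -/
def frameMat (n : ℕ) (I : ModelWithCorners ℂ V H) (E : M → Type*)
    [TopologicalSpace (TotalSpace (Fin n → ℂ) E)]
    [∀ p, AddCommGroup (E p)] [∀ p, Module ℂ (E p)] [∀ p, TopologicalSpace (E p)]
    [FiberBundle (Fin n → ℂ) E] [VectorBundle ℂ (Fin n → ℂ) E] (a b c : M) (y : V) :
    Matrix (Fin n) (Fin n) ℂ :=
  Matrix.of fun i k => frameChange n I E a b c y (Pi.single k 1) i

theorem frameMat_mulVec (a b c : M) (y : V) (v : Fin n → ℂ) :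
    (frameMat n I E a b c y).mulVec v = frameChange n I E a b c y v := by
  have : frameMat n I E a b c y
      = LinearMap.toMatrix' (frameChange n I E a b c y : (Fin n → ℂ) →ₗ[ℂ] (Fin n → ℂ)) := by
    ext i k
    rw [LinearMap.toMatrix'_apply]
    rfl
  rw [this]
  exact LinearMap.toMatrix'_mulVec _ v

theorem contDiffAt_frameMat {a b c : M} {x : V} (hx : x ∈ (extChartAt I c).target)
    (ha : (extChartAt I c).symm x ∈ (trivializationAt (Fin n → ℂ) E a).baseSet)
    (hb : (extChartAt I c).symm x ∈ (trivializationAt (Fin n → ℂ) E b).baseSet) (i j : Fin n) :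
    ContDiffAt ℂ ω (fun y => frameMat n I E a b c y i j) x :=
  contDiffAt_pi.1 ((contDiffAt_frameChange hx ha hb).clm_apply contDiffAt_const) i

theorem frameChange_frameChange {a b c : M} {y : V}
    (ha : (extChartAt I c).symm y ∈ (trivializationAt (Fin n → ℂ) E a).baseSet)
    (hb : (extChartAt I c).symm y ∈ (trivializationAt (Fin n → ℂ) E b).baseSet)
    (v : Fin n → ℂ) : frameChange n I E b a c y (frameChange n I E a b c y v) = v := by
  rw [frameChange_apply ha hb, frameChange_apply hb ha, symmAt_coordAt hb, coordAt_symmAt ha]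

theorem frameMat_mul {a b c : M} {y : V}
    (ha : (extChartAt I c).symm y ∈ (trivializationAt (Fin n → ℂ) E a).baseSet)
    (hb : (extChartAt I c).symm y ∈ (trivializationAt (Fin n → ℂ) E b).baseSet) :
    frameMat n I E a b c y * frameMat n I E b a c y = 1 := by
  refine Matrix.ext_of_mulVec_single fun j => ?_
  rw [← Matrix.mulVec_mulVec, frameMat_mulVec, frameMat_mulVec, frameChange_frameChange hb ha,
    Matrix.one_mulVec]

theorem gram_change (h : HermitianMetric I n E) {c c' : M} {x : V} (hx : x ∈ localDomain I n E c)
    (hs : (extChartAt I c).symm x ∈ (extChartAt I c').source)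
    (h' : (extChartAt I c).symm x ∈ (trivializationAt (Fin n → ℂ) E c').baseSet) :
    gram h c x = (frameMat n I E c c' c x).conjTranspose * gram h c' (locRep I I id c c' x)
      * frameMat n I E c c' c x := by
  have hq : (extChartAt I c').symm (locRep I I id c c' x) = (extChartAt I c).symm x :=
    symm_locRep (f := id) hs
  have hf : ∀ k, frame n E c k ((extChartAt I c).symm x)
      = symmAt n E c' ((extChartAt I c).symm x) (fun i => frameMat n I E c c' c x i k) := by
    intro k
    change frame n E c k ((extChartAt I c).symm x) = symmAt n E c' ((extChartAt I c).symm x)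
      (frameChange n I E c c' c x (Pi.single k 1))
    rw [frameChange_apply hx.2 h', symmAt_coordAt h']
    rfl
  have hi := inner_symmAt h c' (locRep I I id c c' x)
  rw [hq] at hi
  ext k j
  rw [gram, Matrix.of_apply, hf, hf, hi, Matrix.mul_apply]
  simp only [Matrix.mul_apply, Finset.sum_mul, Matrix.conjTranspose_apply]
  rw [Finset.sum_comm]
  rfl

variable [FiniteDimensional ℂ V] [ComplexCoords V]

theorem superCurv_eq_map (h : HermitianMetric I n E) (η : ∀ p, E p) (p : M) :
    superCurv h η p = map (LinearMap.id.prodMap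
      ((symmAt n E p p).prodMap (coordAt n E p p).dualMap))
      (superFlat (gram h p) (secRep I η p) (extChartAt I p p)) := by
  have hpp : (extChartAt I p).symm (extChartAt I p p) = p := extChartAt_to_inv p
  have hF : ∀ j, coordAt n E p p (η p) j = secRep I η p (extChartAt I p p) j := fun j => by
    rw [secRep, hpp]
  have hid : ∀ a : ExteriorAlgebra ℂ (V →ₗ[ℝ] ℂ), map LinearMap.id a = a :=
    fun a => by rw [ExteriorAlgebra.map_id]; rfl
  rw [superCurv, superFlat, map_add, map_smul, map_smul]
  congr 2
  · simp only [covDeriv, covD, map_sum, map_mul, map_inT, map_inE, hF]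
    rfl
  · simp only [curvTilde, curvD, map_sum, map_mul, map_inForm, map_inE, map_inEDual, hid]
    rfl

theorem localSec_superCurv (h : HermitianMetric I n E) {η : ∀ p, E p}
    (hη : ContMDiff I (I.prod 𝓘(ℂ, Fin n → ℂ)) ω (fun p => TotalSpace.mk' (Fin n → ℂ) p (η p)))
    {c : M} {x : V} (hx : x ∈ localDomain I n E c) :
    localSec n I (superCurv h η) c x = superFlat (gram h c) (secRep I η c) x := by
  set p := (extChartAt I c).symm x with hp
  have hps : p ∈ (extChartAt I p).source := mem_extChartAt_source p
  have hpb : p ∈ (trivializationAt (Fin n → ℂ) E p).baseSet :=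
    FiberBundle.mem_baseSet_trivializationAt' p
  have hxp : extChartAt I p p = locRep I I id c p x := rfl
  have hpp : (extChartAt I p).symm (locRep I I id c p x) = p := symm_locRep (f := id) hps
  have hd : locRep I I id c p x ∈ localDomain I n E p := mem_localDomain p
  have hτ := contDiffAt_locRep (contMDiff_id (I := I) (n := ω)) hx.1 (c' := p) hps
  have hev := eventually_mem_domains (n := n) (E := E) hx (c' := p) hps hpb
  have hGG : ∀ᶠ y in 𝓝 x, gram h c y = (frameMat n I E c p c y).conjTranspose *
      gram h p (locRep I I id c p y) * frameMat n I E c p c y := by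
    filter_upwards [hev] with y hy using gram_change h hy.1 hy.2.1 hy.2.2
  have hBB : ∀ᶠ y in 𝓝 x, frameMat n I E c p c y * frameMat n I E p c c y = 1 := by
    filter_upwards [hev] with y hy using frameMat_mul hy.1.2 hy.2.2
  have hFF : ∀ᶠ y in 𝓝 x, secRep I η p (locRep I I id c p y)
      = (frameMat n I E c p c y).mulVec (secRep I η c y) := by
    filter_upwards [hev] with y hy
    rw [frameMat_mulVec, secRep_change η hy.1 hy.2.1 hy.2.2]
  have hBd : IsUnit (frameMat n I E c p c x).det := by
    have := congrArg Matrix.det hBB.self_of_nhds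
    rw [Matrix.det_mul, Matrix.det_one] at this
    exact IsUnit.of_mul_eq_one _ this
  have hcov : ∀ i, precomp (reL (fderiv ℂ (locRep I I id c p) x))
      (covFlat (gram h p) (secRep I η p) (locRep I I id c p x) i)
      = ∑ k, frameMat n I E c p c x i k • covFlat (gram h c) (secRep I η c) x k :=
    covFlat_change hτ (fun i j => (contDiffAt_frameMat hx.1 hx.2 hpb i j).differentiableAt
      (by simp)) hBd (gram_goodAt h hx) (gram_goodAt h hd)
      ((contDiffAt_secRep hη hx).differentiableAt (by simp))
      ((contDiffAt_secRep hη hd).differentiableAt (by simp)) hGG hFF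
  have hcurv : ∀ i j, map (precomp (reL (fderiv ℂ (locRep I I id c p) x)))
      (curvFlat (gram h p) (locRep I I id c p x) i j)
      = ∑ k, ∑ l, (frameMat n I E c p c x i k * frameMat n I E p c c x l j) •
          curvFlat (gram h c) x k l :=
    curvFlat_change hτ (contDiffAt_frameMat hx.1 hx.2 hpb) (contDiffAt_frameMat hx.1 hpb hx.2)
      hBB (gram_goodAt_eventually h hx) (gram_goodAt_eventually h hd) hGG
  have hmap := map_superFlat (G := gram h c) (G' := gram h p) (F := secRep I η c)
    (F' := secRep I η p) (x := x) (x' := locRep I I id c p x)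
    (L := precomp (reL (fderiv ℂ (locRep I I id c p) x)))
    (b := (frameChange n I E c p c x : (Fin n → ℂ) →ₗ[ℂ] (Fin n → ℂ)))
    (b' := (frameChange n I E p c c x : (Fin n → ℂ) →ₗ[ℂ] (Fin n → ℂ)))
    (frameChange_frameChange hx.2 hpb) hcov hcurv
  refine Eq.trans ?_ hmap
  change map _ (superCurv h η p) = _
  rw [superCurv_eq_map]
  change (map _).comp (map _) _ = _
  rw [ExteriorAlgebra.map_comp_map]
  rw [← hxp]
  congr 2
  refine LinearMap.ext fun w => ?_
  obtain ⟨ℓ, v, τ⟩ := w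
  refine Prod.ext rfl (Prod.ext ?_ ?_)
  · exact (frameChange_apply hpb hx.2 v).symm
  · change (τ ∘ₗ coordAt n E p p) ∘ₗ symmAt n E c p = τ ∘ₗ
      (frameChange n I E c p c x : (Fin n → ℂ) →ₗ[ℂ] (Fin n → ℂ))
    refine LinearMap.ext fun w => ?_
    exact congrArg τ (frameChange_apply hx.2 hpb w).symm

end SuperCharts

section DbarRules

variable {V : Type*} [NormedAddCommGroup V] [NormedSpace ℂ V] [ComplexCoords V]
  {R : Type*} [Ring R] [Algebra ℂ R] [Module.Finite ℂ R]
  {c : (V →ₗ[ℝ] ℂ) →ₗ[ℂ] R} {f g : V → R} {x : V}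

theorem dbarFlat_congr (h : f =ᶠ[𝓝 x] g) : dbarFlat c f x = dbarFlat c g x := by
  rw [dbarFlat_eq_wirt, dbarFlat_eq_wirt]; exact wirt_congr h

theorem dbarFlat_add (hf : SmoothAt f x) (hg : SmoothAt g x) :
    dbarFlat c (fun y => f y + g y) x = dbarFlat c f x + dbarFlat c g x := by
  simp only [dbarFlat_eq_wirt]; exact wirt_add hf hg

theorem dbarFlat_const_smul (a : ℂ) (hf : SmoothAt f x) :
    dbarFlat c (fun y => a • f y) x = a • dbarFlat c f x := by
  simp only [dbarFlat_eq_wirt]; exact wirt_const_smul a hf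

theorem dbarFlat_const (a : R) : dbarFlat c (fun _ => a) x = 0 := by
  rw [dbarFlat_eq_wirt]; exact wirt_const a x

theorem dbarFlat_dbarFlat (hc : ∀ ℓ m, c ℓ * c m = -(c m * c ℓ)) (hf : SmoothAt f x) :
    dbarFlat c (dbarFlat c f) x = 0 := by
  simp only [dbarFlat_eq_wirt]; exact wirt_wirt hc hf

end DbarRules

/-! ### The operator `∇` in a frame -/

section NablaFlat

variable {n : ℕ} {V : Type*} [NormedAddCommGroup V] [NormedSpace ℂ V] [FiniteDimensional ℂ V]
  [ComplexCoords V]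

/-- The operator `δ_F - ∂̄` on maps into `Λ[T* ⊕ ℂⁿ ⊕ (ℂⁿ)*]`. -/
def nablaFlat (F : V → Fin n → ℂ) (ξ : V → GFib V (Fin n → ℂ)) (x : V) : GFib V (Fin n → ℂ) :=
  delta (F x) (ξ x) - dbarFlat inT ξ x

variable {F : V → Fin n → ℂ} {ξ ζ : V → GFib V (Fin n → ℂ)} {x : V}

theorem dbarFlat_inT_mul (hξ : SmoothAt ξ x) (hζ : SmoothAt ζ x) :
    dbarFlat inT (fun y => ξ y * ζ y) x
      = dbarFlat inT ξ x * ζ x + invol (ξ x) * dbarFlat inT ζ x :=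
  dbarFlat_mul (c := LinearMap.inl ℂ (V →ₗ[ℝ] ℂ) ((Fin n → ℂ) × Dual ℂ (Fin n → ℂ))) hξ hζ

theorem nablaFlat_mul (hξ : SmoothAt ξ x) (hζ : SmoothAt ζ x) :
    nablaFlat F (fun y => ξ y * ζ y) x
      = nablaFlat F ξ x * ζ x + invol (ξ x) * nablaFlat F ζ x := by
  rw [nablaFlat, nablaFlat, nablaFlat, delta_mul, dbarFlat_inT_mul hξ hζ]
  noncomm_ring

theorem nablaFlat_add (hξ : SmoothAt ξ x) (hζ : SmoothAt ζ x) :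
    nablaFlat F (fun y => ξ y + ζ y) x = nablaFlat F ξ x + nablaFlat F ζ x := by
  rw [nablaFlat, nablaFlat, nablaFlat, map_add, dbarFlat_add hξ hζ]
  abel

theorem nablaFlat_const_smul (a : ℂ) (hξ : SmoothAt ξ x) :
    nablaFlat F (fun y => a • ξ y) x = a • nablaFlat F ξ x := by
  rw [nablaFlat, nablaFlat, map_smul, dbarFlat_const_smul a hξ, smul_sub]

theorem nablaFlat_const (a : ℂ) :
    nablaFlat F (fun _ => algebraMap ℂ (GFib V (Fin n → ℂ)) a) x = 0 := by
  rw [nablaFlat, dbarFlat_const, sub_zero, Algebra.algebraMap_eq_smul_one, map_smul]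
  have : delta (F x) (1 : GFib V (Fin n → ℂ)) = 0 := contr_one _
  rw [this, smul_zero]

theorem nablaFlat_congr (h : ξ =ᶠ[𝓝 x] ζ) : nablaFlat F ξ x = nablaFlat F ζ x := by
  rw [nablaFlat, nablaFlat, h.self_of_nhds, dbarFlat_congr h]

theorem nablaFlat_pow_eq_zero (hξ : SmoothAt ξ x) (h : nablaFlat F ξ x = 0) (k : ℕ) :
    nablaFlat F (fun y => ξ y ^ k) x = 0 := by
  induction k with
  | zero => simpa using nablaFlat_const (F := F) (x := x) 1
  | succ k ih =>
    simp only [pow_succ]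
    rw [nablaFlat_mul (hξ.pow k) hξ, ih, h, zero_mul, mul_zero, add_zero]

/-- If `M` is even and `∇`-closed, then so is its inverse. -/
theorem nablaFlat_inverse_eq_zero {m w : V → GFib V (Fin n → ℂ)} (hm : SmoothAt m x)
    (hw : SmoothAt w x) (hinv : invol (m x) = m x) (hmw : ∀ᶠ y in 𝓝 x, m y * w y = 1)
    (h : nablaFlat F m x = 0) : nablaFlat F w x = 0 := by
  have h1 : nablaFlat F (fun y => m y * w y) x = 0 := by
    rw [nablaFlat_congr (ζ := fun _ => algebraMap ℂ _ 1)
      (hmw.mono fun y hy => hy.trans (map_one _).symm), nablaFlat_const]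
  rw [nablaFlat_mul hm hw, h, zero_mul, zero_add, hinv] at h1
  have hwm : w x * m x = 1 := by
    rw [← (commute_of_even hinv (w x)).eq]; exact hmw.self_of_nhds
  rw [← one_mul (nablaFlat F w x), ← hwm, mul_assoc, h1, mul_zero]

theorem dbarFlat_inForm {f : V → ExteriorAlgebra ℂ (V →ₗ[ℝ] ℂ)} (hf : SmoothAt f x) :
    dbarFlat inT (fun y => (inForm (f y) : GFib V (Fin n → ℂ))) x
      = inForm (dbarFlat (ι ℂ) f x) := by
  rw [dbarFlat_eq_wirt, dbarFlat_eq_wirt]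
  exact wirt_linear (inForm (V := V) (Ep := Fin n → ℂ)).toLinearMap inT (fun ℓ a => by
    rw [AlgHom.toLinearMap_apply, map_mul, inForm_ι]; rfl) hf

theorem dbarFlat_berezinOf (b : Fin n → Fin n → ℂ) (b' : Fin n → Dual ℂ (Fin n → ℂ))
    (hξ : SmoothAt ξ x) :
    dbarFlat (ι ℂ) (fun y => berezinOf b b' (ξ y)) x
      = berezinOf b b' (dbarFlat inT ξ x) := by
  rw [dbarFlat_eq_wirt, dbarFlat_eq_wirt]
  refine wirt_linear (berezinOf b b') (ι ℂ) (fun ℓ a => ?_) hξ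
  rw [← inForm_ι, berezinOf_inForm_mul]

theorem invol_dbarFlat {f : V → ExteriorAlgebra ℂ (V →ₗ[ℝ] ℂ)} (hf : SmoothAt f x) :
    invol (dbarFlat (ι ℂ) f x)
      = -dbarFlat (ι ℂ) (fun y => invol (f y)) x := by
  have h1 := wirt_linear (e := 1) (ν := dzbar) (c := ι ℂ)
    (invol : ExteriorAlgebra ℂ (V →ₗ[ℝ] ℂ) →ₐ[ℂ] _).toLinearMap (-ι ℂ)
    (fun ℓ a => by
      rw [AlgHom.toLinearMap_apply, map_mul, invol_ι]; rfl) hf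
  rw [dbarFlat_eq_wirt, dbarFlat_eq_wirt]
  refine (h1.symm).trans ?_
  simp only [wirt, LinearMap.neg_apply, neg_mul, Finset.sum_neg_distrib]
  rfl

theorem dbarFlat_algebraMap {φ : V → ℂ} (hφ : ContDiffAt ℝ ∞ φ x) :
    dbarFlat inT (fun y => algebraMap ℂ (GFib V (Fin n → ℂ)) (φ y)) x = inT (dbarF φ x) := by
  have := dbarFlat_smul_const (c := inT) hφ (1 : GFib V (Fin n → ℂ))
  rw [mul_one] at this
  simp only [Algebra.algebraMap_eq_smul_one]
  exact this

theorem smoothAt_algebraMap {φ : V → ℂ} (hφ : ContDiffAt ℝ ∞ φ x) :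
    SmoothAt (fun y => algebraMap ℂ (GFib V (Fin n → ℂ)) (φ y)) x := by
  simp only [Algebra.algebraMap_eq_smul_one]
  exact SmoothAt.smul hφ (smoothAt_const _ _)

end NablaFlat

/-! ### The super-curvature is `∇`-closed -/

section SuperClosed

variable {n : ℕ} {V : Type*} [NormedAddCommGroup V] [NormedSpace ℂ V] [FiniteDimensional ℂ V]
  [ComplexCoords V]
  {G : V → Matrix (Fin n) (Fin n) ℂ} {F : V → Fin n → ℂ} {x : V}

theorem smoothAt_curvFlat (hG : ∀ᶠ y in 𝓝 x, GoodAt G y) (i j : Fin n) :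
    SmoothAt (fun y => curvFlat G y i j) x := by
  have h1 : SmoothAt (fun y => ι ℂ (connFlat G y i j)) x :=
    (hG.self_of_nhds.smoothAt_connFlat i j).linear _
  refine (h1.dbarFlat (c := ι ℂ)).congr ?_
  filter_upwards [hG.eventually_nhds] with y hy using curvFlat_eq hy i j

theorem invol_curvFlat (hG : ∀ᶠ y in 𝓝 x, GoodAt G y) (i j : Fin n) :
    invol (curvFlat G x i j) = curvFlat G x i j := by
  have h1 : SmoothAt (fun y => ι ℂ (connFlat G y i j)) x :=
    (hG.self_of_nhds.smoothAt_connFlat i j).linear _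
  rw [curvFlat_eq hG, invol_dbarFlat h1]
  have e : (fun y => invol (ι ℂ (connFlat G y i j)))
      = fun y => (-1 : ℂ) • ι ℂ (connFlat G y i j) := by
    funext y
    rw [invol_ι, neg_one_smul]
  rw [e, dbarFlat_const_smul _ h1, neg_one_smul, neg_neg]

theorem dbarFlat_curvFlat (hG : ∀ᶠ y in 𝓝 x, GoodAt G y) (i j : Fin n) :
    dbarFlat (ι ℂ) (fun y => curvFlat G y i j) x = 0 := by
  have h1 : SmoothAt (fun y => ι ℂ (connFlat G y i j)) x :=
    (hG.self_of_nhds.smoothAt_connFlat i j).linear _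
  have e : (fun y => curvFlat G y i j) =ᶠ[𝓝 x] wirt 1 dzbar (ι ℂ)
      (fun y => ι ℂ (connFlat G y i j)) := by
    filter_upwards [hG.eventually_nhds] with y hy
    rw [curvFlat_eq hy, dbarFlat_eq_wirt]
  rw [dbarFlat_eq_wirt, wirt_congr e, wirt_wirt (fun ℓ m => ι_anticomm ℓ m) h1]

theorem smoothAt_covD (hG : GoodAt G x) (hF : ContDiffAt ℂ ω F x) : SmoothAt (covD G F) x :=
  SmoothAt.sum fun i _ => ((smoothAt_covFlat hG hF i).linear inT).mul (smoothAt_const _ _)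

theorem smoothAt_curvD (hG : ∀ᶠ y in 𝓝 x, GoodAt G y) : SmoothAt (curvD G) x :=
  SmoothAt.sum fun i _ => SmoothAt.sum fun j _ =>
    (((smoothAt_curvFlat hG i j).linear inForm.toLinearMap).mul (smoothAt_const _ _)).mul
      (smoothAt_const _ _)

theorem smoothAt_superFlat (hG : ∀ᶠ y in 𝓝 x, GoodAt G y) (hF : ContDiffAt ℂ ω F x) :
    SmoothAt (superFlat G F) x :=
  ((smoothAt_covD hG.self_of_nhds hF).const_smul _).add ((smoothAt_curvD hG).const_smul _)

theorem invol_superFlat (hG : ∀ᶠ y in 𝓝 x, GoodAt G y) :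
    invol (superFlat G F x) = superFlat G F x := by
  have h1 : invol (covD G F x) = covD G F x := by
    simp only [covD, map_sum, map_mul, invol_inT, invol_inE, neg_mul_neg]
  have h2 : invol (curvD G x) = curvD G x := by
    simp only [curvD, map_sum, map_mul, invol_inForm, invol_curvFlat hG, invol_inE,
      invol_inEDual, mul_neg, neg_mul, neg_neg]
  rw [superFlat, map_add, map_smul, map_smul, h1, h2]

theorem nablaFlat_covD (hG : ∀ᶠ y in 𝓝 x, GoodAt G y) (hF : ContDiffAt ℂ ω F x) :
    nablaFlat F (covD G F) x
      = -∑ i, ∑ j, F x j • ((inForm (curvFlat G x i j) : GFib V (Fin n → ℂ)) *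
          inE (Pi.single i 1)) := by
  have hs : ∀ i, SmoothAt (fun y => (inT (covFlat G F y i) : GFib V (Fin n → ℂ))) x := fun i =>
    (smoothAt_covFlat hG.self_of_nhds hF i).linear inT
  have hd : ∀ i, dbarFlat inT (fun y => (inT (covFlat G F y i) : GFib V (Fin n → ℂ))) x
      = ∑ j, F x j • inForm (curvFlat G x i j) := by
    intro i
    have h1 := dbarFlat_inForm (n := n)
      ((smoothAt_covFlat hG.self_of_nhds hF i).linear (ι ℂ))
    rw [dbarFlat_covFlat hG hF i] at h1
    simp only [inForm_ι] at h1
    rw [h1, map_sum]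
    simp only [map_smul]
  have h0 : delta (F x) (covD G F x) = 0 := by
    simp only [covD, map_sum, delta_mul, delta_inT, delta_inE, zero_mul, mul_zero, add_zero,
      Finset.sum_const_zero]
  have hsum : dbarFlat inT (covD G F) x = ∑ i, dbarFlat inT
      (fun y => (inT (covFlat G F y i) * inE (Pi.single i 1) : GFib V (Fin n → ℂ))) x := by
    rw [dbarFlat_eq_wirt]
    simp only [dbarFlat_eq_wirt]
    exact wirt_sum fun i _ => (hs i).mul (smoothAt_const _ _)
  rw [nablaFlat, h0, zero_sub, hsum]
  congr 1
  refine Finset.sum_congr rfl fun i _ => ?_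
  rw [dbarFlat_inT_mul (hs i) (smoothAt_const _ _), hd, dbarFlat_const, mul_zero,
    add_zero, Finset.sum_mul]
  simp only [smul_mul_assoc]

theorem nablaFlat_curvD (hG : ∀ᶠ y in 𝓝 x, GoodAt G y) :
    nablaFlat F (curvD G) x
      = -∑ i, ∑ j, F x j • ((inForm (curvFlat G x i j) : GFib V (Fin n → ℂ)) *
          inE (Pi.single i 1)) := by
  have hs : ∀ i j, SmoothAt (fun y => (inForm (curvFlat G y i j) : GFib V (Fin n → ℂ))) x :=
    fun i j => (smoothAt_curvFlat hG i j).linear inForm.toLinearMap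
  have h0 : dbarFlat inT (curvD G) x = 0 := by
    rw [dbarFlat_eq_wirt]
    refine (wirt_sum fun i _ => SmoothAt.sum fun j _ => ((hs i j).mul (smoothAt_const _ _)).mul
      (smoothAt_const _ _)).trans ?_
    refine Finset.sum_eq_zero fun i _ => ?_
    refine (wirt_sum fun j _ => ((hs i j).mul (smoothAt_const _ _)).mul
      (smoothAt_const _ _)).trans ?_
    refine Finset.sum_eq_zero fun j _ => ?_
    rw [← dbarFlat_eq_wirt, dbarFlat_inT_mul ((hs i j).mul (smoothAt_const _ _))
      (smoothAt_const _ _), dbarFlat_inT_mul (hs i j) (smoothAt_const _ _),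
      dbarFlat_inForm (smoothAt_curvFlat hG i j), dbarFlat_curvFlat hG, map_zero, zero_mul,
      dbarFlat_const, dbarFlat_const, mul_zero, mul_zero, add_zero, add_zero, zero_mul]
  rw [nablaFlat, h0, sub_zero, curvD]
  simp only [map_sum, delta_mul, delta_inForm, delta_inE, delta_inEDual, zero_mul, mul_zero,
    add_zero, zero_add, map_mul, invol_inForm, invol_curvFlat hG, invol_inE, mul_neg, neg_mul,
    Finset.sum_neg_distrib]
  congr 1
  refine Finset.sum_congr rfl fun i _ => Finset.sum_congr rfl fun j _ => ?_
  rw [← Algebra.commutes, Algebra.smul_def]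
  rfl

/-- The super-curvature is `∇`-closed: `∂̄(DF) = ΘF` is cancelled by contracting `Θ̃` with `F`. -/
theorem nablaFlat_superFlat (hG : ∀ᶠ y in 𝓝 x, GoodAt G y) (hF : ContDiffAt ℂ ω F x) :
    nablaFlat F (superFlat G F) x = 0 := by
  have h1 := smoothAt_covD hG.self_of_nhds hF
  have h2 := smoothAt_curvD hG
  have e : (Complex.I / (2 * Real.pi) : ℂ) = -(1 / (2 * Real.pi * Complex.I)) := by
    have hp : (Real.pi : ℂ) ≠ 0 := by exact_mod_cast Real.pi_ne_zero
    field_simp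
    rw [Complex.I_sq]
  refine (nablaFlat_add (h1.const_smul _) (h2.const_smul _)).trans ?_
  rw [nablaFlat_const_smul _ h1, nablaFlat_const_smul _ h2, nablaFlat_covD hG hF,
    nablaFlat_curvD hG, e, neg_smul, add_neg_cancel]

end SuperClosed

/-! ### The regularised kernel -/

section Regularised

variable {n : ℕ} {V : Type*} [NormedAddCommGroup V] [NormedSpace ℂ V] [FiniteDimensional ℂ V]
  [ComplexCoords V]

/-- The components of the section `h(F, ·)` of the dual bundle. -/
def sFlat (G : V → Matrix (Fin n) (Fin n) ℂ) (F : V → Fin n → ℂ) (j : Fin n) (x : V) : ℂ :=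
  ∑ i, conj (F x i) * G x i j

/-- The squared norm `|F|²`. -/
def rFlat (G : V → Matrix (Fin n) (Fin n) ℂ) (F : V → Fin n → ℂ) (x : V) : ℂ :=
  ∑ j, sFlat G F j x * F x j

/-- The section `s = h(F, ·)` of the dual bundle, as an element of the exterior algebra. -/
def secS (G : V → Matrix (Fin n) (Fin n) ℂ) (F : V → Fin n → ℂ) (x : V) : GFib V (Fin n → ℂ) :=
  ∑ j, sFlat G F j x • inEDual (LinearMap.proj j)

/-- The form `∂̄s`. -/
def dbarS (G : V → Matrix (Fin n) (Fin n) ℂ) (F : V → Fin n → ℂ) (x : V) : GFib V (Fin n → ℂ) :=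
  ∑ j, inT (dbarF (sFlat G F j) x) * inEDual (LinearMap.proj j)

/-- The resolvent `(ε + ∇s)⁻¹`, where `∇s = |F|² - ∂̄s`. -/
def resolvent (G : V → Matrix (Fin n) (Fin n) ℂ) (F : V → Fin n → ℂ) (ε : ℝ) (x : V) :
    GFib V (Fin n → ℂ) :=
  ∑ k ∈ Finset.range (n + 1), ((rFlat G F x + ε) ^ (k + 1))⁻¹ • dbarS G F x ^ k

variable {G : V → Matrix (Fin n) (Fin n) ℂ} {F : V → Fin n → ℂ} {x : V}

theorem contDiffAt_sFlat (hG : GoodAt G x) (hF : ContDiffAt ℂ ω F x) (j : Fin n) :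
    ContDiffAt ℝ ∞ (sFlat G F j) x :=
  ContDiffAt.sum fun i _ => (Complex.conjCLE.contDiff.contDiffAt.comp x
    (((contDiffAt_pi.1 hF i).restrict_scalars ℝ).of_le le_top)).mul (hG.1 i j)

theorem contDiffAt_rFlat (hG : GoodAt G x) (hF : ContDiffAt ℂ ω F x) :
    ContDiffAt ℝ ∞ (rFlat G F) x :=
  ContDiffAt.sum fun j _ => (contDiffAt_sFlat hG hF j).mul
    (((contDiffAt_pi.1 hF j).restrict_scalars ℝ).of_le le_top)

theorem smoothAt_secS (hG : GoodAt G x) (hF : ContDiffAt ℂ ω F x) : SmoothAt (secS G F) x :=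
  SmoothAt.sum fun j _ => SmoothAt.smul (contDiffAt_sFlat hG hF j) (smoothAt_const _ _)

theorem dbarFlat_secS (hG : GoodAt G x) (hF : ContDiffAt ℂ ω F x) :
    dbarFlat inT (secS G F) x = dbarS G F x := by
  rw [dbarFlat_eq_wirt]
  refine (wirt_sum fun j _ => SmoothAt.smul (contDiffAt_sFlat hG hF j)
    (smoothAt_const _ _)).trans ?_
  refine Finset.sum_congr rfl fun j _ => ?_
  rw [← dbarFlat_eq_wirt]
  exact dbarFlat_smul_const (contDiffAt_sFlat hG hF j) _

theorem smoothAt_dbarS (hG : ∀ᶠ y in 𝓝 x, GoodAt G y) (hF : ContDiffAt ℂ ω F x) :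
    SmoothAt (dbarS G F) x := by
  refine ((smoothAt_secS hG.self_of_nhds hF).dbarFlat (c := inT)).congr ?_
  filter_upwards [hG, hF.eventually (by simp)] with y h1 h2
  exact (dbarFlat_secS h1 h2).symm

theorem invol_dbarS : invol (dbarS G F x) = dbarS G F x := by
  simp only [dbarS, map_sum, map_mul, invol_inT, invol_inEDual, neg_mul_neg]

theorem invol_secS : invol (secS G F x) = -secS G F x := by
  simp only [secS, map_sum, map_smul, invol_inEDual, smul_neg, Finset.sum_neg_distrib]

theorem dbarS_pow (G : V → Matrix (Fin n) (Fin n) ℂ) (F : V → Fin n → ℂ) (x : V) :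
    dbarS G F x ^ n = (n.factorial : ℂ) • (List.ofFn fun j => (inT (dbarF (sFlat G F j) x) *
      inEDual (LinearMap.proj j) : GFib V (Fin n → ℂ))).prod ∧ dbarS G F x ^ (n + 1) = 0 :=
  sum_pow_of_sq_zero _ (fun i j => commute_of_even (invol_ι_mul_ι _ _) _)
    fun i => ι_mul_ι_mul_self _ _

theorem secS_mul_dbarS_pow : secS G F x * dbarS G F x ^ n = 0 := by
  rw [← (commute_of_even (by rw [map_pow, invol_dbarS]) (secS G F x)).eq, (dbarS_pow G F x).1,
    secS, Finset.mul_sum]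
  refine Finset.sum_eq_zero fun j _ => ?_
  have h0 : (inEDual (LinearMap.proj j) * inEDual (LinearMap.proj j) : GFib V (Fin n → ℂ)) = 0 :=
    ExteriorAlgebra.ι_sq_zero _
  have h1 : (List.ofFn fun j => (inT (dbarF (sFlat G F j) x) *
      inEDual (LinearMap.proj j) : GFib V (Fin n → ℂ))).prod * inEDual (LinearMap.proj j) = 0 :=
    prod_ofFn_mul_eq_zero (j := j) _ (fun i => commute_of_even (invol_ι_mul_ι _ _) _)
      (by rw [mul_assoc, h0, mul_zero])
  rw [smul_mul_assoc, mul_smul_comm, h1, smul_zero, smul_zero]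

theorem invol_resolvent (ε : ℝ) : invol (resolvent G F ε x) = resolvent G F ε x := by
  simp only [resolvent, map_sum, map_smul, map_pow, invol_dbarS]

theorem mul_resolvent {ε : ℝ} (h : rFlat G F x + ε ≠ 0) :
    (algebraMap ℂ (GFib V (Fin n → ℂ)) (rFlat G F x + ε) - dbarS G F x) * resolvent G F ε x
      = 1 := by
  set t := rFlat G F x + ε with ht
  set X := dbarS G F x with hX
  have h1 : resolvent G F ε x = t⁻¹ • ∑ k ∈ Finset.range (n + 1), (t⁻¹ • X) ^ k := by
    rw [resolvent, Finset.smul_sum]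
    refine Finset.sum_congr rfl fun k _ => ?_
    rw [smul_pow, smul_smul, ← ht, ← hX, pow_succ, mul_inv_rev, inv_pow]
  have h2 : algebraMap ℂ (GFib V (Fin n → ℂ)) t - X = t • (1 - t⁻¹ • X) := by
    rw [smul_sub, smul_smul, mul_inv_cancel₀ h, one_smul, Algebra.algebraMap_eq_smul_one]
  rw [h1, h2, smul_mul_smul_comm, mul_inv_cancel₀ h, one_smul, mul_neg_geom_sum, smul_pow,
    (dbarS_pow G F x).2, smul_zero, sub_zero]

theorem smoothAt_resolvent (hG : ∀ᶠ y in 𝓝 x, GoodAt G y) (hF : ContDiffAt ℂ ω F x) {ε : ℝ}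
    (h : rFlat G F x + ε ≠ 0) : SmoothAt (resolvent G F ε) x :=
  SmoothAt.sum fun k _ => SmoothAt.smul
    ((((contDiffAt_rFlat hG.self_of_nhds hF).add contDiffAt_const).pow _).inv (pow_ne_zero _ h))
    ((smoothAt_dbarS hG hF).pow k)

theorem delta_secS : delta (F x) (secS G F x) = algebraMap ℂ _ (rFlat G F x) := by
  simp only [secS, map_sum, map_smul, delta_inEDual, rFlat, map_mul]
  exact Finset.sum_congr rfl fun j _ => Algebra.smul_def _ _

theorem nablaFlat_secS (hG : GoodAt G x) (hF : ContDiffAt ℂ ω F x) :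
    nablaFlat F (secS G F) x
      = algebraMap ℂ (GFib V (Fin n → ℂ)) (rFlat G F x) - dbarS G F x := by
  rw [nablaFlat, delta_secS, dbarFlat_secS hG hF]

/-- `∇² = 0`, applied to `s`. -/
theorem nablaFlat_nablaFlat_secS (hG : ∀ᶠ y in 𝓝 x, GoodAt G y) (hF : ContDiffAt ℂ ω F x)
    (ε : ℝ) : nablaFlat F (fun y => algebraMap ℂ (GFib V (Fin n → ℂ)) (rFlat G F y + ε)
      - dbarS G F y) x = 0 := by
  have hx := hG.self_of_nhds
  have hFi := contDiffAt_pi.1 hF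
  have hr : ContDiffAt ℝ ∞ (fun y => rFlat G F y + ε) x :=
    (contDiffAt_rFlat hx hF).add contDiffAt_const
  have hX := smoothAt_dbarS hG hF
  have h1 : dbarFlat inT (dbarS G F) x = 0 := by
    have e : dbarS G F =ᶠ[𝓝 x] dbarFlat inT (secS G F) := by
      filter_upwards [hG, hF.eventually (by simp)] with y h1 h2
      exact (dbarFlat_secS h1 h2).symm
    have hc : ∀ ℓ m : V →ₗ[ℝ] ℂ, (inT ℓ * inT m : GFib V (Fin n → ℂ)) = -(inT m * inT ℓ) :=
      fun ℓ m => ι_anticomm _ _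
    rw [dbarFlat_congr e, dbarFlat_dbarFlat hc (smoothAt_secS hx hF)]
  have h2 : dbarF (fun y => rFlat G F y + ε) x = ∑ j, F x j • dbarF (sFlat G F j) x := by
    have hs : ∀ j, DifferentiableAt ℝ (sFlat G F j) x := fun j =>
      (contDiffAt_sFlat hx hF j).differentiableAt (by simp)
    have hd : ∀ j, DifferentiableAt ℂ (fun y => F y j) x := fun j =>
      (hFi j).differentiableAt (by simp)
    have h3 : dbarF (fun y => rFlat G F y + ε) x = dbarF (rFlat G F) x := by
      rw [dbarF, fderiv_add_const]; rfl
    rw [h3]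
    refine (dbarF_sum fun j _ => (hs j).fun_mul ((hd j).restrictScalars ℝ)).trans ?_
    refine Finset.sum_congr rfl fun j _ => ?_
    rw [dbarF_mul (hs j) ((hd j).restrictScalars ℝ), dbarF_eq_zero (hd j), smul_zero, zero_add]
  have h4 : nablaFlat F (fun y => algebraMap ℂ (GFib V (Fin n → ℂ)) (rFlat G F y + ε)) x
      = -∑ j, F x j • inT (dbarF (sFlat G F j) x) := by
    rw [nablaFlat, dbarFlat_algebraMap hr, h2, Algebra.algebraMap_eq_smul_one, map_smul]
    have : delta (F x) (1 : GFib V (Fin n → ℂ)) = 0 := contr_one _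
    rw [this, smul_zero, zero_sub, map_sum]
    simp only [map_smul]
  have h5 : nablaFlat F (dbarS G F) x = -∑ j, F x j • inT (dbarF (sFlat G F j) x) := by
    rw [nablaFlat, h1, sub_zero, dbarS]
    simp only [map_sum, delta_mul, delta_inT, delta_inEDual, zero_mul, zero_add, invol_inT,
      neg_mul, Finset.sum_neg_distrib]
    congr 1
    refine Finset.sum_congr rfl fun j _ => ?_
    rw [← Algebra.commutes, Algebra.smul_def]
    rfl
  have h6 : (fun y => algebraMap ℂ (GFib V (Fin n → ℂ)) (rFlat G F y + ε) - dbarS G F y)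
      = fun y => algebraMap ℂ (GFib V (Fin n → ℂ)) (rFlat G F y + ε) + (-1 : ℂ) • dbarS G F y := by
    funext y
    rw [neg_one_smul, sub_eq_add_neg]
  rw [h6, nablaFlat_add (smoothAt_algebraMap hr) (hX.const_smul _), nablaFlat_const_smul _ hX,
    h4, h5, neg_one_smul, add_neg_cancel]

theorem nablaFlat_resolvent (hG : ∀ᶠ y in 𝓝 x, GoodAt G y) (hF : ContDiffAt ℂ ω F x) {ε : ℝ}
    (h : rFlat G F x + ε ≠ 0) : nablaFlat F (resolvent G F ε) x = 0 := by
  have hr : ContDiffAt ℝ ∞ (fun y => rFlat G F y + ε) x :=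
    (contDiffAt_rFlat hG.self_of_nhds hF).add contDiffAt_const
  refine nablaFlat_inverse_eq_zero ((smoothAt_algebraMap hr).sub (smoothAt_dbarS hG hF))
    (smoothAt_resolvent hG hF h) ?_ ?_ (nablaFlat_nablaFlat_secS hG hF ε)
  · rw [map_sub, invol_dbarS, AlgHom.commutes]
  · filter_upwards [hr.continuousAt.eventually_ne h] with y hy using mul_resolvent hy

/-- `∇(s(ε + ∇s)⁻¹) = 1 - ε(ε + ∇s)⁻¹`. -/
theorem nablaFlat_secS_mul_resolvent (hG : ∀ᶠ y in 𝓝 x, GoodAt G y) (hF : ContDiffAt ℂ ω F x)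
    {ε : ℝ} (h : rFlat G F x + ε ≠ 0) :
    nablaFlat F (fun y => secS G F y * resolvent G F ε y) x
      = 1 - (ε : ℂ) • resolvent G F ε x := by
  rw [nablaFlat_mul (smoothAt_secS hG.self_of_nhds hF) (smoothAt_resolvent hG hF h),
    nablaFlat_resolvent hG hF h, mul_zero, add_zero, nablaFlat_secS hG.self_of_nhds hF,
    ← mul_resolvent h, map_add, sub_mul, sub_mul, add_mul, Algebra.smul_def]
  change _ = _ + algebraMap ℂ (GFib V (Fin n → ℂ)) ε * _ - _ - algebraMap ℂ _ ε * _
  abel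

/-- The Berezin integral in the standard frame. -/
abbrev berezinStd : GFib V (Fin n → ℂ) →ₗ[ℂ] ExteriorAlgebra ℂ (V →ₗ[ℝ] ℂ) :=
  berezinOf (fun j => Pi.single j 1) (fun j => LinearMap.proj j)

theorem isDualPair_std : IsDualPair (fun j : Fin n => (Pi.single j 1 : Fin n → ℂ))
    (fun j => LinearMap.proj j) where
  pairing i j := by
    change (Pi.single j 1 : Fin n → ℂ) i = _
    rw [Pi.single_apply]
  expand v := by
    conv_rhs => rw [← Finset.univ_sum_single v]
    exact Finset.sum_congr rfl fun i _ => by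
      rw [← Pi.single_smul', smul_eq_mul, mul_one]; rfl

/-- The regularised kernel `∫_E s(ε + ∇s)⁻¹ g A_n`. -/
def kerReg (G : V → Matrix (Fin n) (Fin n) ℂ) (F : V → Fin n → ℂ) (g : V → GFib V (Fin n → ℂ))
    (ε : ℝ) (x : V) : ExteriorAlgebra ℂ (V →ₗ[ℝ] ℂ) :=
  berezinStd (secS G F x * resolvent G F ε x * g x * divPow (superFlat G F x) n)

/-- The form `∫_E g A_n`. -/
def kerP (G : V → Matrix (Fin n) (Fin n) ℂ) (F : V → Fin n → ℂ) (g : V → GFib V (Fin n → ℂ))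
    (x : V) : ExteriorAlgebra ℂ (V →ₗ[ℝ] ℂ) :=
  berezinStd (g x * divPow (superFlat G F x) n)

/-- The form `∫_E ε(ε + ∇s)⁻¹ g A_n`. -/
def kerRes (G : V → Matrix (Fin n) (Fin n) ℂ) (F : V → Fin n → ℂ) (g : V → GFib V (Fin n → ℂ))
    (ε : ℝ) (x : V) : ExteriorAlgebra ℂ (V →ₗ[ℝ] ℂ) :=
  berezinStd ((ε : ℂ) • resolvent G F ε x * g x * divPow (superFlat G F x) n)

variable {g : V → GFib V (Fin n → ℂ)}

theorem smoothAt_divPow (hG : ∀ᶠ y in 𝓝 x, GoodAt G y) (hF : ContDiffAt ℂ ω F x) :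
    SmoothAt (fun y => divPow (superFlat G F y) n) x :=
  ((smoothAt_superFlat hG hF).pow n).const_smul _

theorem nablaFlat_divPow (hG : ∀ᶠ y in 𝓝 x, GoodAt G y) (hF : ContDiffAt ℂ ω F x) :
    nablaFlat F (fun y => divPow (superFlat G F y) n) x = 0 := by
  refine (nablaFlat_const_smul _ ((smoothAt_superFlat hG hF).pow n)).trans ?_
  rw [nablaFlat_pow_eq_zero (smoothAt_superFlat hG hF) (nablaFlat_superFlat hG hF), smul_zero]

theorem smoothAt_kerReg (hG : ∀ᶠ y in 𝓝 x, GoodAt G y) (hF : ContDiffAt ℂ ω F x)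
    (hg : SmoothAt g x) {ε : ℝ} (h : rFlat G F x + ε ≠ 0) : SmoothAt (kerReg G F g ε) x :=
  (((((smoothAt_secS hG.self_of_nhds hF).mul (smoothAt_resolvent hG hF h)).mul hg).mul
    (smoothAt_divPow hG hF))).linear berezinStd

theorem smoothAt_kerP (hG : ∀ᶠ y in 𝓝 x, GoodAt G y) (hF : ContDiffAt ℂ ω F x)
    (hg : SmoothAt g x) : SmoothAt (kerP G F g) x :=
  (hg.mul (smoothAt_divPow hG hF)).linear berezinStd

/-- `∂̄K_ε = R_ε - P`: the Berezin integral annihilates contractions, so it turns `∇` into `-∂̄`. -/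
theorem dbarFlat_kerReg (hG : ∀ᶠ y in 𝓝 x, GoodAt G y) (hF : ContDiffAt ℂ ω F x)
    (hg : SmoothAt g x) (hn : nablaFlat F g x = 0) {ε : ℝ} (h : rFlat G F x + ε ≠ 0) :
    dbarFlat (ι ℂ) (kerReg G F g ε) x = kerRes G F g ε x - kerP G F g x := by
  have hu := (smoothAt_secS hG.self_of_nhds hF).mul (smoothAt_resolvent hG hF h)
  have hA := smoothAt_divPow hG hF
  have hQ := (hu.mul hg).mul hA
  have h1 : nablaFlat F (fun y => secS G F y * resolvent G F ε y * g y *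
      divPow (superFlat G F y) n) x
      = (1 - (ε : ℂ) • resolvent G F ε x) * g x * divPow (superFlat G F x) n := by
    rw [nablaFlat_mul (hu.mul hg) hA, nablaFlat_divPow hG hF, mul_zero, add_zero,
      nablaFlat_mul hu hg, hn, mul_zero, add_zero, nablaFlat_secS_mul_resolvent hG hF h]
  have h2 : berezinStd (nablaFlat F (fun y => secS G F y * resolvent G F ε y * g y *
      divPow (superFlat G F y) n) x) = -dbarFlat (ι ℂ) (kerReg G F g ε) x := by
    rw [nablaFlat, map_sub, berezinOf_delta isDualPair_std, zero_sub]
    congr 1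
    exact (dbarFlat_berezinOf _ _ hQ).symm
  rw [h1] at h2
  rw [kerRes, kerP, ← neg_inj, ← h2, ← map_sub, ← map_neg]
  congr 1
  rw [sub_mul, sub_mul, one_mul]
  abel

theorem invol_kerReg (hG : ∀ᶠ y in 𝓝 x, GoodAt G y) (hg : invol (g x) = g x) (ε : ℝ) :
    invol (kerReg G F g ε x) = -kerReg G F g ε x := by
  rw [kerReg, invol_berezinOf, ← map_neg]
  congr 1
  rw [map_mul, map_mul, map_mul, invol_secS, invol_resolvent, hg, divPow, map_smul, map_pow,
    invol_superFlat hG, neg_mul, neg_mul, neg_mul]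

end Regularised

/-! ### The top degree coefficient -/

section TopCoeff

variable {V : Type*} [NormedAddCommGroup V] [NormedSpace ℂ V] [ComplexCoords V]

/-- The frame `b₁, i b₁, b₂, i b₂, …` as a real basis. -/
def realBasis : Basis (Fin (dim V * 2)) ℝ V :=
  (Complex.basisOneI.smulTower (basis (V := V))).reindex
    ((Equiv.prodComm _ _).trans finProdFinEquiv)

theorem realBasis_apply (k : Fin (dim V * 2)) :
    (realBasis k : V) = realFrame k := by
  rw [realBasis, Basis.reindex_apply, Basis.smulTower_apply, realFrame]
  rcases h : finProdFinEquiv.symm k with ⟨j, a⟩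
  have h1 : ((Equiv.prodComm (Fin 2) (Fin (dim V))).trans finProdFinEquiv).symm k
      = (a, j) := by
    rw [Equiv.symm_trans_apply, h]
    rfl
  rw [h1]
  fin_cases a <;> simp

theorem topCoeff_ιMulti (w : Fin (dim V * 2) → V →ₗ[ℝ] ℂ) :
    topCoeff (ExteriorAlgebra.ιMulti ℂ _ w)
      = (Matrix.of fun a b => w a (realFrame b)).det := by
  rw [topCoeff, ExteriorAlgebra.liftAlternating_apply_ιMulti, Pi.single_eq_same]
  rfl

theorem topCoeff_ιMulti_of_ne {m : ℕ} (hm : m ≠ dim V * 2)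
    (w : Fin m → V →ₗ[ℝ] ℂ) : topCoeff (ExteriorAlgebra.ιMulti ℂ m w) = 0 := by
  rw [topCoeff, ExteriorAlgebra.liftAlternating_apply_ιMulti, Pi.single_eq_of_ne hm]
  rfl

theorem topCoeff_map_precomp (L : V →ₗ[ℝ] V) (a : ExteriorAlgebra ℂ (V →ₗ[ℝ] ℂ)) :
    topCoeff (map (precomp L) a) = ((LinearMap.det L : ℝ) : ℂ) * topCoeff a := by
  have h : topCoeff ∘ₗ (map (precomp L)).toLinearMap
      = ((LinearMap.det L : ℝ) : ℂ) • topCoeff (V := V) := by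
    refine ExteriorAlgebra.lhom_ext fun m => AlternatingMap.ext fun w => ?_
    change topCoeff (map (precomp L) (ExteriorAlgebra.ιMulti ℂ m w))
      = ((LinearMap.det L : ℝ) : ℂ) * topCoeff (ExteriorAlgebra.ιMulti ℂ m w)
    rw [ExteriorAlgebra.map_apply_ιMulti]
    by_cases hm : m = dim V * 2
    · subst hm
      rw [topCoeff_ιMulti, topCoeff_ιMulti]
      have h1 : (Matrix.of fun a b => ((precomp L : _ → (V →ₗ[ℝ] ℂ)) ∘ w) a (realFrame b))
          = (Matrix.of fun a b => w a (realFrame b)) *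
            (LinearMap.toMatrix realBasis realBasis L).map Complex.ofReal := by
        ext a b
        rw [Matrix.mul_apply, Matrix.of_apply, Function.comp_apply]
        change w a (L (realFrame b)) = _
        rw [← realBasis_apply, ← realBasis.sum_repr (L (realBasis b)), map_sum]
        refine Finset.sum_congr rfl fun c _ => ?_
        rw [map_smul, Matrix.map_apply, LinearMap.toMatrix_apply, Matrix.of_apply,
          realBasis_apply c, Complex.real_smul, mul_comm]
      rw [h1, Matrix.det_mul, mul_comm]
      congr 1
      rw [← LinearMap.det_toMatrix realBasis L]
      exact (RingHom.map_det Complex.ofRealHom _).symm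
    · rw [topCoeff_ιMulti_of_ne hm, topCoeff_ιMulti_of_ne hm, mul_zero]
  exact LinearMap.congr_fun h a

theorem det_reL_nonneg [FiniteDimensional ℂ V] (D : V →L[ℂ] V) :
    LinearMap.det (reL D) = ‖LinearMap.det (D : V →ₗ[ℂ] V)‖ ^ 2 := by
  have h := LinearMap.det_restrictScalars (R := ℝ) (f := (D : V →ₗ[ℂ] V))
  rw [Algebra.norm_complex_eq] at h
  refine h.trans ?_
  rw [← Complex.normSq_eq_norm_sq]
  rfl

theorem prod_ι_mul_ι_eq_ιMulti {W : Type*} [AddCommGroup W] [Module ℂ W] {m : ℕ}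
    (a u : Fin m → W) :
    (List.ofFn fun j => ι ℂ (a j) * ι ℂ (u j)).prod
      = ExteriorAlgebra.ιMulti ℂ (m * 2) fun k =>
        if (finProdFinEquiv.symm k).2 = 0 then a (finProdFinEquiv.symm k).1
          else u (finProdFinEquiv.symm k).1 := by
  rw [ExteriorAlgebra.ιMulti_apply, List.ofFn_mul, List.prod_flatten, List.map_ofFn]
  congr 2
  funext j
  have e0 : (⟨(j : ℕ) * 2 + ((0 : Fin 2) : ℕ), by omega⟩ : Fin (m * 2))
      = finProdFinEquiv (j, 0) := Fin.ext (by simp [finProdFinEquiv]; ring)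
  have e1 : (⟨(j : ℕ) * 2 + ((1 : Fin 2) : ℕ), by simp; omega⟩ : Fin (m * 2))
      = finProdFinEquiv (j, 1) := Fin.ext (by simp [finProdFinEquiv]; ring)
  rw [Function.comp_apply, List.ofFn_succ, List.ofFn_succ, List.ofFn_zero]
  simp only [Fin.succ_zero_eq_one, List.prod_cons, List.prod_nil, mul_one]
  rw [e0, e1]
  simp

/-- `dz₁ ∧ dz̄₁ ∧ ⋯ = (-2i)ⁿ dx₁ ∧ dy₁ ∧ ⋯`. -/
theorem topCoeff_prod_dz :
    topCoeff (List.ofFn fun j : Fin (dim V) =>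
      ι ℂ (dz j : V →ₗ[ℝ] ℂ) * ι ℂ (dzbar j)).prod
        = (-2 * Complex.I) ^ dim V := by
  rw [prod_ι_mul_ι_eq_ιMulti]
  set w : Fin (dim V * 2) → V →ₗ[ℝ] ℂ := fun k =>
    if (finProdFinEquiv.symm k).2 = 0 then dz (finProdFinEquiv.symm k).1
      else dzbar (finProdFinEquiv.symm k).1 with hw
  rw [topCoeff_ιMulti]
  have h2 : (Matrix.of fun a b => w a (realFrame b : V)).submatrix finProdFinEquiv finProdFinEquiv
      = (Matrix.blockDiagonal fun _ : Fin (dim V) =>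
          (!![1, Complex.I; 1, -Complex.I] : Matrix (Fin 2) (Fin 2) ℂ)).submatrix
            (Equiv.prodComm _ _) (Equiv.prodComm _ _) := by
    ext ⟨j, a⟩ ⟨k, b⟩
    rw [Matrix.submatrix_apply, Matrix.submatrix_apply, Matrix.of_apply]
    simp only [Equiv.prodComm_apply, Prod.swap_prod_mk, Matrix.blockDiagonal_apply, hw,
      Equiv.symm_apply_apply, realFrame]
    by_cases hjk : j = k
    · subst hjk
      fin_cases a <;> fin_cases b <;> simp [dz_apply, dzbar_apply]
    · fin_cases a <;> fin_cases b <;> simp [dz_apply, dzbar_apply, hjk]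
  rw [← Matrix.det_submatrix_equiv_self finProdFinEquiv, h2, Matrix.det_submatrix_equiv_self,
    Matrix.det_blockDiagonal, Finset.prod_const, Finset.card_univ, Fintype.card_fin]
  congr 1
  rw [Matrix.det_fin_two_of]
  ring

variable {W : Type*} [AddCommGroup W] [Module ℂ W] {m : ℕ}

theorem apply_ιMulti_sum (T : ExteriorAlgebra ℂ W →ₗ[ℂ] ℂ) (A : Matrix (Fin m) (Fin m) ℂ)
    (v : Fin m → W) :
    T (ExteriorAlgebra.ιMulti ℂ m fun i => ∑ k, A i k • v k)
      = A.det * T (ExteriorAlgebra.ιMulti ℂ m v) := by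
  let f : (Fin m → ℂ) [⋀^Fin m]→ₗ[ℂ] ℂ :=
    (T.compAlternatingMap (ExteriorAlgebra.ιMulti ℂ m)).compLinearMap
      (Fintype.linearCombination ℂ v)
  have h := DFunLike.congr_fun (AlternatingMap.eq_smul_basis_det (Pi.basisFun ℂ (Fin m)) f) A
  have h1 : f A = T (ExteriorAlgebra.ιMulti ℂ m fun i => ∑ k, A i k • v k) := rfl
  have h2 : f (Pi.basisFun ℂ (Fin m)) = T (ExteriorAlgebra.ιMulti ℂ m v) := by
    change T (ExteriorAlgebra.ιMulti ℂ m fun i =>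
      Fintype.linearCombination ℂ v (Pi.basisFun ℂ (Fin m) i)) = _
    congr 2
    funext i
    rw [Pi.basisFun_apply, Fintype.linearCombination_apply_single, one_smul]
  refine h1.symm.trans (h.trans ?_)
  change f (Pi.basisFun ℂ (Fin m)) * (Pi.basisFun ℂ (Fin m)).det A = _
  rw [h2, mul_comm, Pi.basisFun_det]
  rfl

/-- The effect of linear substitutions on a product of two-forms. -/
theorem apply_prod_ι_mul_ι (T : ExteriorAlgebra ℂ W →ₗ[ℂ] ℂ) (A B : Matrix (Fin m) (Fin m) ℂ)
    (a u : Fin m → W) :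
    T (List.ofFn fun j => ι ℂ (∑ k, A j k • a k) *
        ι ℂ (∑ k, B j k • u k)).prod
      = A.det * B.det *
        T (List.ofFn fun j => ι ℂ (a j) * ι ℂ (u j)).prod := by
  obtain ⟨ε, hε⟩ := prod_ι_mul_ι (W := W) (m := m)
  rw [hε, hε, map_smul, map_smul, smul_eq_mul, smul_eq_mul]
  have h1 := apply_ιMulti_sum (T ∘ₗ LinearMap.mulRight ℂ
    (ExteriorAlgebra.ιMulti ℂ m fun j => ∑ k, B j k • u k)) A a
  have h2 := apply_ιMulti_sum (T ∘ₗ LinearMap.mulLeft ℂ (ExteriorAlgebra.ιMulti ℂ m a)) B u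
  simp only [LinearMap.comp_apply, LinearMap.mulRight_apply, LinearMap.mulLeft_apply] at h1 h2
  rw [h1, h2]
  ring

end TopCoeff

/-! ### Forms near the diagonal of a product -/

section Product

variable {V : Type*} [NormedAddCommGroup V] [NormedSpace ℂ V] [ComplexCoords V]

/-- The map `(ζ, z) ↦ ζ - z`. -/
def subMap : V × V →ₗ[ℝ] V := LinearMap.fst ℝ V V - LinearMap.snd ℝ V V

/-- The diagonal map. -/
def diagMap : V →ₗ[ℝ] V × V := LinearMap.id.prod LinearMap.id

theorem topCoeff_subMap_mul {ψ : ExteriorAlgebra ℂ (V →ₗ[ℝ] ℂ)}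
    (ℓ : Fin (dim V * 2) → V →ₗ[ℝ] ℂ) (hψ : ψ = ExteriorAlgebra.ιMulti ℂ _ ℓ)
    (φ : ExteriorAlgebra ℂ (V × V →ₗ[ℝ] ℂ)) :
    topCoeff (map (precomp subMap) ψ * φ)
      = topCoeff ψ * topCoeff (map (precomp diagMap) φ) := by
  have h : topCoeff ∘ₗ LinearMap.mulLeft ℂ (map (precomp subMap) ψ)
      = topCoeff ψ • (topCoeff ∘ₗ (map (precomp (diagMap (V := V)))).toLinearMap) := by
    refine ExteriorAlgebra.lhom_ext fun m => AlternatingMap.ext fun w => ?_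
    change topCoeff (map (precomp subMap) ψ * ExteriorAlgebra.ιMulti ℂ m w)
      = topCoeff ψ * topCoeff (map (precomp diagMap)
          (ExteriorAlgebra.ιMulti ℂ m w))
    rw [hψ, ExteriorAlgebra.map_apply_ιMulti, ExteriorAlgebra.map_apply_ιMulti,
      ExteriorAlgebra.ιMulti_mul_ιMulti]
    have hdim : dim (V × V) = dim V + dim V := rfl
    by_cases hm : m = dim V * 2
    · subst hm
      have hcast : dim V * 2 + dim V * 2 = dim (V × V) * 2 := by rw [hdim]; ring
      set u : Fin (dim V * 2 + dim V * 2) → (V × V →ₗ[ℝ] ℂ) :=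
        Fin.append ((precomp subMap : _ → (V × V →ₗ[ℝ] ℂ)) ∘ ℓ) w with hu
      have h1 : ExteriorAlgebra.ιMulti ℂ _ u
          = ExteriorAlgebra.ιMulti ℂ _ (u ∘ Fin.cast hcast.symm) := by
        rw [ExteriorAlgebra.ιMulti_apply, ExteriorAlgebra.ιMulti_apply, List.ofFn_congr hcast]
        rfl
      rw [h1, topCoeff_ιMulti, topCoeff_ιMulti, topCoeff_ιMulti]
      -- columns: the frame of the first factor, then the frame of the second factor
      let col : Fin (dim V * 2) ⊕ Fin (dim V * 2) ≃ Fin (dim (V × V) * 2) :=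
        (((finProdFinEquiv.symm.sumCongr finProdFinEquiv.symm).trans
          (Equiv.sumProdDistrib (Fin (dim V)) (Fin (dim V)) (Fin 2)).symm).trans
            (finSumFinEquiv.prodCongr (Equiv.refl _))).trans finProdFinEquiv
      let row : Fin (dim V * 2) ⊕ Fin (dim V * 2) ≃ Fin (dim (V × V) * 2) :=
        finSumFinEquiv.trans (finCongr hcast)
      have hcl : ∀ b, (realFrame (col (Sum.inl b)) : V × V) = (realFrame b, 0) := by
        intro b
        simp only [realFrame, col, Equiv.trans_apply, Equiv.symm_apply_apply,
          Equiv.sumCongr_apply, Sum.map_inl]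
        rcases hb : finProdFinEquiv.symm b with ⟨j, a⟩
        have hbas : (basis (finSumFinEquiv (Sum.inl j) :
            Fin (dim (V × V))) : V × V) = (basis j, 0) := by
          change (((basis (V := V)).prod (basis (V := V))).reindex
            finSumFinEquiv) (finSumFinEquiv (Sum.inl j)) = _
          rw [Basis.reindex_apply, Equiv.symm_apply_apply]
          ext <;> simp
        change (if a = 0 then (basis (finSumFinEquiv (Sum.inl j) :
            Fin (dim (V × V))) : V × V) else Complex.I •
              (basis (finSumFinEquiv (Sum.inl j) :
            Fin (dim (V × V))) : V × V)) = _
        rw [hbas]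
        split_ifs
        · rfl
        · exact Prod.ext rfl (smul_zero _)
      have hcr : ∀ b, (realFrame (col (Sum.inr b)) : V × V) = (0, realFrame b) := by
        intro b
        simp only [realFrame, col, Equiv.trans_apply, Equiv.symm_apply_apply,
          Equiv.sumCongr_apply, Sum.map_inr]
        rcases hb : finProdFinEquiv.symm b with ⟨j, a⟩
        have hbas : (basis (finSumFinEquiv (Sum.inr j) :
            Fin (dim (V × V))) : V × V) = (0, basis j) := by
          change (((basis (V := V)).prod (basis (V := V))).reindex
            finSumFinEquiv) (finSumFinEquiv (Sum.inr j)) = _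
          rw [Basis.reindex_apply, Equiv.symm_apply_apply]
          ext <;> simp
        change (if a = 0 then (basis (finSumFinEquiv (Sum.inr j) :
            Fin (dim (V × V))) : V × V) else Complex.I •
              (basis (finSumFinEquiv (Sum.inr j) :
            Fin (dim (V × V))) : V × V)) = _
        rw [hbas]
        split_ifs
        · rfl
        · exact Prod.ext (smul_zero _) rfl
      -- the permutation of the columns is even, being the identity on pairs
      have hrc : ∀ b, row b = col b := by
        rintro (b | b)
        · rcases hb : finProdFinEquiv.symm b with ⟨j, a⟩
          obtain rfl : b = finProdFinEquiv (j, a) := by rw [← hb, Equiv.apply_symm_apply]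
          apply Fin.ext
          simp only [row, col, Equiv.trans_apply, Equiv.sumCongr_apply, Sum.map_inl,
            Equiv.symm_apply_apply]
          rfl
        · rcases hb : finProdFinEquiv.symm b with ⟨j, a⟩
          obtain rfl : b = finProdFinEquiv (j, a) := by rw [← hb, Equiv.apply_symm_apply]
          apply Fin.ext
          simp only [row, col, Equiv.trans_apply, Equiv.sumCongr_apply, Sum.map_inr,
            Equiv.symm_apply_apply]
          change dim V * 2 + ((a : ℕ) + 2 * (j : ℕ)) = (a : ℕ) + 2 * (dim V + (j : ℕ))
          ring
      have hur : ∀ a : Fin (dim V * 2), (u ∘ Fin.cast hcast.symm) (row (Sum.inl a))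
          = precomp subMap (ℓ a) := fun a => by
        change u (Fin.castAdd _ a) = _
        rw [hu, Fin.append_left]
        rfl
      have hur' : ∀ a : Fin (dim V * 2), (u ∘ Fin.cast hcast.symm) (row (Sum.inr a)) = w a :=
          fun a => by
        change u (Fin.natAdd _ a) = _
        rw [hu, Fin.append_right]
      set A : Matrix (Fin (dim V * 2)) (Fin (dim V * 2)) ℂ := Matrix.of fun a b => ℓ a (realFrame b)
      set W₁ : Matrix (Fin (dim V * 2)) (Fin (dim V * 2)) ℂ :=
        Matrix.of fun a b => w a (realFrame b, 0)
      set W₂ : Matrix (Fin (dim V * 2)) (Fin (dim V * 2)) ℂ :=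
        Matrix.of fun a b => w a (0, realFrame b)
      have h2 : (Matrix.of fun a b => (u ∘ Fin.cast hcast.symm) a (realFrame b : V × V)).submatrix
          row row = Matrix.fromBlocks A (-A) W₁ W₂ := by
        ext a b
        rw [Matrix.submatrix_apply, Matrix.of_apply, hrc b]
        rcases a with a | a <;> rcases b with b | b
        · rw [hur, hcl]
          change ℓ a (realFrame b - 0) = _
          rw [sub_zero]
          rfl
        · rw [hur, hcr]
          change ℓ a (0 - realFrame b) = _
          rw [zero_sub, map_neg]
          rfl
        · rw [hur', hcl]
          rfl
        · rw [hur', hcr]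
          rfl
      have h3 : (Matrix.fromBlocks A (-A) W₁ W₂ * Matrix.fromBlocks 1 1 0 1)
          = Matrix.fromBlocks A 0 W₁ (W₁ + W₂) := by
        rw [Matrix.fromBlocks_multiply]
        congr 1 <;> simp
      have h4 : (Matrix.fromBlocks A (-A) W₁ W₂).det = A.det * (W₁ + W₂).det := by
        rw [← Matrix.det_fromBlocks_zero₁₂, ← h3, Matrix.det_mul, Matrix.det_fromBlocks_zero₂₁,
          Matrix.det_one, mul_one, mul_one]
      rw [← Matrix.det_submatrix_equiv_self row, h2, h4]
      congr 2
      ext a b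
      change w a (realFrame b, 0) + w a (0, realFrame b) = w a (realFrame b, realFrame b)
      rw [← map_add, Prod.mk_add_mk, add_zero, zero_add]
    · rw [topCoeff_ιMulti_of_ne hm, mul_zero]
      refine topCoeff_ιMulti_of_ne (fun h => hm ?_) _
      rw [hdim] at h
      omega
  exact LinearMap.congr_fun h φ

end Product

/-! ### Local integrability and integration of forms in charts -/

section IntAt

variable {V : Type*} [NormedAddCommGroup V] [NormedSpace ℂ V] [FiniteDimensional ℂ V]
  [MeasureSpace V] [BorelSpace V] [(volume : Measure V).IsAddHaarMeasure]
  {A : Type*} [AddCommGroup A] [Module ℂ A] [Module.Finite ℂ A]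
  {B : Type*} [AddCommGroup B] [Module ℂ B] [Module.Finite ℂ B]
  {C : Type*} [AddCommGroup C] [Module ℂ C] [Module.Finite ℂ C]

/-- Integrability near a point of a map into a finite-dimensional complex vector space. -/
def IntAt (f : V → A) (x : V) : Prop :=
  ∀ ℓ : Dual ℂ A, IntegrableAtFilter (fun y => ℓ (f y)) (𝓝 x) volume

theorem SmoothAt.eventually_continuousAt {f : V → A} {x : V} (hf : SmoothAt f x) (ℓ : Dual ℂ A) :
    ∀ᶠ y in 𝓝 x, ContinuousAt (fun z => ℓ (f z)) y := by
  have h : ContDiffAt ℝ 1 (fun z => ℓ (f z)) x := (hf ℓ).of_le (by exact_mod_cast le_top)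
  exact (h.eventually (by simp)).mono fun y hy => hy.continuousAt

/-- The product of a function that is integrable near `x` and one that is continuous near `x`. -/
theorem integrableAtFilter_mul {f g : V → ℂ} {x : V} (hf : IntegrableAtFilter f (𝓝 x) volume)
    (hg : ∀ᶠ y in 𝓝 x, ContinuousAt g y) :
    IntegrableAtFilter (fun y => f y * g y) (𝓝 x) volume := by
  have := FiniteDimensional.proper ℂ V
  obtain ⟨s, hs, hfs⟩ := hf
  obtain ⟨K, hK, hKs, hKc⟩ := local_compact_nhds (Filter.inter_mem hs hg)
  exact ⟨K, hK, (hfs.mono_set fun y hy => (hKs hy).1).mul_continuousOn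
    (fun y hy => (hKs hy).2.continuousWithinAt) hKc⟩

theorem integrableAtFilter_of_continuous {g : V → ℂ} {x : V}
    (hg : ∀ᶠ y in 𝓝 x, ContinuousAt g y) : IntegrableAtFilter g (𝓝 x) volume := by
  have h : IntegrableAtFilter (fun _ : V => (1 : ℂ)) (𝓝 x) volume :=
    Measure.FiniteAtFilter.integrableAtFilter_of_tendsto
      (stronglyMeasurable_const.stronglyMeasurableAtFilter) (Measure.finiteAt_nhds _ _)
      tendsto_const_nhds
  simpa using integrableAtFilter_mul h hg

theorem integrableAtFilter_sum {ι : Type*} {s : Finset ι} {f : ι → V → ℂ} {x : V}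
    (h : ∀ i ∈ s, IntegrableAtFilter (f i) (𝓝 x) volume) :
    IntegrableAtFilter (fun y => ∑ i ∈ s, f i y) (𝓝 x) volume := by
  classical
  induction s using Finset.induction_on with
  | empty =>
    exact integrableAtFilter_of_continuous (Filter.Eventually.of_forall fun _ => by
      simpa using continuousAt_const)
  | insert i s hi ih =>
    simp only [Finset.sum_insert hi]
    exact (h i (Finset.mem_insert_self _ _)).add
      (ih fun j hj => h j (Finset.mem_insert_of_mem hj))

theorem SmoothAt.intAt {f : V → A} {x : V} (hf : SmoothAt f x) : IntAt f x := fun ℓ =>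
  integrableAtFilter_of_continuous (hf.eventually_continuousAt ℓ)

/-- Integrability near a point only depends on the values almost everywhere. -/
theorem IntAt.congr_ae {f g : V → A} {x : V} (hf : IntAt f x) {s : Set V} (hs : s ∈ 𝓝 x)
    {N : Set V} (hN : volume N = 0) (h : ∀ y ∈ s, y ∉ N → f y = g y) : IntAt g x := fun ℓ => by
  obtain ⟨t, ht, hft⟩ := hf ℓ
  obtain ⟨u, hu, huo, hxu⟩ := mem_nhds_iff.1 hs
  refine ⟨t ∩ u, Filter.inter_mem ht (huo.mem_nhds hxu), ?_⟩
  refine (hft.mono_set Set.inter_subset_left).congr ?_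
  refine (ae_restrict_of_ae_restrict_of_subset Set.inter_subset_right ?_)
  rw [ae_restrict_iff' huo.measurableSet]
  have : ∀ᵐ y ∂(volume : Measure V), y ∉ N := measure_eq_zero_iff_ae_notMem.1 hN
  filter_upwards [this] with y hy hyu
  rw [h y (hu hyu) hy]

theorem IntAt.bilinear {L : A →ₗ[ℂ] B →ₗ[ℂ] C} {f : V → A} {g : V → B} {x : V}
    (hf : IntAt f x) (hg : SmoothAt g x) : IntAt (fun y => L (f y) (g y)) x := fun ℓ => by
  have : (fun y => ℓ (L (f y) (g y))) = fun y =>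
      ∑ i, (finBasis ℂ A).repr (f y) i * ℓ (L (finBasis ℂ A i) (g y)) := by
    funext y
    conv_lhs => rw [← (finBasis ℂ A).sum_repr (f y)]
    simp only [map_sum, map_smul, LinearMap.sum_apply, LinearMap.smul_apply, smul_eq_mul]
  rw [this]
  exact integrableAtFilter_sum fun i _ => integrableAtFilter_mul
    (hf ((finBasis ℂ A).coord i))
    (hg.eventually_continuousAt (ℓ ∘ₗ L (finBasis ℂ A i)))

theorem IntAt.mul {R : Type*} [Ring R] [Algebra ℂ R] [Module.Finite ℂ R] {f g : V → R} {x : V}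
    (hf : IntAt f x) (hg : SmoothAt g x) : IntAt (fun y => f y * g y) x :=
  IntAt.bilinear (L := LinearMap.mul ℂ R) hf hg

end IntAt

section Charts

variable {V : Type*} [NormedAddCommGroup V] [NormedSpace ℂ V]
  {H : Type*} [TopologicalSpace H] {I : ModelWithCorners ℂ V H}
  {M : Type*} [TopologicalSpace M] [ChartedSpace H M] [I.Boundaryless]

theorem target_open (c : M) : IsOpen (extChartAt I c).target := isOpen_extChartAt_target c

/-- The part of the chart at `c` that is also covered by the chart at `c'`. -/
def overlap (I : ModelWithCorners ℂ V H) (c c' : M) : Set V :=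
  (extChartAt I c).target ∩ (extChartAt I c).symm ⁻¹' (extChartAt I c').source

theorem overlap_open (c c' : M) : IsOpen (overlap I c c') :=
  (continuousOn_extChartAt_symm c).isOpen_inter_preimage (target_open c)
    (isOpen_extChartAt_source c')

theorem locRep_locRep {c c' : M} {x : V} (hx : x ∈ overlap I c c') :
    locRep I I id c' c (locRep I I id c c' x) = x := by
  change extChartAt I c ((extChartAt I c').symm (extChartAt I c' ((extChartAt I c).symm x))) = x
  rw [(extChartAt I c').left_inv hx.2, (extChartAt I c).right_inv hx.1]

theorem locRep_mem_overlap {c c' : M} {x : V} (hx : x ∈ overlap I c c') :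
    locRep I I id c c' x ∈ overlap I c' c := by
  refine ⟨(extChartAt I c').map_source hx.2, ?_⟩
  change (extChartAt I c').symm (extChartAt I c' ((extChartAt I c).symm x)) ∈
    (extChartAt I c).source
  rw [(extChartAt I c').left_inv hx.2]
  exact (extChartAt I c).map_target hx.1

theorem locRep_injOn (c c' : M) : Set.InjOn (locRep I I id c c') (overlap I c c') :=
  fun x hx y hy h => by
    rw [← locRep_locRep hx, h, locRep_locRep hy]

theorem locRep_image (c c' : M) : locRep I I id c c' '' overlap I c c' = overlap I c' c := by
  refine Set.Subset.antisymm ?_ fun y hy => ⟨_, locRep_mem_overlap hy, locRep_locRep hy⟩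
  rintro _ ⟨x, hx, rfl⟩
  exact locRep_mem_overlap hx

theorem localForm_eq_zero {α : Form V M} {c : M} {x : V} (h : α ((extChartAt I c).symm x) = 0) :
    localForm I α c x = 0 := by
  change map _ (α _) = 0
  rw [h, map_zero]

theorem localForm_mul (α β : Form V M) (c : M) (x : V) :
    localForm I (fun p => α p * β p) c x = localForm I α c x * localForm I β c x :=
  map_mul _ _ _

theorem localForm_add (α β : Form V M) (c : M) (x : V) :
    localForm I (fun p => α p + β p) c x = localForm I α c x + localForm I β c x :=
  map_add _ _ _

variable [IsManifold I ω M]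

theorem contDiffAt_locRep_overlap {c c' : M} {x : V} (hx : x ∈ overlap I c c') :
    ContDiffAt ℂ ω (locRep I I id c c') x :=
  contDiffAt_locRep contMDiff_id hx.1 hx.2

theorem hasFDerivAt_locRep {c c' : M} {x : V} (hx : x ∈ overlap I c c') :
    HasFDerivAt (locRep I I id c c')
      ((fderiv ℂ (locRep I I id c c') x).restrictScalars ℝ) x :=
  (((contDiffAt_locRep_overlap hx).differentiableAt (by simp)).hasFDerivAt).restrictScalars ℝ

theorem det_fderiv_locRep_ne_zero {c c' : M} {x : V} (hx : x ∈ overlap I c c') :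
    LinearMap.det (reL (fderiv ℂ (locRep I I id c c') x)) ≠ 0 := by
  have h1 : fderiv ℂ (locRep I I id c' c ∘ locRep I I id c c') x = ContinuousLinearMap.id ℂ V := by
    rw [← fderiv_id (𝕜 := ℂ) (x := x)]
    refine Filter.EventuallyEq.fderiv_eq ?_
    filter_upwards [(overlap_open c c').mem_nhds hx] with y hy using locRep_locRep hy
  rw [fderiv_comp x ((contDiffAt_locRep_overlap (locRep_mem_overlap hx)).differentiableAt (by simp))
    ((contDiffAt_locRep_overlap hx).differentiableAt (by simp))] at h1
  intro h
  have h2 : LinearMap.det (reL (fderiv ℂ (locRep I I id c' c) (locRep I I id c c' x)) ∘ₗ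
      reL (fderiv ℂ (locRep I I id c c') x)) = 1 := by
    rw [← LinearMap.det_id (A := ℝ) (M := V)]
    congr 1
    ext v
    exact DFunLike.congr_fun h1 v
  rw [LinearMap.det_comp, h, mul_zero] at h2
  exact zero_ne_one h2

variable [FiniteDimensional ℂ V] [ComplexCoords V]
  [MeasureSpace V] [BorelSpace V] [(volume : Measure V).IsAddHaarMeasure]

theorem abs_det_fderiv_locRep (c c' : M) (x : V) :
    |((fderiv ℂ (locRep I I id c c') x).restrictScalars ℝ).det|
      = LinearMap.det (reL (fderiv ℂ (locRep I I id c c') x)) := by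
  refine abs_of_nonneg ?_
  refine le_of_le_of_eq ?_ (det_reL_nonneg (fderiv ℂ (locRep I I id c c') x)).symm
  positivity

theorem integrableAtFilter_comp_locRep {c c' : M} {x : V} (hx : x ∈ overlap I c c') {g : V → ℂ}
    (hg : IntegrableAtFilter g (𝓝 (locRep I I id c c' x)) volume) :
    IntegrableAtFilter (fun y => g (locRep I I id c c' y)) (𝓝 x) volume := by
  obtain ⟨s, hs, hgs⟩ := hg
  have hx' := locRep_mem_overlap hx
  obtain ⟨u, hu, huo, hxu⟩ := mem_nhds_iff.1
    (Filter.inter_mem hs ((overlap_open c' c).mem_nhds hx'))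
  set t := overlap I c c' ∩ locRep I I id c c' ⁻¹' u with ht
  have hto : IsOpen t := ContinuousOn.isOpen_inter_preimage
    (fun y hy => (hasFDerivAt_locRep hy).continuousAt.continuousWithinAt) (overlap_open c c') huo
  have him : locRep I I id c c' '' t = u := by
    refine Set.Subset.antisymm (by rintro _ ⟨y, hy, rfl⟩; exact hy.2) fun y hy => ?_
    exact ⟨_, ⟨locRep_mem_overlap (hu hy).2, by
      rw [Set.mem_preimage, locRep_locRep (hu hy).2]; exact hy⟩, locRep_locRep (hu hy).2⟩
  have h1 : IntegrableOn g (locRep I I id c c' '' t) volume := by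
    rw [him]
    exact hgs.mono_set fun y hy => (hu hy).1
  rw [integrableOn_image_iff_integrableOn_abs_det_fderiv_smul volume hto.measurableSet
    (fun y hy => (hasFDerivAt_locRep hy.1).hasFDerivWithinAt)
    ((locRep_injOn c c').mono fun y hy => hy.1)] at h1
  simp only [abs_det_fderiv_locRep] at h1
  have h2 : ∀ᶠ y in 𝓝 x, ContinuousAt
      (fun y => ((LinearMap.det (reL (fderiv ℂ (locRep I I id c c') y)) : ℝ) : ℂ)⁻¹) y := by
    filter_upwards [(overlap_open c c').mem_nhds hx] with y hy
    refine ContinuousAt.inv₀ ?_ (by exact_mod_cast det_fderiv_locRep_ne_zero hy)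
    refine Complex.continuous_ofReal.continuousAt.comp ?_
    have h3 : ContinuousAt (fderiv ℂ (locRep I I id c c')) y :=
      (contDiffAt_real_fderiv (contDiffAt_locRep_overlap hy)).continuousAt
    have h4 : (fun D : V →L[ℂ] V => LinearMap.det (reL D))
        = fun D : V →L[ℂ] V => (D.restrictScalars ℝ).det := rfl
    have h5 : Continuous fun D : V →L[ℂ] V => LinearMap.det (reL D) := by
      rw [h4]
      exact ContinuousLinearMap.continuous_det.comp
        (ContinuousLinearMap.continuous_restrictScalars ℝ)
    exact h5.continuousAt.comp h3
  have h3 := integrableAtFilter_mul ⟨t, hto.mem_nhds ⟨hx, hxu⟩, h1⟩ h2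
  obtain ⟨w, hw, hgw⟩ := h3
  obtain ⟨w', hw', hwo, hxw⟩ := mem_nhds_iff.1
    (Filter.inter_mem hw ((overlap_open c c').mem_nhds hx))
  refine ⟨w', hwo.mem_nhds hxw, (hgw.mono_set fun y hy => (hw' hy).1).congr_fun
    (fun y hy => ?_) hwo.measurableSet⟩
  have h6 : ((LinearMap.det (reL (fderiv ℂ (locRep I I id c c') y)) : ℝ) : ℂ) ≠ 0 := by
    exact_mod_cast det_fderiv_locRep_ne_zero (hw' hy).2
  change _ • g _ * _ = g _
  rw [Complex.real_smul, mul_comm, ← mul_assoc, inv_mul_cancel₀ h6, one_mul]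

theorem locIntForm_iff {α : Form V M} : LocIntForm I α ↔
    ∀ c, ∀ x ∈ (extChartAt I c).target, IntAt (localForm I α c) x := by
  refine forall_congr' fun c => ⟨fun h x hx ℓ => ?_, fun h ℓ x hx => ?_⟩
  · have := h ℓ x hx
    rwa [(target_open c).nhdsWithin_eq hx] at this
  · rw [(target_open c).nhdsWithin_eq hx]
    exact h x hx ℓ

theorem intAt_localForm_change {α : Form V M} {c c' : M} {x : V} (hx : x ∈ overlap I c c')
    (h : IntAt (localForm I α c') (locRep I I id c c' x)) : IntAt (localForm I α c) x := by
  intro ℓ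
  set b := finBasis ℂ (ExteriorAlgebra ℂ (V →ₗ[ℝ] ℂ))
  have h1 : IntegrableAtFilter (fun y => ∑ i, b.repr (localForm I α c' (locRep I I id c c' y)) i *
      ℓ (map (precomp (reL (fderiv ℂ (locRep I I id c c') y))) (b i)))
      (𝓝 x) volume := by
    refine integrableAtFilter_sum fun i _ => integrableAtFilter_mul
      (integrableAtFilter_comp_locRep hx (h (b.coord i))) ?_
    refine SmoothAt.eventually_continuousAt (smoothAt_map (fun w => ?_) (b i)) ℓ
    exact smoothAt_realLinear (precompL w) (contDiffAt_real_fderiv (contDiffAt_locRep_overlap hx))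
  obtain ⟨s, hs, hi⟩ := h1
  obtain ⟨u, hu, huo, hxu⟩ := mem_nhds_iff.1
    (Filter.inter_mem hs ((overlap_open c c').mem_nhds hx))
  refine ⟨u, huo.mem_nhds hxu, (hi.mono_set fun y hy => (hu hy).1).congr_fun (fun y hy => ?_)
    huo.measurableSet⟩
  rw [localForm_change α (hu hy).2.1 (hu hy).2.2]
  conv_rhs => rw [← b.sum_repr (localForm I α c' (locRep I I id c c' y))]
  simp only [map_sum, map_smul, smul_eq_mul]

/-- Local integrability can be checked in one chart around each point. -/
theorem locIntForm_of_forall {α : Form V M}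
    (h : ∀ p, ∃ c, p ∈ (extChartAt I c).source ∧ IntAt (localForm I α c) (extChartAt I c p)) :
    LocIntForm I α := by
  refine locIntForm_iff.2 fun c x hx => ?_
  obtain ⟨c', hc', hi⟩ := h ((extChartAt I c).symm x)
  exact intAt_localForm_change ⟨hx, hc'⟩ hi

theorem LocIntForm.mul {α β : Form V M} (hα : LocIntForm I α) (hβ : SmoothForm I β) :
    LocIntForm I fun p => α p * β p :=
  locIntForm_iff.2 fun c x hx => by
    have h := (locIntForm_iff.1 hα c x hx).mul (smoothForm_iff.1 hβ c x hx)
    simp only [← localForm_mul] at h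
    exact h

theorem SmoothForm.locIntForm {α : Form V M} (hα : SmoothForm I α) : LocIntForm I α :=
  locIntForm_iff.2 fun c x hx => (smoothForm_iff.1 hα c x hx).intAt

/-- In a chart, a locally integrable form with compact support inside the domain of the chart has
an integrable top coefficient. -/
theorem integrableOn_topCoeff {α : Form V M} (hα : LocIntForm I α) {c : M} {K : Set M}
    (hK : IsCompact K) (hKc : K ⊆ (extChartAt I c).source) {w : M → ℂ} (hw : Continuous w)
    (h0 : ∀ p ∉ K, w p = 0 ∨ α p = 0) :
    IntegrableOn (fun x => w ((extChartAt I c).symm x) * topCoeff (localForm I α c x))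
      (extChartAt I c).target volume := by
  have := FiniteDimensional.proper ℂ V
  have hK' : IsCompact (extChartAt I c '' K) :=
    hK.image_of_continuousOn ((continuousOn_extChartAt c).mono hKc)
  have hsub : extChartAt I c '' K ⊆ (extChartAt I c).target := by
    rintro _ ⟨p, hp, rfl⟩
    exact (extChartAt I c).map_source (hKc hp)
  have h1 : IntegrableOn (fun x => topCoeff (localForm I α c x)) (extChartAt I c '' K) volume :=
    (hα c topCoeff).integrableOn_compact_subset hsub hK'
  have h2 := IntegrableOn.continuousOn_mul (g := fun x => w ((extChartAt I c).symm x))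
    (hw.comp_continuousOn ((continuousOn_extChartAt_symm c).mono hsub)) h1 hK'
  refine h2.of_forall_sdiff_eq_zero (target_open c).measurableSet fun x hx => ?_
  have hxK : (extChartAt I c).symm x ∉ K := fun h => hx.2
    ⟨_, h, (extChartAt I c).right_inv hx.1⟩
  rcases h0 _ hxK with h | h
  · rw [h, zero_mul]
  · rw [localForm_eq_zero h, map_zero, mul_zero]

end Charts

/-! ### The integral of a form over the manifold -/

section Integral

variable {V : Type*} [NormedAddCommGroup V] [NormedSpace ℂ V] [FiniteDimensional ℂ V]
  [ComplexCoords V]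
  [MeasureSpace V] [BorelSpace V] [(volume : Measure V).IsAddHaarMeasure]
  {H : Type*} [TopologicalSpace H] {I : ModelWithCorners ℂ V H} [I.Boundaryless]
  {M : Type*} [TopologicalSpace M] [ChartedSpace H M] [IsManifold I ω M]

/-- The chart integral does not depend on the chart, by the change of variables formula and
`|det_ℝ| = |det_ℂ|²`. -/
theorem setIntegral_topCoeff_change {α : Form V M} {c c' : M}
    (h0 : ∀ p, α p ≠ 0 → p ∈ (extChartAt I c).source ∧ p ∈ (extChartAt I c').source) :
    ∫ x in (extChartAt I c).target, topCoeff (localForm I α c x)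
      = ∫ x in (extChartAt I c').target, topCoeff (localForm I α c' x) := by
  have key : ∀ c c' : M,
      (∀ p, α p ≠ 0 → p ∈ (extChartAt I c).source ∧ p ∈ (extChartAt I c').source) →
      ∫ x in (extChartAt I c).target, topCoeff (localForm I α c x)
        = ∫ x in overlap I c c', topCoeff (localForm I α c x) := by
    intro c c' h0
    refine setIntegral_eq_of_subset_of_forall_sdiff_eq_zero (target_open c).measurableSet
      Set.inter_subset_left fun x hx => ?_
    have : α ((extChartAt I c).symm x) = 0 := by
      by_contra h
      exact hx.2 ⟨hx.1, (h0 _ h).2⟩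
    rw [localForm_eq_zero this, map_zero]
  rw [key c c' h0, key c' c fun p hp => (h0 p hp).symm, ← locRep_image c c',
    integral_image_eq_integral_abs_det_fderiv_smul volume (overlap_open c c').measurableSet
      (fun y hy => (hasFDerivAt_locRep hy).hasFDerivWithinAt) (locRep_injOn c c')]
  refine setIntegral_congr_fun (overlap_open c c').measurableSet fun x hx => ?_
  rw [localForm_change α hx.1 hx.2, topCoeff_map_precomp, abs_det_fderiv_locRep, Complex.real_smul]

variable [T2Space M] [SecondCountableTopology M]

theorem chartPartition_isSubordinate :
    (chartPartition (M := M) I).IsSubordinate fun c => (extChartAt I c).source :=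
  (exists_chartPartition (M := M) I).choose_spec

theorem exists_finset_chartPartition {K : Set M} (hK : IsCompact K) :
    ∃ T : Finset M, ∀ c ∉ T, ∀ p ∈ K, chartPartition I c p = 0 := by
  have h := (chartPartition (M := M) I).locallyFinite.finite_nonempty_inter_compact hK
  refine ⟨h.toFinset, fun c hc p hp => ?_⟩
  by_contra hne
  exact hc (h.mem_toFinset.2 ⟨p, hne, hp⟩)

theorem integralForm_eq_sum {K : Set M} {T : Finset M}
    (hT : ∀ c ∉ T, ∀ p ∈ K, chartPartition I c p = 0) {α : Form V M} (h0 : ∀ p ∉ K, α p = 0) :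
    integralForm I α = ∑ c ∈ T, ∫ x in (extChartAt I c).target,
      (chartPartition I c ((extChartAt I c).symm x) : ℂ) * topCoeff (localForm I α c x) := by
  refine finsum_eq_sum_of_support_subset _ fun c hc => ?_
  by_contra hcT
  refine hc (integral_eq_zero_of_ae (Filter.Eventually.of_forall fun x => ?_))
  change (chartPartition I c ((extChartAt I c).symm x) : ℂ) * topCoeff (localForm I α c x) = 0
  by_cases hx : (extChartAt I c).symm x ∈ K
  · rw [hT c hcT _ hx, Complex.ofReal_zero, zero_mul]
  · rw [localForm_eq_zero (h0 _ hx), map_zero, mul_zero]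

theorem continuous_chartPartition (c : M) :
    Continuous fun p => (chartPartition (M := M) I c p : ℂ) :=
  Complex.continuous_ofReal.comp (chartPartition (M := M) I c).continuous

theorem integrableOn_chartPartition_mul {α : Form V M} (hα : LocIntForm I α)
    (hc : HasCompactSupport α) (c : M) :
    IntegrableOn (fun x => (chartPartition I c ((extChartAt I c).symm x) : ℂ) *
      topCoeff (localForm I α c x)) (extChartAt I c).target volume := by
  refine integrableOn_topCoeff hα (K := tsupport (chartPartition (M := M) I c) ∩ tsupport α)
    (IsCompact.inter_left hc (isClosed_tsupport _))
    (fun p hp => chartPartition_isSubordinate c hp.1) (continuous_chartPartition c)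
    fun p hp => ?_
  by_cases h : p ∈ tsupport α
  · left
    rw [image_eq_zero_of_notMem_tsupport fun h' => hp ⟨h', h⟩, Complex.ofReal_zero]
  · exact Or.inr (image_eq_zero_of_notMem_tsupport h)

theorem integralForm_add {α β : Form V M} (hα : LocIntForm I α) (hβ : LocIntForm I β)
    (hα' : HasCompactSupport α) (hβ' : HasCompactSupport β) :
    integralForm I (fun p => α p + β p) = integralForm I α + integralForm I β := by
  obtain ⟨T, hT⟩ := exists_finset_chartPartition (I := I)
    (K := tsupport α ∪ tsupport β) (IsCompact.union hα' hβ')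
  have h0 : ∀ p ∉ tsupport α ∪ tsupport β, α p = 0 ∧ β p = 0 := fun p hp =>
    ⟨image_eq_zero_of_notMem_tsupport fun h => hp (Or.inl h),
      image_eq_zero_of_notMem_tsupport fun h => hp (Or.inr h)⟩
  rw [integralForm_eq_sum hT fun p hp => (h0 p hp).1,
    integralForm_eq_sum hT fun p hp => (h0 p hp).2, integralForm_eq_sum hT fun p hp => by
      rw [(h0 p hp).1, (h0 p hp).2, add_zero], ← Finset.sum_add_distrib]
  refine Finset.sum_congr rfl fun c _ => ?_
  rw [← integral_add (integrableOn_chartPartition_mul hα hα' c)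
    (integrableOn_chartPartition_mul hβ hβ' c)]
  congr 1
  funext x
  rw [localForm_add, map_add, mul_add]

theorem integralForm_zero : integralForm I (fun _ => 0 : Form V M) = 0 := by
  rw [integralForm_eq_sum (K := ∅) (T := ∅) (fun _ _ p hp => hp.elim) fun _ _ => rfl,
    Finset.sum_empty]

theorem integralForm_smul (a : ℂ) (α : Form V M) :
    integralForm I (fun p => a • α p) = a * integralForm I α := by
  rw [integralForm, integralForm, ← smul_eq_mul, smul_finsum]
  refine finsum_congr fun c => ?_
  rw [smul_eq_mul, ← integral_const_mul]
  congr 1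
  funext x
  have : localForm I (fun p => a • α p) c x = a • localForm I α c x := map_smul _ _ _
  rw [this, map_smul, smul_eq_mul]
  ring

/-- The integral of a form that is supported in the domain of a chart. -/
theorem integralForm_eq_setIntegral {α : Form V M} (hα : LocIntForm I α) {c : M} {K : Set M}
    (hK : IsCompact K) (hKc : K ⊆ (extChartAt I c).source) (h0 : ∀ p ∉ K, α p = 0) :
    integralForm I α = ∫ x in (extChartAt I c).target, topCoeff (localForm I α c x) := by
  obtain ⟨T, hT⟩ := exists_finset_chartPartition (I := I) hK
  have hsmul : ∀ (a c' : M) (x : V),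
      topCoeff (localForm I (fun p => (chartPartition I a p : ℂ) • α p) c' x)
        = (chartPartition I a ((extChartAt I c').symm x) : ℂ) * topCoeff (localForm I α c' x) := by
    intro a c' x
    have : localForm I (fun p => (chartPartition I a p : ℂ) • α p) c' x
      = (chartPartition I a ((extChartAt I c').symm x) : ℂ) • localForm I α c' x := map_smul _ _ _
    rw [this, map_smul, smul_eq_mul]
  rw [integralForm_eq_sum hT h0]
  have h1 : ∀ a ∈ T, ∫ x in (extChartAt I a).target,
      (chartPartition I a ((extChartAt I a).symm x) : ℂ) * topCoeff (localForm I α a x)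
      = ∫ x in (extChartAt I c).target,
        (chartPartition I a ((extChartAt I c).symm x) : ℂ) * topCoeff (localForm I α c x) := by
    intro a _
    have h2 := setIntegral_topCoeff_change (I := I) (c := a) (c' := c)
      (α := fun p => (chartPartition I a p : ℂ) • α p) fun p hp => by
        refine ⟨chartPartition_isSubordinate a (subset_closure ?_), hKc ?_⟩
        · intro h
          exact hp (by rw [h, Complex.ofReal_zero, zero_smul])
        · by_contra h
          exact hp (by rw [h0 p h, smul_zero])
    simpa only [hsmul] using h2
  rw [Finset.sum_congr rfl h1, ← integral_finsetSum]
  · refine setIntegral_congr_fun (target_open c).measurableSet fun x hx => ?_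
    change ∑ a ∈ T, _ * topCoeff _ = topCoeff _
    rw [← Finset.sum_mul]
    by_cases h : (extChartAt I c).symm x ∈ K
    · have h3 : ∑ a ∈ T, chartPartition I a ((extChartAt I c).symm x) = 1 := by
        rw [← (chartPartition (M := M) I).sum_eq_one (Set.mem_univ ((extChartAt I c).symm x))]
        refine (finsum_eq_sum_of_support_subset _ fun a ha => ?_).symm
        by_contra haT
        exact ha (hT a haT _ h)
      rw [← Complex.ofReal_sum, h3, Complex.ofReal_one, one_mul]
    · rw [localForm_eq_zero (h0 _ h), map_zero, mul_zero]
  · intro a _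
    exact integrableOn_topCoeff hα hK hKc (continuous_chartPartition a) fun p hp =>
      Or.inr (h0 p hp)

end Integral

section Stokes

variable {V : Type*} [NormedAddCommGroup V] [NormedSpace ℂ V] [FiniteDimensional ℂ V]
  [ComplexCoords V]
  [MeasureSpace V] [BorelSpace V] [(volume : Measure V).IsAddHaarMeasure]

theorem integral_fderiv_eq_zero {φ : V → ℂ} (hφ : ∀ x, ContDiffAt ℝ ∞ φ x)
    (hc : HasCompactSupport φ) (v : V) :
    Integrable (fun x => fderiv ℝ φ x v) volume ∧ ∫ x, fderiv ℝ φ x v = 0 := by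
  have h1 : ContDiff ℝ ∞ φ := contDiff_iff_contDiffAt.2 hφ
  have h2 : Integrable (fun x => fderiv ℝ φ x v) volume :=
    ((h1.continuous_fderiv (by simp)).clm_apply continuous_const).integrable_of_hasCompactSupport
      ((hc.fderiv (𝕜 := ℝ)).mono fun x hx h => hx (by simp only [h]; rfl))
  have h3 := integral_mul_fderiv_eq_neg_fderiv_mul_of_integrable (𝕜 := ℂ) (μ := volume)
    (f := fun _ : V => (1 : ℂ)) (g := φ) (v := v) (by simp) (by simpa using h2)
    (by simpa using h1.continuous.integrable_of_hasCompactSupport hc)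
    (fun x _ => differentiableAt_const _) (fun x _ => (hφ x).differentiableAt (by simp))
  exact ⟨h2, by simpa using h3⟩

/-- Stokes' theorem for compactly supported forms on the model space. -/
theorem integral_topCoeff_dbarFlat {F : V → ExteriorAlgebra ℂ (V →ₗ[ℝ] ℂ)}
    (hF : ∀ x, SmoothAt F x) (hc : HasCompactSupport F) :
    ∫ x, topCoeff (dbarFlat (ι ℂ) F x) = 0 := by
  set L : Fin (dim V) → Dual ℂ (ExteriorAlgebra ℂ (V →ₗ[ℝ] ℂ)) := fun j =>
    topCoeff ∘ₗ LinearMap.mulLeft ℂ (ι ℂ (dzbar j : V →ₗ[ℝ] ℂ)) with hL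
  have hLc : ∀ j, HasCompactSupport fun x => L j (F x) := fun j =>
    hc.comp_left (g := L j) (map_zero _)
  have hi := fun j v => integral_fderiv_eq_zero (fun x => hF x (L j)) (hLc j) v
  have h1 : ∀ x, topCoeff (dbarFlat (ι ℂ) F x)
      = ∑ j, (1 / 2 : ℂ) * (fderiv ℝ (fun y => L j (F y)) x (basis j)
        + Complex.I * fderiv ℝ (fun y => L j (F y)) x (Complex.I • basis j)) := by
    intro x
    rw [dbarFlat, map_sum]
    refine Finset.sum_congr rfl fun j _ => ?_
    change L j (dirDzbar F x j) = _
    rw [dirDzbar, map_smul, map_add, map_smul, dual_dirDeriv (hF x), dual_dirDeriv (hF x)]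
    rfl
  simp only [h1]
  rw [integral_finsetSum]
  · refine Finset.sum_eq_zero fun j _ => ?_
    rw [integral_const_mul, integral_add (hi j _).1 ((hi j _).1.const_mul _), integral_const_mul,
      (hi j _).2, (hi j _).2]
    simp
  · exact fun j _ => (((hi j _).1.add ((hi j _).1.const_mul _)).const_mul _)

end Stokes

/-! ### Localization of identities between currents -/

section Localization

variable {V : Type*} [NormedAddCommGroup V] [NormedSpace ℂ V] [FiniteDimensional ℂ V]
  [ComplexCoords V]
  {H : Type*} [TopologicalSpace H] {I : ModelWithCorners ℂ V H} [I.Boundaryless]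
  {M : Type*} [TopologicalSpace M] [ChartedSpace H M] [IsManifold I ω M]

theorem smoothForm_add {α β : Form V M} (hα : SmoothForm I α) (hβ : SmoothForm I β) :
    SmoothForm I fun p => α p + β p := smoothForm_iff.2 fun c x hx => by
  have h := (smoothForm_iff.1 hα c x hx).add (smoothForm_iff.1 hβ c x hx)
  simp only [← localForm_add] at h
  exact h

theorem smoothForm_mul {α β : Form V M} (hα : SmoothForm I α) (hβ : SmoothForm I β) :
    SmoothForm I fun p => α p * β p := smoothForm_iff.2 fun c x hx => by
  have h := (smoothForm_iff.1 hα c x hx).mul (smoothForm_iff.1 hβ c x hx)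
  simp only [← localForm_mul] at h
  exact h

theorem smoothForm_dbarForm {α : Form V M} (hα : SmoothForm I α) :
    SmoothForm I (dbarForm I α) := smoothForm_iff.2 fun c x hx => by
  refine ((smoothForm_iff.1 hα c x hx).dbarFlat (c := ι ℂ)).congr ?_
  filter_upwards [(target_open c).mem_nhds hx] with y hy
  exact localForm_dbarForm hy (smoothForm_iff.1 hα c y hy)

theorem dbarForm_add {α β : Form V M} (hα : SmoothForm I α) (hβ : SmoothForm I β) :
    dbarForm I (fun p => α p + β p) = fun p => dbarForm I α p + dbarForm I β p := by
  funext p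
  have h : localForm I (fun p => α p + β p) p
      = fun x => localForm I α p x + localForm I β p x := funext fun x => localForm_add α β p x
  rw [dbarForm, h]
  exact dbarFlat_add (smoothForm_iff.1 hα p _ (mem_extChartAt_target p))
    (smoothForm_iff.1 hβ p _ (mem_extChartAt_target p))

theorem localForm_eventually_zero {α : Form V M} {c : M} {x : V}
    (hx : x ∈ (extChartAt I c).target) (h : (extChartAt I c).symm x ∉ tsupport α) :
    localForm I α c =ᶠ[𝓝 x] fun _ => 0 := by
  have h1 : (tsupport α)ᶜ ∈ 𝓝 ((extChartAt I c).symm x) :=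
    (isClosed_tsupport α).isOpen_compl.mem_nhds h
  filter_upwards [(continuousAt_symm_chart hx).preimage_mem_nhds h1] with y hy
  exact localForm_eq_zero (image_eq_zero_of_notMem_tsupport hy)

theorem dbarForm_eq_zero {α : Form V M} {p : M} (h : p ∉ tsupport α) : dbarForm I α p = 0 := by
  have h1 := localForm_eventually_zero (I := I) (mem_extChartAt_target p)
    (by rwa [(extChartAt I p).left_inv (mem_extChartAt_source p)])
  rw [dbarForm, dbarFlat_congr h1, dbarFlat_const]

theorem tsupport_dbarForm_subset (α : Form V M) : tsupport (dbarForm I α) ⊆ tsupport α :=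
  closure_minimal (fun _ hp => by_contra fun h => hp (dbarForm_eq_zero h)) (isClosed_tsupport α)

theorem TestForm.dbar {α : Form V M} (hα : TestForm I α) : TestForm I (dbarForm I α) :=
  ⟨smoothForm_dbarForm hα.1, hα.2.mono' (subset_closure.trans (tsupport_dbarForm_subset α))⟩

/-- A smooth function supported in a given neighbourhood of a point and equal to one near it,
acting on test forms by multiplication. -/
theorem exists_cutoff [T2Space M] (p : M) {U : Set M} (hU : U ∈ 𝓝 p) :
    ∃ χ : M → ℂ, tsupport χ ⊆ U ∧ (∀ᶠ q in 𝓝 p, χ q = 1) ∧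
      ∀ α : Form V M, SmoothForm I α → SmoothForm I fun q => χ q • α q := by
  classical
  set a := extChartAt I p p
  have hW : (extChartAt I p).target ∩ (extChartAt I p).symm ⁻¹' U ∈ 𝓝 a := by
    refine Filter.inter_mem (extChartAt_target_mem_nhds p) ?_
    refine (continuousAt_symm_chart (mem_extChartAt_target p)).preimage_mem_nhds ?_
    rwa [(extChartAt I p).left_inv (mem_extChartAt_source p)]
  obtain ⟨r, hr, hrW⟩ := Metric.nhds_basis_closedBall.mem_iff.1 hW
  have := FiniteDimensional.proper ℂ V
  let b : ContDiffBump a := ⟨r / 2, r, by positivity, by linarith⟩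
  have hbs : ∀ x, (b x : ℝ) ≠ 0 → x ∈ Metric.closedBall a r := fun x hx =>
    Metric.ball_subset_closedBall (b.support_eq ▸ (show x ∈ Function.support b from hx))
  let χ : M → ℂ := fun q => if q ∈ (extChartAt I p).source then (b (extChartAt I p q) : ℂ) else 0
  set K := (extChartAt I p).symm '' Metric.closedBall a r
  have hK : IsCompact K := (isCompact_closedBall a r).image_of_continuousOn
    ((continuousOn_extChartAt_symm p).mono fun x hx => (hrW hx).1)
  have hχK : ∀ q, q ∉ K → χ q = 0 := by
    intro q hq
    by_cases hs : q ∈ (extChartAt I p).source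
    · change (if _ then _ else _) = _
      rw [if_pos hs]
      by_contra h
      exact hq ⟨_, hbs _ fun h' => h (by rw [h', Complex.ofReal_zero]),
        (extChartAt I p).left_inv hs⟩
    · exact if_neg hs
  have hKs : K ⊆ (extChartAt I p).source := by
    rintro _ ⟨x, hx, rfl⟩
    exact (extChartAt I p).map_target (hrW hx).1
  have hχs : tsupport χ ⊆ K :=
    closure_minimal (fun q hq => by_contra fun h => hq (hχK q h)) hK.isClosed
  refine ⟨χ, hχs.trans ?_, ?_, fun α hα => smoothForm_of_forall fun q => ?_⟩
  · rintro _ ⟨x, hx, rfl⟩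
    exact (hrW hx).2
  · have h1 : ∀ᶠ q in 𝓝 p, extChartAt I p q ∈ Metric.closedBall a (r / 2) :=
      (continuousAt_extChartAt p).preimage_mem_nhds
        (Metric.closedBall_mem_nhds _ (by positivity))
    filter_upwards [h1, extChartAt_source_mem_nhds (I := I) p] with q hq hs
    change (if _ then _ else _) = _
    rw [if_pos hs, b.one_of_mem_closedBall hq, Complex.ofReal_one]
  · by_cases hq : q ∈ K
    · refine ⟨p, hKs hq, ?_⟩
      have ht := (extChartAt I p).map_source (hKs hq)
      have h1 : SmoothAt (fun x => (b x : ℂ) • localForm I α p x) (extChartAt I p q) :=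
        SmoothAt.smul (Complex.ofRealCLM.contDiff.contDiffAt.comp _ b.contDiff.contDiffAt)
          (smoothForm_iff.1 hα p _ ht)
      refine h1.congr ?_
      filter_upwards [(target_open p).mem_nhds ht] with x hx
      have h2 : χ ((extChartAt I p).symm x) = (b x : ℂ) := by
        change (if _ then _ else _) = _
        rw [if_pos ((extChartAt I p).map_target hx), (extChartAt I p).right_inv hx]
      rw [← h2]
      exact map_smul _ _ _
    · refine ⟨q, mem_extChartAt_source q, (smoothAt_const 0 _).congr ?_⟩
      refine localForm_eventually_zero (mem_extChartAt_target q) ?_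
      rw [(extChartAt I q).left_inv (mem_extChartAt_source q)]
      refine fun h => hq (hχs (closure_mono ?_ h))
      exact fun y hy h => hy (by simp only [h, zero_smul])

/-- An additive property of test forms that holds locally holds globally. -/
theorem testForm_induction [T2Space M] {C : Form V M → Prop} (h0 : C fun _ => 0)
    (hadd : ∀ α β, TestForm I α → TestForm I β → C α → C β → C fun p => α p + β p)
    (hloc : ∀ p, ∃ U ∈ 𝓝 p, ∀ α, TestForm I α → tsupport α ⊆ U → C α) :
    ∀ α, TestForm I α → C α := by
  classical
  choose U hU hUC using hloc
  choose χ hχU hχ1 hχs using fun p => exists_cutoff (I := I) p (hU p)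
  -- induction on the set of cut-off functions that cover the support: `χ a • α` is supported in
  -- `U a`, and the support of `(1 - χ a) • α` avoids the points near which `χ a` is one
  have key : ∀ (T : Finset M) (α : Form V M), TestForm I α →
      (∀ q ∈ tsupport α, ∃ p ∈ T, ∀ᶠ y in 𝓝 q, χ p y = 1) → C α := by
    intro T
    induction T using Finset.induction_on with
    | empty =>
      intro α _ h
      have : α = fun _ => 0 := funext fun q => image_eq_zero_of_notMem_tsupport fun hq => by
        obtain ⟨p, hp, -⟩ := h q hq
        exact absurd hp (Finset.notMem_empty p)
      rw [this]
      exact h0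
    | insert a T _ ih =>
      intro α hα h
      have hs : tsupport (fun q => χ a q • α q) ⊆ tsupport α :=
        closure_mono fun q hq h => hq (by simp only [h, smul_zero])
      have h1 : TestForm I fun q => χ a q • α q :=
        ⟨hχs a α hα.1, hα.2.mono' (subset_closure.trans hs)⟩
      have h2e : (fun q => α q + (-1 : ℂ) • (χ a q • α q)) = fun q => (1 - χ a q) • α q := by
        funext q
        rw [sub_smul, one_smul, neg_one_smul, sub_eq_add_neg]
      have hs2 : tsupport (fun q => (1 - χ a q) • α q) ⊆ tsupport α :=
        closure_mono fun q hq h => hq (by simp only [h, smul_zero])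
      have h2 : TestForm I fun q => (1 - χ a q) • α q := by
        refine ⟨?_, hα.2.mono' (subset_closure.trans hs2)⟩
        rw [← h2e]
        refine smoothForm_add hα.1 (smoothForm_iff.2 fun c x hx => ?_)
        have h3 := (smoothForm_iff.1 h1.1 c x hx).const_smul (-1)
        refine h3.congr (Filter.Eventually.of_forall fun y => ?_)
        exact map_smul _ _ _
      have h3 : α = fun q => χ a q • α q + (1 - χ a q) • α q := by
        funext q
        rw [← add_smul, add_sub_cancel, one_smul]
      rw [h3]
      refine hadd _ _ h1 h2 (hUC a _ h1 (Set.Subset.trans (closure_mono ?_) (hχU a)))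
        (ih _ h2 fun q hq => ?_)
      · exact fun q hq h => hq (by simp only [h, zero_smul])
      · obtain ⟨p, hp, hpq⟩ := h q (hs2 hq)
        rcases Finset.mem_insert.1 hp with rfl | hp
        · exfalso
          have : ∀ᶠ y in 𝓝 q, (1 - χ p y) • α y = 0 :=
            hpq.mono fun y hy => by rw [hy, sub_self, zero_smul]
          exact (notMem_tsupport_iff_eventuallyEq.2 this) hq
        · exact ⟨p, hp, hpq⟩
  intro α hα
  obtain ⟨T, -, hT⟩ := hα.2.elim_nhds_subcover (fun p => {q | ∀ᶠ y in 𝓝 q, χ p y = 1})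
    fun p _ => eventually_eventually_nhds.2 (hχ1 p)
  refine key T α hα fun q hq => ?_
  simpa using hT hq

end Localization

/-! ### Singular integrals near the diagonal -/

section Analysis

variable {n : ℕ}

instance instIsAddHaarMeasureProd :
    (volume : Measure ((Fin n → ℂ) × (Fin n → ℂ))).IsAddHaarMeasure := by
  exact Measure.prod.instIsAddHaarMeasure (volume : Measure (Fin n → ℂ))
    (volume : Measure (Fin n → ℂ))

theorem finrank_real_pi : finrank ℝ (Fin n → ℂ) = 2 * n := by
  rw [finrank_real_of_complex, finrank_fin_fun]

theorem volume_diagonal (hn : 0 < n) :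
    volume {p : (Fin n → ℂ) × (Fin n → ℂ) | p.1 = p.2} = 0 := by
  let S : Submodule ℝ ((Fin n → ℂ) × (Fin n → ℂ)) := LinearMap.ker (subMap (V := Fin n → ℂ))
  have h : {p : (Fin n → ℂ) × (Fin n → ℂ) | p.1 = p.2} = S := by
    ext p
    exact sub_eq_zero.symm
  rw [h]
  refine Measure.addHaar_submodule _ S fun hS => ?_
  have h1 : ((fun _ => 1, 0) : (Fin n → ℂ) × (Fin n → ℂ)) ∈ S := hS ▸ Submodule.mem_top
  have h2 : (fun _ : Fin n => (1 : ℂ)) - 0 = 0 := h1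
  rw [sub_zero] at h2
  exact one_ne_zero (congr_fun h2 ⟨0, hn⟩)

/-- The singularities `|ζ - z|⁻ᵐ`, `m < 2n`, are integrable. -/
theorem integrableOn_norm_sub_pow {m : ℕ} (hm : m < 2 * n)
    {K : Set ((Fin n → ℂ) × (Fin n → ℂ))} (hK : IsCompact K) :
    IntegrableOn (fun p : (Fin n → ℂ) × (Fin n → ℂ) => (‖p.1 - p.2‖ ^ m)⁻¹) K volume := by
  obtain ⟨R, hR⟩ := hK.isBounded.exists_norm_le
  have h1 : LocallyIntegrable (fun x : Fin n → ℂ => (‖x‖ ^ m)⁻¹) volume := by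
    refine locallyIntegrable_of_norm_le_rpow (C := 1) (α := m)
      (by rw [finrank_real_pi]; omega) (by rw [finrank_real_pi]; exact_mod_cast hm)
      (Filter.Eventually.of_forall fun x => ?_) (by fun_prop)
    rw [Real.rpow_neg (norm_nonneg x), Real.rpow_natCast, one_mul, norm_inv, norm_pow, norm_norm]
  have h2 := (h1.integrableOn_isCompact
    (isCompact_closedBall (0 : Fin n → ℂ) (2 * R))).integrable_indicator
      measurableSet_closedBall
  have h3 : Integrable ((Metric.closedBall (0 : Fin n → ℂ) R).indicator fun _ => (1 : ℝ)) volume :=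
    (integrableOn_const measure_closedBall_lt_top.ne).integrable_indicator measurableSet_closedBall
  have h4 := (measurePreserving_prod_sub (volume : Measure (Fin n → ℂ))
    (volume : Measure (Fin n → ℂ))).integrable_comp_of_integrable (h3.mul_prod h2)
  refine (h4.integrableOn (s := K)).congr_fun (fun p hp => ?_) hK.measurableSet
  have hp1 : ‖p.1‖ ≤ R := (norm_fst_le p).trans (hR p hp)
  have hp2 : ‖p.2‖ ≤ R := (norm_snd_le p).trans (hR p hp)
  have h5 : ‖p.2 - p.1‖ ≤ 2 * R := (norm_sub_le _ _).trans (by linarith)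
  change Set.indicator _ _ p.1 * Set.indicator _ _ (p.2 - p.1) = _
  rw [Set.indicator_of_mem (by simpa using hp1), Set.indicator_of_mem (by simpa using h5),
    one_mul, norm_sub_rev]

/-- Dominated convergence for kernels of compact support with an integrable singularity along the
diagonal. -/
theorem tendsto_integral_of_singular {m : ℕ} (hm : m < 2 * n) {q : ℝ → _ → ℂ}
    {q₀ : (Fin n → ℂ) × (Fin n → ℂ) → ℂ} {K : Set ((Fin n → ℂ) × (Fin n → ℂ))}
    (hK : IsCompact K) {C : ℝ}
    (hq : ∀ ε, 0 ≤ ε → ContinuousOn (q ε) {p | p.1 ≠ p.2})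
    (hb : ∀ ε, 0 ≤ ε → ∀ p ∈ K, p.1 ≠ p.2 → ‖q ε p‖ ≤ C * (‖p.1 - p.2‖ ^ m)⁻¹)
    (h0 : ∀ ε, 0 ≤ ε → ∀ p ∉ K, q ε p = 0)
    (hl : ∀ p, p.1 ≠ p.2 → Filter.Tendsto (fun ε => q ε p) (𝓝[>] 0) (𝓝 (q₀ p))) :
    (∀ ε, 0 ≤ ε → Integrable (q ε) volume) ∧
      Filter.Tendsto (fun ε => ∫ p, q ε p) (𝓝[>] 0) (𝓝 (∫ p, q₀ p)) := by
  have hn : 0 < n := by omega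
  have hΔ : ∀ᵐ p : (Fin n → ℂ) × (Fin n → ℂ), p.1 ≠ p.2 :=
    measure_eq_zero_iff_ae_notMem.1 (volume_diagonal hn)
  have hopen : IsOpen {p : (Fin n → ℂ) × (Fin n → ℂ) | p.1 ≠ p.2} :=
    isOpen_ne_fun continuous_fst continuous_snd
  have hmeas : ∀ ε, 0 ≤ ε → AEStronglyMeasurable (q ε) volume := fun ε hε => by
    have h1 := (hq ε hε).aestronglyMeasurable (μ := volume) hopen.measurableSet
    have h2 : (volume : Measure ((Fin n → ℂ) × (Fin n → ℂ))).restrict {p | p.1 ≠ p.2} = volume :=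
      Measure.restrict_eq_self_of_ae_mem hΔ
    rwa [h2] at h1
  have hbi : Integrable (K.indicator fun p => C * (‖p.1 - p.2‖ ^ m)⁻¹) volume :=
    IntegrableOn.integrable_indicator ((integrableOn_norm_sub_pow hm hK).const_mul C)
      hK.measurableSet
  have hb' : ∀ ε, 0 ≤ ε → ∀ᵐ p, ‖q ε p‖ ≤ K.indicator (fun p => C * (‖p.1 - p.2‖ ^ m)⁻¹) p := by
    intro ε hε
    filter_upwards [hΔ] with p hp
    by_cases hpK : p ∈ K
    · rw [Set.indicator_of_mem hpK]
      exact hb ε hε p hpK hp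
    · rw [Set.indicator_of_notMem hpK, h0 ε hε p hpK, norm_zero]
  have hpos : ∀ᶠ ε : ℝ in 𝓝[>] 0, 0 ≤ ε :=
    (eventually_mem_nhdsWithin).mono fun ε hε => le_of_lt hε
  exact ⟨fun ε hε => hbi.mono' (hmeas ε hε) (hb' ε hε),
    tendsto_integral_filter_of_dominated_convergence _ (hpos.mono hmeas) (hpos.mono hb') hbi
      (hΔ.mono hl)⟩

variable {U : Set ((Fin n → ℂ) × (Fin n → ℂ))} {r s ψ : (Fin n → ℂ) × (Fin n → ℂ) → ℂ} {c : ℝ}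

theorem norm_add_ofReal_ge {z : ℂ} {a ε : ℝ} (h : a ≤ z.re) : a + ε ≤ ‖z + ε‖ :=
  le_trans (by simpa using h) (Complex.re_le_norm _)

theorem continuousAt_mul_of_tsupport {a : (Fin n → ℂ) × (Fin n → ℂ) → ℂ}
    {p : (Fin n → ℂ) × (Fin n → ℂ)} (hψ : Continuous ψ) (ha : p ∈ tsupport ψ → ContinuousAt a p) :
    ContinuousAt (fun p => a p * ψ p) p := by
  by_cases h : p ∈ tsupport ψ
  · exact (ha h).mul hψ.continuousAt
  · refine (continuousAt_const (y := (0 : ℂ))).congr ?_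
    filter_upwards [notMem_tsupport_iff_eventuallyEq.1 h] with y hy
    rw [hy]
    simp

theorem norm_sub_pos {p : (Fin n → ℂ) × (Fin n → ℂ)} (hp : p.1 ≠ p.2) : 0 < ‖p.1 - p.2‖ :=
  norm_pos_iff.2 (sub_ne_zero.2 hp)

theorem add_ofReal_ne_zero (hc : 0 < c) {p : (Fin n → ℂ) × (Fin n → ℂ)}
    (h : c * ‖p.1 - p.2‖ ^ 2 ≤ (r p).re) {ε : ℝ} (hε : 0 ≤ ε) (hp : p.1 ≠ p.2 ∨ 0 < ε) :
    r p + ε ≠ 0 := by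
  rw [← norm_pos_iff]
  refine lt_of_lt_of_le ?_ (norm_add_ofReal_ge h)
  rcases hp with hp | hp
  · have := norm_sub_pos hp
    positivity
  · positivity

variable (hU : IsOpen U) (hr : ContinuousOn r U) (hc : 0 < c)
  (hrc : ∀ p ∈ U, c * ‖p.1 - p.2‖ ^ 2 ≤ (r p).re)
  (hψ : Continuous ψ) (hψc : HasCompactSupport ψ) (hψU : tsupport ψ ⊆ U)

include hU hr hc hrc hψ hψc hψU

/-- Convergence of the terms of the regularised kernel. -/
theorem tendsto_integral_kernel_term {C : ℝ} (hs : ContinuousOn s U)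
    (hsC : ∀ p ∈ U, ‖s p‖ ≤ C * ‖p.1 - p.2‖) {k : ℕ} (hk : k < n) :
    (∀ ε : ℝ, 0 ≤ ε → Integrable (fun p => ((r p + ε) ^ (k + 1))⁻¹ * s p * ψ p) volume) ∧
      Filter.Tendsto (fun ε : ℝ => ∫ p, ((r p + ε) ^ (k + 1))⁻¹ * s p * ψ p) (𝓝[>] 0)
        (𝓝 (∫ p, ((r p + (0 : ℝ)) ^ (k + 1))⁻¹ * s p * ψ p)) := by
  obtain ⟨D, hD⟩ := hψc.exists_bound_of_continuous hψ
  have hD0 : 0 ≤ D := (norm_nonneg _).trans (hD 0)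
  refine tendsto_integral_of_singular (m := 2 * k + 1) (by omega) hψc
    (C := (c ^ (k + 1))⁻¹ * |C| * D) (fun ε hε p hp => ?_) (fun ε hε p hpK hp => ?_)
    (fun ε hε p hpK => ?_) fun p hp => ?_
  · refine (continuousAt_mul_of_tsupport hψ fun h => ?_).continuousWithinAt
    have hpU := hU.mem_nhds (hψU h)
    exact ((((hr.continuousAt hpU).add continuousAt_const).pow _).inv₀
      (pow_ne_zero _ (add_ofReal_ne_zero hc (hrc p (hψU h)) hε (Or.inl hp)))).mul
        (hs.continuousAt hpU)
  · have hpU := hψU hpK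
    have hd := norm_sub_pos hp
    have h1 : c * ‖p.1 - p.2‖ ^ 2 ≤ ‖r p + ε‖ :=
      le_trans (by linarith) (norm_add_ofReal_ge (ε := ε) (hrc p hpU))
    have h2 : (‖r p + ε‖ ^ (k + 1))⁻¹ ≤ ((c * ‖p.1 - p.2‖ ^ 2) ^ (k + 1))⁻¹ := by gcongr
    have h3 : ‖s p‖ ≤ |C| * ‖p.1 - p.2‖ := (hsC p hpU).trans (by gcongr; exact le_abs_self C)
    rw [norm_mul, norm_mul, norm_inv, norm_pow]
    calc (‖r p + ε‖ ^ (k + 1))⁻¹ * ‖s p‖ * ‖ψ p‖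
        ≤ ((c * ‖p.1 - p.2‖ ^ 2) ^ (k + 1))⁻¹ * (|C| * ‖p.1 - p.2‖) * D := by
          gcongr
          exact hD p
      _ = (c ^ (k + 1))⁻¹ * |C| * D * (‖p.1 - p.2‖ ^ (2 * k + 1))⁻¹ := by
          field_simp
          ring
  · rw [image_eq_zero_of_notMem_tsupport hpK, mul_zero]
  · by_cases h : p ∈ tsupport ψ
    · have h1 : Filter.Tendsto (fun ε : ℝ => ((ε : ℝ) : ℂ)) (𝓝[>] 0) (𝓝 ((0 : ℝ) : ℂ)) :=
        (Complex.continuous_ofReal.tendsto 0).mono_left nhdsWithin_le_nhds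
      exact ((((tendsto_const_nhds.add h1).pow _).inv₀ (pow_ne_zero _
        (add_ofReal_ne_zero hc (hrc p (hψU h)) le_rfl (Or.inl hp)))).mul_const _).mul_const _
    · simp only [image_eq_zero_of_notMem_tsupport h, mul_zero]
      exact tendsto_const_nhds

/-- The residue terms of lower order tend to zero. -/
theorem tendsto_integral_residue_term {k : ℕ} (hk : k < n) :
    (∀ ε : ℝ, 0 ≤ ε → Integrable (fun p => ε * ((r p + ε) ^ (k + 1))⁻¹ * ψ p) volume) ∧
      Filter.Tendsto (fun ε : ℝ => ∫ p, ε * ((r p + ε) ^ (k + 1))⁻¹ * ψ p) (𝓝[>] 0)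
        (𝓝 0) := by
  obtain ⟨D, hD⟩ := hψc.exists_bound_of_continuous hψ
  have hD0 : 0 ≤ D := (norm_nonneg _).trans (hD 0)
  have key := tendsto_integral_of_singular (m := 2 * k) (by omega) hψc (q₀ := fun _ => 0)
    (q := fun ε p => ε * ((r p + ε) ^ (k + 1))⁻¹ * ψ p)
    (C := (c ^ k)⁻¹ * D) (fun ε hε p hp => ?_) (fun ε hε p hpK hp => ?_)
    (fun ε hε p hpK => ?_) fun p hp => ?_
  · rwa [integral_zero] at key
  · refine (continuousAt_mul_of_tsupport hψ fun h => ?_).continuousWithinAt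
    have hpU := hU.mem_nhds (hψU h)
    exact continuousAt_const.mul ((((hr.continuousAt hpU).add continuousAt_const).pow _).inv₀
      (pow_ne_zero _ (add_ofReal_ne_zero hc (hrc p (hψU h)) hε (Or.inl hp))))
  · have hpU := hψU hpK
    have hd := norm_sub_pos hp
    have h0 := norm_add_ofReal_ge (ε := ε) (hrc p hpU)
    have hcd : 0 < c * ‖p.1 - p.2‖ ^ 2 := by positivity
    have h1 : c * ‖p.1 - p.2‖ ^ 2 ≤ ‖r p + ε‖ := by linarith
    have h2 : ε ≤ ‖r p + ε‖ := by linarith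
    have hpos : 0 < ‖r p + ε‖ := by linarith
    have h3 : (‖r p + ε‖ ^ k)⁻¹ ≤ ((c * ‖p.1 - p.2‖ ^ 2) ^ k)⁻¹ := by gcongr
    rw [norm_mul, norm_mul, norm_inv, norm_pow, Complex.norm_real, Real.norm_of_nonneg hε]
    calc ε * (‖r p + ε‖ ^ (k + 1))⁻¹ * ‖ψ p‖
        ≤ ‖r p + ε‖ * (‖r p + ε‖ ^ (k + 1))⁻¹ * D := by
          gcongr
          exact hD p
      _ = (‖r p + ε‖ ^ k)⁻¹ * D := by
          rw [pow_succ, mul_inv, mul_comm ‖r p + ε‖, mul_assoc _ _ ‖r p + ε‖,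
            inv_mul_cancel₀ hpos.ne', mul_one]
      _ ≤ ((c * ‖p.1 - p.2‖ ^ 2) ^ k)⁻¹ * D := by gcongr
      _ = (c ^ k)⁻¹ * D * (‖p.1 - p.2‖ ^ (2 * k))⁻¹ := by
          rw [mul_pow, mul_inv, ← pow_mul]
          ring
  · rw [image_eq_zero_of_notMem_tsupport hpK, mul_zero]
  · by_cases h : p ∈ tsupport ψ
    · have h1 : Filter.Tendsto (fun ε : ℝ => ((ε : ℝ) : ℂ)) (𝓝[>] 0) (𝓝 ((0 : ℝ) : ℂ)) :=
        (Complex.continuous_ofReal.tendsto 0).mono_left nhdsWithin_le_nhds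
      have h2 := ((h1.mul (((tendsto_const_nhds (x := r p)).add h1).pow (k + 1) |>.inv₀
        (pow_ne_zero _ (add_ofReal_ne_zero hc (hrc p (hψU h)) le_rfl (Or.inl hp)))))).mul_const
          (ψ p)
      simpa using h2
    · simp only [image_eq_zero_of_notMem_tsupport h, mul_zero]
      exact tendsto_const_nhds

end Analysis

/-! ### The residue on the diagonal -/

section Scaling

variable {n : ℕ} {U : Set ((Fin n → ℂ) × (Fin n → ℂ))} {r d : (Fin n → ℂ) × (Fin n → ℂ) → ℂ}
  {c : ℝ}

theorem integrable_inv_one_add_sq (hc : 0 < c) :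
    Integrable (fun s : Fin n → ℂ => ((c * ‖s‖ ^ 2 + 1) ^ (n + 1))⁻¹) volume := by
  have h1 := integrable_rpow_neg_one_add_norm_sq (E := Fin n → ℂ) (μ := volume)
    (r := 2 * (n + 1)) (by rw [finrank_real_pi]; push_cast; linarith)
  have h2 := h1.comp_smul (Real.sqrt_ne_zero'.2 hc)
  refine h2.congr (Filter.Eventually.of_forall fun s => ?_)
  change (1 + ‖Real.sqrt c • s‖ ^ 2) ^ (-(2 * ((n : ℝ) + 1)) / 2) = _
  rw [norm_smul, mul_pow, Real.norm_of_nonneg (Real.sqrt_nonneg c), Real.sq_sqrt hc.le,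
    show -(2 * ((n : ℝ) + 1)) / 2 = -((n + 1 : ℕ) : ℝ) by push_cast; ring,
    Real.rpow_neg (by positivity), Real.rpow_natCast, add_comm]

/-- The leading residue term: after the substitution `ζ = z + t s` it converges to an integral
over the diagonal. -/
theorem tendsto_integral_residue_leading (hU : IsOpen U) (hr : ContinuousOn r U) (hc : 0 < c)
    (hrc : ∀ p ∈ U, c * ‖p.1 - p.2‖ ^ 2 ≤ (r p).re)
    (hd : Continuous d) (hdc : HasCompactSupport d) (hdU : tsupport d ⊆ U)
    {Q : (Fin n → ℂ) → (Fin n → ℂ) → ℂ}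
    (hQ : ∀ z, (z, z) ∈ U → ∀ s, Filter.Tendsto
      (fun t : ℝ => r (z + t • s, z) / (t : ℂ) ^ 2) (𝓝[>] 0) (𝓝 (Q z s))) :
    (∀ t : ℝ, 0 < t → Integrable (fun p =>
      ((t ^ 2 : ℝ) : ℂ) * ((r p + (t ^ 2 : ℝ)) ^ (n + 1))⁻¹ * d p) volume) ∧
    Filter.Tendsto (fun t : ℝ => ∫ p, ((t ^ 2 : ℝ) : ℂ) * ((r p + (t ^ 2 : ℝ)) ^ (n + 1))⁻¹ * d p)
      (𝓝[>] 0) (𝓝 (∫ z, (∫ s, ((Q z s + 1) ^ (n + 1))⁻¹) * d (z, z))) := by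
  obtain ⟨D, hD⟩ := hdc.exists_bound_of_continuous hd
  have hD0 : 0 ≤ D := (norm_nonneg _).trans (hD 0)
  set h : ℝ → (Fin n → ℂ) × (Fin n → ℂ) → ℂ := fun t p =>
    ((t ^ 2 : ℝ) : ℂ) * ((r p + (t ^ 2 : ℝ)) ^ (n + 1))⁻¹ * d p with hh
  have hcont : ∀ t, 0 < t → Continuous (h t) := fun t ht => continuous_iff_continuousAt.2 fun p =>
    continuousAt_mul_of_tsupport hd fun hp => continuousAt_const.mul
      ((((hr.continuousAt (hU.mem_nhds (hdU hp))).add continuousAt_const).pow _).inv₀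
        (pow_ne_zero _ (add_ofReal_ne_zero hc (hrc p (hdU hp)) (by positivity)
          (Or.inr (by positivity)))))
  have hint : ∀ t, 0 < t → Integrable (h t) volume := fun t ht =>
    (hcont t ht).integrable_of_hasCompactSupport hdc.mul_left
  refine ⟨hint, ?_⟩
  -- the integrand after the substitution: the factor `t²` and the Jacobian `t²ⁿ` are cancelled by
  -- the denominator
  set e : ℝ → (Fin n → ℂ) → (Fin n → ℂ) → ℂ := fun t z s =>
    ((r (z + t • s, z) / (t : ℂ) ^ 2 + 1) ^ (n + 1))⁻¹ * d (z + t • s, z) with he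
  have hscale : ∀ t : ℝ, 0 < t → ∀ z, ∫ ζ, h t (ζ, z) = ∫ s, e t z s := by
    intro t ht z
    have htC : (t : ℂ) ≠ 0 := by exact_mod_cast ht.ne'
    rw [← integral_add_left_eq_self (fun ζ => h t (ζ, z)) z]
    have h1 := Measure.integral_comp_smul (volume : Measure (Fin n → ℂ))
      (fun s => h t (z + s, z)) t
    rw [finrank_real_pi, abs_of_pos (by positivity)] at h1
    have h2 : ∫ s, h t (z + s, z) = (t ^ (2 * n) : ℝ) • ∫ s, h t (z + t • s, z) := by
      rw [h1, smul_smul, mul_inv_cancel₀ (by positivity), one_smul]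
    rw [h2, ← integral_smul]
    congr 1
    funext s
    rw [Complex.real_smul, hh, he]
    have h3 : r (z + t • s, z) + ((t ^ 2 : ℝ) : ℂ)
        = (t : ℂ) ^ 2 * (r (z + t • s, z) / (t : ℂ) ^ 2 + 1) := by
      rw [mul_add, mul_div_cancel₀ _ (pow_ne_zero 2 htC)]
      push_cast
      ring
    change ((t ^ (2 * n) : ℝ) : ℂ) * (((t ^ 2 : ℝ) : ℂ) *
      ((r (z + t • s, z) + ((t ^ 2 : ℝ) : ℂ)) ^ (n + 1))⁻¹ * d (z + t • s, z))
      = ((r (z + t • s, z) / (t : ℂ) ^ 2 + 1) ^ (n + 1))⁻¹ * d (z + t • s, z)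
    rw [h3, mul_pow, mul_inv]
    push_cast
    field_simp
    ring
  have hre : ∀ t : ℝ, 0 < t → ∀ z s, (z + t • s, z) ∈ U →
      c * ‖s‖ ^ 2 + 1 ≤ ‖r (z + t • s, z) / (t : ℂ) ^ 2 + 1‖ := by
    intro t ht z s hzs
    have h1 := hrc _ hzs
    have h2 : (z + t • s, z).1 - (z + t • s, z).2 = t • s := add_sub_cancel_left _ _
    rw [h2, norm_smul, Real.norm_of_nonneg ht.le, mul_pow] at h1
    have h3 : (r (z + t • s, z) / (t : ℂ) ^ 2).re = (r (z + t • s, z)).re / t ^ 2 := by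
      rw [← Complex.ofReal_pow, Complex.div_ofReal_re]
    have h4 : c * ‖s‖ ^ 2 ≤ (r (z + t • s, z) / (t : ℂ) ^ 2).re := by
      rw [h3, le_div_iff₀ (by positivity)]
      linarith
    have h5 := norm_add_ofReal_ge (ε := 1) h4
    rwa [Complex.ofReal_one] at h5
  -- an integrable bound for the rescaled integrand that does not depend on `t`
  set β : (Fin n → ℂ) → ℝ := fun s => ((c * ‖s‖ ^ 2 + 1) ^ (n + 1))⁻¹ with hβ
  have hβi : Integrable β volume := integrable_inv_one_add_sq hc
  have hβ0 : ∀ s, 0 ≤ β s := fun s => by positivity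
  set K₂ : Set (Fin n → ℂ) := Prod.snd '' tsupport d
  have hK₂ : IsCompact K₂ := IsCompact.image hdc continuous_snd
  have heb : ∀ t : ℝ, 0 < t → ∀ z s, ‖e t z s‖ ≤ β s * K₂.indicator (fun _ => D) z := by
    intro t ht z s
    by_cases hz : (z + t • s, z) ∈ tsupport d
    · rw [Set.indicator_of_mem (show z ∈ K₂ from ⟨_, hz, rfl⟩), norm_mul, norm_inv, norm_pow]
      refine mul_le_mul ?_ (hD _) (norm_nonneg _) (hβ0 s)
      have := hre t ht z s (hdU hz)
      exact inv_anti₀ (by positivity) (pow_le_pow_left₀ (by positivity) this _)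
    · rw [he]
      simp only [image_eq_zero_of_notMem_tsupport hz, mul_zero, norm_zero]
      exact mul_nonneg (hβ0 s) (Set.indicator_nonneg (fun _ _ => hD0) z)
  have htend : ∀ z s : Fin n → ℂ, Filter.Tendsto (fun t : ℝ => (z + t • s, z)) (𝓝[>] 0)
      (𝓝 (z, z)) := by
    intro z s
    have : Continuous fun t : ℝ => (z + t • s, z) := by fun_prop
    simpa using (this.tendsto 0).mono_left nhdsWithin_le_nhds
  have hpt : ∀ z s, Filter.Tendsto (fun t => e t z s) (𝓝[>] 0)
      (𝓝 (((Q z s + 1) ^ (n + 1))⁻¹ * d (z, z))) := by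
    intro z s
    by_cases hz : (z, z) ∈ tsupport d
    · have hzU := hdU hz
      have h1 := (hQ z hzU s).add_const 1
      have h2 : c * ‖s‖ ^ 2 + 1 ≤ ‖Q z s + 1‖ := by
        refine ge_of_tendsto h1.norm ?_
        filter_upwards [htend z s (hU.mem_nhds hzU), self_mem_nhdsWithin] with t h3 h4
        exact hre t h4 z s h3
      have h3 : Q z s + 1 ≠ 0 := norm_pos_iff.1 (lt_of_lt_of_le (by positivity) h2)
      exact ((h1.pow _).inv₀ (pow_ne_zero _ h3)).mul ((hd.tendsto _).comp (htend z s))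
    · rw [image_eq_zero_of_notMem_tsupport hz, mul_zero]
      refine tendsto_const_nhds.congr' ?_
      have h1 : (tsupport d)ᶜ ∈ 𝓝 (z, z) := (isClosed_tsupport d).isOpen_compl.mem_nhds hz
      filter_upwards [htend z s h1] with t ht
      change 0 = _ * d _
      rw [image_eq_zero_of_notMem_tsupport ht, mul_zero]
  have hpos : ∀ᶠ t : ℝ in 𝓝[>] 0, 0 < t := self_mem_nhdsWithin
  have hemeas : ∀ t : ℝ, 0 < t → ∀ z, AEStronglyMeasurable (e t z) volume := by
    intro t ht z
    have h1 : Continuous (fun s => h t (z + t • s, z)) :=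
      (hcont t ht).comp (by fun_prop)
    have htC : (t : ℂ) ≠ 0 := by exact_mod_cast ht.ne'
    have h2 : e t z = fun s => (t : ℂ) ^ (2 * n) * h t (z + t • s, z) := by
      funext s
      have h3 : r (z + t • s, z) + ((t ^ 2 : ℝ) : ℂ)
          = (t : ℂ) ^ 2 * (r (z + t • s, z) / (t : ℂ) ^ 2 + 1) := by
        rw [mul_add, mul_div_cancel₀ _ (pow_ne_zero 2 htC)]
        push_cast
        ring
      rw [he, hh]
      simp only [h3, mul_pow, mul_inv]
      push_cast
      field_simp
      ring
    rw [h2]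
    exact (continuous_const.mul h1).aestronglyMeasurable
  have hinner : ∀ z, Filter.Tendsto (fun t => ∫ s, e t z s) (𝓝[>] 0)
      (𝓝 (∫ s, ((Q z s + 1) ^ (n + 1))⁻¹ * d (z, z))) := fun z =>
    tendsto_integral_filter_of_dominated_convergence _ (hpos.mono fun t ht => hemeas t ht z)
      (hpos.mono fun t ht => Filter.Eventually.of_forall fun s => heb t ht z s)
      (hβi.mul_const _) (Filter.Eventually.of_forall fun s => hpt z s)
  have houter : Filter.Tendsto (fun t => ∫ z, ∫ s, e t z s) (𝓝[>] 0)
      (𝓝 (∫ z, ∫ s, ((Q z s + 1) ^ (n + 1))⁻¹ * d (z, z))) := by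
    refine tendsto_integral_filter_of_dominated_convergence
      (fun z => (∫ s, β s) * K₂.indicator (fun _ => D) z) (hpos.mono fun t ht => ?_)
      (hpos.mono fun t ht => Filter.Eventually.of_forall fun z => ?_) ?_
      (Filter.Eventually.of_forall hinner)
    · have h1 : (fun z => ∫ s, e t z s) = fun z => ∫ ζ, h t (ζ, z) :=
        funext fun z => (hscale t ht z).symm
      rw [h1]
      exact (Integrable.integral_prod_right (hint t ht)).aestronglyMeasurable
    · refine (norm_integral_le_of_norm_le (hβi.mul_const _)
        (Filter.Eventually.of_forall fun s => heb t ht z s)).trans_eq ?_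
      rw [integral_mul_const]
    · exact ((integrableOn_const hK₂.measure_lt_top.ne).integrable_indicator
        hK₂.measurableSet).const_mul _
  have h1 : ∀ z, (∫ s, ((Q z s + 1) ^ (n + 1))⁻¹) * d (z, z)
      = ∫ s, ((Q z s + 1) ^ (n + 1))⁻¹ * d (z, z) := fun z => (integral_mul_const _ _).symm
  simp only [h1]
  refine houter.congr' (hpos.mono fun t ht => ?_)
  change _ = ∫ p, h t p
  rw [Measure.volume_eq_prod, integral_prod_symm _ (hint t ht)]
  exact integral_congr_ae (Filter.Eventually.of_forall fun z => (hscale t ht z).symm)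

end Scaling

section Constant

variable {n : ℕ}

theorem integral_exp_neg_sum_sq {t : ℝ} (ht : 0 < t) :
    Integrable (fun s : Fin n → ℂ => Real.exp (-t * ∑ i, ‖s i‖ ^ 2)) volume ∧
      ∫ s : Fin n → ℂ, Real.exp (-t * ∑ i, ‖s i‖ ^ 2) = (Real.pi / t) ^ n := by
  have h1 : ∫ w : ℂ, Real.exp (-t * ‖w‖ ^ 2) = Real.pi / t := by
    rw [GaussianFourier.integral_rexp_neg_mul_sq_norm ht, Complex.finrank_real_complex]
    simp
  have h2 : Integrable (fun w : ℂ => Real.exp (-t * ‖w‖ ^ 2)) volume := by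
    by_contra h
    rw [integral_undef h] at h1
    have : 0 < Real.pi / t := by positivity
    linarith
  have h3 : (fun s : Fin n → ℂ => Real.exp (-t * ∑ i, ‖s i‖ ^ 2))
      = fun s => ∏ i, Real.exp (-t * ‖s i‖ ^ 2) := by
    funext s
    rw [Finset.mul_sum, Real.exp_sum]
  rw [h3]
  refine ⟨Integrable.fintype_prod fun _ => h2, ?_⟩
  rw [integral_fintype_prod_volume_eq_pow (fun w : ℂ => Real.exp (-t * ‖w‖ ^ 2)), h1,
    Fintype.card_fin]

/-- `∫ (1 + |s|²)⁻ⁿ⁻¹ = πⁿ / n!` over `ℂⁿ`, by writing the integrand as a superposition of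
Gaussians. -/
theorem integral_inv_sum_sq_add_one :
    ∫ s : Fin n → ℂ, ((∑ i, ‖s i‖ ^ 2 + 1) ^ (n + 1))⁻¹ = Real.pi ^ n / n.factorial := by
  set f : (Fin n → ℂ) → ℝ → ℝ := fun s t => t ^ n * Real.exp (-((∑ i, ‖s i‖ ^ 2 + 1) * t))
  have hf : ∀ s t, f s t = t ^ n * Real.exp (-t) * Real.exp (-t * ∑ i, ‖s i‖ ^ 2) := by
    intro s t
    rw [mul_assoc, ← Real.exp_add]
    change t ^ n * _ = _
    congr 2
    ring
  have h1 : ∀ s : Fin n → ℂ, ∫ t in Set.Ioi (0 : ℝ), f s t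
      = ((∑ i, ‖s i‖ ^ 2 + 1) ^ (n + 1))⁻¹ * n.factorial := by
    intro s
    have hpos : 0 < ∑ i, ‖s i‖ ^ 2 + 1 := by positivity
    have := Real.integral_rpow_mul_exp_neg_mul_Ioi (a := n + 1) (by positivity) hpos
    rw [Real.Gamma_nat_eq_factorial, one_div, Real.inv_rpow hpos.le] at this
    rw [← Real.rpow_natCast _ (n + 1), Nat.cast_add_one, ← this]
    refine setIntegral_congr_fun measurableSet_Ioi fun t ht => ?_
    change t ^ n * _ = t ^ ((n : ℝ) + 1 - 1) * _
    rw [add_sub_cancel_right, Real.rpow_natCast]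
  have h2 : ∀ t ∈ Set.Ioi (0 : ℝ), ∫ s, f s t = Real.pi ^ n * Real.exp (-t) := by
    intro t ht
    have ht' : t ≠ 0 := (Set.mem_Ioi.1 ht).ne'
    simp only [hf]
    rw [integral_const_mul, (integral_exp_neg_sum_sq ht).2, div_pow]
    field_simp
  have hexp : IntegrableOn (fun t => Real.pi ^ n * Real.exp (-t)) (Set.Ioi 0) volume :=
    (integrableOn_exp_neg_Ioi 0).const_mul _
  have hmeas : AEStronglyMeasurable (Function.uncurry f)
      ((volume : Measure (Fin n → ℂ)).prod (volume.restrict (Set.Ioi (0 : ℝ)))) := by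
    refine Continuous.aestronglyMeasurable ?_
    change Continuous fun p : (Fin n → ℂ) × ℝ =>
      p.2 ^ n * Real.exp (-((∑ i, ‖p.1 i‖ ^ 2 + 1) * p.2))
    fun_prop
  have hint : Integrable (Function.uncurry f)
      ((volume : Measure (Fin n → ℂ)).prod (volume.restrict (Set.Ioi (0 : ℝ)))) := by
    rw [integrable_prod_iff' hmeas]
    constructor
    · refine (ae_restrict_mem measurableSet_Ioi).mono fun t ht => ?_
      simp only [Function.uncurry_apply_pair, hf]
      exact (integral_exp_neg_sum_sq ht).1.const_mul _
    · refine hexp.congr ((ae_restrict_mem measurableSet_Ioi).mono fun t ht => ?_)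
      change Real.pi ^ n * Real.exp (-t) = ∫ s, ‖f s t‖
      rw [← h2 t ht]
      congr 1
      funext s
      have ht0 : 0 < t := ht
      exact (Real.norm_of_nonneg (by positivity)).symm
  have h3 := integral_integral_swap hint
  simp only [h1] at h3
  rw [integral_mul_const, setIntegral_congr_fun measurableSet_Ioi h2, integral_const_mul,
    integral_exp_neg_Ioi_zero, mul_one] at h3
  rw [eq_div_iff (by positivity), h3]

/-- The residue integral of a positive definite Hermitian form `|N s|²`. -/
theorem integral_inv_normSq_add_one {N : Matrix (Fin n) (Fin n) ℂ} (hN : N.det ≠ 0) :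
    ∫ s : Fin n → ℂ, (((∑ i, ‖N.mulVec s i‖ ^ 2 : ℝ) + 1 : ℂ) ^ (n + 1))⁻¹
      = (Real.pi : ℂ) ^ n / n.factorial / (‖N.det‖ ^ 2 : ℝ) := by
  set L : (Fin n → ℂ) →L[ℂ] (Fin n → ℂ) := LinearMap.toContinuousLinearMap (Matrix.toLin' N)
  have hdet : LinearMap.det (reL L) = ‖N.det‖ ^ 2 := by
    rw [det_reL_nonneg, ← LinearMap.det_toLin']
    rfl
  have h1 := integral_image_eq_integral_abs_det_fderiv_smul
    (volume : Measure (Fin n → ℂ)) (s := Set.univ) (f := fun s => N.mulVec s)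
    (f' := fun _ => L.restrictScalars ℝ) MeasurableSet.univ
    (fun x _ => (L.restrictScalars ℝ).hasFDerivAt.hasFDerivWithinAt)
    (Matrix.mulVec_injective_of_isUnit ((Matrix.isUnit_iff_isUnit_det N).2
      (isUnit_iff_ne_zero.2 hN))).injOn
    (fun s => (((∑ i, ‖s i‖ ^ 2 : ℝ) + 1 : ℂ) ^ (n + 1))⁻¹)
  have h2 : (fun s => N.mulVec s) '' Set.univ = Set.univ := by
    rw [Set.image_univ, Set.range_eq_univ]
    exact fun y => ⟨N⁻¹.mulVec y, by
      change N.mulVec (N⁻¹.mulVec y) = y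
      rw [Matrix.mulVec_mulVec, Matrix.mul_nonsing_inv _ (isUnit_iff_ne_zero.2 hN),
        Matrix.one_mulVec]⟩
  have h3 : |(L.restrictScalars ℝ).det| = ‖N.det‖ ^ 2 := by
    rw [← hdet]
    refine abs_of_nonneg ?_
    exact le_of_le_of_eq (by positivity) hdet.symm
  rw [h2, setIntegral_univ, setIntegral_univ, h3, integral_smul, Complex.real_smul] at h1
  have h4 : ∫ s : Fin n → ℂ, (((∑ i, ‖s i‖ ^ 2 : ℝ) + 1 : ℂ) ^ (n + 1))⁻¹
      = (Real.pi : ℂ) ^ n / n.factorial := by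
    have h5 : (fun s : Fin n → ℂ => (((∑ i, ‖s i‖ ^ 2 : ℝ) + 1 : ℂ) ^ (n + 1))⁻¹)
        = fun s => ((((∑ i, ‖s i‖ ^ 2 + 1) ^ (n + 1))⁻¹ : ℝ) : ℂ) := by
      funext s
      push_cast
      rfl
    rw [h5, integral_complex_ofReal, integral_inv_sum_sq_add_one]
    push_cast
    rfl
  rw [h4] at h1
  have h6 : ((‖N.det‖ ^ 2 : ℝ) : ℂ) ≠ 0 := by
    have := norm_pos_iff.2 hN
    exact_mod_cast (by positivity : ‖N.det‖ ^ 2 ≠ 0)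
  rw [h1, mul_div_cancel_left₀ _ h6]

end Constant

/-! ### The Berezin integral on the diagonal -/

section LFib

variable {V : Type*} [NormedAddCommGroup V] [NormedSpace ℂ V]
  {Ep : Type*} [AddCommGroup Ep] [Module ℂ Ep]

theorem invol_of_mem_range_pow {W : Type*} [AddCommGroup W] [Module ℂ W]
    {P : Submodule ℂ (ExteriorAlgebra ℂ W)} (hP : ∀ y ∈ P, invol y = -y) (k : ℕ) :
    ∀ y ∈ P ^ k, invol y = (-1 : ℂ) ^ k • y := by
  induction k with
  | zero =>
    intro y hy
    obtain ⟨a, rfl⟩ := Submodule.mem_one.1 (pow_zero P ▸ hy)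
    rw [AlgHom.commutes, pow_zero, one_smul]
  | succ k ih =>
    intro y hy
    rw [pow_succ] at hy
    induction hy using Submodule.mul_induction_on' with
    | mem_mul_mem a ha b hb =>
      rw [map_mul, ih a ha, hP b hb, mul_neg, smul_mul_assoc, pow_succ, mul_neg_one, neg_smul]
    | add a _ b _ h1 h2 => rw [map_add, h1, h2, smul_add]

theorem mem_lFib_zero_induction {p : GFib V Ep → Prop}
    (h0 : ∀ k, ∀ y ∈ LinearMap.range (inEDual : Dual ℂ Ep →ₗ[ℂ] GFib V Ep) ^ k *
      (covec01 V).map (inT : (V →ₗ[ℝ] ℂ) →ₗ[ℂ] GFib V Ep) ^ k, p y)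
    (hz : p 0) (ha : ∀ x y, p x → p y → p (x + y)) {y : GFib V Ep} (hy : y ∈ lFib V Ep 0) :
    p y := by
  refine Submodule.iSup_induction _ (motive := p) hy (fun k x hx => ?_) hz ha
  refine Submodule.iSup_induction _ (motive := p) hx (fun l x hx => ?_) hz ha
  refine Submodule.iSup_induction _ (motive := p) hx (fun h x hx => ?_) hz ha
  have : l = k := by omega
  subst this
  exact h0 _ _ hx

theorem invol_of_mem_lFib {y : GFib V Ep} (hy : y ∈ lFib V Ep 0) : invol y = y := by
  refine mem_lFib_zero_induction (p := fun y => invol y = y) (fun k y hy => ?_) (map_zero _)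
    (fun x y hx hy => by rw [map_add, hx, hy]) hy
  induction hy using Submodule.mul_induction_on' with
  | mem_mul_mem a ha b hb =>
    rw [map_mul, invol_of_mem_range_pow (P := LinearMap.range inEDual) ?_ k a ha,
      invol_of_mem_range_pow (P := (covec01 V).map inT) ?_ k b hb, smul_mul_smul_comm, ← mul_pow,
      neg_one_mul, neg_neg, one_pow, one_smul]
    · rintro _ ⟨ℓ, -, rfl⟩
      exact invol_inT ℓ
    · rintro _ ⟨ℓ, rfl⟩
      exact invol_inEDual ℓ
  | add a _ b _ h1 h2 => rw [map_add, h1, h2]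

/-- An element annihilated by `E*` only sees the component of degree zero of `𝓛⁰`. -/
theorem mul_of_mem_lFib {X : GFib V Ep} (hX : ∀ τ : Dual ℂ Ep, X * inEDual τ = 0) {y : GFib V Ep}
    (hy : y ∈ lFib V Ep 0) : X * y = ExteriorAlgebra.algebraMapInv y • X := by
  refine mem_lFib_zero_induction
    (p := fun y => X * y = ExteriorAlgebra.algebraMapInv y • X) (fun k y hy => ?_)
    (by rw [map_zero, mul_zero, zero_smul])
    (fun x y hx hy => by rw [map_add, mul_add, hx, hy, add_smul]) hy
  cases k with
  | zero =>
    rw [pow_zero, pow_zero, one_mul] at hy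
    obtain ⟨a, rfl⟩ := Submodule.mem_one.1 hy
    rw [ExteriorAlgebra.algebraMap_leftInverse, Algebra.smul_def, Algebra.commutes]
  | succ k =>
    rw [pow_succ', mul_assoc] at hy
    induction hy using Submodule.mul_induction_on' with
    | mem_mul_mem a ha b hb =>
      obtain ⟨τ, rfl⟩ := ha
      have h : ExteriorAlgebra.algebraMapInv (inEDual τ : GFib V Ep) = 0 :=
        ExteriorAlgebra.lift_ι_apply _ _ _ _
      rw [← mul_assoc, hX, zero_mul, map_mul, h, zero_mul, zero_smul]
    | add a _ b _ h1 h2 => rw [map_add, mul_add, h1, h2, add_smul]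

end LFib

section Diagonal

variable {n : ℕ} {V : Type*} [NormedAddCommGroup V] [NormedSpace ℂ V] [FiniteDimensional ℂ V]
  [ComplexCoords V]
  {G : V → Matrix (Fin n) (Fin n) ℂ} {F : V → Fin n → ℂ} {x : V}

theorem dbarS_pow_mul_inEDual (τ : Dual ℂ (Fin n → ℂ)) : dbarS G F x ^ n * inEDual τ = 0 := by
  rw [← isDualPair_std.expand_dual τ, map_sum, Finset.mul_sum]
  refine Finset.sum_eq_zero fun j _ => ?_
  have h0 : (inEDual (LinearMap.proj j) * inEDual (LinearMap.proj j) : GFib V (Fin n → ℂ)) = 0 :=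
    ExteriorAlgebra.ι_sq_zero _
  have h1 : (List.ofFn fun j => (inT (dbarF (sFlat G F j) x) *
      inEDual (LinearMap.proj j) : GFib V (Fin n → ℂ))).prod * inEDual (LinearMap.proj j) = 0 :=
    prod_ofFn_mul_eq_zero (j := j) _ (fun i => commute_of_even (invol_ι_mul_ι _ _) _)
      (by rw [mul_assoc, h0, mul_zero])
  rw [map_smul, mul_smul_comm, (dbarS_pow G F x).1, smul_mul_assoc, h1, smul_zero, smul_zero]

theorem dbarS_pow_mul_superFlat_pow (m : ℕ) : dbarS G F x ^ n * superFlat G F x ^ m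
    = (1 / (2 * Real.pi * Complex.I) : ℂ) ^ m • (dbarS G F x ^ n * covD G F x ^ m) := by
  have hX : ∀ y, Commute (dbarS G F x ^ n) y :=
    commute_of_even (by rw [map_pow, invol_dbarS])
  have h0 : dbarS G F x ^ n * curvD G x = 0 := by
    rw [curvD, Finset.mul_sum]
    refine Finset.sum_eq_zero fun i _ => ?_
    rw [Finset.mul_sum]
    refine Finset.sum_eq_zero fun j _ => ?_
    rw [← mul_assoc, (hX _).eq, mul_assoc, dbarS_pow_mul_inEDual, mul_zero]
  induction m with
  | zero => simp
  | succ m ih =>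
    have h1 : dbarS G F x ^ n * covD G F x ^ m * curvD G x = 0 := by
      rw [(hX _).eq, mul_assoc, h0, mul_zero]
    rw [pow_succ, ← mul_assoc, ih, superFlat, smul_mul_assoc, mul_add, mul_smul_comm,
      mul_smul_comm, h1, smul_zero, add_zero, smul_smul, ← pow_succ,
      mul_assoc (dbarS G F x ^ n), ← pow_succ]

/-- Only the terms that contain all of `E` and `E*` survive the Berezin integral. -/
theorem berezinStd_dbarS_pow : berezinStd (dbarS G F x ^ n * divPow (superFlat G F x) n)
    = ((n.factorial : ℂ) * (-(1 / (2 * Real.pi * Complex.I))) ^ n) •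
      (List.ofFn fun j => ι ℂ (covFlat G F x j) *
        ι ℂ (dbarF (sFlat G F j) x)).prod := by
  have hfac : (n.factorial : ℂ) ≠ 0 := by exact_mod_cast n.factorial_ne_zero
  have hcov : covD G F x ^ n = (n.factorial : ℂ) • (List.ofFn fun j => (inT (covFlat G F x j) *
      inE (Pi.single j 1) : GFib V (Fin n → ℂ))).prod :=
    (sum_pow_of_sq_zero _ (fun i j => commute_of_even (invol_ι_mul_ι _ _) _)
      fun i => ι_mul_ι_mul_self _ _).1
  have h1 : ∀ j, (inT (dbarF (sFlat G F j) x) * inEDual (LinearMap.proj j) *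
      (inT (covFlat G F x j) * inE (Pi.single j 1)) : GFib V (Fin n → ℂ))
      = (-1 : ℂ) • (inForm (ι ℂ (covFlat G F x j) *
        ι ℂ (dbarF (sFlat G F j) x)) *
          (inE (Pi.single j 1) * inEDual (LinearMap.proj j))) := by
    intro j
    have e1 : (inEDual (LinearMap.proj j) * inE (Pi.single j 1) : GFib V (Fin n → ℂ))
        = -(inE (Pi.single j 1) * inEDual (LinearMap.proj j)) := ι_anticomm _ _
    have e2 : (inEDual (LinearMap.proj j) * inT (covFlat G F x j) : GFib V (Fin n → ℂ))
        = -(inT (covFlat G F x j) * inEDual (LinearMap.proj j)) := ι_anticomm _ _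
    have e3 : (inT (dbarF (sFlat G F j) x) * inT (covFlat G F x j) : GFib V (Fin n → ℂ))
        = -(inT (covFlat G F x j) * inT (dbarF (sFlat G F j) x)) := ι_anticomm _ _
    rw [map_mul, inForm_ι, inForm_ι, mul_assoc, ← mul_assoc (inEDual _), e2, neg_mul, mul_assoc,
      e1, mul_neg, mul_neg, mul_neg, neg_neg, ← mul_assoc, e3, neg_mul, neg_one_smul]
  have h2 : (List.ofFn fun j => (inT (dbarF (sFlat G F j) x) * inEDual (LinearMap.proj j) :
        GFib V (Fin n → ℂ))).prod *
      (List.ofFn fun j => (inT (covFlat G F x j) * inE (Pi.single j 1) :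
        GFib V (Fin n → ℂ))).prod
      = (-1 : ℂ) ^ n • (inForm (List.ofFn fun j => ι ℂ (covFlat G F x j) *
          ι ℂ (dbarF (sFlat G F j) x)).prod *
        (List.ofFn fun j => (inE (Pi.single j 1) * inEDual (LinearMap.proj j) :
          GFib V (Fin n → ℂ))).prod) := by
    have e1 := prod_ofFn_mul (fun j => (inT (dbarF (sFlat G F j) x) * inEDual (LinearMap.proj j) :
        GFib V (Fin n → ℂ))) (fun j => (inT (covFlat G F x j) * inE (Pi.single j 1) :
        GFib V (Fin n → ℂ))) fun i j => commute_of_even (invol_ι_mul_ι _ _) _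
    have e2 := prod_ofFn_mul (fun j => (inForm (ι ℂ (covFlat G F x j) *
        ι ℂ (dbarF (sFlat G F j) x)) : GFib V (Fin n → ℂ)))
      (fun j => (inE (Pi.single j 1) * inEDual (LinearMap.proj j) : GFib V (Fin n → ℂ)))
      fun i j => (commute_of_even (invol_ι_mul_ι _ _) _).symm
    rw [map_prod_ofFn, ← e2, ← e1]
    simp only [h1]
    rw [prod_ofFn_smul, Finset.prod_const, Finset.card_univ, Fintype.card_fin]
  rw [divPow, mul_smul_comm, dbarS_pow_mul_superFlat_pow, (dbarS_pow G F x).1, hcov,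
    smul_mul_smul_comm, h2]
  simp only [map_smul]
  rw [berezinOf_inForm_mul, berezinOf_prod isDualPair_std.pairing, mul_one, smul_smul, smul_smul,
    smul_smul, neg_pow (1 / _)]
  congr 1
  field_simp

end Diagonal

section Product

variable {n : ℕ} {G : (Fin n → ℂ) × (Fin n → ℂ) → Matrix (Fin n) (Fin n) ℂ}
  {F : (Fin n → ℂ) × (Fin n → ℂ) → Fin n → ℂ} {x : (Fin n → ℂ) × (Fin n → ℂ)}
  {L : Matrix (Fin n) (Fin n) ℂ}

theorem covFlat_of_zero (h0 : F x = 0) (hF : DifferentiableAt ℂ F x)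
    (hL : ∀ v w, fderiv ℂ F x (v, w) = L.mulVec (v - w)) (i : Fin n) :
    covFlat G F x i = precomp subMap (∑ k, L i k • (dz k : (Fin n → ℂ) →ₗ[ℝ] ℂ)) := by
  have h1 : (fderiv ℝ (fun y => F y i) x : _ →ₗ[ℝ] ℂ)
      = precomp subMap (∑ k, L i k • (dz k : (Fin n → ℂ) →ₗ[ℝ] ℂ)) := by
    have h2 := ((hasFDerivAt_pi'.1 hF.hasFDerivAt i).restrictScalars ℝ).fderiv
    rw [h2]
    refine LinearMap.ext fun vw => ?_
    change fderiv ℂ F x (vw.1, vw.2) i = (∑ k, L i k • (dz k : (Fin n → ℂ) →ₗ[ℝ] ℂ)) (vw.1 - vw.2)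
    rw [hL, LinearMap.sum_apply]
    rfl
  rw [covFlat, h0, h1]
  simp

theorem dbarF_sFlat_of_zero (h0 : F x = 0) (hF : DifferentiableAt ℂ F x) (hG : GoodAt G x)
    (hL : ∀ v w, fderiv ℂ F x (v, w) = L.mulVec (v - w)) (j : Fin n) :
    dbarF (sFlat G F j) x = precomp subMap
      (∑ k, ((G x).transpose * L.map conj) j k • (dzbar k : (Fin n → ℂ) →ₗ[ℝ] ℂ)) := by
  have hc : ∀ i, HasFDerivAt (𝕜 := ℝ) (fun y => conj (F y i))
      (Complex.conjCLE.toContinuousLinearMap.comp (((ContinuousLinearMap.proj i).comp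
        (fderiv ℂ F x)).restrictScalars ℝ)) x := fun i =>
    Complex.conjCLE.toContinuousLinearMap.hasFDerivAt.comp x
      ((hasFDerivAt_pi'.1 hF.hasFDerivAt i).restrictScalars ℝ)
  have h1 : ∀ i, dbarF (fun y => conj (F y i)) x
      = precomp subMap (∑ k, conj (L i k) • (dzbar k : (Fin n → ℂ) →ₗ[ℝ] ℂ)) := by
    intro i
    have h2 : ∀ vw : (Fin n → ℂ) × (Fin n → ℂ), fderiv ℝ (fun y => conj (F y i)) x vw
        = conj (fderiv ℂ F x vw i) := fun vw => by rw [(hc i).fderiv]; rfl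
    have h3 : dbarF (fun y => conj (F y i)) x
        = (fderiv ℝ (fun y => conj (F y i)) x : _ →ₗ[ℝ] ℂ) := part01_eq_self fun v => by
      change fderiv ℝ (fun y => conj (F y i)) x (Complex.I • v)
        = -Complex.I * fderiv ℝ (fun y => conj (F y i)) x v
      rw [h2, h2, map_smul, Pi.smul_apply, smul_eq_mul, map_mul, Complex.conj_I]
    rw [h3]
    refine LinearMap.ext fun vw => ?_
    change fderiv ℝ (fun y => conj (F y i)) x vw
      = (∑ k, conj (L i k) • (dzbar k : (Fin n → ℂ) →ₗ[ℝ] ℂ)) (vw.1 - vw.2)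
    rw [h2, show vw = (vw.1, vw.2) from rfl, hL, LinearMap.sum_apply]
    change conj (∑ k, L i k * (vw.1 - vw.2) k) = _
    rw [map_sum]
    exact Finset.sum_congr rfl fun k _ => map_mul _ _ _
  have h4 : dbarF (sFlat G F j) x
      = ∑ i, (conj (F x i) • dbarF (fun y => G y i j) x
        + G x i j • dbarF (fun y => conj (F y i)) x) := by
    have hd : ∀ i, DifferentiableAt ℝ (fun y => G y i j) x := fun i =>
      (hG.1 i j).differentiableAt (by simp)
    refine (dbarF_sum fun i _ => ((hc i).differentiableAt.fun_mul (hd i))).trans ?_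
    exact Finset.sum_congr rfl fun i _ => dbarF_mul (hc i).differentiableAt (hd i)
  rw [h4]
  simp only [h1, h0, Pi.zero_apply, map_zero, zero_smul, zero_add, ← map_smul, ← map_sum]
  congr 1
  simp only [Finset.smul_sum, smul_smul, Matrix.mul_apply, Matrix.transpose_apply,
    Matrix.map_apply, Finset.sum_smul]
  exact Finset.sum_comm

/-- The leading residue on the diagonal, evaluated on a form. -/
theorem topCoeff_residue (h0 : F x = 0) (hF : DifferentiableAt ℂ F x) (hG : GoodAt G x)
    (hL : ∀ v w, fderiv ℂ F x (v, w) = L.mulVec (v - w))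
    {g : GFib ((Fin n → ℂ) × (Fin n → ℂ)) (Fin n → ℂ)} (hg : g ∈ lFib _ _ 0)
    (hg1 : ExteriorAlgebra.algebraMapInv g = 1)
    (φ : ExteriorAlgebra ℂ ((Fin n → ℂ) × (Fin n → ℂ) →ₗ[ℝ] ℂ)) :
    topCoeff (berezinStd (dbarS G F x ^ n * g * divPow (superFlat G F x) n) * φ)
      = (n.factorial : ℂ) / (Real.pi : ℂ) ^ n * ((G x).det * (‖L.det‖ ^ 2 : ℝ)) *
        topCoeff (map (precomp diagMap) φ) := by
  rw [mul_of_mem_lFib dbarS_pow_mul_inEDual hg, hg1, one_smul, berezinStd_dbarS_pow]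
  simp only [covFlat_of_zero h0 hF hL, dbarF_sFlat_of_zero h0 hF hG hL]
  have h1 : (List.ofFn fun j : Fin n =>
      ι ℂ (precomp subMap (∑ k, L j k • (dz k : (Fin n → ℂ) →ₗ[ℝ] ℂ))) *
      ι ℂ (precomp subMap (∑ k, ((G x).transpose * L.map conj) j k •
        (dzbar k : (Fin n → ℂ) →ₗ[ℝ] ℂ)))).prod
      = map (precomp subMap) (List.ofFn fun j : Fin n =>
          ι ℂ (∑ k, L j k • (dz k : (Fin n → ℂ) →ₗ[ℝ] ℂ)) *
          ι ℂ (∑ k, ((G x).transpose * L.map conj) j k •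
            (dzbar k : (Fin n → ℂ) →ₗ[ℝ] ℂ))).prod := by
    rw [map_prod_ofFn]
    simp only [map_mul, map_apply_ι]
  have h2 : topCoeff (List.ofFn fun j : Fin n =>
      ι ℂ (dz j : (Fin n → ℂ) →ₗ[ℝ] ℂ) * ι ℂ (dzbar j)).prod
        = (-2 * Complex.I) ^ n := topCoeff_prod_dz (V := Fin n → ℂ)
  rw [h1, smul_mul_assoc, map_smul, smul_eq_mul]
  refine (congrArg (_ * ·) (topCoeff_subMap_mul _ (prod_ι_mul_ι_eq_ιMulti _ _) φ)).trans ?_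
  refine (congrArg (fun t => _ * (t * _)) (apply_prod_ι_mul_ι _ _ _ _ _)).trans ?_
  refine (congrArg (fun t => _ * (_ * t * _)) h2).trans ?_
  rw [Matrix.det_mul, Matrix.det_transpose]
  have h3 : (L.map conj).det = conj L.det := (RingHom.map_det (starRingEnd ℂ) L).symm
  have h4 : L.det * conj L.det = ((‖L.det‖ ^ 2 : ℝ) : ℂ) := by
    rw [Complex.mul_conj, Complex.normSq_eq_norm_sq]
  -- the factor `1 / 2πi` of `Dη` against `dz ∧ dz̄ = -2i dx ∧ dy`
  have h5 : (-(1 / (2 * Real.pi * Complex.I)) : ℂ) ^ n * (-2 * Complex.I) ^ n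
      = ((Real.pi : ℂ) ^ n)⁻¹ := by
    rw [← mul_pow, ← inv_pow]
    congr 1
    have : (Real.pi : ℂ) ≠ 0 := by exact_mod_cast Real.pi_ne_zero
    field_simp [Complex.I_ne_zero]
  rw [h3, ← h4, div_eq_mul_inv (n.factorial : ℂ), ← h5]
  ring

end Product

/-! ### Estimates near a point of the diagonal -/

section Bounds

variable {n : ℕ} {G : (Fin n → ℂ) × (Fin n → ℂ) → Matrix (Fin n) (Fin n) ℂ}
  {F : (Fin n → ℂ) × (Fin n → ℂ) → Fin n → ℂ}

theorem continuousAt_form {Y : Type*} [TopologicalSpace Y] {A : Y → Matrix (Fin n) (Fin n) ℂ}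
    {a : Y} (hA : ∀ i j, ContinuousAt (fun y => A y i j) a) (v : Fin n → ℂ) :
    ContinuousAt (fun q : Y × (Fin n → ℂ) =>
      (∑ j, (∑ i, conj (q.2 i) * A q.1 i j) * q.2 j).re) (a, v) := by
  have hv : ∀ i, ContinuousAt (fun q : Y × (Fin n → ℂ) => q.2 i) (a, v) := fun i =>
    ((continuous_apply i).comp continuous_snd).continuousAt
  have hv' : ∀ i, ContinuousAt (fun q : Y × (Fin n → ℂ) => conj (q.2 i)) (a, v) := fun i =>
    (Complex.continuous_conj.comp ((continuous_apply i).comp continuous_snd)).continuousAt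
  have hA' : ∀ i j, ContinuousAt (fun q : Y × (Fin n → ℂ) => A q.1 i j) (a, v) := fun i j =>
    Filter.Tendsto.comp (hA i j) continuousAt_fst
  have h1 : ContinuousAt (fun q : Y × (Fin n → ℂ) =>
      ∑ j, (∑ i, conj (q.2 i) * A q.1 i j) * q.2 j) (a, v) :=
    tendsto_finsetSum _ fun j _ => Filter.Tendsto.mul
      (tendsto_finsetSum _ fun i _ => Filter.Tendsto.mul (hv' i) (hA' i j)) (hv j)
  exact (Complex.continuous_re.tendsto _).comp h1

/-- A continuous family of positive quadratic forms is locally uniformly positive. -/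
theorem exists_lower_bound_quadratic {Y W : Type*} [TopologicalSpace Y] [NormedAddCommGroup W]
    [NormedSpace ℝ W] [FiniteDimensional ℝ W] {q : Y × W → ℝ} {a : Y}
    (hq : ∀ v, ContinuousAt q (a, v)) (hsq : ∀ y (t : ℝ) v, q (y, t • v) = t ^ 2 * q (y, v))
    (hpos : ∀ v, v ≠ 0 → 0 < q (a, v)) :
    ∃ m > 0, ∀ᶠ y in 𝓝 a, ∀ v, m * ‖v‖ ^ 2 ≤ q (y, v) := by
  have hK : IsCompact (Metric.sphere (0 : W) 1) := isCompact_sphere 0 1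
  have hc : ContinuousOn (fun v => q (a, v)) (Metric.sphere (0 : W) 1) := fun v _ =>
    ContinuousAt.continuousWithinAt (Filter.Tendsto.comp (hq v)
      (Continuous.prodMk_right a).continuousAt)
  obtain ⟨m, hm, hmle⟩ := hK.exists_forall_le' (a := 0) hc
    fun v hv => hpos v fun h => by simp [h] at hv
  refine ⟨m / 2, half_pos hm, ?_⟩
  have h := hK.eventually_forall_of_forall_eventually (x₀ := a)
    (P := fun y v => m / 2 < q (y, v)) fun v hv =>
      (hq v).eventually (lt_mem_nhds ((half_lt_self hm).trans_le (hmle v hv)))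
  filter_upwards [h] with y hy v
  rcases eq_or_ne v 0 with rfl | hv
  · have := hsq y 0 0
    rw [zero_smul, sq, zero_mul, zero_mul] at this
    rw [this, norm_zero, sq, zero_mul, mul_zero]
  have hn := norm_ne_zero_iff.2 hv
  have hw1 : ‖v‖⁻¹ • v ∈ Metric.sphere (0 : W) 1 := by
    rw [mem_sphere_zero_iff_norm, norm_smul, norm_inv, norm_norm, inv_mul_cancel₀ hn]
  have h1 := hsq y ‖v‖ (‖v‖⁻¹ • v)
  rw [smul_smul, mul_inv_cancel₀ hn, one_smul] at h1
  rw [h1, mul_comm]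
  exact mul_le_mul_of_nonneg_left (hy _ hw1).le (sq_nonneg _)

theorem re_form_smul (A : Matrix (Fin n) (Fin n) ℂ) (t : ℝ) (v : Fin n → ℂ) :
    (∑ j, (∑ i, conj ((t • v) i) * A i j) * (t • v) j).re
      = t ^ 2 * (∑ j, (∑ i, conj (v i) * A i j) * v j).re := by
  rw [← Complex.re_ofReal_mul]
  congr 1
  simp only [Finset.mul_sum, Finset.sum_mul, Pi.smul_apply, Complex.real_smul, map_mul,
    Complex.conj_ofReal]
  refine Finset.sum_congr rfl fun j _ => Finset.sum_congr rfl fun i _ => ?_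
  push_cast
  ring

/-- The derivative of a map that vanishes on the diagonal only depends on the difference. -/
theorem fderiv_of_vanish {z : Fin n → ℂ} (hF : DifferentiableAt ℂ F (z, z))
    (h0 : ∀ᶠ w in 𝓝 z, F (w, w) = 0) (v w : Fin n → ℂ) :
    fderiv ℂ F (z, z) (v, w) = fderiv ℂ F (z, z) (v - w, 0) := by
  have h1 : HasFDerivAt (fun w => F (w, w)) ((fderiv ℂ F (z, z)).comp
      ((ContinuousLinearMap.id ℂ _).prod (ContinuousLinearMap.id ℂ _))) z :=
    HasFDerivAt.comp (g := F) (f := fun w => (w, w)) z hF.hasFDerivAt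
      ((hasFDerivAt_id z).prodMk (hasFDerivAt_id z))
  have h2 : HasFDerivAt (fun w => F (w, w)) (0 : (Fin n → ℂ) →L[ℂ] (Fin n → ℂ)) z :=
    (hasFDerivAt_const 0 z).congr_of_eventuallyEq h0
  have h3 : fderiv ℂ F (z, z) (w, w) = 0 := DFunLike.congr_fun (h1.unique h2) w
  rw [show (v, w) = (v - w, (0 : Fin n → ℂ)) + (w, w) by simp, map_add, h3, add_zero]

/-- A defining map of the diagonal is comparable with the distance to it. -/
theorem exists_norm_bounds {a : Fin n → ℂ} (hF : ContDiffAt ℂ ω F (a, a))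
    (h0 : ∀ᶠ w in 𝓝 a, F (w, w) = 0) (hs : Function.Surjective (fderiv ℂ F (a, a))) :
    ∃ c > 0, ∃ C, ∀ᶠ p in 𝓝 (a, a), c * ‖p.1 - p.2‖ ≤ ‖F p‖ ∧ ‖F p‖ ≤ C * ‖p.1 - p.2‖ := by
  have hst : HasStrictFDerivAt F (fderiv ℂ F (a, a)) (a, a) :=
    hF.hasStrictFDerivAt (by simp)
  set D := fderiv ℂ F (a, a) with hD
  set D₁ : (Fin n → ℂ) →L[ℂ] (Fin n → ℂ) := D.comp (ContinuousLinearMap.inl ℂ _ _) with hD₁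
  have hsurj : Function.Surjective D₁ := fun y => by
    obtain ⟨⟨v, w⟩, rfl⟩ := hs y
    exact ⟨v - w, (fderiv_of_vanish hst.hasFDerivAt.differentiableAt h0 v w).symm⟩
  have hinj : Function.Injective (D₁ : (Fin n → ℂ) →ₗ[ℂ] (Fin n → ℂ)) :=
    LinearMap.injective_iff_surjective.2 hsurj
  obtain ⟨K, hK, hKD⟩ := (D₁ : (Fin n → ℂ) →ₗ[ℂ] (Fin n → ℂ)).exists_antilipschitzWith
    (LinearMap.ker_eq_bot.2 hinj)
  have hK' : (0 : ℝ) < K := hK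
  have hlow : ∀ v, (K : ℝ)⁻¹ * ‖v‖ ≤ ‖D₁ v‖ := fun v => by
    have := hKD.le_mul_norm (map_zero D₁) v
    rw [inv_mul_le_iff₀ hK']
    exact this
  refine ⟨(K : ℝ)⁻¹ / 2, by positivity, ‖D₁‖ + (K : ℝ)⁻¹ / 2, ?_⟩
  have hδ : (0 : ℝ) < (K : ℝ)⁻¹ / 2 := by positivity
  -- strict differentiability for the points `(ζ, z)` and `(z, z)`: `F (ζ, z) = D₁ (ζ - z)` up to
  -- `o(|ζ - z|)`
  have h1 := hst.isLittleO.def hδ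
  have h2 : Filter.Tendsto (fun p : (Fin n → ℂ) × (Fin n → ℂ) => (p, (p.2, p.2))) (𝓝 (a, a))
      (𝓝 ((a, a), (a, a))) :=
    (Continuous.prodMk continuous_id
      (continuous_snd.prodMk continuous_snd)).continuousAt (x := (a, a))
  have h3 : ∀ᶠ p in 𝓝 ((a, a) : (Fin n → ℂ) × (Fin n → ℂ)), F (p.2, p.2) = 0 :=
    (continuous_snd.continuousAt (x := (a, a))).eventually h0
  filter_upwards [h2.eventually h1, h3] with p hp hp0
  have e : p - (p.2, p.2) = (p.1 - p.2, 0) := by ext <;> simp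
  have e2 : ‖((p.1 - p.2, 0) : (Fin n → ℂ) × (Fin n → ℂ))‖ = ‖p.1 - p.2‖ := by
    rw [Prod.norm_mk, norm_zero, max_eq_left (norm_nonneg _)]
  simp only [hp0, sub_zero, e, e2] at hp
  have h4 : D (p.1 - p.2, 0) = D₁ (p.1 - p.2) := rfl
  rw [h4] at hp
  have h5 := hlow (p.1 - p.2)
  have h6 := D₁.le_opNorm (p.1 - p.2)
  have h7 := norm_sub_norm_le (F p) (D₁ (p.1 - p.2))
  have h8 := norm_sub_norm_le (D₁ (p.1 - p.2)) (F p)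
  rw [norm_sub_rev] at h8
  exact ⟨by linarith, by linarith⟩

variable {g : (Fin n → ℂ) × (Fin n → ℂ) → GFib ((Fin n → ℂ) × (Fin n → ℂ)) (Fin n → ℂ)}

/-- The local picture at the diagonal: `F` is a holomorphic defining map of the diagonal of
`U ⊆ ℂⁿ × ℂⁿ`, the matrices `G` are the Gram matrices of a metric, `g` is a weight, and `U` is so
small that `|F|` is comparable with the distance to the diagonal. -/
structure DiagonalModel (G : (Fin n → ℂ) × (Fin n → ℂ) → Matrix (Fin n) (Fin n) ℂ)
    (F : (Fin n → ℂ) × (Fin n → ℂ) → Fin n → ℂ)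
    (g : (Fin n → ℂ) × (Fin n → ℂ) → GFib ((Fin n → ℂ) × (Fin n → ℂ)) (Fin n → ℂ))
    (U : Set ((Fin n → ℂ) × (Fin n → ℂ))) : Prop where
  isOpen : IsOpen U
  good : ∀ x ∈ U, GoodAt G x
  pos : open scoped ComplexOrder in ∀ x ∈ U, (G x).PosDef
  hol : ∀ x ∈ U, ContDiffAt ℂ ω F x
  zero : ∀ z, (z, z) ∈ U → F (z, z) = 0
  lower : ∃ c > 0, ∀ p ∈ U, c * ‖p.1 - p.2‖ ≤ ‖F p‖
  rLower : ∃ c > 0, ∀ p ∈ U, c * ‖p.1 - p.2‖ ^ 2 ≤ (rFlat G F p).re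
  sUpper : ∃ C, ∀ j, ∀ p ∈ U, ‖sFlat G F j p‖ ≤ C * ‖p.1 - p.2‖
  weight : ∀ x ∈ U, SmoothAt g x
  closed : ∀ x ∈ U, nablaFlat F g x = 0
  mem : ∀ x ∈ U, g x ∈ lFib _ _ 0
  one : ∀ z, (z, z) ∈ U → ExteriorAlgebra.algebraMapInv (g (z, z)) = 1

open scoped ComplexOrder in
theorem re_form_pos {A : Matrix (Fin n) (Fin n) ℂ} (hA : A.PosDef) {v : Fin n → ℂ} (hv : v ≠ 0) :
    0 < (∑ j, (∑ i, conj (v i) * A i j) * v j).re := by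
  have h := hA.dotProduct_mulVec_pos hv
  have e : star v ⬝ᵥ A.mulVec v = ∑ j, (∑ i, conj (v i) * A i j) * v j := by
    rw [Matrix.dotProduct_mulVec]
    rfl
  rw [e] at h
  exact (Complex.lt_def.1 h).1

open scoped ComplexOrder in
theorem exists_diagonalModel {a : Fin n → ℂ}
    (hG : ∀ᶠ x in 𝓝 (a, a), GoodAt G x) (hpos : ∀ᶠ x in 𝓝 (a, a), (G x).PosDef)
    (hF : ContDiffAt ℂ ω F (a, a)) (h0 : ∀ᶠ p in 𝓝 (a, a), p.1 = p.2 → F p = 0)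
    (hs : Function.Surjective (fderiv ℂ F (a, a))) (hg : ∀ᶠ x in 𝓝 (a, a), SmoothAt g x)
    (hn : ∀ᶠ x in 𝓝 (a, a), nablaFlat F g x = 0) (hm : ∀ᶠ x in 𝓝 (a, a), g x ∈ lFib _ _ 0)
    (h1 : ∀ᶠ p in 𝓝 (a, a), p.1 = p.2 → ExteriorAlgebra.algebraMapInv (g p) = 1) :
    ∃ U, (a, a) ∈ U ∧ DiagonalModel G F g U := by
  have hd : Filter.Tendsto (fun w : Fin n → ℂ => (w, w)) (𝓝 a) (𝓝 (a, a)) :=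
    (continuous_id.prodMk continuous_id).continuousAt
  obtain ⟨c, hc, C, hFb⟩ := exists_norm_bounds hF ((hd.eventually h0).mono fun w hw => hw rfl) hs
  have hGa := hG.self_of_nhds
  obtain ⟨m, hm0, hGb⟩ := exists_lower_bound_quadratic
    (continuousAt_form fun i j => (hGa.1 i j).continuousAt) (fun y t v => re_form_smul (G y) t v)
    fun v hv => re_form_pos hpos.self_of_nhds hv
  have hGu : ∀ᶠ x in 𝓝 (a, a), ∀ i j, ‖G x i j‖ < ‖G (a, a) i j‖ + 1 := by
    rw [Filter.eventually_all]
    intro i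
    rw [Filter.eventually_all]
    intro j
    exact (hGa.1 i j).continuousAt.norm.eventually (gt_mem_nhds (lt_add_one _))
  have hFω : ∀ᶠ x in 𝓝 (a, a), ContDiffAt ℂ ω F x := hF.eventually (by simp)
  obtain ⟨U, hU, hUo, haU⟩ := eventually_nhds_iff.1
    (hG.and <| hpos.and <| hFω.and <| h0.and <| hFb.and <| hGb.and <| hGu.and <| hg.and <|
      hn.and <| hm.and h1)
  refine ⟨U, haU, hUo, fun x hx => (hU x hx).1, fun x hx => (hU x hx).2.1,
    fun x hx => (hU x hx).2.2.1, fun z hz => (hU _ hz).2.2.2.1 rfl,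
    ⟨c, hc, fun p hp => (hU p hp).2.2.2.2.1.1⟩, ⟨m * c ^ 2, by positivity, fun p hp => ?_⟩,
    ⟨∑ j, ∑ i, C * (‖G (a, a) i j‖ + 1), fun j p hp => ?_⟩,
    fun x hx => (hU x hx).2.2.2.2.2.2.2.1, fun x hx => (hU x hx).2.2.2.2.2.2.2.2.1,
    fun x hx => (hU x hx).2.2.2.2.2.2.2.2.2.1, fun z hz => (hU _ hz).2.2.2.2.2.2.2.2.2.2 rfl⟩
  · have h2 := (hU p hp).2.2.2.2.2.1 (F p)
    refine le_trans ?_ h2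
    rw [mul_assoc, ← mul_pow]
    have := (hU p hp).2.2.2.2.1.1
    gcongr
  · have hFp := (hU p hp).2.2.2.2.1.2
    have hGp := (hU p hp).2.2.2.2.2.2.1
    have hC : 0 ≤ C * ‖p.1 - p.2‖ := (norm_nonneg _).trans hFp
    calc ‖sFlat G F j p‖ ≤ ∑ i, ‖conj (F p i) * G p i j‖ := norm_sum_le _ _
      _ ≤ ∑ i, C * (‖G (a, a) i j‖ + 1) * ‖p.1 - p.2‖ := by
        refine Finset.sum_le_sum fun i _ => ?_
        rw [norm_mul, RCLike.norm_conj]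
        calc ‖F p i‖ * ‖G p i j‖ ≤ (C * ‖p.1 - p.2‖) * (‖G (a, a) i j‖ + 1) :=
              mul_le_mul ((norm_le_pi_norm _ i).trans hFp) (hGp i j).le (norm_nonneg _) hC
          _ = _ := by ring
      _ ≤ ∑ j, ∑ i, C * (‖G (a, a) i j‖ + 1) * ‖p.1 - p.2‖ := by
        refine Finset.single_le_sum (f := fun j => ∑ i, C * (‖G (a, a) i j‖ + 1) * ‖p.1 - p.2‖)
          (fun j _ => Finset.sum_nonneg fun i _ => ?_) (Finset.mem_univ j)
        rw [mul_right_comm]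
        positivity
      _ = _ := by simp only [Finset.sum_mul]

end Bounds

/-! ### The equation for the kernel in a chart -/

section Pairing

variable {V : Type*} [NormedAddCommGroup V] [NormedSpace ℂ V] [FiniteDimensional ℂ V]
  {A : Type*} [AddCommGroup A] [Module ℂ A] [Module.Finite ℂ A]
  {C : Type*} [AddCommGroup C] [Module ℂ C] [Module.Finite ℂ C] {U : Set V}

/-- Pairing with a smooth map that is compactly supported in `U` turns maps that are smooth on `U`
into continuous functions with compact support in `U`. -/
theorem pairing_of_tsupport_subset (B : A →ₗ[ℂ] C →ₗ[ℂ] ℂ) {Y : V → A} {f : V → C}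
    (hY : ∀ x ∈ U, SmoothAt Y x) (hf : ∀ x, SmoothAt f x) (hc : HasCompactSupport f)
    (hfU : tsupport f ⊆ U) :
    (∀ x, SmoothAt (fun x => B (Y x) (f x)) x) ∧ Continuous (fun x => B (Y x) (f x)) ∧
      HasCompactSupport (fun x => B (Y x) (f x)) ∧ tsupport (fun x => B (Y x) (f x)) ⊆ U := by
  have h0 : ∀ x, f x = 0 → B (Y x) (f x) = 0 := fun x hx => by rw [hx, map_zero]
  have hs : ∀ x, SmoothAt (fun x => B (Y x) (f x)) x := fun x => by
    by_cases h : x ∈ tsupport f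
    · exact (hY x (hfU h)).bilinear B (hf x)
    · refine (smoothAt_const 0 x).congr ?_
      filter_upwards [notMem_tsupport_iff_eventuallyEq.1 h] with y hy
      exact h0 y hy
  have ht : tsupport (fun x => B (Y x) (f x)) ⊆ tsupport f :=
    closure_mono fun x hx hx0 => hx (h0 x hx0)
  exact ⟨hs, continuous_iff_continuousAt.2 fun x => (smoothAt_complex_iff.1 (hs x)).continuousAt,
    hc.mono' (subset_closure.trans ht), ht.trans hfU⟩

variable [MeasureSpace V] [BorelSpace V] [(volume : Measure V).IsAddHaarMeasure]

theorem intAt_of_integrable_mul (hU : IsOpen U) {a : V} (ha : a ∈ U) {K : V → A}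
    (h : ∀ (ℓ : Dual ℂ A) (f : V → ℂ), (∀ x, ContDiffAt ℝ ∞ f x) → HasCompactSupport f →
      tsupport f ⊆ U → Integrable (fun x => ℓ (K x) * f x) volume) : IntAt K a := by
  intro ℓ
  have := FiniteDimensional.proper ℂ V
  have := FiniteDimensional.complexToReal V
  obtain ⟨r, hr, hrU⟩ := Metric.nhds_basis_closedBall.mem_iff.1 (hU.mem_nhds ha)
  let b : ContDiffBump a := ⟨r / 2, r, by positivity, by linarith⟩
  have hbc : HasCompactSupport fun x => (b x : ℂ) :=
    b.hasCompactSupport.comp_left Complex.ofReal_zero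
  have hbU : tsupport (fun x => (b x : ℂ)) ⊆ U := by
    refine (closure_mono fun x hx => ?_).trans (b.tsupport_eq.subset.trans hrU)
    exact fun h => hx (show ((b x : ℝ) : ℂ) = 0 by rw [h, Complex.ofReal_zero])
  have h := h ℓ _ (fun x => Complex.ofRealCLM.contDiff.contDiffAt.comp x b.contDiffAt) hbc hbU
  refine ⟨Metric.closedBall a (r / 2), Metric.closedBall_mem_nhds _ (by positivity),
    (h.integrableOn).congr_fun (fun x hx => ?_) Metric.isClosed_closedBall.measurableSet⟩
  have h1 : b x = 1 := b.one_of_mem_closedBall hx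
  change ℓ (K x) * (b x : ℂ) = ℓ (K x)
  rw [h1, Complex.ofReal_one, mul_one]

end Pairing

section Stokes

variable {n : ℕ} {V : Type*} [NormedAddCommGroup V] [NormedSpace ℂ V] [FiniteDimensional ℂ V]
  [ComplexCoords V]

/-- The top degree coefficient of `α ∧ β`, as a bilinear map. -/
def wedgeTop : ExteriorAlgebra ℂ (V →ₗ[ℝ] ℂ) →ₗ[ℂ] ExteriorAlgebra ℂ (V →ₗ[ℝ] ℂ) →ₗ[ℂ] ℂ :=
  (LinearMap.mul ℂ _).compr₂ topCoeff

theorem smoothAt_dbarFlat_of_tsupport {f : V → ExteriorAlgebra ℂ (V →ₗ[ℝ] ℂ)}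
    (hf : ∀ x, SmoothAt f x) (hc : HasCompactSupport f) :
    (∀ x, SmoothAt (dbarFlat (ι ℂ) f) x) ∧
      HasCompactSupport (dbarFlat (ι ℂ) f) ∧
      tsupport (dbarFlat (ι ℂ) f) ⊆ tsupport f := by
  have h : tsupport (dbarFlat (ι ℂ) f) ⊆ tsupport f := by
    refine closure_minimal (fun x hx => ?_) (isClosed_tsupport f)
    by_contra hx'
    exact hx ((dbarFlat_congr (notMem_tsupport_iff_eventuallyEq.1 hx')).trans (dbarFlat_const 0))
  exact ⟨fun x => (hf x).dbarFlat, hc.mono' (subset_closure.trans h), h⟩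

theorem dbarFlat_ι_mul {f g : V → ExteriorAlgebra ℂ (V →ₗ[ℝ] ℂ)} {x : V} (hf : SmoothAt f x)
    (hg : SmoothAt g x) : dbarFlat (ι ℂ) (fun y => f y * g y) x
      = dbarFlat (ι ℂ) f x * g x
        + invol (f x) * dbarFlat (ι ℂ) g x :=
  dbarFlat_mul (c := LinearMap.id) hf hg

variable [MeasureSpace V] [BorelSpace V] [(volume : Measure V).IsAddHaarMeasure]
  {G : V → Matrix (Fin n) (Fin n) ℂ} {F : V → Fin n → ℂ} {g : V → GFib V (Fin n → ℂ)} {U : Set V}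

/-- Stokes' theorem for the regularised kernel. -/
theorem integral_kerReg_dbarFlat (hU : IsOpen U) (hG : ∀ x ∈ U, GoodAt G x)
    (hF : ∀ x ∈ U, ContDiffAt ℂ ω F x) (hg : ∀ x ∈ U, SmoothAt g x)
    (hn : ∀ x ∈ U, nablaFlat F g x = 0) (hi : ∀ x ∈ U, invol (g x) = g x) {ε : ℝ}
    (hr : ∀ x ∈ U, rFlat G F x + ε ≠ 0) {f : V → ExteriorAlgebra ℂ (V →ₗ[ℝ] ℂ)}
    (hf : ∀ x, SmoothAt f x) (hc : HasCompactSupport f) (hfU : tsupport f ⊆ U) :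
    ∫ x, topCoeff (kerReg G F g ε x * dbarFlat (ι ℂ) f x)
      = (∫ x, topCoeff (kerRes G F g ε x * f x)) - ∫ x, topCoeff (kerP G F g x * f x) := by
  have hG' : ∀ x ∈ U, ∀ᶠ y in 𝓝 x, GoodAt G y := fun x hx =>
    (hU.eventually_mem hx).mono fun y hy => hG y hy
  have hK : ∀ x ∈ U, SmoothAt (kerReg G F g ε) x := fun x hx =>
    smoothAt_kerReg (hG' x hx) (hF x hx) (hg x hx) (hr x hx)
  have hP : ∀ x ∈ U, SmoothAt (kerP G F g) x := fun x hx =>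
    smoothAt_kerP (hG' x hx) (hF x hx) (hg x hx)
  obtain ⟨hdf, hdc, hdU⟩ := smoothAt_dbarFlat_of_tsupport hf hc
  have hKf : ∀ x, SmoothAt (fun x => kerReg G F g ε x * f x) x := fun x => by
    by_cases h : x ∈ tsupport f
    · exact (hK x (hfU h)).mul (hf x)
    · refine (smoothAt_const 0 x).congr ?_
      filter_upwards [notMem_tsupport_iff_eventuallyEq.1 h] with y hy
      rw [hy, Pi.zero_apply, mul_zero]
  have hKc : HasCompactSupport (fun x => kerReg G F g ε x * f x) := hc.mul_left
  have h1 := integral_topCoeff_dbarFlat hKf hKc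
  have h2 : ∀ x, topCoeff (dbarFlat (ι ℂ) (fun x => kerReg G F g ε x * f x) x)
      = topCoeff (kerRes G F g ε x * f x) - topCoeff (kerP G F g x * f x)
        - topCoeff (kerReg G F g ε x * dbarFlat (ι ℂ) f x) := by
    intro x
    by_cases h : x ∈ tsupport f
    · have hx := hfU h
      rw [dbarFlat_ι_mul (hK x hx) (hf x), dbarFlat_kerReg (hG' x hx) (hF x hx) (hg x hx)
        (hn x hx) (hr x hx), invol_kerReg (hG' x hx) (hi x hx), map_add, sub_mul, map_sub, neg_mul,
        map_neg, ← sub_eq_add_neg]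
    · have h3 := notMem_tsupport_iff_eventuallyEq.1 h
      have h4 : dbarFlat (ι ℂ) f x = 0 :=
        (dbarFlat_congr h3).trans (dbarFlat_const 0)
      have h5 : dbarFlat (ι ℂ) (fun x => kerReg G F g ε x * f x) x = 0 := by
        refine (dbarFlat_congr (g := fun _ => 0) ?_).trans (dbarFlat_const 0)
        filter_upwards [h3] with y hy
        rw [hy, Pi.zero_apply, mul_zero]
      rw [h4, h5, h3.self_of_nhds, Pi.zero_apply]
      simp
  have hR : ∀ x ∈ U, SmoothAt (kerRes G F g ε) x := fun x hx =>
    (((((smoothAt_resolvent (hG' x hx) (hF x hx) (hr x hx)).const_smul ε).mul (hg x hx)).mul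
      (smoothAt_divPow (hG' x hx) (hF x hx)))).linear berezinStd
  have i1 := pairing_of_tsupport_subset wedgeTop hR hf hc hfU
  have i2 := pairing_of_tsupport_subset wedgeTop hP hf hc hfU
  have i3 := pairing_of_tsupport_subset wedgeTop hK hdf hdc (hdU.trans hfU)
  have i1' : Integrable (fun x => topCoeff (kerRes G F g ε x * f x)) :=
    i1.2.1.integrable_of_hasCompactSupport i1.2.2.1
  have i2' : Integrable (fun x => topCoeff (kerP G F g x * f x)) :=
    i2.2.1.integrable_of_hasCompactSupport i2.2.2.1
  have i3' : Integrable (fun x => topCoeff (kerReg G F g ε x *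
      dbarFlat (ι ℂ) f x)) :=
    i3.2.1.integrable_of_hasCompactSupport i3.2.2.1
  simp only [h2] at h1
  have h3 := integral_sub (i1'.sub i2') i3'
  have h4 := integral_sub i1' i2'
  exact (sub_eq_zero.1 (((congrArg (· - _) h4).symm.trans h3.symm).trans h1)).symm

end Stokes

section Limit

theorem finite_gFib {n : ℕ} {V : Type*} [NormedAddCommGroup V] [NormedSpace ℂ V]
    [FiniteDimensional ℂ V] : Module.Finite ℂ (GFib V (Fin n → ℂ)) := inferInstance

/-- Instance search does not find this through the general instances for product spaces. -/
instance instFiniteGFib {n : ℕ} :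
    Module.Finite ℂ (GFib ((Fin n → ℂ) × (Fin n → ℂ)) (Fin n → ℂ)) := finite_gFib

variable {n : ℕ} {G : (Fin n → ℂ) × (Fin n → ℂ) → Matrix (Fin n) (Fin n) ℂ}
  {F : (Fin n → ℂ) × (Fin n → ℂ) → Fin n → ℂ}
  {g : (Fin n → ℂ) × (Fin n → ℂ) → GFib ((Fin n → ℂ) × (Fin n → ℂ)) (Fin n → ℂ)}
  {U : Set ((Fin n → ℂ) × (Fin n → ℂ))}
  {C : Type*} [AddCommGroup C] [Module ℂ C] [Module.Finite ℂ C]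

theorem kerReg_eq_sum (ε : ℝ) (x : (Fin n → ℂ) × (Fin n → ℂ)) : kerReg G F g ε x
    = ∑ k ∈ Finset.range n, ∑ j, (((rFlat G F x + ε) ^ (k + 1))⁻¹ * sFlat G F j x) •
      berezinStd (inEDual (LinearMap.proj j) * dbarS G F x ^ k * g x *
        divPow (superFlat G F x) n) := by
  have h : secS G F x * resolvent G F ε x = ∑ k ∈ Finset.range n, ∑ j,
      (((rFlat G F x + ε) ^ (k + 1))⁻¹ * sFlat G F j x) •
        (inEDual (LinearMap.proj j) * dbarS G F x ^ k) := by
    rw [resolvent, Finset.mul_sum, Finset.sum_range_succ, mul_smul_comm, secS_mul_dbarS_pow,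
      smul_zero, add_zero]
    refine Finset.sum_congr rfl fun k _ => ?_
    rw [mul_smul_comm, secS, Finset.sum_mul, Finset.smul_sum]
    refine Finset.sum_congr rfl fun j _ => ?_
    rw [smul_mul_assoc, smul_smul]
  rw [kerReg, h]
  simp only [Finset.sum_mul, smul_mul_assoc, map_sum, map_smul]

theorem kerRes_eq_sum (ε : ℝ) (x : (Fin n → ℂ) × (Fin n → ℂ)) : kerRes G F g ε x
    = ∑ k ∈ Finset.range (n + 1), ((ε : ℂ) * ((rFlat G F x + ε) ^ (k + 1))⁻¹) •
      berezinStd (dbarS G F x ^ k * g x * divPow (superFlat G F x) n) := by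
  rw [kerRes, resolvent]
  simp only [Finset.smul_sum, smul_smul, Finset.sum_mul, smul_mul_assoc, map_sum, map_smul]

/-- The kernel is locally integrable, and the regularised kernels converge to it weakly. -/
theorem DiagonalModel.tendsto_kerReg (hM : DiagonalModel G F g U)
    (B : ExteriorAlgebra ℂ ((Fin n → ℂ) × (Fin n → ℂ) →ₗ[ℝ] ℂ) →ₗ[ℂ] C →ₗ[ℂ] ℂ)
    {f : (Fin n → ℂ) × (Fin n → ℂ) → C} (hf : ∀ x, SmoothAt f x) (hc : HasCompactSupport f)
    (hfU : tsupport f ⊆ U) :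
    (∀ ε : ℝ, 0 ≤ ε → Integrable (fun x => B (kerReg G F g ε x) (f x)) volume) ∧
      Filter.Tendsto (fun ε : ℝ => ∫ x, B (kerReg G F g ε x) (f x)) (𝓝[>] 0)
        (𝓝 (∫ x, B (kerReg G F g 0 x) (f x))) := by
  have hG' : ∀ x ∈ U, ∀ᶠ y in 𝓝 x, GoodAt G y := fun x hx =>
    (hM.isOpen.eventually_mem hx).mono fun y hy => hM.good y hy
  obtain ⟨c, hc0, hrc⟩ := hM.rLower
  obtain ⟨C', hsC⟩ := hM.sUpper
  have hr : ContinuousOn (rFlat G F) U := fun x hx =>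
    (contDiffAt_rFlat (hM.good x hx) (hM.hol x hx)).continuousAt.continuousWithinAt
  have hs : ∀ j, ContinuousOn (sFlat G F j) U := fun j x hx =>
    (contDiffAt_sFlat (hM.good x hx) (hM.hol x hx) j).continuousAt.continuousWithinAt
  set Y : ℕ → Fin n → (Fin n → ℂ) × (Fin n → ℂ) → ExteriorAlgebra ℂ _ := fun k j x =>
    berezinStd (inEDual (LinearMap.proj j) * dbarS G F x ^ k * g x * divPow (superFlat G F x) n)
    with hYdef
  have hY : ∀ k j, ∀ x ∈ U, SmoothAt (Y k j) x := fun k j x hx =>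
    (((((smoothAt_const _ x).mul ((smoothAt_dbarS (hG' x hx) (hM.hol x hx)).pow k)).mul
      (hM.weight x hx)).mul (smoothAt_divPow (hG' x hx) (hM.hol x hx)))).linear berezinStd
  -- the term of index `k` is of size `|ζ - z|⁻²ᵏ⁻¹`, and `2k + 1 < 2n`
  have key : ∀ k < n, ∀ j, _ := fun k hk j =>
    tendsto_integral_kernel_term hM.isOpen hr hc0 hrc
      (pairing_of_tsupport_subset B (hY k j) hf hc hfU).2.1
      (pairing_of_tsupport_subset B (hY k j) hf hc hfU).2.2.1
      (pairing_of_tsupport_subset B (hY k j) hf hc hfU).2.2.2 (hs j) (hsC j) hk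
  have he : ∀ ε x, B (kerReg G F g ε x) (f x) = ∑ k ∈ Finset.range n, ∑ j,
      ((rFlat G F x + ε) ^ (k + 1))⁻¹ * sFlat G F j x * B (Y k j x) (f x) := by
    intro ε x
    rw [kerReg_eq_sum]
    simp only [map_sum, map_smul, LinearMap.sum_apply, LinearMap.smul_apply, smul_eq_mul, hYdef]
  simp only [he]
  have hint : ∀ ε : ℝ, 0 ≤ ε → ∀ k ∈ Finset.range n, ∀ j ∈ Finset.univ, Integrable
      (fun x => ((rFlat G F x + ε) ^ (k + 1))⁻¹ * sFlat G F j x * B (Y k j x) (f x)) volume :=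
    fun ε hε k hk j _ => (key k (Finset.mem_range.1 hk) j).1 ε hε
  refine ⟨fun ε hε => integrable_finsetSum _ fun k hk => integrable_finsetSum _ (hint ε hε k hk),
    ?_⟩
  have hsum : ∀ ε : ℝ, 0 ≤ ε → (∫ x, ∑ k ∈ Finset.range n, ∑ j,
      ((rFlat G F x + ε) ^ (k + 1))⁻¹ * sFlat G F j x * B (Y k j x) (f x))
      = ∑ k ∈ Finset.range n, ∑ j, ∫ x,
        ((rFlat G F x + ε) ^ (k + 1))⁻¹ * sFlat G F j x * B (Y k j x) (f x) := by
    intro ε hε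
    rw [integral_finsetSum _ fun k hk => integrable_finsetSum _ (hint ε hε k hk)]
    exact Finset.sum_congr rfl fun k hk => integral_finsetSum _ (hint ε hε k hk)
  rw [hsum 0 le_rfl]
  refine (tendsto_finsetSum _ fun k hk => tendsto_finsetSum _ fun j _ =>
    (key k (Finset.mem_range.1 hk) j).2).congr' ?_
  filter_upwards [self_mem_nhdsWithin] with ε hε
  exact (hsum ε (le_of_lt hε)).symm

theorem DiagonalModel.intAt_kerReg (hM : DiagonalModel G F g U) {a : (Fin n → ℂ) × (Fin n → ℂ)}
    (ha : a ∈ U) : IntAt (kerReg G F g 0) a := by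
  exact intAt_of_integrable_mul hM.isOpen ha fun ℓ f hf hc hfU =>
    (hM.tendsto_kerReg (LinearMap.mul ℂ ℂ ∘ₗ ℓ) (fun x => smoothAt_complex_iff.2 (hf x)) hc hfU).1 0
      le_rfl

end Limit

section Residue

variable {n : ℕ} {G : (Fin n → ℂ) × (Fin n → ℂ) → Matrix (Fin n) (Fin n) ℂ}
  {F : (Fin n → ℂ) × (Fin n → ℂ) → Fin n → ℂ}
  {g : (Fin n → ℂ) × (Fin n → ℂ) → GFib ((Fin n → ℂ) × (Fin n → ℂ)) (Fin n → ℂ)}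
  {U : Set ((Fin n → ℂ) × (Fin n → ℂ))} {z : Fin n → ℂ}

/-- The matrix of the derivative of `F` at `(z, z)` in the first variable. -/
def diffMatrix (F : (Fin n → ℂ) × (Fin n → ℂ) → Fin n → ℂ) (z : Fin n → ℂ) :
    Matrix (Fin n) (Fin n) ℂ :=
  LinearMap.toMatrix' ((fderiv ℂ F (z, z) : (Fin n → ℂ) × (Fin n → ℂ) →ₗ[ℂ] Fin n → ℂ) ∘ₗ
    LinearMap.inl ℂ _ _)

theorem DiagonalModel.fderiv_eq (hM : DiagonalModel G F g U) (hz : (z, z) ∈ U)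
    (v w : Fin n → ℂ) : fderiv ℂ F (z, z) (v, w) = (diffMatrix F z).mulVec (v - w) := by
  have hd : Filter.Tendsto (fun w : Fin n → ℂ => (w, w)) (𝓝 z) (𝓝 (z, z)) :=
    (continuous_id.prodMk continuous_id).continuousAt
  rw [fderiv_of_vanish ((hM.hol _ hz).differentiableAt (by simp))
    ((hd.eventually (hM.isOpen.mem_nhds hz)).mono fun w hw => hM.zero w hw), diffMatrix,
    LinearMap.toMatrix'_mulVec]
  rfl

theorem DiagonalModel.tendsto_slope (hM : DiagonalModel G F g U) (hz : (z, z) ∈ U)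
    (s : Fin n → ℂ) : Filter.Tendsto (fun t : ℝ => t⁻¹ • F (z + t • s, z)) (𝓝[>] 0)
      (𝓝 ((diffMatrix F z).mulVec s)) := by
  have h1 : HasDerivAt (fun t : ℝ => (z + t • s, z)) (s, (0 : Fin n → ℂ)) 0 := by
    have h := ((hasDerivAt_id (0 : ℝ)).smul_const s).const_add z
    rw [one_smul] at h
    exact h.prodMk (hasDerivAt_const 0 z)
  have h0 : ((z + (0 : ℝ) • s, z) : (Fin n → ℂ) × (Fin n → ℂ)) = (z, z) := by
    rw [zero_smul, add_zero]
  have h2 : HasFDerivAt F ((fderiv ℂ F (z, z)).restrictScalars ℝ) (z + (0 : ℝ) • s, z) := by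
    rw [h0]
    exact ((hM.hol _ hz).differentiableAt (by simp)).hasFDerivAt.restrictScalars ℝ
  have h3 := (h2.comp_hasDerivAt (0 : ℝ) h1).tendsto_slope_zero_right
  have h4 := hM.fderiv_eq hz s 0
  rw [sub_zero] at h4
  refine (h3.congr fun t => ?_).trans (le_of_eq (congrArg 𝓝 h4))
  simp only [Function.comp_apply, zero_add, h0, hM.zero z hz, sub_zero]

theorem DiagonalModel.det_diffMatrix_ne_zero (hM : DiagonalModel G F g U) (hz : (z, z) ∈ U) :
    (diffMatrix F z).det ≠ 0 := by
  obtain ⟨c, hc, hcF⟩ := hM.lower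
  intro h0
  obtain ⟨s, hs, hs0⟩ := Matrix.exists_mulVec_eq_zero_iff.2 h0
  have h1 := (hM.tendsto_slope hz s).norm
  rw [hs0, norm_zero] at h1
  have hp : Filter.Tendsto (fun t : ℝ => (z + t • s, z)) (𝓝[>] 0) (𝓝 (z, z)) := by
    have : Continuous fun t : ℝ => ((z + t • s, z) : (Fin n → ℂ) × (Fin n → ℂ)) := by fun_prop
    refine (this.tendsto' 0 _ ?_).mono_left nhdsWithin_le_nhds
    rw [zero_smul, add_zero]
  have h2 : c * ‖s‖ ≤ 0 := by
    refine ge_of_tendsto h1 ?_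
    filter_upwards [self_mem_nhdsWithin, hp.eventually (hM.isOpen.mem_nhds hz)] with t ht htU
    have ht' : (0 : ℝ) < t := ht
    have h3 := hcF _ htU
    have h4 : ‖(z + t • s, z).1 - (z + t • s, z).2‖ = t * ‖s‖ := by
      rw [show (z + t • s, z).1 - (z + t • s, z).2 = t • s by simp, norm_smul,
        Real.norm_of_nonneg ht'.le]
    rw [h4] at h3
    rw [norm_smul, norm_inv, Real.norm_of_nonneg ht'.le, le_inv_mul_iff₀ ht']
    linarith
  have := norm_pos_iff.2 hs
  nlinarith

/-- The quadratic form that `|F|²` is asymptotic to in the normal directions at the diagonal. -/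
def diagForm (G : (Fin n → ℂ) × (Fin n → ℂ) → Matrix (Fin n) (Fin n) ℂ)
    (F : (Fin n → ℂ) × (Fin n → ℂ) → Fin n → ℂ) (z s : Fin n → ℂ) : ℂ :=
  ∑ j, (∑ i, conj ((diffMatrix F z).mulVec s i) * G (z, z) i j) * (diffMatrix F z).mulVec s j

theorem DiagonalModel.tendsto_rFlat (hM : DiagonalModel G F g U) (hz : (z, z) ∈ U)
    (s : Fin n → ℂ) : Filter.Tendsto (fun t : ℝ => rFlat G F (z + t • s, z) / (t : ℂ) ^ 2)
      (𝓝[>] 0) (𝓝 (diagForm G F z s)) := by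
  have hp : Filter.Tendsto (fun t : ℝ => (z + t • s, z)) (𝓝[>] 0) (𝓝 (z, z)) := by
    have : Continuous fun t : ℝ => ((z + t • s, z) : (Fin n → ℂ) × (Fin n → ℂ)) := by fun_prop
    refine (this.tendsto' 0 _ ?_).mono_left nhdsWithin_le_nhds
    rw [zero_smul, add_zero]
  have hs := fun i => tendsto_pi_nhds.1 (hM.tendsto_slope hz s) i
  have h1 : Filter.Tendsto (fun t : ℝ => ∑ j, (∑ i, conj ((t⁻¹ • F (z + t • s, z)) i) *
      G (z + t • s, z) i j) * (t⁻¹ • F (z + t • s, z)) j) (𝓝[>] 0) (𝓝 (diagForm G F z s)) :=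
    tendsto_finsetSum _ fun j _ => (tendsto_finsetSum _ fun i _ =>
      ((Complex.continuous_conj.tendsto _).comp (hs i)).mul
        ((((hM.good _ hz).1 i j).continuousAt.tendsto).comp hp)).mul (hs j)
  refine h1.congr fun t => ?_
  rw [rFlat, Finset.sum_div]
  refine Finset.sum_congr rfl fun j _ => ?_
  rw [sFlat, Finset.sum_mul, Finset.sum_mul, Finset.sum_div]
  refine Finset.sum_congr rfl fun i _ => ?_
  simp only [Pi.smul_apply, Complex.real_smul, map_mul, Complex.ofReal_inv, map_inv₀,
    Complex.conj_ofReal]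
  rw [div_eq_mul_inv, ← inv_pow]
  ring

open scoped ComplexOrder MatrixOrder in
theorem exists_conjTranspose_mul_self {A : Matrix (Fin n) (Fin n) ℂ} (hA : A.PosDef) :
    ∃ B : Matrix (Fin n) (Fin n) ℂ, A = B.conjTranspose * B := by
  obtain ⟨B, hB⟩ := CStarAlgebra.nonneg_iff_eq_star_mul_self.1 hA.posSemidef.nonneg
  exact ⟨B, hB⟩

/-- The leading term of the residue has total mass one. -/
theorem DiagonalModel.residue_mass (hM : DiagonalModel G F g U) (hz : (z, z) ∈ U)
    (φ : ExteriorAlgebra ℂ ((Fin n → ℂ) × (Fin n → ℂ) →ₗ[ℝ] ℂ)) :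
    (∫ s, ((diagForm G F z s + 1) ^ (n + 1))⁻¹) * topCoeff (berezinStd
        (dbarS G F (z, z) ^ n * g (z, z) * divPow (superFlat G F (z, z)) n) * φ)
      = topCoeff (map (precomp diagMap) φ) := by
  set L := diffMatrix F z with hL
  have hdet := hM.det_diffMatrix_ne_zero hz
  -- for `G = Bᴴ B` the quadratic form is `|B L s|²`
  obtain ⟨B, hB⟩ := exists_conjTranspose_mul_self (hM.pos _ hz)
  have hBdet : (G (z, z)).det = conj B.det * B.det := by
    rw [hB, Matrix.det_mul, Matrix.det_conjTranspose]
    rfl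
  have hB0 : B.det ≠ 0 := fun h => ((hM.good _ hz).2).ne_zero (by rw [hBdet, h, mul_zero])
  have hN0 : (B * L).det ≠ 0 := by
    rw [Matrix.det_mul]
    exact mul_ne_zero hB0 hdet
  have hQ : ∀ s, diagForm G F z s = ((∑ i, ‖(B * L).mulVec s i‖ ^ 2 : ℝ) : ℂ) := by
    intro s
    set v := L.mulVec s with hv
    have h1 : diagForm G F z s = star v ⬝ᵥ (G (z, z)).mulVec v := by
      rw [Matrix.dotProduct_mulVec]
      rfl
    rw [h1, hB, ← Matrix.mulVec_mulVec, Matrix.dotProduct_mulVec, Matrix.vecMul_conjTranspose,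
      star_star, ← Matrix.mulVec_mulVec, ← hv, Complex.ofReal_sum]
    refine Finset.sum_congr rfl fun i _ => ?_
    change conj (B.mulVec v i) * B.mulVec v i = _
    rw [mul_comm, Complex.mul_conj, Complex.normSq_eq_norm_sq]
  simp only [hQ]
  have hG1 : (G (z, z)).det * (‖L.det‖ ^ 2 : ℝ) = ((‖(B * L).det‖ ^ 2 : ℝ) : ℂ) := by
    rw [hBdet, mul_comm (conj _), Complex.mul_conj, Complex.normSq_eq_norm_sq, Matrix.det_mul,
      norm_mul, mul_pow, Complex.ofReal_mul]
  refine (congrArg₂ (· * ·) (integral_inv_normSq_add_one hN0)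
    (topCoeff_residue (hM.zero z hz) ((hM.hol _ hz).differentiableAt (by simp)) (hM.good _ hz)
      (hM.fderiv_eq hz) (hM.mem _ hz) (hM.one z hz) φ)).trans ?_
  rw [hG1]
  have e1 : ((‖(B * L).det‖ ^ 2 : ℝ) : ℂ) ≠ 0 := by
    exact_mod_cast pow_ne_zero 2 (norm_ne_zero_iff.2 hN0)
  have e2 : (n.factorial : ℂ) ≠ 0 := by exact_mod_cast n.factorial_ne_zero
  have e3 : (Real.pi : ℂ) ^ n ≠ 0 := pow_ne_zero _ (by exact_mod_cast Real.pi_ne_zero)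
  generalize ((‖(B * L).det‖ ^ 2 : ℝ) : ℂ) = d at e1 ⊢
  field_simp

/-- The residue forms converge to the current of integration over the diagonal. -/
theorem DiagonalModel.tendsto_kerRes (hM : DiagonalModel G F g U)
    {f : (Fin n → ℂ) × (Fin n → ℂ) → ExteriorAlgebra ℂ ((Fin n → ℂ) × (Fin n → ℂ) →ₗ[ℝ] ℂ)}
    (hf : ∀ x, SmoothAt f x) (hc : HasCompactSupport f) (hfU : tsupport f ⊆ U) :
    Filter.Tendsto (fun t : ℝ => ∫ x, topCoeff (kerRes G F g (t ^ 2) x * f x)) (𝓝[>] 0)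
      (𝓝 (∫ z, topCoeff (map (precomp diagMap) (f (z, z))))) := by
  have hG' : ∀ x ∈ U, ∀ᶠ y in 𝓝 x, GoodAt G y := fun x hx =>
    (hM.isOpen.eventually_mem hx).mono fun y hy => hM.good y hy
  obtain ⟨c, hc0, hrc⟩ := hM.rLower
  have hr : ContinuousOn (rFlat G F) U := fun x hx =>
    (contDiffAt_rFlat (hM.good x hx) (hM.hol x hx)).continuousAt.continuousWithinAt
  set Y : ℕ → (Fin n → ℂ) × (Fin n → ℂ) → ExteriorAlgebra ℂ _ := fun k x =>
    berezinStd (dbarS G F x ^ k * g x * divPow (superFlat G F x) n) with hYdef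
  have hY : ∀ k, ∀ x ∈ U, SmoothAt (Y k) x := fun k x hx =>
    ((((smoothAt_dbarS (hG' x hx) (hM.hol x hx)).pow k).mul
      (hM.weight x hx)).mul (smoothAt_divPow (hG' x hx) (hM.hol x hx))).linear berezinStd
  -- the terms with `k < n` tend to zero, so only the term `(∂̄s)ⁿ` leaves a residue
  have key : ∀ k < n, _ := fun k hk =>
    tendsto_integral_residue_term hM.isOpen hr hc0 hrc
      (pairing_of_tsupport_subset wedgeTop (hY k) hf hc hfU).2.1
      (pairing_of_tsupport_subset wedgeTop (hY k) hf hc hfU).2.2.1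
      (pairing_of_tsupport_subset wedgeTop (hY k) hf hc hfU).2.2.2 hk
  have lead := tendsto_integral_residue_leading hM.isOpen hr hc0 hrc
      (pairing_of_tsupport_subset wedgeTop (hY n) hf hc hfU).2.1
      (pairing_of_tsupport_subset wedgeTop (hY n) hf hc hfU).2.2.1
      (pairing_of_tsupport_subset wedgeTop (hY n) hf hc hfU).2.2.2
      (Q := diagForm G F) fun z hz s => hM.tendsto_rFlat hz s
  have hlim : ∀ z, (∫ s, ((diagForm G F z s + 1) ^ (n + 1))⁻¹) * wedgeTop (Y n (z, z)) (f (z, z))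
      = topCoeff (map (precomp diagMap) (f (z, z))) := by
    intro z
    by_cases hz : (z, z) ∈ tsupport f
    · exact hM.residue_mass (hfU hz) _
    · have h0 : f (z, z) = 0 := image_eq_zero_of_notMem_tsupport hz
      rw [h0, map_zero, map_zero, map_zero, mul_zero]
  simp only [hlim] at lead
  have hsq : Filter.Tendsto (fun t : ℝ => t ^ 2) (𝓝[>] 0) (𝓝[>] 0) := by
    refine tendsto_nhdsWithin_iff.2 ⟨?_, ?_⟩
    · exact ((continuous_pow 2).tendsto' (0 : ℝ) 0 (by norm_num)).mono_left nhdsWithin_le_nhds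
    · filter_upwards [self_mem_nhdsWithin] with t ht
      exact pow_pos (show (0 : ℝ) < t from ht) 2
  have hsum := (tendsto_finsetSum (Finset.range n) fun k hk =>
    ((key k (Finset.mem_range.1 hk)).2.comp hsq)).add lead.2
  rw [Finset.sum_const_zero, zero_add] at hsum
  refine hsum.congr' ?_
  filter_upwards [self_mem_nhdsWithin] with t ht
  have he : ∀ x, topCoeff (kerRes G F g (t ^ 2) x * f x)
      = (∑ k ∈ Finset.range n, ((t ^ 2 : ℝ) : ℂ) * ((rFlat G F x + (t ^ 2 : ℝ)) ^ (k + 1))⁻¹ *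
          wedgeTop (Y k x) (f x))
        + ((t ^ 2 : ℝ) : ℂ) * ((rFlat G F x + (t ^ 2 : ℝ)) ^ (n + 1))⁻¹ *
          wedgeTop (Y n x) (f x) := by
    intro x
    rw [kerRes_eq_sum, ← Finset.sum_range_succ (fun k => ((t ^ 2 : ℝ) : ℂ) *
      ((rFlat G F x + (t ^ 2 : ℝ)) ^ (k + 1))⁻¹ * wedgeTop (Y k x) (f x)), Finset.sum_mul, map_sum]
    refine Finset.sum_congr rfl fun k _ => ?_
    rw [smul_mul_assoc, map_smul, smul_eq_mul]
    rfl
  have hint : ∀ k ∈ Finset.range n, Integrable (fun x => ((t ^ 2 : ℝ) : ℂ) *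
      ((rFlat G F x + (t ^ 2 : ℝ)) ^ (k + 1))⁻¹ * wedgeTop (Y k x) (f x)) volume := fun k hk =>
    (key k (Finset.mem_range.1 hk)).1 _ (sq_nonneg t)
  simp only [he]
  refine ((integral_add (integrable_finsetSum _ hint) (lead.1 t ht)).trans ?_).symm
  congr 1
  exact integral_finsetSum _ hint

/-- The equation `∂̄K = [Δ] - P` near a point of the diagonal. -/
theorem DiagonalModel.integral_kerReg_zero (hM : DiagonalModel G F g U)
    {f : (Fin n → ℂ) × (Fin n → ℂ) → ExteriorAlgebra ℂ ((Fin n → ℂ) × (Fin n → ℂ) →ₗ[ℝ] ℂ)}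
    (hf : ∀ x, SmoothAt f x) (hc : HasCompactSupport f) (hfU : tsupport f ⊆ U) :
    ∫ x, topCoeff (kerReg G F g 0 x * dbarFlat (ι ℂ) f x)
      = (∫ z, topCoeff (map (precomp diagMap) (f (z, z))))
        - ∫ x, topCoeff (kerP G F g x * f x) := by
  obtain ⟨hdf, hdc, hdU⟩ := smoothAt_dbarFlat_of_tsupport hf hc
  obtain ⟨c, hc0, hrc⟩ := hM.rLower
  have hsq : Filter.Tendsto (fun t : ℝ => t ^ 2) (𝓝[>] 0) (𝓝[>] 0) := by
    refine tendsto_nhdsWithin_iff.2 ⟨?_, ?_⟩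
    · exact ((continuous_pow 2).tendsto' (0 : ℝ) 0 (by norm_num)).mono_left nhdsWithin_le_nhds
    · filter_upwards [self_mem_nhdsWithin] with t ht
      exact pow_pos (show (0 : ℝ) < t from ht) 2
  have h1 := (hM.tendsto_kerReg wedgeTop hdf hdc (hdU.trans hfU)).2.comp hsq
  have h2 := (hM.tendsto_kerRes hf hc hfU).sub_const (∫ x, topCoeff (kerP G F g x * f x))
  refine tendsto_nhds_unique h1 (h2.congr' ?_)
  filter_upwards [self_mem_nhdsWithin] with t ht
  have ht' : (0 : ℝ) < t := ht
  exact (integral_kerReg_dbarFlat hM.isOpen hM.good hM.hol hM.weight hM.closed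
    (fun x hx => invol_of_mem_lFib (hM.mem x hx))
    (fun x hx => add_ofReal_ne_zero hc0 (hrc x hx) (sq_nonneg t) (Or.inr (by positivity)))
    hf hc hfU).symm

end Residue

/-! ### The minimal solution and the kernels in a chart -/

section Minimal

/-- In a finite-dimensional Hilbert space, the functional of minimal norm with `τ η = 1` is
`⟪η, ·⟫ / |η|²`. -/
theorem eq_inner_div_of_minimal {W : Type*} [NormedAddCommGroup W] [InnerProductSpace ℂ W]
    [FiniteDimensional ℂ W] {η : W} (hη : η ≠ 0) {τ : Dual ℂ W} (h1 : τ η = 1)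
    (hmin : ∀ τ' : Dual ℂ W, τ' η = 1 →
      sSup {r | ∃ v : W, ‖v‖ ≤ 1 ∧ r = ‖τ v‖} ≤ sSup {r | ∃ v : W, ‖v‖ ≤ 1 ∧ r = ‖τ' v‖}) (v : W) :
    τ v = (inner ℂ η η)⁻¹ * inner ℂ η v := by
  have hn : ‖η‖ ≠ 0 := norm_ne_zero_iff.2 hη
  have hηη : inner ℂ η η = ((‖η‖ : ℂ)) ^ 2 := inner_self_eq_norm_sq_to_K η
  have hn' : (‖η‖ : ℂ) ≠ 0 := by exact_mod_cast hn
  have : CompleteSpace W := FiniteDimensional.complete ℂ W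
  obtain ⟨ξ, hξ⟩ := (InnerProductSpace.toDual ℂ W).surjective (LinearMap.toContinuousLinearMap τ)
  have hτ : ∀ w, τ w = inner ℂ ξ w := fun w => by
    rw [← InnerProductSpace.toDual_apply_apply, hξ]
    rfl
  have hξη : inner ℂ ξ η = 1 := by rw [← hτ, h1]
  let τ₀ : Dual ℂ W := (inner ℂ η η)⁻¹ • (innerₛₗ ℂ η)
  have hτ₀ : ∀ w, τ₀ w = (inner ℂ η η)⁻¹ * inner ℂ η w := fun w => rfl
  have h2 := hmin τ₀ (by rw [hτ₀, inv_mul_cancel₀ (inner_self_ne_zero.2 hη)])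
  have h3 : sSup {r | ∃ v : W, ‖v‖ ≤ 1 ∧ r = ‖τ₀ v‖} ≤ ‖η‖⁻¹ := by
    refine csSup_le ⟨_, 0, by simp, rfl⟩ ?_
    rintro _ ⟨w, hw, rfl⟩
    rw [hτ₀, norm_mul, norm_inv, hηη, norm_pow, Complex.norm_real, norm_norm]
    calc (‖η‖ ^ 2)⁻¹ * ‖inner ℂ η w‖ ≤ (‖η‖ ^ 2)⁻¹ * (‖η‖ * 1) := by
          gcongr
          exact (norm_inner_le_norm _ _).trans (by gcongr)
      _ = ‖η‖⁻¹ := by field_simp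
  have hξ0 : ξ ≠ 0 := fun h => by simp [h] at hξη
  have h4 : ‖ξ‖ ≤ sSup {r | ∃ v : W, ‖v‖ ≤ 1 ∧ r = ‖τ v‖} := by
    refine le_csSup ⟨‖ξ‖, ?_⟩ ⟨(‖ξ‖ : ℂ)⁻¹ • ξ, ?_, ?_⟩
    · rintro _ ⟨w, hw, rfl⟩
      rw [hτ]
      calc ‖inner ℂ ξ w‖ ≤ ‖ξ‖ * ‖w‖ := norm_inner_le_norm _ _
        _ ≤ ‖ξ‖ * 1 := by gcongr
        _ = ‖ξ‖ := mul_one _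
    · rw [norm_smul, norm_inv, Complex.norm_real, norm_norm,
        inv_mul_cancel₀ (norm_ne_zero_iff.2 hξ0)]
    · rw [hτ, inner_smul_right, inner_self_eq_norm_sq_to_K]
      have : ‖ξ‖ ≠ 0 := norm_ne_zero_iff.2 hξ0
      have h5 : ((‖ξ‖ : ℂ)⁻¹ * (‖ξ‖ : ℂ) ^ 2) = (‖ξ‖ : ℂ) := by
        have : (‖ξ‖ : ℂ) ≠ 0 := by exact_mod_cast this
        field_simp
      exact (congrArg norm h5).symm ▸ (by rw [Complex.norm_real, norm_norm])
  have h6 : ‖ξ‖ ≤ ‖η‖⁻¹ := h4.trans (h2.trans h3)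
  -- equality in the Cauchy-Schwarz inequality
  have h7 : ‖ξ - ((‖η‖ ^ 2 : ℝ) : ℂ)⁻¹ • η‖ ^ 2 ≤ 0 := by
    rw [@norm_sub_sq ℂ, inner_smul_right, hξη, norm_smul, norm_inv, Complex.norm_real, mul_one,
      Real.norm_of_nonneg (sq_nonneg _), ← Complex.ofReal_inv]
    change ‖ξ‖ ^ 2 - 2 * (‖η‖ ^ 2)⁻¹ + ((‖η‖ ^ 2)⁻¹ * ‖η‖) ^ 2 ≤ 0
    have h8 : ‖ξ‖ ^ 2 ≤ (‖η‖⁻¹) ^ 2 := by gcongr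
    have h9 : ((‖η‖ ^ 2)⁻¹ * ‖η‖) ^ 2 = (‖η‖ ^ 2)⁻¹ := by field_simp
    rw [h9]
    rw [inv_pow] at h8
    linarith
  have h10 : ξ = ((‖η‖ ^ 2 : ℝ) : ℂ)⁻¹ • η := by
    rw [← sub_eq_zero, ← norm_eq_zero]
    exact pow_eq_zero_iff two_ne_zero |>.1 (le_antisymm h7 (sq_nonneg _))
  rw [hτ, h10, inner_smul_left, ← Complex.ofReal_inv, Complex.conj_ofReal, hηη]
  push_cast
  rfl

variable {n : ℕ} {V : Type*} [NormedAddCommGroup V] [NormedSpace ℂ V]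
  {H : Type*} [TopologicalSpace H] {I : ModelWithCorners ℂ V H}
  {M : Type*} [TopologicalSpace M] [ChartedSpace H M]
  {E : M → Type*} [TopologicalSpace (TotalSpace (Fin n → ℂ) E)]
  [∀ p, AddCommGroup (E p)] [∀ p, Module ℂ (E p)] [∀ p, TopologicalSpace (E p)]
  [FiberBundle (Fin n → ℂ) E] [VectorBundle ℂ (Fin n → ℂ) E]

theorem minimalSolution_eq {h : HermitianMetric I n E} {η : ∀ p, E p} {σ : ∀ p, Dual ℂ (E p)}
    (hσ : IsMinimalSolution h η σ) {p : M} (hp : η p ≠ 0) (v : E p) :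
    σ p v = (h.inner p (η p) (η p))⁻¹ * h.inner p (η p) v := by
  have hre : ∀ v : E p, 0 ≤ (h.inner p v v).re := fun v => by
    rcases eq_or_ne v 0 with rfl | hv
    · simp
    · exact (h.pos p v hv).le
  let core : InnerProductSpace.Core ℂ (E p) :=
    { inner := fun v w => h.inner p v w
      conj_inner_symm := fun v w => h.symm p w v
      re_inner_nonneg := hre
      add_left := fun v w u => by rw [map_add, LinearMap.add_apply]
      smul_left := fun v w a => by rw [LinearMap.map_smulₛₗ, LinearMap.smul_apply, smul_eq_mul]
      definite := fun v hv => by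
        by_contra hv0
        have := h.pos p v hv0
        rw [show h.inner p v v = 0 from hv] at this
        simp at this }
  have hfin : Module.Finite ℂ (E p) := Module.Finite.of_surjective (symmAt n E p p) fun v =>
    ⟨_, symmAt_coordAt (FiberBundle.mem_baseSet_trivializationAt' p) v⟩
  let i1 : NormedAddCommGroup (E p) := core.toNormedAddCommGroup
  let i2 : InnerProductSpace ℂ (E p) := InnerProductSpace.ofCore core.toCore
  exact eq_inner_div_of_minimal (W := E p) hp (hσ p hp).1 (hσ p hp).2 v

end Minimal

section LocalKernels

variable {n : ℕ} {V : Type*} [NormedAddCommGroup V] [NormedSpace ℂ V]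
  {H : Type*} [TopologicalSpace H] {I : ModelWithCorners ℂ V H}
  {M : Type*} [TopologicalSpace M] [ChartedSpace H M]
  {E : M → Type*} [TopologicalSpace (TotalSpace (Fin n → ℂ) E)]
  [∀ p, AddCommGroup (E p)] [∀ p, Module ℂ (E p)] [∀ p, TopologicalSpace (E p)]
  [FiberBundle (Fin n → ℂ) E] [VectorBundle ℂ (Fin n → ℂ) E]
  [FiniteDimensional ℂ V] [ComplexCoords V]
  [I.Boundaryless] [IsManifold I ω M] [ContMDiffVectorBundle ω (Fin n → ℂ) E I]
  {h : HermitianMetric I n E} {η : ∀ p, E p} {σ : ∀ p, Dual ℂ (E p)} {g : ∀ p, GFib V (E p)}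
  {c : M} {x : V}

theorem rFlat_gram (hx : x ∈ localDomain I n E c) :
    rFlat (gram h c) (secRep I η c) x = h.inner ((extChartAt I c).symm x)
      (η ((extChartAt I c).symm x)) (η ((extChartAt I c).symm x)) := by
  have h1 := inner_symmAt h c x (secRep I η c x) (secRep I η c x)
  rw [secRep, symmAt_coordAt hx.2] at h1
  rw [h1, rFlat, Finset.sum_comm]
  refine Finset.sum_congr rfl fun j _ => ?_
  rw [sFlat, Finset.sum_mul]
  rfl

theorem rFlat_gram_ne_zero (hx : x ∈ localDomain I n E c) (h0 : η ((extChartAt I c).symm x) ≠ 0) :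
    rFlat (gram h c) (secRep I η c) x ≠ 0 := fun hr => by
  have := h.pos _ _ h0
  rw [← rFlat_gram (h := h) hx, hr] at this
  simp at this

theorem localSec_minimal (hσ : IsMinimalSolution h η σ) (hx : x ∈ localDomain I n E c)
    (h0 : η ((extChartAt I c).symm x) ≠ 0) : localSec n I (fun q => inEDual (σ q)) c x
      = (rFlat (gram h c) (secRep I η c) x)⁻¹ • secS (gram h c) (secRep I η c) x := by
  refine (map_inEDual _).trans ?_
  rw [secS, Finset.smul_sum]
  have h1 : (symmAt n E c ((extChartAt I c).symm x)).dualMap (σ ((extChartAt I c).symm x))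
      = ∑ j, ((rFlat (gram h c) (secRep I η c) x)⁻¹ * sFlat (gram h c) (secRep I η c) j x) •
          LinearMap.proj j := by
    refine LinearMap.ext fun w => ?_
    have h2 := inner_symmAt h c x (secRep I η c x) w
    rw [secRep, symmAt_coordAt hx.2] at h2
    change σ _ (symmAt n E c _ w) = _
    rw [minimalSolution_eq hσ h0, rFlat_gram hx, h2, LinearMap.sum_apply, Finset.sum_comm,
      Finset.mul_sum]
    refine Finset.sum_congr rfl fun j _ => ?_
    change _ = _ * sFlat (gram h c) (secRep I η c) j x * w j
    rw [sFlat, mul_assoc, Finset.sum_mul]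
    rfl
  rw [h1, map_sum]
  simp only [map_smul, smul_smul]

theorem mul_add_pow_of_absorb {R : Type*} [Ring R] {S A Y : R} (hY : Commute S Y)
    (hA : S * A = 0) (k : ℕ) : S * (A + Y) ^ k = S * Y ^ k := by
  induction k with
  | zero => simp
  | succ k ih =>
    rw [pow_succ, ← mul_assoc, ih, mul_add, (hY.pow_right k).eq, mul_assoc _ S A, hA, mul_zero,
      zero_add, ← (hY.pow_right k).eq, mul_assoc, ← pow_succ]

theorem secS_sq {G : V → Matrix (Fin n) (Fin n) ℂ} {F : V → Fin n → ℂ} :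
    secS G F x * secS G F x = 0 := by
  have : secS G F x = ι ℂ (∑ j, sFlat G F j x •
      ((0 : V →ₗ[ℝ] ℂ), (0 : Fin n → ℂ), (LinearMap.proj j : Dual ℂ (Fin n → ℂ)))) := by
    rw [secS, map_sum]
    refine Finset.sum_congr rfl fun j _ => ?_
    rw [map_smul]
    rfl
  rw [this, ExteriorAlgebra.ι_sq_zero]

theorem localSec_mul (ξ ζ : ∀ p, GFib V (E p)) (c : M) (x : V) :
    localSec n I (fun p => ξ p * ζ p) c x = localSec n I ξ c x * localSec n I ζ c x := map_mul _ _ _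

theorem localSec_divPow (ξ : ∀ p, GFib V (E p)) (k : ℕ) (c : M) (x : V) :
    localSec n I (fun p => divPow (ξ p) k) c x = divPow (localSec n I ξ c x) k :=
  (map_smul _ _ _).trans (congrArg _ (map_pow _ _ _))

theorem localDomain_nonzero_open (hη : ContMDiff I (I.prod 𝓘(ℂ, Fin n → ℂ)) ω
      (fun p => TotalSpace.mk' (Fin n → ℂ) p (η p))) (hx : x ∈ localDomain I n E c)
    (h0 : η ((extChartAt I c).symm x) ≠ 0) :
    ∀ᶠ y in 𝓝 x, y ∈ localDomain I n E c ∧ η ((extChartAt I c).symm y) ≠ 0 := by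
  have h1 := (contDiffAt_secRep hη hx).continuousAt.eventually_ne
    ((secRep_eq_zero_iff hx).not.2 h0)
  filter_upwards [(localDomain_open (n := n) (E := E) c).eventually_mem hx, h1] with y hy hy0
  exact ⟨hy, (secRep_eq_zero_iff hy).not.1 hy0⟩

theorem localSec_uSec (hη : ContMDiff I (I.prod 𝓘(ℂ, Fin n → ℂ)) ω
      (fun p => TotalSpace.mk' (Fin n → ℂ) p (η p))) (hσ : IsMinimalSolution h η σ)
    (hx : x ∈ localDomain I n E c) (h0 : η ((extChartAt I c).symm x) ≠ 0) :
    localSec n I (uSec n I σ) c x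
      = secS (gram h c) (secRep I η c) x * resolvent (gram h c) (secRep I η c) 0 x := by
  set G := gram h c
  set F : V → Fin n → ℂ := secRep I η c with hFdef
  have hr := rFlat_gram_ne_zero (h := h) hx h0
  have hG := gram_goodAt h hx
  have hF := contDiffAt_secRep hη hx
  have hev : localSec n I (fun q => inEDual (σ q)) c =ᶠ[𝓝 x]
      fun y => (rFlat G F y)⁻¹ • secS G F y := by
    filter_upwards [localDomain_nonzero_open hη hx h0] with y hy
    exact localSec_minimal hσ hy.1 hy.2
  have hrs : ContDiffAt ℝ ∞ (fun y => (rFlat G F y)⁻¹) x := (contDiffAt_rFlat hG hF).inv hr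
  have hsm : SmoothAt (localSec n I (fun q => inEDual (σ q)) c) x :=
    (SmoothAt.smul hrs (smoothAt_secS hG hF)).congr hev
  have hd : localSec n I (dbarSec n I fun q => inEDual (σ q)) c x
      = inT (dbarF (fun y => (rFlat G F y)⁻¹) x) * secS G F x
        + (rFlat G F x)⁻¹ • dbarS G F x := by
    rw [localSec_dbarSec hx hsm, dbarFlat_congr hev, dbarFlat_smul hrs (smoothAt_secS hG hF),
      dbarFlat_secS hG hF]
  have hu : localSec n I (uSec n I σ) c x = ∑ k ∈ Finset.range n,
      localSec n I (fun q => inEDual (σ q)) c x *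
        localSec n I (dbarSec n I fun q => inEDual (σ q)) c x ^ k := by
    refine (map_sum _ _ _).trans (Finset.sum_congr rfl fun k _ => ?_)
    exact (map_mul _ _ _).trans (congrArg _ (map_pow _ _ _))
  have hS : secS G F x * (inT (dbarF (fun y => (rFlat G F y)⁻¹) x) * secS G F x) = 0 := by
    rw [← mul_assoc, show secS G F x * inT (dbarF (fun y => (rFlat G F y)⁻¹) x)
      = -(inT (dbarF (fun y => (rFlat G F y)⁻¹) x) * secS G F x) from ?_, neg_mul, mul_assoc,
      secS_sq, mul_zero, neg_zero]
    have := ι_mul_eq_invol_mul ((dbarF (fun y => (rFlat G F y)⁻¹) x,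
      (0 : Fin n → ℂ), (0 : Dual ℂ (Fin n → ℂ)))) (secS G F x)
    rw [invol_secS, neg_mul] at this
    exact neg_eq_iff_eq_neg.1 this.symm
  have hc : Commute (secS G F x) ((rFlat G F x)⁻¹ • dbarS G F x) :=
    ((commute_of_even invol_dbarS _).symm).smul_right _
  rw [hu, hd, hev.self_of_nhds, resolvent, Finset.mul_sum, Finset.sum_range_succ, mul_smul_comm,
    secS_mul_dbarS_pow, smul_zero, add_zero]
  refine Finset.sum_congr rfl fun k _ => ?_
  rw [smul_mul_assoc, mul_add_pow_of_absorb hc hS, smul_pow, mul_smul_comm, smul_smul,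
    mul_smul_comm, Complex.ofReal_zero, add_zero, ← inv_pow, pow_succ']

/-- In a chart and a frame, `K` is the regularised kernel for `ε = 0`, because `σ = s / |η|²`. -/
theorem localForm_kernelK (hη : ContMDiff I (I.prod 𝓘(ℂ, Fin n → ℂ)) ω
      (fun p => TotalSpace.mk' (Fin n → ℂ) p (η p))) (hσ : IsMinimalSolution h η σ)
    (hx : x ∈ localDomain I n E c) (h0 : η ((extChartAt I c).symm x) ≠ 0) :
    localForm I (kernelK h η σ g) c x
      = kerReg (gram h c) (secRep I η c) (localSec n I g c) 0 x := by
  refine (localForm_berezin _ hx).trans ?_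
  rw [kerReg, ← localSec_uSec hη hσ hx h0, ← localSec_superCurv h hη hx, ← localSec_divPow,
    ← localSec_mul, ← localSec_mul]

theorem localForm_kernelP (hη : ContMDiff I (I.prod 𝓘(ℂ, Fin n → ℂ)) ω
      (fun p => TotalSpace.mk' (Fin n → ℂ) p (η p))) (hx : x ∈ localDomain I n E c) :
    localForm I (kernelP h η g) c x
      = kerP (gram h c) (secRep I η c) (localSec n I g c) x := by
  refine (localForm_berezin _ hx).trans ?_
  rw [kerP, ← localSec_superCurv h hη hx, ← localSec_divPow, ← localSec_mul]

theorem smoothForm_kernelP (hη : ContMDiff I (I.prod 𝓘(ℂ, Fin n → ℂ)) ω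
      (fun p => TotalSpace.mk' (Fin n → ℂ) p (η p)))
    (hg : ∀ c, ∀ x ∈ localDomain I n E c, SmoothAt (localSec n I g c) x) :
    SmoothForm I (kernelP h η g) := smoothForm_of_forall fun p => by
  have hd := mem_localDomain (I := I) (n := n) (E := E) p
  refine ⟨p, mem_extChartAt_source p, (smoothAt_kerP (gram_goodAt_eventually h hd)
    (contDiffAt_secRep hη hd) (hg p _ hd)).congr ?_⟩
  filter_upwards [(localDomain_open (n := n) (E := E) p).eventually_mem hd] with y hy
  exact localForm_kernelP hη hy

theorem map_mem_lFib {Ep Fp : Type*} [AddCommGroup Ep] [Module ℂ Ep] [AddCommGroup Fp]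
    [Module ℂ Fp] {D : V →L[ℂ] V}
    {a : Ep →ₗ[ℂ] Fp} {b : Dual ℂ Ep →ₗ[ℂ] Dual ℂ Fp} {y : GFib V Ep} (hy : y ∈ lFib V Ep 0) :
    map ((precomp (reL D)).prodMap (a.prodMap b)) y ∈ lFib V Fp 0 := by
  refine mem_lFib_zero_induction (p := fun y => map
    ((precomp (reL D)).prodMap (a.prodMap b)) y ∈ lFib V Fp 0) (fun k y hy => ?_)
    (by rw [map_zero]; exact zero_mem _) (fun x y hx hy => by rw [map_add]; exact add_mem hx hy) hy
  have h1 : lFib V Fp 0 ≥ LinearMap.range (inEDual : Dual ℂ Fp →ₗ[ℂ] GFib V Fp) ^ k *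
      (covec01 V).map (inT : (V →ₗ[ℝ] ℂ) →ₗ[ℂ] GFib V Fp) ^ k :=
    le_iSup_of_le k (le_iSup_of_le k (le_iSup_of_le (by simp) le_rfl))
  refine h1 ?_
  have h2 := Submodule.mem_map_of_mem (f := (map
    ((precomp (reL D)).prodMap (a.prodMap b))).toLinearMap) hy
  rw [Submodule.map_mul, Submodule.map_pow, Submodule.map_pow] at h2
  refine SetLike.le_def.1 (mul_le_mul' (pow_le_pow_left' ?_ k) (pow_le_pow_left' ?_ k)) h2
  · rintro _ ⟨_, ⟨τ, rfl⟩, rfl⟩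
    exact ⟨b τ, (map_inEDual τ).symm⟩
  · rintro _ ⟨_, ⟨ℓ, hℓ, rfl⟩, rfl⟩
    refine ⟨precomp (reL D) ℓ, fun v => ?_, (map_inT ℓ).symm⟩
    change ℓ (D (Complex.I • v)) = -Complex.I * ℓ (D v)
    rw [map_smul]
    exact hℓ _

theorem algebraMapInv_map {W W' : Type*} [AddCommGroup W] [Module ℂ W] [AddCommGroup W']
    [Module ℂ W'] (f : W →ₗ[ℂ] W') (y : ExteriorAlgebra ℂ W) :
    ExteriorAlgebra.algebraMapInv (map f y) = ExteriorAlgebra.algebraMapInv y := by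
  have : (ExteriorAlgebra.algebraMapInv (R := ℂ)).comp (map f)
      = ExteriorAlgebra.algebraMapInv := ExteriorAlgebra.hom_ext (LinearMap.ext fun w => by
    change ExteriorAlgebra.algebraMapInv (map f (ι ℂ w))
      = ExteriorAlgebra.algebraMapInv (ι ℂ w)
    have e : ExteriorAlgebra.algebraMapInv (ι ℂ w) = 0 :=
      ExteriorAlgebra.lift_ι_apply _ _ _ _
    rw [map_apply_ι, e]
    exact ExteriorAlgebra.lift_ι_apply _ _ _ _)
  exact DFunLike.congr_fun this y

theorem smoothAt_localSec_of_smoothSec (hg : SmoothSec n I g) (hx : x ∈ localDomain I n E c) :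
    SmoothAt (localSec n I g c) x := fun ℓ =>
  (hg c ℓ).contDiffAt ((localDomain_open c).mem_nhds hx)

theorem nablaFlat_localSec (hg : SmoothSec n I g) (hn : ∀ p, nabla n I η g p = 0)
    (hx : x ∈ localDomain I n E c) : nablaFlat (secRep I η c) (localSec n I g c) x = 0 := by
  rw [nablaFlat, ← localSec_dbarSec (n := n) hx (smoothAt_localSec_of_smoothSec hg hx)]
  have h1 : localSec n I (nabla n I η g) c x = delta (secRep (n := n) I η c x) (localSec n I g c x)
      - localSec n I (dbarSec n I g) c x :=
    (map_sub _ _ _).trans (congrArg (· - _) (localSec_delta η g hx))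
  have h2 : localSec n I (nabla n I η g) c x = 0 :=
    (congrArg (map _) (hn _)).trans (map_zero _)
  exact h1.symm.trans h2

theorem localSec_one : localSec n I (1 : ∀ p, GFib V (E p)) c x = 1 := map_one _

theorem kernelP_one (h : HermitianMetric I n E) (η : ∀ p, E p) :
    kernelP h η 1 = topChernForm h := by
  funext p
  have hd := mem_localDomain (I := I) (n := n) (E := E) p
  have hp := isDualPair_frame (n := n) (E := E) (c := p) (q := p)
    (FiberBundle.mem_baseSet_trivializationAt' p)
  have h1 : superCurv h η p = (∑ i, inT ((1 / (2 * Real.pi * Complex.I) : ℂ) •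
        ((fderiv ℝ (fun y => coordAt n E p ((extChartAt I p).symm y)
          (η ((extChartAt I p).symm y)) i) (extChartAt I p p) : V →ₗ[ℝ] ℂ)
        + ∑ j, (coordAt n E p p (η p) j) • connMat h p (extChartAt I p p) i j)) *
        inE (frame n E p i p))
      + ∑ i, ∑ j, inForm ((Complex.I / (2 * Real.pi) : ℂ) •
        curvMat h p (extChartAt I p p) i j) * inE (frame n E p i p) *
          inEDual (dualFrame n E p j p) := by
    simp only [superCurv, covDeriv, curvTilde, Finset.smul_sum, map_smul, smul_mul_assoc]
  have hinv : ∀ i j, invol ((Complex.I / (2 * Real.pi) : ℂ) •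
      curvMat h p (extChartAt I p p) i j)
        = (Complex.I / (2 * Real.pi) : ℂ) • curvMat h p (extChartAt I p p) i j := fun i j => by
    rw [map_smul]
    exact congrArg _ (invol_curvFlat (gram_goodAt_eventually h hd) i j)
  have h2 := berezinOf_divPow hp.pairing (fun i => (1 / (2 * Real.pi * Complex.I) : ℂ) •
        ((fderiv ℝ (fun y => coordAt n E p ((extChartAt I p).symm y)
          (η ((extChartAt I p).symm y)) i) (extChartAt I p p) : V →ₗ[ℝ] ℂ)
        + ∑ j, (coordAt n E p p (η p) j) • connMat h p (extChartAt I p p) i j)) _ hinv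
  rw [← h1] at h2
  refine Eq.trans ?_ h2
  change berezinOf _ _ ((1 : GFib V (E p)) * _) = _
  rw [one_mul]

end LocalKernels

/-! ### The current equation on `X × X` -/

section ChartRep

variable {V : Type*} [NormedAddCommGroup V] [NormedSpace ℂ V]
  {H : Type*} [TopologicalSpace H] {I : ModelWithCorners ℂ V H}
  {M : Type*} [TopologicalSpace M] [ChartedSpace H M] {α β : Form V M} {c : M}

/-- The expression of a form in a chart, extended by zero. -/
def chartRep (I : ModelWithCorners ℂ V H) (α : Form V M) (c : M) (x : V) :
    ExteriorAlgebra ℂ (V →ₗ[ℝ] ℂ) :=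
  open scoped Classical in if x ∈ (extChartAt I c).target then localForm I α c x else 0

theorem chartRep_of_mem {x : V} (hx : x ∈ (extChartAt I c).target) :
    chartRep I α c x = localForm I α c x := if_pos hx

theorem chartRep_of_notMem {x : V} (hx : x ∉ (extChartAt I c).target) :
    chartRep I α c x = 0 := if_neg hx

variable [I.Boundaryless]

theorem tsupport_chartRep (hc : HasCompactSupport α) (hα : tsupport α ⊆ (extChartAt I c).source) :
    HasCompactSupport (chartRep I α c) ∧ ∀ x ∈ tsupport (chartRep I α c),
      x ∈ (extChartAt I c).target ∧ (extChartAt I c).symm x ∈ tsupport α := by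
  have hK : IsCompact (extChartAt I c '' tsupport α) :=
    hc.isCompact.image_of_continuousOn ((continuousOn_extChartAt c).mono hα)
  have h0 : ∀ x, chartRep I α c x ≠ 0 → x ∈ extChartAt I c '' tsupport α := by
    intro x hx
    by_cases ht : x ∈ (extChartAt I c).target
    · rw [chartRep_of_mem ht] at hx
      exact ⟨_, subset_closure fun h => hx (localForm_eq_zero h), (extChartAt I c).right_inv ht⟩
    · exact absurd (chartRep_of_notMem ht) hx
  have ht : tsupport (chartRep I α c) ⊆ extChartAt I c '' tsupport α :=
    closure_minimal h0 hK.isClosed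
  refine ⟨HasCompactSupport.of_support_subset_isCompact hK h0, fun x hx => ?_⟩
  obtain ⟨p, hp, rfl⟩ := ht hx
  exact ⟨(extChartAt I c).map_source (hα hp), by rwa [(extChartAt I c).left_inv (hα hp)]⟩

variable [FiniteDimensional ℂ V] [ComplexCoords V] [IsManifold I ω M]

theorem smoothAt_chartRep (hα : TestForm I α) (hc : tsupport α ⊆ (extChartAt I c).source) (x : V) :
    SmoothAt (chartRep I α c) x := by
  by_cases hx : x ∈ (extChartAt I c).target
  · refine (smoothForm_iff.1 hα.1 c x hx).congr ?_
    filter_upwards [(target_open c).eventually_mem hx] with y hy using chartRep_of_mem hy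
  · exact (smoothAt_const 0 x).congr (notMem_tsupport_iff_eventuallyEq.1 fun h =>
      hx ((tsupport_chartRep hα.2 hc).2 x h).1)

theorem dbarFlat_chartRep (hα : TestForm I α) (hc : tsupport α ⊆ (extChartAt I c).source) :
    dbarFlat (ι ℂ) (chartRep I α c) = chartRep I (dbarForm I α) c := by
  funext x
  by_cases hx : x ∈ (extChartAt I c).target
  · rw [chartRep_of_mem hx, localForm_dbarForm hx (smoothForm_iff.1 hα.1 c x hx)]
    refine dbarFlat_congr ?_
    filter_upwards [(target_open c).eventually_mem hx] with y hy using chartRep_of_mem hy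
  · rw [chartRep_of_notMem hx]
    exact (dbarFlat_congr (notMem_tsupport_iff_eventuallyEq.1 fun h =>
      hx ((tsupport_chartRep hα.2 hc).2 x h).1)).trans (dbarFlat_const 0)

theorem smoothForm_pullback {V' : Type*} [NormedAddCommGroup V'] [NormedSpace ℂ V']
    {H' : Type*} [TopologicalSpace H'] {I' : ModelWithCorners ℂ V' H'}
    {M' : Type*} [TopologicalSpace M'] [ChartedSpace H' M'] [I'.Boundaryless] [IsManifold I' ω M']
    [FiniteDimensional ℂ V'] [ComplexCoords V'] {f : M' → M} (hf : ContMDiff I' I ω f)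
    (hα : SmoothForm I α) : SmoothForm I' (pullback I I' f α) := smoothForm_of_forall fun p => by
  have hs : f ((extChartAt I' p).symm (extChartAt I' p p)) ∈ (extChartAt I (f p)).source := by
    rw [extChartAt_to_inv p]
    exact mem_extChartAt_source (f p)
  exact ⟨p, mem_extChartAt_source p, smoothAt_localForm_pullback hf (mem_extChartAt_target p) hs
    (smoothForm_iff.1 hα _ _ (locRep_mem_target hs))⟩

variable [MeasureSpace V] [BorelSpace V] [(volume : Measure V).IsAddHaarMeasure]
  [T2Space M] [SecondCountableTopology M]

/-- The pairing of a form with a test form that is supported in a chart, computed in that chart. -/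
theorem formCurrent_eq_integral (hβ : LocIntForm I β) (hα : TestForm I α)
    (hc : tsupport α ⊆ (extChartAt I c).source) {b : V → ExteriorAlgebra ℂ (V →ₗ[ℝ] ℂ)}
    {N : Set V} (hN : volume N = 0) (hb : ∀ x ∈ (extChartAt I c).target,
      (extChartAt I c).symm x ∈ tsupport α → x ∉ N → localForm I β c x = b x) :
    formCurrent I β α = ∫ x, topCoeff (b x * chartRep I α c x) := by
  rw [formCurrent, integralForm_eq_setIntegral (hβ.mul hα.1) hα.2.isCompact hc fun p hp => by
      rw [image_eq_zero_of_notMem_tsupport hp, mul_zero],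
    ← integral_indicator (target_open c).measurableSet]
  refine integral_congr_ae ?_
  filter_upwards [compl_mem_ae_iff.2 hN] with x hx
  by_cases ht : x ∈ (extChartAt I c).target
  · rw [Set.indicator_of_mem ht, localForm_mul, chartRep_of_mem ht]
    by_cases hs : (extChartAt I c).symm x ∈ tsupport α
    · rw [hb x ht hs hx]
    · rw [localForm_eq_zero (image_eq_zero_of_notMem_tsupport hs), mul_zero, mul_zero]
  · rw [Set.indicator_of_notMem ht, chartRep_of_notMem ht, mul_zero, map_zero]

end ChartRep

section Kernel

variable {n : ℕ} {X : Type*} [TopologicalSpace X] [ChartedSpace (Fin n → ℂ) X]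
  [IsManifold 𝓘(ℂ, Fin n → ℂ) ω X]
  {E : X × X → Type*} [TopologicalSpace (TotalSpace (Fin n → ℂ) E)]
  [∀ p, AddCommGroup (E p)] [∀ p, Module ℂ (E p)] [∀ p, TopologicalSpace (E p)]
  [FiberBundle (Fin n → ℂ) E] [VectorBundle ℂ (Fin n → ℂ) E]
  [ContMDiffVectorBundle ω (Fin n → ℂ) E (modelXX n)]
  {h : HermitianMetric (modelXX n) n E} {η : ∀ p, E p} {σ : ∀ p, Dual ℂ (E p)}
  {g : ∀ p, GFib ((Fin n → ℂ) × (Fin n → ℂ)) (E p)}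

theorem isWeight_one : IsWeight n η (1 : ∀ p, GFib ((Fin n → ℂ) × (Fin n → ℂ)) (E p)) := by
  have hl : ∀ c, localSec n (modelXX n) (1 : ∀ p, GFib ((Fin n → ℂ) × (Fin n → ℂ)) (E p)) c
      = fun _ => 1 := fun c => funext fun x => localSec_one
  refine ⟨fun c ℓ => ?_, fun p => ?_, fun p => ?_, fun z => map_one _⟩
  · simp only [hl]
    exact contDiffOn_const
  · have h1 : (1 : GFib ((Fin n → ℂ) × (Fin n → ℂ)) (E p)) ∈
        LinearMap.range (inEDual : Dual ℂ (E p) →ₗ[ℂ] GFib ((Fin n → ℂ) × (Fin n → ℂ)) (E p)) ^ 0 *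
          (covec01 ((Fin n → ℂ) × (Fin n → ℂ))).map (inT : _ →ₗ[ℂ] GFib _ (E p)) ^ 0 := by
      rw [pow_zero, pow_zero, one_mul]
      exact Submodule.one_le.1 le_rfl
    exact Submodule.mem_iSup_of_mem 0 (Submodule.mem_iSup_of_mem 0
      (Submodule.mem_iSup_of_mem (by simp) h1))
  · rw [nabla, dbarSec, hl, dbarFlat_const, map_zero, sub_zero]
    exact contr_one _

theorem extChartAt_symm_eq_iff {a : X} {x : (Fin n → ℂ) × (Fin n → ℂ)}
    (hx : x ∈ (extChartAt (modelXX n) (a, a)).target) :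
    ((extChartAt (modelXX n) (a, a)).symm x).1 = ((extChartAt (modelXX n) (a, a)).symm x).2
      ↔ x.1 = x.2 := by
  rw [extChartAt_prod] at hx ⊢
  exact (extChartAt 𝓘(ℂ, Fin n → ℂ) a).symm.injOn.eq_iff hx.1 hx.2

theorem surjective_fderiv_secRep (hΔ : DefinesDiagonal n η) (a : X) :
    Function.Surjective (fderiv ℂ (secRep (n := n) (modelXX n) η (a, a))
      (extChartAt (modelXX n) (a, a) (a, a))) := by
  have hs := hΔ.2 a
  by_cases hd : MDifferentiableAt (modelXX n) 𝓘(ℂ, Fin n → ℂ)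
      (fun q => coordAt n E (a, a) q (η q)) (a, a)
  · have h1 : fderivWithin ℂ (secRep (n := n) (modelXX n) η (a, a)) (Set.range (modelXX n))
        (extChartAt (modelXX n) (a, a) (a, a)) = fderiv ℂ (secRep (n := n) (modelXX n) η (a, a))
          (extChartAt (modelXX n) (a, a) (a, a)) := by
      rw [ModelWithCorners.range_eq_univ, fderivWithin_univ]
    have h2 := hd.mfderiv.trans h1
    exact fun y => (hs y).imp fun v hv => (DFunLike.congr_fun h2 v).symm.trans hv
  · rw [mfderiv_zero_of_not_mdifferentiableAt hd] at hs
    intro y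
    obtain ⟨v, hv⟩ := hs y
    exact ⟨0, (map_zero _).trans hv⟩

theorem exists_diagonalModel_chart (hη : ContMDiff (modelXX n)
      ((modelXX n).prod 𝓘(ℂ, Fin n → ℂ)) ω (fun p => TotalSpace.mk' (Fin n → ℂ) p (η p)))
    (hΔ : DefinesDiagonal n η) (hg : IsWeight n η g) (a : X) :
    ∃ U, extChartAt (modelXX n) (a, a) (a, a) ∈ U ∧ DiagonalModel (gram h (a, a))
      (secRep (modelXX n) η (a, a)) (localSec n (modelXX n) g (a, a)) U := by
  have hd := mem_localDomain (I := modelXX n) (n := n) (E := E) (a, a)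
  have hev := (localDomain_open (I := modelXX n) (n := n) (E := E) (a, a)).eventually_mem hd
  have hda : (extChartAt (modelXX n) (a, a) (a, a)) = (extChartAt 𝓘(ℂ, Fin n → ℂ) a a,
    extChartAt 𝓘(ℂ, Fin n → ℂ) a a) := by rw [extChartAt_prod]; rfl
  have hs := surjective_fderiv_secRep hΔ a
  rw [hda] at hev hd hs ⊢
  refine exists_diagonalModel (gram_goodAt_eventually h hd)
    (hev.mono fun x hx => gram_posDef h hx) (contDiffAt_secRep hη hd)
    (hev.mono fun x hx h0 => ?_) hs
    (hev.mono fun x hx => smoothAt_localSec_of_smoothSec hg.1 hx)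
    (hev.mono fun x hx => nablaFlat_localSec hg.1 hg.2.2.1 hx)
    (hev.mono fun x hx => map_mem_lFib (hg.2.1 _)) (hev.mono fun x hx h0 => ?_)
  · rw [secRep_eq_zero_iff hx, hΔ.1, extChartAt_symm_eq_iff hx.1]
    exact h0
  · refine (algebraMapInv_map _ _).trans ?_
    have h1 := (extChartAt_symm_eq_iff hx.1).2 h0
    have h2 : (extChartAt (modelXX n) (a, a)).symm x
      = (((extChartAt (modelXX n) (a, a)).symm x).1, ((extChartAt (modelXX n) (a, a)).symm x).1) :=
      Prod.ext rfl h1.symm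
    rw [h2]
    exact hg.2.2.2 _

/-- In a chart at a point of the diagonal, the kernel is almost everywhere given by the explicit
formula; if `n = 0`, both vanish. -/
theorem exists_null_localForm_kernelK (hη : ContMDiff (modelXX n)
      ((modelXX n).prod 𝓘(ℂ, Fin n → ℂ)) ω (fun p => TotalSpace.mk' (Fin n → ℂ) p (η p)))
    (hΔ : DefinesDiagonal n η) (hσ : IsMinimalSolution h η σ) (a : X) :
    ∃ N : Set ((Fin n → ℂ) × (Fin n → ℂ)), volume N = 0 ∧
      ∀ x ∈ localDomain (modelXX n) n E (a, a), x ∉ N →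
        localForm (modelXX n) (kernelK h η σ g) (a, a) x
          = kerReg (gram h (a, a)) (secRep (modelXX n) η (a, a))
            (localSec n (modelXX n) g (a, a)) 0 x := by
  rcases Nat.eq_zero_or_pos n with hn | hn
  · have h0 : Finset.range n = ∅ := by rw [hn, Finset.range_zero]
    refine ⟨∅, measure_empty, fun x hx _ => ?_⟩
    rw [kerReg_eq_sum, h0, Finset.sum_empty]
    refine localForm_eq_zero ?_
    rw [kernelK, uSec, h0, Finset.sum_empty, zero_mul, zero_mul, map_zero]
  · refine ⟨_, volume_diagonal hn, fun x hx hxN => localForm_kernelK hη hσ hx fun h0 => hxN ?_⟩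
    exact (extChartAt_symm_eq_iff hx.1).1 ((hΔ.1 _).1 h0)

theorem locIntForm_kernelK (hη : ContMDiff (modelXX n)
      ((modelXX n).prod 𝓘(ℂ, Fin n → ℂ)) ω (fun p => TotalSpace.mk' (Fin n → ℂ) p (η p)))
    (hΔ : DefinesDiagonal n η) (hσ : IsMinimalSolution h η σ) (hg : IsWeight n η g) :
    LocIntForm (modelXX n) (kernelK h η σ g) := by
  refine locIntForm_of_forall fun p => ⟨p, mem_extChartAt_source p, ?_⟩
  have hd := mem_localDomain (I := modelXX n) (n := n) (E := E) p
  have hpp : (extChartAt (modelXX n) p).symm (extChartAt (modelXX n) p p) = p := extChartAt_to_inv p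
  by_cases h0 : η p = 0
  · obtain ⟨a, b⟩ := p
    obtain rfl : a = b := (hΔ.1 (a, b)).1 h0
    obtain ⟨U, haU, hM⟩ := exists_diagonalModel_chart (h := h) hη hΔ hg a
    obtain ⟨N, hN, hK⟩ := exists_null_localForm_kernelK (g := g) hη hΔ hσ a
    exact (hM.intAt_kerReg haU).congr_ae ((localDomain_open _).mem_nhds hd) hN
      fun y hy hyN => (hK y hy hyN).symm
  · have h0' : η ((extChartAt (modelXX n) p).symm (extChartAt (modelXX n) p p)) ≠ 0 := by rwa [hpp]
    refine ((smoothAt_kerReg (gram_goodAt_eventually h hd) (contDiffAt_secRep hη hd)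
      (smoothAt_localSec_of_smoothSec hg.1 hd) (ε := 0) ?_).congr ?_).intAt
    · rw [Complex.ofReal_zero, add_zero]
      exact rFlat_gram_ne_zero hd h0'
    · filter_upwards [localDomain_nonzero_open hη hd h0'] with y hy
      exact localForm_kernelK hη hσ hy.1 hy.2

variable [T2Space X] [SecondCountableTopology X]

theorem contMDiff_diag : ContMDiff 𝓘(ℂ, Fin n → ℂ) (modelXX n) ω fun x : X => (x, x) :=
  contMDiff_id.prodMk contMDiff_id

theorem isCompact_diag_preimage {K : Set (X × X)} (hK : IsCompact K) :
    IsCompact {x : X | (x, x) ∈ K} :=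
  (hK.image continuous_fst).of_isClosed_subset
    (hK.isClosed.preimage (continuous_id.prodMk continuous_id)) fun x hx => ⟨(x, x), hx, rfl⟩

theorem pullback_diag_eq_zero {α : Form ((Fin n → ℂ) × (Fin n → ℂ)) (X × X)} {x : X}
    (hx : α (x, x) = 0) :
    pullback (modelXX n) 𝓘(ℂ, Fin n → ℂ) (fun x : X => (x, x)) α x = 0 := by
  rw [pullback, hx, map_zero]

theorem testForm_pullback_diag {α : Form ((Fin n → ℂ) × (Fin n → ℂ)) (X × X)}
    (hα : TestForm (modelXX n) α) : TestForm 𝓘(ℂ, Fin n → ℂ)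
      (pullback (modelXX n) 𝓘(ℂ, Fin n → ℂ) (fun x : X => (x, x)) α) :=
  ⟨smoothForm_pullback contMDiff_diag hα.1, HasCompactSupport.intro
    (isCompact_diag_preimage hα.2.isCompact) fun _ hx =>
      pullback_diag_eq_zero (image_eq_zero_of_notMem_tsupport hx)⟩

/-- The diagonal current, computed in a product chart. -/
theorem diagonalCurrent_eq_integral {α : Form ((Fin n → ℂ) × (Fin n → ℂ)) (X × X)} {a : X}
    (hα : TestForm (modelXX n) α) (hc : tsupport α ⊆ (extChartAt (modelXX n) (a, a)).source) :
    diagonalCurrent 𝓘(ℂ, Fin n → ℂ) α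
      = ∫ z, topCoeff (map (precomp diagMap)
          (chartRep (modelXX n) α (a, a) (z, z))) := by
  have hsrc : ∀ x : X, (x, x) ∈ (extChartAt (modelXX n) (a, a)).source ↔
      x ∈ (extChartAt 𝓘(ℂ, Fin n → ℂ) a).source := fun x => by
    rw [extChartAt_prod]
    exact and_self_iff
  have htgt : ∀ z, (z, z) ∈ (extChartAt (modelXX n) (a, a)).target ↔
      z ∈ (extChartAt 𝓘(ℂ, Fin n → ℂ) a).target := fun x => by
    rw [extChartAt_prod]
    exact and_self_iff
  rw [diagonalCurrent, integralForm_eq_setIntegral (testForm_pullback_diag hα).1.locIntForm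
    (isCompact_diag_preimage hα.2.isCompact) (c := a) (fun x hx => (hsrc x).1 (hc hx)) fun x hx =>
      pullback_diag_eq_zero (image_eq_zero_of_notMem_tsupport hx),
    ← integral_indicator (target_open (I := 𝓘(ℂ, Fin n → ℂ)) a).measurableSet]
  congr 1
  funext z
  by_cases hz : z ∈ (extChartAt 𝓘(ℂ, Fin n → ℂ) a).target
  · have hs := (hsrc _).2 ((extChartAt 𝓘(ℂ, Fin n → ℂ) a).map_target hz)
    have hev : locRep 𝓘(ℂ, Fin n → ℂ) (modelXX n) (fun x : X => (x, x)) a (a, a)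
        =ᶠ[𝓝 z] fun w => (w, w) := by
      filter_upwards [(target_open (I := 𝓘(ℂ, Fin n → ℂ)) a).eventually_mem hz] with w hw
      rw [locRep, extChartAt_prod]
      exact Prod.ext ((extChartAt 𝓘(ℂ, Fin n → ℂ) a).right_inv hw)
        ((extChartAt 𝓘(ℂ, Fin n → ℂ) a).right_inv hw)
    have hfd : fderiv ℂ (locRep 𝓘(ℂ, Fin n → ℂ) (modelXX n) (fun x : X => (x, x)) a (a, a)) z
        = (ContinuousLinearMap.id ℂ _).prod (ContinuousLinearMap.id ℂ _) :=
      hev.fderiv_eq.trans ((hasFDerivAt_id z).prodMk (hasFDerivAt_id z)).fderiv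
    rw [Set.indicator_of_mem hz, localForm_pullback contMDiff_diag α hz hs, hfd, hev.self_of_nhds,
      chartRep_of_mem ((htgt z).2 hz)]
    rfl
  · rw [Set.indicator_of_notMem hz, chartRep_of_notMem ((htgt z).not.2 hz), map_zero, map_zero]

/-- The equation `∂̄K = [Δ] - P`. -/
theorem formCurrent_dbarForm (hη : ContMDiff (modelXX n)
      ((modelXX n).prod 𝓘(ℂ, Fin n → ℂ)) ω (fun p => TotalSpace.mk' (Fin n → ℂ) p (η p)))
    (hΔ : DefinesDiagonal n η) (hσ : IsMinimalSolution h η σ) (hg : IsWeight n η g) :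
    ∀ α, TestForm (modelXX n) α →
      formCurrent (modelXX n) (kernelK h η σ g) (dbarForm (modelXX n) α)
        = diagonalCurrent 𝓘(ℂ, Fin n → ℂ) α - formCurrent (modelXX n) (kernelP h η g) α := by
  have hK := locIntForm_kernelK hη hΔ hσ hg
  have hP : SmoothForm (modelXX n) (kernelP h η g) :=
    smoothForm_kernelP hη fun c x hx => smoothAt_localSec_of_smoothSec hg.1 hx
  -- the identity is additive, so it suffices to find a neighbourhood of each point such that it
  -- holds for the test forms supported there
  refine testForm_induction ?_ ?_ fun p => ?_
  · have hd : dbarForm (modelXX n) (fun _ => 0 : Form ((Fin n → ℂ) × (Fin n → ℂ)) (X × X))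
        = fun _ => 0 := funext fun p => dbarForm_eq_zero (by simp [tsupport])
    have hp : pullback (modelXX n) 𝓘(ℂ, Fin n → ℂ) (fun x : X => (x, x))
        (fun _ => 0 : Form ((Fin n → ℂ) × (Fin n → ℂ)) (X × X)) = fun _ => 0 :=
      funext fun x => pullback_diag_eq_zero rfl
    simp only [formCurrent, diagonalCurrent, hd, hp, mul_zero, integralForm_zero, sub_zero]
  · intro α β hα hβ h1 h2
    have hp : pullback (modelXX n) 𝓘(ℂ, Fin n → ℂ) (fun x : X => (x, x)) (fun p => α p + β p)
        = fun x => pullback (modelXX n) 𝓘(ℂ, Fin n → ℂ) (fun x : X => (x, x)) α x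
          + pullback (modelXX n) 𝓘(ℂ, Fin n → ℂ) (fun x : X => (x, x)) β x :=
      funext fun x => map_add _ _ _
    have e1 := integralForm_add (hK.mul hα.dbar.1) (hK.mul hβ.dbar.1) hα.dbar.2.mul_left
      hβ.dbar.2.mul_left
    have e2 := integralForm_add (hP.locIntForm.mul hα.1) (hP.locIntForm.mul hβ.1) hα.2.mul_left
      hβ.2.mul_left
    have e3 := integralForm_add (testForm_pullback_diag hα).1.locIntForm
      (testForm_pullback_diag hβ).1.locIntForm (testForm_pullback_diag hα).2
      (testForm_pullback_diag hβ).2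
    simp only [formCurrent, diagonalCurrent] at h1 h2 ⊢
    rw [dbarForm_add hα.1 hβ.1, hp, e3]
    simp only [mul_add]
    rw [e1, e2, h1, h2]
    ring
  have hsrc : ∀ᶠ q in 𝓝 p, q ∈ (extChartAt (modelXX n) p).source ∧
      q ∈ (trivializationAt (Fin n → ℂ) E p).baseSet :=
    Filter.inter_mem (extChartAt_source_mem_nhds (I := modelXX n) p)
      ((trivializationAt (Fin n → ℂ) E p).open_baseSet.mem_nhds
        (FiberBundle.mem_baseSet_trivializationAt' p))
  by_cases h0 : p.1 = p.2
  · obtain ⟨a, b⟩ := p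
    obtain rfl : a = b := h0
    obtain ⟨U, haU, hM⟩ := exists_diagonalModel_chart (h := h) hη hΔ hg a
    obtain ⟨N, hN, hKN⟩ := exists_null_localForm_kernelK (g := g) hη hΔ hσ a
    refine ⟨_, hsrc.and ((continuousAt_extChartAt (I := modelXX n) (a, a)).eventually
      (hM.isOpen.mem_nhds haU)), fun α hα hαU => ?_⟩
    have hc : tsupport α ⊆ (extChartAt (modelXX n) (a, a)).source := fun q hq => (hαU hq).1.1
    have hdom : ∀ x ∈ (extChartAt (modelXX n) (a, a)).target,
        (extChartAt (modelXX n) (a, a)).symm x ∈ tsupport α →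
          x ∈ localDomain (modelXX n) n E (a, a) := fun x hx hxs => ⟨hx, (hαU hxs).1.2⟩
    have hU : tsupport (chartRep (modelXX n) α (a, a)) ⊆ U := fun x hx => by
      obtain ⟨hxt, hxs⟩ := (tsupport_chartRep hα.2 hc).2 x hx
      have := (hαU hxs).2
      rwa [(extChartAt (modelXX n) (a, a)).right_inv hxt] at this
    have key := hM.integral_kerReg_zero (smoothAt_chartRep hα hc) (tsupport_chartRep hα.2 hc).1 hU
    rw [dbarFlat_chartRep hα hc] at key
    rw [diagonalCurrent_eq_integral hα hc, formCurrent_eq_integral hP.locIntForm hα hc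
      measure_empty fun x hx hxs _ => localForm_kernelP hη (hdom x hx hxs),
      formCurrent_eq_integral hK hα.dbar ((tsupport_dbarForm_subset α).trans hc) hN
        fun x hx hxs hxN => hKN x (hdom x hx (tsupport_dbarForm_subset α hxs)) hxN]
    exact key
  · have hopen : IsOpen {q : X × X | q.1 ≠ q.2} := isOpen_ne_fun continuous_fst continuous_snd
    refine ⟨_, hsrc.and (hopen.eventually_mem h0), fun α hα hαU => ?_⟩
    have hc : tsupport α ⊆ (extChartAt (modelXX n) p).source := fun q hq => (hαU hq).1.1
    have hdiag : pullback (modelXX n) 𝓘(ℂ, Fin n → ℂ) (fun x : X => (x, x)) α = fun _ => 0 :=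
      funext fun x => pullback_diag_eq_zero <| image_eq_zero_of_notMem_tsupport fun hx =>
        (hαU hx).2 rfl
    have hne : ∀ q : X × X, q.1 ≠ q.2 → η q ≠ 0 := fun q hq h0 => hq ((hΔ.1 q).1 h0)
    -- off the diagonal the kernel is smooth, and Stokes' theorem applies with `ε = 0`
    set U := {x | x ∈ localDomain (modelXX n) n E p ∧ η ((extChartAt (modelXX n) p).symm x) ≠ 0}
      with hUdef
    have hUo : IsOpen U := isOpen_iff_mem_nhds.2 fun x hx =>
      localDomain_nonzero_open hη hx.1 hx.2
    have hdom : ∀ x ∈ (extChartAt (modelXX n) p).target,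
        (extChartAt (modelXX n) p).symm x ∈ tsupport α → x ∈ U :=
      fun x hx hxs => ⟨⟨hx, (hαU hxs).1.2⟩, hne _ (hαU hxs).2⟩
    have key := integral_kerReg_dbarFlat (ε := 0) hUo (fun x hx => gram_goodAt h hx.1)
      (fun x hx => contDiffAt_secRep hη hx.1)
      (fun x hx => smoothAt_localSec_of_smoothSec hg.1 hx.1)
      (fun x hx => nablaFlat_localSec hg.1 hg.2.2.1 hx.1)
      (fun x hx => invol_of_mem_lFib (map_mem_lFib (hg.2.1 _)))
      (fun x hx => by
        rw [Complex.ofReal_zero, add_zero]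
        exact rFlat_gram_ne_zero hx.1 hx.2)
      (smoothAt_chartRep hα hc) (tsupport_chartRep hα.2 hc).1 fun x hx =>
        hdom x ((tsupport_chartRep hα.2 hc).2 x hx).1 ((tsupport_chartRep hα.2 hc).2 x hx).2
    have hres : ∀ x, kerRes (gram h p) (secRep (modelXX n) η p) (localSec n (modelXX n) g p) 0 x
        = 0 := fun x => by
      rw [kerRes, Complex.ofReal_zero, zero_smul, zero_mul, zero_mul, map_zero]
    simp only [hres, zero_mul, map_zero, integral_zero] at key
    rw [dbarFlat_chartRep hα hc] at key
    rw [diagonalCurrent, hdiag, integralForm_zero, formCurrent_eq_integral hP.locIntForm hα hc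
      measure_empty fun x hx hxs _ => localForm_kernelP hη (hdom x hx hxs).1,
      formCurrent_eq_integral hK hα.dbar ((tsupport_dbarForm_subset α).trans hc) measure_empty
        fun x hx hxs _ => localForm_kernelK hη hσ (hdom x hx (tsupport_dbarForm_subset α hxs)).1
          (hdom x hx (tsupport_dbarForm_subset α hxs)).2]
    exact key

theorem solvesDiagonalEquation (hη : ContMDiff (modelXX n)
      ((modelXX n).prod 𝓘(ℂ, Fin n → ℂ)) ω (fun p => TotalSpace.mk' (Fin n → ℂ) p (η p)))
    (hΔ : DefinesDiagonal n η) (hσ : IsMinimalSolution h η σ) (hg : IsWeight n η g) :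
    SolvesDiagonalEquation (kernelK h η σ g) (kernelP h η g) := by
  refine ⟨locIntForm_kernelK hη hΔ hσ hg,
    smoothForm_kernelP hη fun c x hx => smoothAt_localSec_of_smoothSec hg.1 hx, fun α hα => ?_⟩
  rw [← formCurrent_dbarForm hη hΔ hσ hg α hα, dbarCurrent]
  -- for `n = 0` the degree `2n - 1` is truncated to zero, but then `K` vanishes
  rcases Nat.eq_zero_or_pos n with hn | hn
  · have hK0 : formCurrent (modelXX n) (kernelK h η σ g) (dbarForm (modelXX n) α) = 0 := by
      have h0 : ∀ p, kernelK h η σ g p = 0 := fun p => by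
        rw [kernelK, uSec, show Finset.range n = ∅ by rw [hn, Finset.range_zero],
          Finset.sum_empty, zero_mul, zero_mul, map_zero]
      simp only [formCurrent, h0, zero_mul, integralForm_zero]
    rw [hK0, mul_zero]
  · rw [Nat.sub_add_cancel (by omega), pow_mul, neg_one_sq, one_pow, one_mul]

end Kernel

/-! ### The Koppelman formula -/

section Functoriality

variable {V V' V'' : Type*} [NormedAddCommGroup V] [NormedSpace ℂ V]
  [NormedAddCommGroup V'] [NormedSpace ℂ V'] [NormedAddCommGroup V''] [NormedSpace ℂ V'']
  {H H' H'' : Type*} [TopologicalSpace H] [TopologicalSpace H'] [TopologicalSpace H'']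
  {I : ModelWithCorners ℂ V H} {I' : ModelWithCorners ℂ V' H'} {I'' : ModelWithCorners ℂ V'' H''}
  {M M' M'' : Type*} [TopologicalSpace M] [ChartedSpace H M] [TopologicalSpace M']
  [ChartedSpace H' M'] [TopologicalSpace M''] [ChartedSpace H'' M'']

theorem pullback_comp {f : M' → M} {k : M'' → M'} (hf : MDifferentiable I' I f)
    (hk : MDifferentiable I'' I' k) (α : Form V M) :
    pullback I' I'' k (pullback I I' f α) = pullback I I'' (f ∘ k) α := by
  funext p
  have e : tangentRep I'' I (f ∘ k) p = (tangentRep I' I f (k p)).comp (tangentRep I'' I' k p) :=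
    mfderiv_comp p (hf (k p)) (hk p)
  refine (map_precomp_comp _ _ _).trans ?_
  change _ = map (precomp (reL (tangentRep I'' I (f ∘ k) p))) (α (f (k p)))
  rw [e]
  rfl

end Functoriality

section Product

variable {V : Type*} [NormedAddCommGroup V] [NormedSpace ℂ V] [FiniteDimensional ℂ V]
  [ComplexCoords V] {H : Type*} [TopologicalSpace H] {I : ModelWithCorners ℂ V H}
  [I.Boundaryless] {M : Type*} [TopologicalSpace M] [ChartedSpace H M] [IsManifold I ω M]

theorem localForm_self (α : Form V M) (p : M) : localForm I α p (extChartAt I p p) = α p := by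
  have h1 : (fun y => extChartAt I p ((extChartAt I p).symm y)) =ᶠ[𝓝 (extChartAt I p p)] id := by
    filter_upwards [extChartAt_target_mem_nhds (I := I) p] with y hy
    exact (extChartAt I p).right_inv hy
  have h2 : transition I p p (extChartAt I p p) = LinearMap.id := by
    rw [transition, h1.fderiv_eq, fderiv_id]
    rfl
  change map (precomp (transition I p
    ((extChartAt I p).symm (extChartAt I p p)) (extChartAt I p p)))
      (α ((extChartAt I p).symm (extChartAt I p p))) = α p
  rw [extChartAt_to_inv p, h2]
  change map LinearMap.id (α p) = α p
  rw [ExteriorAlgebra.map_id]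
  rfl

theorem smoothForm_smul {α : Form V M} (a : ℂ) (hα : SmoothForm I α) :
    SmoothForm I fun p => a • α p := fun c ℓ =>
  (contDiffOn_const (c := a).smul (hα c ℓ)).congr fun x _ => by
    rw [show localForm I (fun p => a • α p) c x = a • localForm I α c x from map_smul _ _ _,
      map_smul]
    rfl

/-- The Leibniz rule for `∂̄`. -/
theorem dbarForm_mul {α β : Form V M} (hα : SmoothForm I α) (hβ : SmoothForm I β) (p : M) :
    dbarForm I (fun q => α q * β q) p
      = dbarForm I α p * β p + invol (α p) * dbarForm I β p := by
  have h : localForm I (fun q => α q * β q) p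
      = fun x => localForm I α p x * localForm I β p x := funext fun x => localForm_mul α β p x
  rw [dbarForm, h, dbarFlat_ι_mul (smoothForm_iff.1 hα p _ (mem_extChartAt_target p))
    (smoothForm_iff.1 hβ p _ (mem_extChartAt_target p)), localForm_self, localForm_self]
  rfl

theorem HasDegree.invol_eq {r : ℕ} {α : Form V M} (hα : HasDegree r α) (p : M) :
    invol (α p) = (-1 : ℂ) ^ r • α p := by
  refine invol_of_mem_range_pow (P := LinearMap.range (ι ℂ)) ?_ r _ (hα p)
  rintro _ ⟨ℓ, rfl⟩
  exact invol_ι ℓ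

end Product

section Diagonal

variable {n : ℕ} {X : Type*} [TopologicalSpace X] [ChartedSpace (Fin n → ℂ) X]
  [IsManifold 𝓘(ℂ, Fin n → ℂ) ω X]

theorem pullback_diag_pullback {f : X × X → X} (hf : ContMDiff (modelXX n) 𝓘(ℂ, Fin n → ℂ) ω f)
    (hfd : ∀ x, f (x, x) = x) (φ : Form (Fin n → ℂ) X) :
    pullback (modelXX n) 𝓘(ℂ, Fin n → ℂ) (fun x : X => (x, x))
      (pullback 𝓘(ℂ, Fin n → ℂ) (modelXX n) f φ) = φ := by
  have hid : f ∘ (fun x : X => (x, x)) = id := funext hfd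
  have hd : ContMDiff 𝓘(ℂ, Fin n → ℂ) (modelXX n) ω fun x : X => (x, x) :=
    contMDiff_id.prodMk contMDiff_id
  rw [pullback_comp (hf.mdifferentiable (by simp)) (hd.mdifferentiable (by simp)), hid,
    pullback_id]

theorem pullback_mul {V : Type*} [NormedAddCommGroup V] [NormedSpace ℂ V]
    {H : Type*} [TopologicalSpace H] (I : ModelWithCorners ℂ V H)
    {M : Type*} [TopologicalSpace M] [ChartedSpace H M]
    {V' : Type*} [NormedAddCommGroup V'] [NormedSpace ℂ V']
    {H' : Type*} [TopologicalSpace H'] (I' : ModelWithCorners ℂ V' H')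
    {M' : Type*} [TopologicalSpace M'] [ChartedSpace H' M'] (f : M' → M) (α β : Form V M) :
    pullback I I' f (fun p => α p * β p)
      = fun p => pullback I I' f α p * pullback I I' f β p :=
  funext fun _ => map_mul _ _ _

variable [T2Space X] [SecondCountableTopology X]

/-- The Koppelman formula is the equation `∂̄K = [Δ] - P`, tested on the forms `φ(ζ) ∧ ψ(z)`. -/
theorem koppelmanFormula_of_current_equation {K P : Form ((Fin n → ℂ) × (Fin n → ℂ)) (X × X)}
    (hK : LocIntForm (modelXX n) K)
    (h : ∀ α, TestForm (modelXX n) α → formCurrent (modelXX n) K (dbarForm (modelXX n) α)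
      = diagonalCurrent 𝓘(ℂ, Fin n → ℂ) α - formCurrent (modelXX n) P α) :
    KoppelmanFormula K P := by
  intro r φ ψ hφ hr hψ atζ atz
  have hfst : ContMDiff (modelXX n) 𝓘(ℂ, Fin n → ℂ) ω (Prod.fst : X × X → X) := contMDiff_fst
  have hsnd : ContMDiff (modelXX n) 𝓘(ℂ, Fin n → ℂ) ω (Prod.snd : X × X → X) := contMDiff_snd
  have hc : ∀ {α β : Form (Fin n → ℂ) X}, HasCompactSupport α → HasCompactSupport β →
      HasCompactSupport fun p => atζ α p * atz β p := fun {α β} hα hβ =>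
    HasCompactSupport.intro (hα.isCompact.prod hβ.isCompact) fun p hp => by
      rcases not_and_or.1 hp with h0 | h0
      · have : atζ α p = 0 := by
          change map _ (α p.1) = 0
          rw [image_eq_zero_of_notMem_tsupport h0, map_zero]
        rw [this, zero_mul]
      · have : atz β p = 0 := by
          change map _ (β p.2) = 0
          rw [image_eq_zero_of_notMem_tsupport h0, map_zero]
        rw [this, mul_zero]
  have hs : ∀ {α β : Form (Fin n → ℂ) X}, SmoothForm 𝓘(ℂ, Fin n → ℂ) α →
      SmoothForm 𝓘(ℂ, Fin n → ℂ) β → SmoothForm (modelXX n) fun p => atζ α p * atz β p :=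
    fun hα hβ => smoothForm_mul (smoothForm_pullback hfst hα) (smoothForm_pullback hsnd hβ)
  have hdbar : dbarForm (modelXX n) (fun p => atζ φ p * atz ψ p)
      = fun p => atζ (dbarForm 𝓘(ℂ, Fin n → ℂ) φ) p * atz ψ p
        + (-1 : ℂ) ^ r • (atζ φ p * atz (dbarForm 𝓘(ℂ, Fin n → ℂ) ψ) p) := funext fun p => by
    have hi : invol (atζ φ p) = (-1 : ℂ) ^ r • atζ φ p :=
      (invol_map _ _).trans (((congrArg _ (hr.invol_eq p.1))).trans (map_smul _ _ _))
    rw [dbarForm_mul (smoothForm_pullback hfst hφ.1) (smoothForm_pullback hsnd hψ.1) p, hi,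
      dbarForm_pullback hfst hφ.1, dbarForm_pullback hsnd hψ.1, smul_mul_assoc]
  have key := h (fun p => atζ φ p * atz ψ p) ⟨hs hφ.1 hψ.1, hc hφ.2 hψ.2⟩
  have hdiag : diagonalCurrent 𝓘(ℂ, Fin n → ℂ) (fun p => atζ φ p * atz ψ p)
      = integralForm 𝓘(ℂ, Fin n → ℂ) fun x => φ x * ψ x := by
    rw [diagonalCurrent]
    refine congrArg _ ((pullback_mul _ _ _ _ _).trans ?_)
    rw [pullback_diag_pullback hfst (fun _ => rfl), pullback_diag_pullback hsnd (fun _ => rfl)]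
  have hsplit : formCurrent (modelXX n) K (dbarForm (modelXX n) fun p => atζ φ p * atz ψ p)
      = integralForm (modelXX n) (fun p => K p * atζ (dbarForm 𝓘(ℂ, Fin n → ℂ) φ) p * atz ψ p)
        + (-1) ^ r * integralForm (modelXX n)
          (fun p => K p * atζ φ p * atz (dbarForm 𝓘(ℂ, Fin n → ℂ) ψ) p) := by
    rw [formCurrent, hdbar, ← integralForm_smul]
    simp only [mul_add, mul_smul_comm, mul_assoc]
    have h2 := hK.mul (smoothForm_smul ((-1 : ℂ) ^ r) (hs hφ.1 hψ.dbar.1))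
    simp only [mul_smul_comm] at h2
    refine integralForm_add (hK.mul (hs hφ.dbar.1 hψ.1)) h2 (hc hφ.dbar.2 hψ.2).mul_left ?_
    exact ((hc hφ.2 hψ.dbar.2).mul_left (f := K)).smul_left (f := fun _ => (-1 : ℂ) ^ r)
  rw [hsplit, hdiag] at key
  simp only [formCurrent, ← mul_assoc] at key
  rw [key]
  ring

end Diagonal

end Koppelman

end

theorem mainTheorem1 (n : ℕ) {X : Type*} [TopologicalSpace X] [T2Space X]
    [SecondCountableTopology X] [ChartedSpace (Fin n → ℂ) X]
    [IsManifold 𝓘(ℂ, Fin n → ℂ) ω X]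
    {E : X × X → Type*} [TopologicalSpace (TotalSpace (Fin n → ℂ) E)]
    [∀ p, AddCommGroup (E p)] [∀ p, Module ℂ (E p)] [∀ p, TopologicalSpace (E p)]
    [FiberBundle (Fin n → ℂ) E] [VectorBundle ℂ (Fin n → ℂ) E]
    [ContMDiffVectorBundle ω (Fin n → ℂ) E (Koppelman.modelXX n)]
    (η : ∀ p, E p)
    (hη : ContMDiff (Koppelman.modelXX n) ((Koppelman.modelXX n).prod 𝓘(ℂ, Fin n → ℂ)) ω
      (fun p => TotalSpace.mk' (Fin n → ℂ) p (η p)))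
    (hΔ : Koppelman.DefinesDiagonal n η)
    (h : Koppelman.HermitianMetric (Koppelman.modelXX n) n E)
    (σ : ∀ p, Dual ℂ (E p)) (hσ : Koppelman.IsMinimalSolution h η σ) :
    (Koppelman.SolvesDiagonalEquation (Koppelman.kernelK h η σ 1) (Koppelman.kernelP h η 1) ∧
      Koppelman.kernelP h η 1 = Koppelman.topChernForm h ∧
      Koppelman.KoppelmanFormula (Koppelman.kernelK h η σ 1) (Koppelman.kernelP h η 1)) ∧
    ∀ g, Koppelman.IsWeight n η g →
      Koppelman.SolvesDiagonalEquation (Koppelman.kernelK h η σ g) (Koppelman.kernelP h η g) ∧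
      Koppelman.KoppelmanFormula (Koppelman.kernelK h η σ g) (Koppelman.kernelP h η g) := by
  have key : ∀ g, Koppelman.IsWeight n η g →
      Koppelman.SolvesDiagonalEquation (Koppelman.kernelK h η σ g) (Koppelman.kernelP h η g) ∧
      Koppelman.KoppelmanFormula (Koppelman.kernelK h η σ g) (Koppelman.kernelP h η g) :=
    fun g hg => ⟨Koppelman.solvesDiagonalEquation hη hΔ hσ hg,
      Koppelman.koppelmanFormula_of_current_equation (Koppelman.locIntForm_kernelK hη hΔ hσ hg)
        (Koppelman.formCurrent_dbarForm hη hΔ hσ hg)⟩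
  exact ⟨⟨(key 1 Koppelman.isWeight_one).1, Koppelman.kernelP_one h η,
    (key 1 Koppelman.isWeight_one).2⟩, key⟩
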